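/- Let $(M,\gamma)$ be a closed smooth Riemannian 3-manifold (for instance one with $\mathrm{Ric}[\gamma]=-\tfrac29\gamma$). Sobolev norms $\|\cdot\|_\ell$ and sup norms $\|\cdot\|_\infty$ of functions and covariant tensors on $M$ are taken with respect to $\gamma$. Let $\tau=\tau_0e^{-T}$ with $\tau_0<0$, and on an open set $I$ of times $T$ consider the spacetime metric $$\overline g=\tau^{-2}\bigl(-N^2dT^2+g_{ab}(dx^a-X^adT)(dx^b-X^bdT)\bigr),$$ where $g(T)$ are Riemannian metrics on $M$, $N>0$ and $|X|_g<N$, and whose slices $\{T\}\times M$ have mean curvature $\tau$; that is, there are symmetric $g$-tracefree tensors $\Sigma(T)$ with $$\partial_Tg_{ab}=2N\Sigma_{ab}+2\bigl(\tfrac N3-1\bigr)g_{ab}-\mathcal L_Xg_{ab},\qquad k:=\Sigma+\tfrac13g .$$ Let $f\ge 0$ be a function of $T\in I$ and $(x,p)\in TM$, with compact momentum support locally uniformly in $T$, which solves the Vlasov equation of $\overline g$ for particles of mass $1$; here the rescaled momentum $p$ corresponds to the spacetime momentum $-\tau p^0\partial_T+\tau^2p^a\partial_a$, where, with $\hat X=X/N$,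 $$p^0=\frac{\tau\langle\hat X,p\rangle_g+\hat p}{N(1-|\hat X|_g^2)},\qquad \hat p=\sqrt{\tau^2\langle\hat X,p\rangle_g^2+(1-|\hat X|_g^2)(1+\tau^2|p|_g^2)} .$$ The rescaled energy density, matter current and spatial stress tensor are, with $w^a=p^a+\tau^{-1}p^0X^a$, $$\rho=N^2\!\int f\,(p^0)^2\,\frac{\sqrt g}{\hat p}\,dp,\qquad j^a=N\!\int f\,p^0w^a\,\frac{\sqrt g}{\hat p}\,dp,\qquad T^{ab}=\int f\,w^aw^b\,\frac{\sqrt g}{\hat p}\,dp ,$$ and the energy of $\rho$ with respect to the dynamical metric is $$\boldsymbol\varrho_\ell=\Bigl(\sum_{m\le\ell}\int_M|\nabla^m\rho|_g^2\,\mu_g\Bigr)^{1/2},$$ where $\nabla$ is the Levi-Civita connection of $g$. There is $\delta>0$, depending only on $(M,\gamma)$, such that for every $\ell\ge4$ and $K\in\mathbb R$ there is a constant $C>0$, depending only on $(M,\gamma)$, $\ell$ and $K$, with the following property. Suppose that $g,N,X,f$ are as above and of class $C^{\ell+2}$ in all their variables. Then at every time $T\in I$ with $\|g-\gamma\|_6<\delta$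 and, in case $\ell\ge8$, also $\|g-\gamma\|_{\ell-1}\le K$, the function $\boldsymbol\varrho_\ell$ is differentiable and $$\begin{aligned}|\partial_T\boldsymbol\varrho_\ell|\le C\Bigl[&\bigl(\|3-N\|_\infty+\|N\Sigma\|_\infty+\|\nabla(Nk)\|_{\ell-2}+\|3-N\|_\ell\bigr)\boldsymbol\varrho_\ell\\&+|\tau|^2\bigl\|N(\Sigma_{ab}+\tfrac13g_{ab})T^{ab}\bigr\|_\ell+|\tau|\,\bigl\|N^{-1}\mathrm{div}_g(N^2j)\bigr\|_\ell\Bigr].\end{aligned}$$ -/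

import Mathlib

open Set MeasureTheory
open scoped Manifold ContDiff Topology

noncomputable section

namespace EinsteinVlasov

/-! ### Tensor calculus in the charts of a 3-manifold

`M` is a 3-manifold modelled on `E3`. For `x₀ : M` the local coordinates "centred at `x₀`" are those
of the preferred chart `chartAt E3 x₀`. -/

/-- The model space `ℝ³`. -/
abbrev E3 : Type := EuclideanSpace ℝ (Fin 3)

/-- The standard basis vectors of `ℝ³`. -/
def e3 (i : Fin 3) : E3 := EuclideanSpace.single i 1

section Local

variable {ι V : Type*} [Fintype ι] [DecidableEq ι] [NormedAddCommGroup V] [NormedSpace ℝ V]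

/-- The partial derivative `∂ᵢ u` at `z`, with respect to the coordinate frame `b`. -/
def pderiv (b : ι → V) (i : ι) (u : V → ℝ) (z : V) : ℝ := fderiv ℝ u z (b i)

/-- The Christoffel symbols
`Γˡₘₙ = ½ Gˡˢ (∂ₘ Gₛₙ + ∂ₙ Gₛₘ - ∂ₛ Gₘₙ)` of a (pseudo-)Riemannian metric with components `G`
in the coordinates with coordinate frame `b`. -/
def christoffel (b : ι → V) (G : V → Matrix ι ι ℝ) (z : V) (l m n : ι) : ℝ :=
  (1 / 2) * ∑ s, (G z)⁻¹ l s *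
    (pderiv b m (fun w => G w s n) z + pderiv b n (fun w => G w s m) z
      - pderiv b s (fun w => G w m n) z)

end Local

/-- The covariant derivative, in local coordinates, of a covariant tensor field with
components `u`, for the metric with components `G`:
`∇_{a₀} u_{a₁…aₖ} = ∂_{a₀} u_{a₁…aₖ} - ∑ᵢ Γᶜ_{a₀ aᵢ} u_{a₁…c…aₖ}`. -/
def covDerivLocal {k : ℕ} (G : E3 → Matrix (Fin 3) (Fin 3) ℝ)
    (u : E3 → (Fin k → Fin 3) → ℝ) : E3 → (Fin (k + 1) → Fin 3) → ℝ :=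
  fun y a =>
    pderiv e3 (a 0) (fun w => u w (Fin.tail a)) y
      - ∑ i : Fin k, ∑ c : Fin 3,
          christoffel e3 G y c (a 0) (a i.succ) * u y (Function.update (Fin.tail a) i c)

/-- `|u|² = G^{a₁b₁} ⋯ G^{aₖbₖ} u_{a₁…aₖ} u_{b₁…bₖ}` for a covariant tensor with components `u`
at a point where the metric has components `G`. -/
def tensorNormSq {k : ℕ} (G : Matrix (Fin 3) (Fin 3) ℝ) (u : (Fin k → Fin 3) → ℝ) : ℝ :=
  ∑ a : Fin k → Fin 3, ∑ b : Fin k → Fin 3, (∏ i, G⁻¹ (a i) (b i)) * u a * u b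

section Manifold

variable {M : Type*} [TopologicalSpace M] [ChartedSpace E3 M]

variable (M) in
/-- Fields of continuous bilinear forms on the tangent spaces of `M`. -/
abbrev BilinField : Type _ :=
  ∀ x : M, TangentSpace 𝓘(ℝ, E3) x →L[ℝ] TangentSpace 𝓘(ℝ, E3) x →L[ℝ] ℝ

variable (M) in
/-- Vector fields on `M`. -/
abbrev VecField : Type _ := ∀ x : M, TangentSpace 𝓘(ℝ, E3) x

variable (M) in
/-- Covariant tensor fields of rank `k`, given by their components in the charts of `M`:
`u x₀ y a` is the component with indices `a 0, …, a (k-1)` in the coordinates centred at `x₀`, at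
the point with coordinates `y`. -/
abbrev TField (k : ℕ) : Type _ := M → E3 → (Fin k → Fin 3) → ℝ

/-- The point of `M` that has coordinates `y` in the chart centred at `x₀`. -/
def chartPt (x₀ : M) (y : E3) : M := (chartAt E3 x₀).symm y

/-- A function as a tensor field of rank 0. -/
def ofFun (u : M → ℝ) : TField M 0 := fun x₀ y _ => u (chartPt x₀ y)

variable [IsManifold 𝓘(ℝ, E3) 1 M]

/-- The tangent vector `∑ vⁱ ∂ᵢ` at the point with coordinates `y` in the chart centred
at `x₀`. -/
def chartVec (x₀ : M) (y v : E3) : TangentSpace 𝓘(ℝ, E3) (chartPt x₀ y) :=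
  tangentCoordChange 𝓘(ℝ, E3) x₀ (chartPt x₀ y) (chartPt x₀ y) v

/-- The components of a vector field in the chart centred at `x₀`. -/
def vecComp (X : VecField M) (x₀ : M) (y : E3) : E3 :=
  tangentCoordChange 𝓘(ℝ, E3) (chartPt x₀ y) x₀ (chartPt x₀ y) (X (chartPt x₀ y))

/-- The components `B(∂ᵢ, ∂ⱼ)` of a field of bilinear forms in the chart centred at `x₀`. -/
def bilinComp (B : BilinField M) (x₀ : M) (y : E3) : Matrix (Fin 3) (Fin 3) ℝ :=
  fun i j => B (chartPt x₀ y) (chartVec x₀ y (e3 i)) (chartVec x₀ y (e3 j))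

/-- A field of bilinear forms as a tensor field of rank 2. -/
def ofBilin (B : BilinField M) : TField M 2 := fun x₀ y a => bilinComp B x₀ y (a 0) (a 1)

/-- The covariant derivative `∇[g] u` of a covariant tensor field. -/
def covDeriv {k : ℕ} (g : BilinField M) (u : TField M k) : TField M (k + 1) :=
  fun x₀ => covDerivLocal (bilinComp g x₀) (u x₀)

/-- The iterated covariant derivative `∇[g]ᵐ u`. -/
def iterCovDeriv {k : ℕ} (g : BilinField M) (u : TField M k) : (m : ℕ) → TField M (k + m)
  | 0 => u
  | m + 1 => covDeriv g (iterCovDeriv g u m)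

/-- The pointwise squared norm `|u|²_g` at `x`. -/
def normSqAt {k : ℕ} (g : BilinField M) (u : TField M k) (x : M) : ℝ :=
  tensorNormSq (bilinComp g x (chartAt E3 x x)) (u x (chartAt E3 x x))

/-- The divergence `∇ₐ vᵃ = ∂ₐ vᵃ + Γᵃₐ_b vᵇ` of a vector field on `(M, g)`. -/
def divergence (g : BilinField M) (v : VecField M) (x : M) : ℝ :=
  ∑ a, (pderiv e3 a (fun y => vecComp v x y a) (chartAt E3 x x)
    + ∑ b, christoffel e3 (bilinComp g x) (chartAt E3 x x) a a b
        * vecComp v x (chartAt E3 x x) b)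

/-- The Lie derivative of `B` along `X`, in the chart centred at `x₀`:
`(ℒ_X B)_{ab} = Xᶜ ∂_c B_{ab} + B_{cb} ∂ₐ Xᶜ + B_{ac} ∂_b Xᶜ`. -/
def lieDerivComp (X : VecField M) (B : BilinField M) (x₀ : M) (y : E3) (a b : Fin 3) : ℝ :=
  ∑ c, (vecComp X x₀ y c * pderiv e3 c (fun w => bilinComp B x₀ w a b) y
    + bilinComp B x₀ y c b * pderiv e3 a (fun w => vecComp X x₀ w c) y
    + bilinComp B x₀ y a c * pderiv e3 b (fun w => vecComp X x₀ w c) y)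

/-! ### Riemannian measure and Sobolev norms on a compact manifold -/

theorem exists_chart_cover (M : Type*) [TopologicalSpace M] [ChartedSpace E3 M]
    [CompactSpace M] :
    ∃ t : Finset M, (⋃ c ∈ t, (chartAt E3 c).source) = univ :=
  CompactSpace.elim_nhds_subcover (fun c => (chartAt E3 c).source)
    fun c => (chartAt E3 c).open_source.mem_nhds (mem_chart_source E3 c)

/-- A finite set of points whose charts cover `M`. -/
def chartCover (M : Type*) [TopologicalSpace M] [ChartedSpace E3 M] [CompactSpace M] : Finset M :=
  (exists_chart_cover M).choose

/-- The points of `chartCover M`, enumerated. -/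
def coverPt (M : Type*) [TopologicalSpace M] [ChartedSpace E3 M] [CompactSpace M]
    (i : Fin (chartCover M).card) : M := ((chartCover M).equivFin.symm i : M)

/-- The Riemannian measure `μ_g`, which is `√(det g_{ij}) dy` in local coordinates. It is put
together from the finitely many charts of a cover, each of them restricted to the part of `M` that
the previous ones have left over. -/
def riemVol [CompactSpace M] [MeasurableSpace M] (g : BilinField M) : Measure M :=
  Measure.sum fun i : Fin (chartCover M).card =>
    (((volume.restrict (chartAt E3 (coverPt M i)).target).withDensity
        fun y => ENNReal.ofReal √(bilinComp g (coverPt M i) y).det).map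
      (chartAt E3 (coverPt M i)).symm).restrict
      (disjointed (fun j => (chartAt E3 (coverPt M j)).source) i)

/-- The Sobolev norm `(∑_{m ≤ ℓ} ∫_M |∇[g]ᵐ u|²_g dμ_g)^{1/2}` with respect to the metric `g`. -/
def sobolevNorm [CompactSpace M] [MeasurableSpace M] {k : ℕ} (g : BilinField M) (l : ℕ)
    (u : TField M k) : ℝ :=
  √(∑ m ∈ Finset.range (l + 1), ∫ x, normSqAt g (iterCovDeriv g u m) x ∂(riemVol g))

/-- The supremum norm `sup_M |u|_g` with respect to the metric `g`. -/
def supNorm {k : ℕ} (g : BilinField M) (u : TField M k) : ℝ := ⨆ x, √(normSqAt g u x)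

/-! ### Spacetimes with Vlasov matter in rescaled variables -/

/-- The mean curvature `τ = τ₀ e^{-T}` as a function of the logarithmic time `T`. -/
def meanCurv (τ₀ T : ℝ) : ℝ := τ₀ * Real.exp (-T)

variable (M) in
/-- The rescaled variables as functions of the logarithmic time `T`: the Riemannian metric `g`, the
tracefree part `Σ` of the second fundamental form, the lapse function `N`, the shift vector field
`X`, and the distribution function `f` on the tangent bundle `TM`. -/
structure RescaledVars where
  g : ℝ → BilinField M
  Sig : ℝ → BilinField M
  lapse : ℝ → M → ℝ
  shift : ℝ → VecField M
  f : ℝ → TangentBundle 𝓘(ℝ, E3) M → ℝ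

namespace RescaledVars

variable (S : RescaledVars M) (τ₀ : ℝ)

/-- `Σ + g/3`, the rescaled second fundamental form `k`. -/
def k (T : ℝ) : BilinField M := fun x => S.Sig T x + (1 / 3 : ℝ) • S.g T x

/-! #### The mass shell and the energy-momentum tensor

The spacetime metric is `τ⁻² (-N² dT² + g_{ab} (dxᵃ - Xᵃ dT) (dxᵇ - Xᵇ dT))`. A particle of mass one
with rescaled momentum `pᵃ` has the spacetime momentum `P = -τ p⁰ ∂_T + τ² pᵃ ∂ₐ`. -/

/-- `p̂ = (τ² ⟨X̂, p⟩² + (1 - |X̂|²) (1 + τ² |p|²))^{1/2}` with `X̂ = X / N`. -/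
def pHat (T : ℝ) (x : M) (p : TangentSpace 𝓘(ℝ, E3) x) : ℝ :=
  √((meanCurv τ₀ T) ^ 2 * (S.g T x (S.shift T x) p / S.lapse T x) ^ 2
    + (1 - S.g T x (S.shift T x) (S.shift T x) / (S.lapse T x) ^ 2)
      * (1 + (meanCurv τ₀ T) ^ 2 * S.g T x p p))

/-- `p⁰ = N⁻¹ (1 - |X̂|²)⁻¹ (τ ⟨X̂, p⟩ + p̂)`: the future-directed solution of the mass-shell relation
`N² (p⁰)² = 1 + τ² |p + τ⁻¹ p⁰ X|²`. -/
def p0 (T : ℝ) (x : M) (p : TangentSpace 𝓘(ℝ, E3) x) : ℝ :=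
  (S.lapse T x)⁻¹ * (1 - S.g T x (S.shift T x) (S.shift T x) / (S.lapse T x) ^ 2)⁻¹
    * (meanCurv τ₀ T * (S.g T x (S.shift T x) p / S.lapse T x) + S.pHat τ₀ T x p)

/-- `p + τ⁻¹ p⁰ X`: up to the factor `τ²`, the orthogonal projection of the spacetime momentum to
the slice of constant `T`. -/
def pProj (T : ℝ) (x : M) (p : TangentSpace 𝓘(ℝ, E3) x) : TangentSpace 𝓘(ℝ, E3) x :=
  p + ((meanCurv τ₀ T)⁻¹ * S.p0 τ₀ T x p) • S.shift T x

/-- `√g` on the tangent space at `x`, in its standard coordinates. -/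
def sqrtDet (T : ℝ) (x : M) : ℝ := √(bilinComp (S.g T) x (chartAt E3 x x)).det

/-- The rescaled momentum-space integral `∫ f(T,x,p) w(p) (√g / p̂) dp` over the mass shell. -/
def momentum (T : ℝ) (x : M) (w : TangentSpace 𝓘(ℝ, E3) x → ℝ) : ℝ :=
  ∫ p : E3, S.f T ⟨x, p⟩ * w p / S.pHat τ₀ T x p * S.sqrtDet T x

/-- The rescaled energy density `ρ = N² ∫ f (p⁰)² (√g / p̂) dp`. -/
def rho (T : ℝ) (x : M) : ℝ :=
  (S.lapse T x) ^ 2 * S.momentum τ₀ T x fun p => (S.p0 τ₀ T x p) ^ 2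

/-- The rescaled matter current `jᵃ = N ∫ f p⁰ (pᵃ + τ⁻¹ p⁰ Xᵃ) (√g / p̂) dp`. -/
def current (T : ℝ) : VecField M := fun x =>
  S.lapse T x • WithLp.toLp 2 fun a : Fin 3 =>
    S.momentum τ₀ T x fun p => S.p0 τ₀ T x p * (show E3 from S.pProj τ₀ T x p) a

/-- The components of the rescaled spatial stress tensor
`Tᵃᵇ = ∫ f (pᵃ + τ⁻¹ p⁰ Xᵃ) (pᵇ + τ⁻¹ p⁰ Xᵇ) (√g / p̂) dp`, in the standard coordinates of the
tangent space at `x`. -/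
def stress (T : ℝ) (x : M) (a b : Fin 3) : ℝ :=
  S.momentum τ₀ T x fun p =>
    (show E3 from S.pProj τ₀ T x p) a * (show E3 from S.pProj τ₀ T x p) b

/-- The function `N (Σ_{ab} + g_{ab}/3) Tᵃᵇ`. -/
def stressSource (T : ℝ) (x : M) : ℝ :=
  S.lapse T x * ∑ a, ∑ b,
    bilinComp (S.k T) x (chartAt E3 x x) a b * S.stress τ₀ T x a b

/-- The function `N⁻¹ div_g (N² j)`. -/
def currentSource (T : ℝ) (x : M) : ℝ :=
  (S.lapse T x)⁻¹ * divergence (S.g T) (fun z => (S.lapse T z) ^ 2 • S.current τ₀ T z) x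

/-! #### The Vlasov equation -/

/-- The coordinate frame `∂_T, ∂₁, ∂₂, ∂₃` of `ℝ × ℝ³`. -/
def frame4 : Option (Fin 3) → ℝ × E3
  | none => (1, 0)
  | some i => (0, e3 i)

/-- The components of the spacetime metric
`τ⁻² (-N² dT² + g_{ab} (dxᵃ - Xᵃ dT) (dxᵇ - Xᵇ dT))` in the coordinates `(T, y)`, where `y` are the
coordinates centred at `x₀`. -/
def spacetimeMetric (x₀ : M) (z : ℝ × E3) : Matrix (Option (Fin 3)) (Option (Fin 3)) ℝ :=
  fun μ ν =>
    let x := chartPt x₀ z.2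
    let X := S.shift z.1 x
    ((meanCurv τ₀ z.1) ^ 2)⁻¹ *
      match μ, ν with
      | none, none => -(S.lapse z.1 x) ^ 2 + S.g z.1 x X X
      | none, some b => -S.g z.1 x X (chartVec x₀ z.2 (e3 b))
      | some a, none => -S.g z.1 x X (chartVec x₀ z.2 (e3 a))
      | some a, some b => bilinComp (S.g z.1) x₀ z.2 a b

/-- The distribution function as a function of `(T, y, q)`, where `q = τ² p` are the spatial
components of the (unrescaled) momentum. -/
def fUnscaled (x₀ : M) (z : ℝ × E3 × E3) : ℝ :=
  S.f z.1 ⟨chartPt x₀ z.2.1, chartVec x₀ z.2.1 (((meanCurv τ₀ z.1) ^ 2)⁻¹ • z.2.2)⟩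

/-- The components `P^μ` in the coordinates `(T, y)` of the spacetime momentum on the mass shell with
spatial components `q = τ² p`: they are `P^T = -τ p⁰` and `Pᵃ = qᵃ`. -/
def spacetimeMomentum (x₀ : M) (z : ℝ × E3 × E3) : Option (Fin 3) → ℝ
  | none => -meanCurv τ₀ z.1 *
      S.p0 τ₀ z.1 (chartPt x₀ z.2.1) (chartVec x₀ z.2.1 (((meanCurv τ₀ z.1) ^ 2)⁻¹ • z.2.2))
  | some a => z.2.2 a

/-- The geodesic spray of the spacetime applied to the distribution function:
`P^μ ∂_μ f - Γᵃ_{μν} P^μ P^ν ∂f/∂qᵃ`. -/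
def sprayDeriv (x₀ : M) (z : ℝ × E3 × E3) : ℝ :=
  S.spacetimeMomentum τ₀ x₀ z none * fderiv ℝ (S.fUnscaled τ₀ x₀) z (1, 0, 0)
    + ∑ a, S.spacetimeMomentum τ₀ x₀ z (some a) * fderiv ℝ (S.fUnscaled τ₀ x₀) z (0, e3 a, 0)
    - ∑ a, (∑ μ, ∑ ν,
        christoffel frame4 (S.spacetimeMetric τ₀ x₀) (z.1, z.2.1) (some a) μ ν
          * S.spacetimeMomentum τ₀ x₀ z μ * S.spacetimeMomentum τ₀ x₀ z ν)
        * fderiv ℝ (S.fUnscaled τ₀ x₀) z (0, 0, e3 a)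

/-- On the set `I` of times, `S` is a spacetime of class `C^n`, foliated by slices of constant mean
curvature `τ = τ₀ e^{-T}`, with a solution of the Vlasov equation on it, in rescaled variables. -/
structure IsVlasovSolution (n : ℕ) (I : Set ℝ) : Prop where
  /-- `g` is a Riemannian metric. -/
  g_symm : ∀ T ∈ I, ∀ x v w, S.g T x v w = S.g T x w v
  g_pos : ∀ T ∈ I, ∀ x, ∀ v ≠ 0, 0 < S.g T x v v
  /-- `Σ` is symmetric and tracefree. -/
  Sig_symm : ∀ T ∈ I, ∀ x v w, S.Sig T x v w = S.Sig T x w v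
  Sig_trace : ∀ T ∈ I, ∀ x₀ : M, ∀ y ∈ (chartAt E3 x₀).target,
    ((bilinComp (S.g T) x₀ y)⁻¹ * bilinComp (S.Sig T) x₀ y).trace = 0
  /-- The lapse function is positive, and `∂_T` is timelike. -/
  lapse_pos : ∀ T ∈ I, ∀ x, 0 < S.lapse T x
  shift_lt : ∀ T ∈ I, ∀ x, S.g T x (S.shift T x) (S.shift T x) < (S.lapse T x) ^ 2
  /-- `f` is non-negative, with compact momentum support, locally uniformly in time. -/
  f_nonneg : ∀ T ∈ I, ∀ v, 0 ≤ S.f T v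
  f_supp : ∀ T ∈ I, ∃ R : ℝ, ∀ᶠ T' in 𝓝 T, ∀ (x : M) (p : TangentSpace 𝓘(ℝ, E3) x),
    R < S.g T' x p p → S.f T' ⟨x, p⟩ = 0
  /-- `g`, `N`, `X` and `f` are of class `C^n`, jointly in all their variables. -/
  g_smooth : ∀ (x₀ : M) (i j : Fin 3),
    ContDiffOn ℝ n (fun z : ℝ × E3 => bilinComp (S.g z.1) x₀ z.2 i j)
      (I ×ˢ (chartAt E3 x₀).target)
  lapse_smooth : ∀ x₀ : M,
    ContDiffOn ℝ n (fun z : ℝ × E3 => S.lapse z.1 (chartPt x₀ z.2)) (I ×ˢ (chartAt E3 x₀).target)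
  shift_smooth : ∀ x₀ : M,
    ContDiffOn ℝ n (fun z : ℝ × E3 => vecComp (S.shift z.1) x₀ z.2) (I ×ˢ (chartAt E3 x₀).target)
  f_smooth : ∀ x₀ : M,
    ContDiffOn ℝ n (fun z : ℝ × E3 × E3 => S.f z.1 ⟨chartPt x₀ z.2.1, chartVec x₀ z.2.1 z.2.2⟩)
      (I ×ˢ (chartAt E3 x₀).target ×ˢ univ)
  /-- `∂_T g_{ab} = 2 N Σ_{ab} + 2 (N/3 - 1) g_{ab} - ℒ_X g_{ab}`. -/
  evolution_g : ∀ T ∈ I, ∀ x₀ : M, ∀ y ∈ (chartAt E3 x₀).target, ∀ a b : Fin 3,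
    deriv (fun t => bilinComp (S.g t) x₀ y a b) T =
      2 * S.lapse T (chartPt x₀ y) * bilinComp (S.Sig T) x₀ y a b
        + 2 * (S.lapse T (chartPt x₀ y) / 3 - 1) * bilinComp (S.g T) x₀ y a b
        - lieDerivComp (S.shift T) (S.g T) x₀ y a b
  /-- The Vlasov equation. -/
  vlasov : ∀ T ∈ I, ∀ x₀ : M, ∀ y ∈ (chartAt E3 x₀).target, ∀ q : E3,
    S.sprayDeriv τ₀ x₀ (T, y, q) = 0

/-- The energy `ϱ_ℓ` of the rescaled energy density, with respect to the dynamical metric `g`. -/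
def rhoEnergy [CompactSpace M] [MeasurableSpace M] (l : ℕ) (T : ℝ) : ℝ :=
  sobolevNorm (S.g T) l (ofFun (S.rho τ₀ T))

end RescaledVars

end Manifold

end EinsteinVlasov

end

/-!
Let `D` be the derivative along `∂_T + X`. The estimate rests on the transport equation
`Dρ = (3 - N) ρ - τ² N k_{ab} Tᵃᵇ + τ N⁻¹ div (N² j)` (`transport`): its right-hand side is bounded
in `H^ℓ` by the terms of the claim, so no derivatives of `f` have to be estimated.

*Transport equation.* The spatial covariant components `π` of the four-momentum are canonical: with
`E = (1 + τ²|π|²)^{1/2}`, the Vlasov equation is the Liouville equation of the Hamiltonian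
`X·π - τ⁻¹NE` (`hamilton`, `vlasov_canonical`), and the matter variables become simple moments,
`ρ√g = ∫ f E dπ` (`momentum_eq`). The `T`-derivative of this integral is computed by parts; the
remaining term is the divergence of `E` times the Hamiltonian field (`bracket_eq`), in which the
evolution equation of `g` produces `k_{ab} Tᵃᵇ`.

*Energy identity.* As `∂_T g + ℒ_X g = 2Nk - 2g`, the volume element changes by the factor `N - 3`
along `∂_T + X`, and `∂_T ∫|∇ᵐρ|²` is an integral over one slice (`hasDerivAt_integral_riemVol`,
`hasDerivAt_integral_enM`). With `D = ∂_T + ℒ_X` on tensors, `[D, ∇]` is multiplication by the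
variation of the Christoffel symbols (`lieD_covD`), hence by `∇(Nk)` (`dChr_eq_covDeriv`). So
`D∇ᵐρ` is `∇ᵐDρ` plus terms with at most `ℓ - 1` derivatives of `ρ` and `ℓ - 2` of `∇(Nk)`.

*Estimates.* All norms are compared with those of components in finitely many coordinate balls. By
Taylor's formula, `H²` embeds into the bounded functions on a ball (`sobolev_ball`); hence products
and inverses are controlled in `H^a` (`Bd.mul`, `Bd.inv`). Closeness to `γ` in `H⁶` makes `g`
uniformly elliptic; beyond that only bounds are used, so `δ` does not depend on `ℓ`
(`exists_metricBd`). The energy then controls the norm of `ρ` with respect to `γ`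
(`sobNN_le_sobNN`), which closes the estimate (`exists_deriv_bound`).

*Vanishing energy.* The square root is not differentiable at `0`. But if the energy vanishes, then
`ρ ≥ 0` vanishes on the slice, where it has a minimum; so all `∇ᵐρ` are `o(|t - T|)` and the energy
has derivative `0` (`hasDerivAt_rhoEnergy_of_rho_eq_zero`).
-/

open Set MeasureTheory
open scoped Manifold ContDiff Topology NNReal
open Finset (mul_sum sum_comm sum_congr sum_mul sum_add_distrib sum_insert sum_sub_distrib
  sum_le_sum sum_nonneg single_le_sum abs_sum_le_sum_abs sum_neg_distrib sum_const_zero)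
open Filter (Eventually EventuallyEq)
open Metric (nhds_basis_closedBall closedBall ball isOpen_ball ball_subset_closedBall
  ball_subset_ball)
open ENNReal (ofReal ofReal_mul ofReal_ne_top ofReal_le_ofReal)
open ContinuousLinearMap (fst snd inl le_opENorm smulRight_apply comp_apply)
open Matrix (mulVec mul_apply transpose_apply mul_nonsing_inv nonsing_inv_mul det_transpose
  det_fin_three adjugate_fin_three det_mul)
open Real (sqrt_nonneg norm_of_nonneg sqrt_mul coe_toNNReal sqrt_pos sq_sqrt)
open Fin (tail sum_univ_three)
open Fintype (sum_option)
open Function (update update_of_ne)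

noncomputable section

namespace EinsteinVlasov

variable {M : Type*} [TopologicalSpace M] [ChartedSpace E3 M] [IsManifold 𝓘(ℝ, E3) ∞ M]
  {V F : Type*} [NormedAddCommGroup V] [NormedSpace ℝ V] [NormedAddCommGroup F] [NormedSpace ℝ F]
  {ι : Type*} {k : ℕ}

/-! ### Algebra of covariant tensors -/

section TensorAlgebra

/-- The components of bilinear forms and of endomorphisms. -/
abbrev Mat3 : Type := Matrix (Fin 3) (Fin 3) ℝ

/-- The components of covariant tensors of rank `k`. -/
abbrev Ten (k : ℕ) : Type := (Fin k → Fin 3) → ℝ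

/-- The phase space of a coordinate chart: points `((T, y), q)` with spatial covector
components `q`. -/
abbrev Phase : Type := (ℝ × E3) × E3

/-- The transformation of a covariant tensor, given by its components `u`, that acts by the matrix
`A i` on the `i`-th index. -/
def mpull (A : Fin k → Mat3) (u : Ten k) : Ten k :=
  fun a => ∑ b : Fin k → Fin 3, (∏ i, A i (b i) (a i)) * u b

/-- The action of a matrix on covariant tensors: the pull-back by `A`. -/
def pull (A : Mat3) (u : Ten k) : Ten k := mpull (fun _ => A) u

/-- The infinitesimal action of a matrix on covariant tensors, the derivative of `pull` at `1`. -/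
def act (A : Mat3) (u : Ten k) : Ten k :=
  fun a => ∑ i, ∑ c, A c (a i) * u (update a i c)

/-- The Euclidean pairing of components. -/
def dot (u v : Ten k) : ℝ := ∑ a, u a * v a

lemma mpull_mpull (A B : Fin k → Mat3) (u : Ten k) :
    mpull B (mpull A u) = mpull (fun i => A i * B i) u := by
  ext a
  simp only [mpull, mul_apply, mul_sum]
  rw [sum_comm]
  refine sum_congr rfl fun b _ => ?_
  rw [Finset.prod_univ_sum, Fintype.piFinset_univ, sum_mul]
  refine sum_congr rfl fun c _ => ?_
  rw [Finset.prod_mul_distrib]; ring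

lemma mpull_one (u : Ten k) : mpull (fun _ => 1) u = u := by
  ext a
  simp only [mpull]
  rw [Finset.sum_eq_single a]
  · simp
  · intro b _ hb
    obtain ⟨i, hi⟩ := Function.ne_iff.1 hb
    rw [Finset.prod_eq_zero (Finset.mem_univ i) (by simp [hi]), zero_mul]
  · simp

lemma pull_mul (A B : Mat3) (u : Ten k) : pull (A * B) u = pull B (pull A u) :=
  (mpull_mpull _ _ u).symm

lemma pull_one (u : Ten k) : pull 1 u = u := mpull_one u

lemma mpull_add (A : Fin k → Mat3) (u v : Ten k) : mpull A (u + v) = mpull A u + mpull A v := by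
  ext a; simp [mpull, mul_add, sum_add_distrib]

lemma mpull_smul (A : Fin k → Mat3) (c : ℝ) (u : Ten k) : mpull A (c • u) = c • mpull A u := by
  ext a; simp [mpull, mul_sum, mul_left_comm]

lemma mpull_sum (s : Finset ι) (A : Fin k → Mat3) (u : ι → Ten k) :
    mpull A (∑ i ∈ s, u i) = ∑ i ∈ s, mpull A (u i) := by
  classical
  induction s using Finset.induction_on with
  | empty => ext a; simp [mpull]
  | insert i s hi ih => rw [sum_insert hi, mpull_add, ih, sum_insert hi]

lemma pull_add (A : Mat3) (u v : Ten k) : pull A (u + v) = pull A u + pull A v :=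
  mpull_add _ u v

lemma pull_smul (A : Mat3) (c : ℝ) (u : Ten k) : pull A (c • u) = c • pull A u :=
  mpull_smul _ c u

lemma pull_sum (s : Finset ι) (A : Mat3) (u : ι → Ten k) :
    pull A (∑ i ∈ s, u i) = ∑ i ∈ s, pull A (u i) := mpull_sum s _ u

lemma act_eq_sum_mpull (A : Mat3) (u : Ten k) :
    act A u = ∑ i, mpull (update (fun _ => 1) i A) u := by
  ext a
  rw [Finset.sum_apply]
  refine sum_congr rfl fun i _ => ?_
  simp only [mpull]
  refine Fintype.sum_of_injective (fun c => update a i c)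
    (Function.update_injective a i) _ _ (fun b hb => ?_) fun c => ?_
  · obtain ⟨j, hj⟩ : ∃ j, b j ≠ update a i (b i) j := by
      by_contra! h
      exact hb ⟨b i, (funext h).symm⟩
    have hji : j ≠ i := by rintro rfl; simp at hj
    rw [Finset.prod_eq_zero (Finset.mem_univ j), zero_mul]
    simp only [update_of_ne hji] at hj ⊢
    exact Matrix.one_apply_ne hj
  · congr 1
    rw [← Finset.mul_prod_erase _ _ (Finset.mem_univ i)]
    rw [Finset.prod_eq_one]
    · simp
    · intro j hj
      have hji := Finset.ne_of_mem_erase hj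
      simp [update_of_ne hji]

lemma act_add (A : Mat3) (u v : Ten k) : act A (u + v) = act A u + act A v := by
  ext a; simp [act, mul_add, sum_add_distrib]

lemma act_smul (A : Mat3) (c : ℝ) (u : Ten k) : act A (c • u) = c • act A u := by
  ext a; simp [act, mul_sum, mul_left_comm]

lemma act_add_left (A B : Mat3) (u : Ten k) : act (A + B) u = act A u + act B u := by
  ext a; simp [act, add_mul, sum_add_distrib]

lemma act_smul_left (A : Mat3) (c : ℝ) (u : Ten k) : act (c • A) u = c • act A u := by
  ext a; simp [act, mul_sum, mul_assoc]

lemma act_neg_left (A : Mat3) (u : Ten k) : act (-A) u = -act A u := by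
  ext a; simp [act]

lemma act_sub_left (A B : Mat3) (u : Ten k) : act (A - B) u = act A u - act B u := by
  rw [sub_eq_add_neg, act_add_left, act_neg_left, sub_eq_add_neg]

lemma act_sub (A : Mat3) (u v : Ten k) : act A (u - v) = act A u - act A v := by
  ext a; simp [act, mul_sub, sum_sub_distrib]

lemma act_sum_left (s : Finset ι) (A : ι → Mat3) (u : Ten k) :
    act (∑ i ∈ s, A i) u = ∑ i ∈ s, act (A i) u := by
  classical
  induction s using Finset.induction_on with
  | empty => ext a; simp [act]
  | insert i s hi ih => rw [sum_insert hi, act_add_left, ih, sum_insert hi]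

/-- If `A` is conjugate to `B` by `J`, then `pull J` intertwines their infinitesimal actions. -/
lemma pull_act {A B J : Mat3} (h : A * J = J * B) (u : Ten k) :
    pull J (act A u) = act B (pull J u) := by
  rw [act_eq_sum_mpull, act_eq_sum_mpull, pull_sum]
  refine sum_congr rfl fun i _ => ?_
  rw [pull, pull, mpull_mpull, mpull_mpull]
  congr 1
  ext1 j
  by_cases hj : j = i
  · subst hj; simp [h]
  · simp [update_of_ne hj]

/-- The Leibniz rule for `pull A u`: the index-wise derivatives add up to an infinitesimal action.
-/
lemma sum_mpull_update {A A' B : Mat3} (h : A' = A * B) (u : Ten k) :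
    ∑ i, mpull (update (fun _ => A) i A') u = act B (pull A u) := by
  rw [act_eq_sum_mpull]
  refine sum_congr rfl fun i _ => ?_
  rw [pull, mpull_mpull]
  congr 1
  ext1 j
  by_cases hj : j = i
  · subst hj; simp [h]
  · simp [update_of_ne hj]

/-- The infinitesimal action reverses commutators, as `pull` reverses products. -/
lemma act_act_sub (A B : Mat3) (u : Ten k) :
    act A (act B u) - act B (act A u) = act (B * A - A * B) u := by
  have key : ∀ A B : Mat3, act A (act B u) = ∑ i, ∑ j, mpull (fun m =>
      update (fun _ => (1 : Mat3)) j B m * update (fun _ => (1 : Mat3)) i A m) u := by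
    intro A B
    rw [act_eq_sum_mpull B, act_eq_sum_mpull A]
    refine sum_congr rfl fun i _ => ?_
    rw [mpull_sum]
    exact sum_congr rfl fun j _ => mpull_mpull _ _ u
  rw [key, key, sum_comm (γ := Fin k)]
  rw [act_sub_left, act_eq_sum_mpull, act_eq_sum_mpull, ← sum_sub_distrib, ← sum_sub_distrib]
  refine sum_congr rfl fun i _ => ?_
  rw [← sum_sub_distrib, Finset.sum_eq_single i]
  · congr 1 <;>
    · congr 1
      ext1 m
      by_cases hm : m = i
      · subst hm; simp
      · simp [update_of_ne hm]
  · intro j _ hj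
    rw [sub_eq_zero]
    congr 1
    ext1 m
    by_cases hm : m = i
    · subst hm; simp [update_of_ne (Ne.symm hj)]
    · simp [update_of_ne hm]
  · simp

lemma dot_comm (u v : Ten k) : dot u v = dot v u :=
  sum_congr rfl fun _ _ => mul_comm _ _

lemma dot_add (u v w : Ten k) : dot u (v + w) = dot u v + dot u w := by
  simp [dot, mul_add, sum_add_distrib]

lemma dot_sum (s : Finset ι) (u : Ten k)
    (v : ι → Ten k) : dot u (∑ i ∈ s, v i) = ∑ i ∈ s, dot u (v i) := by
  simp only [dot, Finset.sum_apply, mul_sum]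
  rw [sum_comm]

lemma dot_mpull (A : Fin k → Mat3) (u v : Ten k) :
    dot (mpull A u) v = dot u (mpull (fun i => (A i).transpose) v) := by
  simp only [dot, mpull, sum_mul, mul_sum]
  rw [sum_comm]
  refine sum_congr rfl fun a _ => sum_congr rfl fun b _ => ?_
  simp only [transpose_apply]; ring

lemma dot_pull (A : Mat3) (u v : Ten k) :
    dot (pull A u) v = dot u (pull A.transpose v) := dot_mpull _ u v

lemma dot_act (A : Mat3) (u v : Ten k) : dot (act A u) v = dot u (act A.transpose v) := by
  rw [act_eq_sum_mpull, act_eq_sum_mpull, dot_comm, dot_sum, dot_sum]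
  refine sum_congr rfl fun i _ => ?_
  rw [dot_comm, dot_mpull]
  congr 2
  ext1 m
  by_cases hm : m = i
  · subst hm; simp
  · simp [update_of_ne hm]

lemma tensorNormSq_eq_dot (G : Mat3) (u : Ten k) : tensorNormSq G u = dot (pull G⁻¹ u) u := by
  simp only [tensorNormSq, dot, pull, mpull, sum_mul]
  rw [sum_comm]

/-- The squared norm of a tensor does not depend on the coordinates. -/
lemma tensorNormSq_pull {G J : Mat3} (hJ : IsUnit J.det) (u : Ten k) :
    tensorNormSq (J.transpose * G * J) (pull J u) = tensorNormSq G u := by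
  rw [tensorNormSq_eq_dot, tensorNormSq_eq_dot, dot_comm, dot_pull, ← pull_mul, ← pull_mul,
    Matrix.mul_inv_rev, Matrix.mul_inv_rev, dot_comm]
  congr 2
  have h1 : J * J⁻¹ = 1 := mul_nonsing_inv J hJ
  have h2 : J.transpose⁻¹ * J.transpose = 1 := nonsing_inv_mul _ (by rwa [det_transpose])
  rw [Matrix.mul_assoc J⁻¹, ← Matrix.mul_assoc J, h1, Matrix.one_mul, Matrix.mul_assoc, h2,
    Matrix.mul_one]

lemma pull_cons (A : Mat3) (u : Ten (k + 1)) (a : Fin (k + 1) → Fin 3) :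
    pull A u a = ∑ d, A d (a 0) * pull A (fun b => u (Fin.cons d b)) (tail a) := by
  simp only [pull, mpull, mul_sum]
  rw [← (Fin.consEquiv (fun _ => Fin 3)).sum_comp, Fintype.sum_prod_type]
  refine sum_congr rfl fun d _ => sum_congr rfl fun b _ => ?_
  have : (Fin.consEquiv fun _ : Fin (k + 1) => Fin 3) (d, b) = Fin.cons d b := rfl
  simp only [this, Fin.prod_univ_succ, Fin.cons_zero, Fin.cons_succ, tail]
  ring

end TensorAlgebra

/-! ### Covariant derivatives in a frame -/

section Connection

/-- A matrix as a covariant tensor of rank 2. -/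
def tens2 (H : Mat3) : (Fin 2 → Fin 3) → ℝ := fun a => H (a 0) (a 1)

lemma act_tens2 (B H : Mat3) (a : Fin 2 → Fin 3) :
    act B (tens2 H) a = ∑ d, (B d (a 0) * H d (a 1) + B d (a 1) * H (a 0) d) := by
  simp [act, tens2, Fin.sum_univ_two, sum_add_distrib]

lemma tens2_pull (J H : Mat3) : pull J (tens2 H) = tens2 (J.transpose * H * J) := by
  ext a
  have h0 : ∀ v : (Fin 1 → Fin 3) → ℝ, pull J v = fun a => ∑ d, J d (a 0) * v (fun _ => d) := by
    intro v; ext a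
    rw [pull_cons]
    refine sum_congr rfl fun d _ => ?_
    simp only [pull, mpull, Finset.univ_eq_empty, Finset.prod_empty, one_mul]
    rw [Fintype.sum_unique]
    congr 2
    ext j; fin_cases j; rfl
  rw [pull_cons]
  simp only [h0, tens2, mul_apply, transpose_apply, mul_sum, sum_mul]
  rw [sum_comm]
  refine sum_congr rfl fun d _ => sum_congr rfl fun c _ => ?_
  simp [tail]; ring

lemma act_cons (A : Mat3) (v : Ten (k + 1)) (a : Fin (k + 1) → Fin 3) :
    act A v a = (∑ c, A c (a 0) * v (Fin.cons c (tail a)))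
      + act A (fun β => v (Fin.cons (a 0) β)) (tail a) := by
  simp only [act, Fin.sum_univ_succ]
  congr 1
  · have h : ∀ c, update a 0 c = Fin.cons c (tail a) := by
      intro c; rw [← Fin.cons_self_tail a, Fin.update_cons_zero]; simp
    simp [h]
  · refine sum_congr rfl fun i _ => ?_
    have h : ∀ c, update a i.succ c = Fin.cons (a 0) (update (tail a) i c) := by
      intro c
      conv_lhs => rw [← Fin.cons_self_tail a]
      rw [Fin.cons_update]
    simp only [h]; rfl

/-- The Koszul formula: a torsion-free connection is determined by the covariant constancy of the
metric. Here `A a` stands for `∂ₐ G` and `B a d b` for `Γᵈₐᵦ`. -/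
lemma koszul {H : Mat3} (hH : IsUnit H.det) (hs : ∀ i j, H i j = H j i) {A B : Fin 3 → Mat3}
    (hB : ∀ a b d, B a d b = B b d a)
    (hA : ∀ a b c, A a b c = ∑ d, (B a d b * H d c + B a d c * H b d)) (l m n : Fin 3) :
    B m l n = (1 / 2) * ∑ s, H⁻¹ l s * (A m s n + A n s m - A s m n) := by
  have h1 : ∀ s, A m s n + A n s m - A s m n = 2 * ∑ d, H s d * B m d n := by
    intro s
    rw [hA, hA, hA, ← sum_add_distrib, ← sum_sub_distrib, mul_sum]
    refine sum_congr rfl fun d _ => ?_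
    rw [hB m s d, hB n s d, hB n m d, hs d m]; ring
  have h2 : ∑ s, H⁻¹ l s * ∑ d, H s d * B m d n = B m l n := by
    have h3 : H⁻¹ * (H * B m) = B m := by
      rw [← Matrix.mul_assoc, nonsing_inv_mul H hH, Matrix.one_mul]
    have := congrFun (congrFun h3 l) n
    simpa only [mul_apply] using this
  simp only [h1]
  rw [← h2, mul_sum]
  refine sum_congr rfl fun s _ => by ring

lemma koszul_symm {H : Mat3} (hH : IsUnit H.det) (hs : ∀ i j, H i j = H j i) {A B : Fin 3 → Mat3}
    (hA : ∀ a b c, A a b c = A a c b)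
    (hB : ∀ l m n, B m l n = (1 / 2) * ∑ s, H⁻¹ l s * (A m s n + A n s m - A s m n))
    (a b c : Fin 3) : A a b c = ∑ d, (B a d b * H d c + B a d c * H b d) := by
  have h2 : ∀ m n s, ∑ d, H s d * B m d n = (1 / 2) * (A m s n + A n s m - A s m n) := by
    intro m n s
    set w : Fin 3 → ℝ := fun s => (1 / 2) * (A m s n + A n s m - A s m n) with hw
    have h3 : H.mulVec (H⁻¹.mulVec w) = w := by
      rw [Matrix.mulVec_mulVec, mul_nonsing_inv H hH, Matrix.one_mulVec]
    have h4 : (fun d => B m d n) = H⁻¹.mulVec w := by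
      ext d
      simp only [hB, mulVec, dotProduct, hw, mul_sum]
      refine sum_congr rfl fun s _ => by ring
    have := congrFun h3 s
    rw [← h4] at this
    simpa only [mulVec, dotProduct] using this
  have h5 : ∑ d, B a d c * H b d = ∑ d, H b d * B a d c := sum_congr rfl fun d _ => mul_comm _ _
  rw [sum_add_distrib, h5, h2 a c b]
  have : ∑ d, B a d b * H d c = ∑ d, H c d * B a d b :=
    sum_congr rfl fun d _ => by rw [hs d c]; ring
  rw [this, h2 a b c, hA c a b, hA b a c, hA a c b]; ring

variable {b : Fin 3 → V} {z : V} {G : V → Mat3} {n : ℕ∞ω}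

lemma contDiffAt_det (hG : ∀ i j, ContDiffAt ℝ n (fun w => G w i j) z) :
    ContDiffAt ℝ n (fun w => (G w).det) z := by
  simp only [det_fin_three]
  have := hG
  fun_prop

lemma contDiffAt_inv (hG : ∀ i j, ContDiffAt ℝ n (fun w => G w i j) z) (h : IsUnit (G z).det)
    (i j : Fin 3) : ContDiffAt ℝ n (fun w => (G w)⁻¹ i j) z := by
  simp only [Matrix.inv_def, Ring.inverse_eq_inv', Matrix.smul_apply, smul_eq_mul]
  refine ((contDiffAt_det hG).inv h.ne_zero).mul ?_
  fin_cases i <;> fin_cases j <;> simp only [adjugate_fin_three] <;> simp <;>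
    · have := hG
      fun_prop

lemma differentiableAt_inv (hG : ∀ i j, DifferentiableAt ℝ (fun w => G w i j) z)
    (h : IsUnit (G z).det) (i j : Fin 3) : DifferentiableAt ℝ (fun w => (G w)⁻¹ i j) z := by
  have hd : DifferentiableAt ℝ (fun w => (G w).det) z := by
    simp only [det_fin_three]
    have := hG
    fun_prop
  simp only [Matrix.inv_def, Ring.inverse_eq_inv', Matrix.smul_apply, smul_eq_mul]
  refine (hd.inv h.ne_zero).mul ?_
  fin_cases i <;> fin_cases j <;> simp only [adjugate_fin_three] <;> simp <;>
    · have := hG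
      fun_prop

/-- The directional derivative of a matrix-valued function. -/
def dMat (A : V → Mat3) (z v : V) : Mat3 := fun i j => fderiv ℝ (fun w => A w i j) z v

/-- The directional derivative of a tensor-valued function. -/
def dTen (u : V → Ten k) (z v : V) : Ten k :=
  fun a => fderiv ℝ (fun w => u w a) z v

lemma dMat_mul {A B : V → Mat3} (hA : ∀ i j, DifferentiableAt ℝ (fun w => A w i j) z)
    (hB : ∀ i j, DifferentiableAt ℝ (fun w => B w i j) z) (v : V) :
    dMat (fun w => A w * B w) z v = dMat A z v * B z + A z * dMat B z v := by
  ext i j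
  simp only [dMat, mul_apply, Matrix.add_apply]
  rw [fderiv_fun_sum fun c _ => (hA i c).fun_mul (hB c j), ← sum_add_distrib, sum_apply]
  refine sum_congr rfl fun c _ => ?_
  rw [fderiv_fun_mul (hA i c) (hB c j)]
  simp; ring

lemma dMat_inv (hG : ∀ i j, DifferentiableAt ℝ (fun w => G w i j) z)
    (h : IsUnit (G z).det) (v : V) :
    dMat (fun w => (G w)⁻¹) z v = -((G z)⁻¹ * dMat G z v * (G z)⁻¹) := by
  have h1 := dMat_mul hG (differentiableAt_inv hG h) v
  have h2 : dMat (fun w => G w * (G w)⁻¹) z v = 0 := by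
    have hev : ∀ᶠ w in 𝓝 z, IsUnit (G w).det := by
      have hd : ContinuousAt (fun w => (G w).det) z := by
        simp only [det_fin_three]
        have : ∀ i j, ContinuousAt (fun w => G w i j) z := fun i j => (hG i j).continuousAt
        fun_prop
      filter_upwards [hd.eventually_ne h.ne_zero] with w hw using isUnit_iff_ne_zero.2 hw
    ext i j
    simp only [dMat]
    have : (fun w => (G w * (G w)⁻¹) i j) =ᶠ[𝓝 z] fun _ => (1 : Mat3) i j := by
      filter_upwards [hev] with w hw
      rw [mul_nonsing_inv _ hw]
    rw [this.fderiv_eq]; simp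
  rw [h2] at h1
  have h3 : G z * dMat (fun w => (G w)⁻¹) z v = -(dMat G z v * (G z)⁻¹) := by
    rw [eq_neg_iff_add_eq_zero, add_comm]; exact h1.symm
  calc _ = (G z)⁻¹ * (G z * dMat (fun w => (G w)⁻¹) z v) := by
        rw [← Matrix.mul_assoc, nonsing_inv_mul _ h, Matrix.one_mul]
    _ = _ := by rw [h3, Matrix.mul_neg, Matrix.mul_assoc]

lemma hasFDerivAt_pull {A : V → Mat3} {u : V → Ten k}
    (hA : ∀ i j, DifferentiableAt ℝ (fun w => A w i j) z)
    (hu : ∀ a, DifferentiableAt ℝ (fun w => u w a) z) (a : Fin k → Fin 3) :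
    HasFDerivAt (fun w => pull (A w) (u w) a)
      (∑ c : Fin k → Fin 3, ((∏ i, A z (c i) (a i)) • fderiv ℝ (fun w => u w c) z
        + u z c • ∑ i, (∏ j ∈ Finset.univ.erase i, A z (c j) (a j))
          • fderiv ℝ (fun w => A w (c i) (a i)) z)) z := by
  unfold pull mpull
  refine HasFDerivAt.fun_sum fun c _ => ?_
  refine HasFDerivAt.fun_mul ?_ (hu c).hasFDerivAt
  exact HasFDerivAt.finsetProd fun i _ => (hA (c i) (a i)).hasFDerivAt

lemma dTen_pull {A : V → Mat3} {u : V → Ten k} (hA : ∀ i j, DifferentiableAt ℝ (fun w => A w i j) z)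
    (hu : ∀ a, DifferentiableAt ℝ (fun w => u w a) z) (v : V) :
    dTen (fun w => pull (A w) (u w)) z v = pull (A z) (dTen u z v)
      + ∑ i, mpull (update (fun _ => A z) i (dMat A z v)) (u z) := by
  ext a
  simp only [dTen]
  rw [(hasFDerivAt_pull hA hu a).fderiv]
  simp only [sum_apply, add_apply, smul_apply, smul_eq_mul, sum_add_distrib, Pi.add_apply,
    Finset.sum_apply, pull, mpull]
  congr 1
  rw [sum_comm]
  refine sum_congr rfl fun c _ => ?_
  rw [mul_sum]
  refine sum_congr rfl fun i _ => ?_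
  rw [← Finset.mul_prod_erase _ _ (Finset.mem_univ i)]
  have : ∏ j ∈ Finset.univ.erase i, update (fun _ => A z) i (dMat A z v) j (c j) (a j)
      = ∏ j ∈ Finset.univ.erase i, A z (c j) (a j) :=
    Finset.prod_congr rfl fun j hj => by rw [update_of_ne (Finset.ne_of_mem_erase hj)]
  rw [this]
  simp [dMat]; ring

lemma dTen_pull_of_isUnit {A : V → Mat3} {u : V → Ten k}
    (hA : ∀ i j, DifferentiableAt ℝ (fun w => A w i j) z) (h : IsUnit (A z).det)
    (hu : ∀ a, DifferentiableAt ℝ (fun w => u w a) z) (v : V) :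
    dTen (fun w => pull (A w) (u w)) z v = pull (A z) (dTen u z v)
      + act ((A z)⁻¹ * dMat A z v) (pull (A z) (u z)) := by
  rw [dTen_pull hA hu, sum_mpull_update]
  rw [← Matrix.mul_assoc, mul_nonsing_inv _ h, Matrix.one_mul]

/-- The matrix `(Γₐ)ᶜ_d` of Christoffel symbols. -/
def chrMat (b : Fin 3 → V) (G : V → Mat3) (z : V) (a : Fin 3) : Mat3 :=
  fun c d => christoffel b G z c a d

/-- The covariant derivative in a coordinate frame `b` of a part of the variables. -/
def covD (b : Fin 3 → V) (G : V → Mat3) (u : V → Ten k) : V → Ten (k + 1) :=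
  fun z a => dTen u z (b (a 0)) (tail a) - act (chrMat b G z (a 0)) (u z) (tail a)

lemma chrMat_symm (hs : ∀ᶠ w in 𝓝 z, ∀ i j, G w i j = G w j i) (a d c : Fin 3) :
    chrMat b G z a d c = chrMat b G z c d a := by
  have : ∀ s i j, pderiv b s (fun w => G w i j) z = pderiv b s (fun w => G w j i) z := by
    intro s i j
    unfold pderiv
    rw [EventuallyEq.fderiv_eq (hs.mono fun w hw => hw i j)]
  simp only [chrMat, christoffel]
  congr 1
  refine sum_congr rfl fun s _ => ?_
  rw [this s a c]; ring

/-- The metric is covariantly constant. -/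
lemma dTen_tens2_eq (hs : ∀ᶠ w in 𝓝 z, ∀ i j, G w i j = G w j i) (h : IsUnit (G z).det)
    (a : Fin 3) : dTen (fun w => tens2 (G w)) z (b a) = act (chrMat b G z a) (tens2 (G z)) := by
  ext β
  rw [act_tens2]
  refine koszul_symm (A := fun a => dMat G z (b a)) (B := chrMat b G z) h hs.self_of_nhds
    (fun a i j => ?_) (fun l m n => rfl) a (β 0) (β 1)
  simp only [dMat]
  rw [EventuallyEq.fderiv_eq (hs.mono fun w hw => hw i j)]

lemma covD_metric (hs : ∀ᶠ w in 𝓝 z, ∀ i j, G w i j = G w j i) (h : IsUnit (G z).det) :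
    covD b G (fun w => tens2 (G w)) z = 0 := by
  ext a
  simp only [covD]
  rw [dTen_tens2_eq hs h]; simp

end Connection

/-! ### Changes of coordinates -/

section Covariance

/-- The coordinate functions on `ℝ³`. -/
def coordL (i : Fin 3) : E3 →L[ℝ] ℝ := EuclideanSpace.proj i

/-- The Jacobian matrix of a map of coordinates. -/
def jac (φ : E3 → E3) (y : E3) : Mat3 := fun i a => fderiv ℝ φ y (e3 a) i

variable {φ : E3 → E3} {y : E3}

lemma e3_expand (v : E3) : v = ∑ d, v d • e3 d := by
  ext i
  simp [e3, Pi.single_apply]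

lemma fderiv_e3_expand (L : E3 →L[ℝ] F) (v : E3) : L v = ∑ d, v d • L (e3 d) := by
  conv_lhs => rw [e3_expand v]
  simp

lemma differentiableAt_jac (hφ : ContDiffAt ℝ 2 φ y) (i j : Fin 3) :
    DifferentiableAt ℝ (fun w => jac φ w i j) y := by
  unfold jac
  have h1 : ContDiffAt ℝ 1 (fderiv ℝ φ) y := hφ.fderiv_right (by norm_num)
  have h2 : DifferentiableAt ℝ (fun w => fderiv ℝ φ w (e3 j)) y :=
    (h1.differentiableAt (by norm_num)).clm_apply (differentiableAt_const _)
  exact (coordL i).differentiableAt.comp y h2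

/-- The second derivatives of a change of coordinates are symmetric. -/
lemma dMat_jac_symm (hφ : ContDiffAt ℝ 2 φ y) (a b c : Fin 3) :
    dMat (jac φ) y (e3 a) c b = dMat (jac φ) y (e3 b) c a := by
  have h1 : ContDiffAt ℝ 1 (fderiv ℝ φ) y := hφ.fderiv_right (by norm_num)
  have h1' := h1.differentiableAt (by norm_num)
  have key : ∀ a b, dMat (jac φ) y (e3 a) c b = (fderiv ℝ (fderiv ℝ φ) y (e3 a) (e3 b)) c := by
    intro a b
    simp only [dMat, jac]
    have h2 : HasFDerivAt (fun w => fderiv ℝ φ w (e3 b))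
        ((fderiv ℝ (fderiv ℝ φ) y).flip (e3 b)) y := by
      have := h1'.hasFDerivAt.clm_apply (hasFDerivAt_const (e3 b) y)
      simpa using this
    have h3 := ((coordL c).hasFDerivAt).comp y h2
    have h4 : (fun w => (fderiv ℝ φ w) (e3 b) c)
      = ⇑(coordL c)
        ∘ fun w => (fderiv ℝ φ w) (e3 b) := rfl
    rw [h4, h3.fderiv]; rfl
  rw [key, key]
  have := (hφ.isSymmSndFDerivAt (by simp)) (e3 a) (e3 b)
  rw [this]

/-- The chain rule for tensor components; the last term comes from the derivatives of the Jacobian.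
-/
lemma dTen_pull_comp (hφ : ContDiffAt ℝ 2 φ y) (hJ : IsUnit (jac φ y).det) {u u' : E3 → Ten k}
    (hu' : ∀ᶠ w in 𝓝 y, u' w = pull (jac φ w) (u (φ w)))
    (hu : ∀ a, DifferentiableAt ℝ (fun w => u w a) (φ y)) (a : Fin 3) :
    dTen u' y (e3 a) = (∑ d, jac φ y d a • pull (jac φ y) (dTen u (φ y) (e3 d)))
      + act ((jac φ y)⁻¹ * dMat (jac φ) y (e3 a)) (u' y) := by
  have hφ' : DifferentiableAt ℝ φ y := hφ.differentiableAt (by norm_num)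
  have h1 : dTen u' y (e3 a) = dTen (fun w => pull (jac φ w) (u (φ w))) y (e3 a) := by
    ext β
    simp only [dTen]
    rw [EventuallyEq.fderiv_eq (hu'.mono fun w hw => congrFun hw β)]
  have hcomp : ∀ β, HasFDerivAt (fun w => u (φ w) β)
      ((fderiv ℝ (fun w => u w β) (φ y)).comp (fderiv ℝ φ y)) y := fun β =>
    (hu β).hasFDerivAt.comp y hφ'.hasFDerivAt
  rw [h1, dTen_pull_of_isUnit (u := fun w => u (φ w)) (differentiableAt_jac hφ) hJ
    (fun β => (hcomp β).differentiableAt), hu'.self_of_nhds]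
  congr 1
  simp only [← pull_smul, ← pull_sum]
  congr 1
  ext β
  simp only [dTen]
  rw [(hcomp β).fderiv, comp_apply, fderiv_e3_expand, Finset.sum_apply]
  rfl

/-- The transformation law of the Christoffel symbols. -/
lemma chrMat_transform {G G' : E3 → Mat3} (hφ : ContDiffAt ℝ 2 φ y) (hJ : IsUnit (jac φ y).det)
    (hG' : ∀ᶠ w in 𝓝 y, G' w = (jac φ w).transpose * G (φ w) * jac φ w)
    (hG : ∀ i j, DifferentiableAt ℝ (fun w => G w i j) (φ y))
    (hs : ∀ᶠ w in 𝓝 (φ y), ∀ i j, G w i j = G w j i) (h : IsUnit (G (φ y)).det) (a : Fin 3) :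
    chrMat e3 G' y a = (jac φ y)⁻¹ * dMat (jac φ) y (e3 a)
      + ∑ d, jac φ y d a • ((jac φ y)⁻¹ * chrMat e3 G (φ y) d * jac φ y) := by
  have hφc : ContinuousAt φ y := hφ.continuousAt
  have hs' : ∀ᶠ w in 𝓝 y, ∀ i j, G' w i j = G' w j i := by
    filter_upwards [hG', hφc.eventually hs] with w hw hsw i j
    rw [hw]
    have h1 : (G (φ w)).transpose = G (φ w) := by ext i j; exact hsw j i
    have h2 : ((jac φ w).transpose * G (φ w) * jac φ w).transpose
        = (jac φ w).transpose * G (φ w) * jac φ w := by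
      rw [Matrix.transpose_mul, Matrix.transpose_mul, h1, Matrix.transpose_transpose,
        Matrix.mul_assoc]
    conv_lhs => rw [← h2]
    rfl
  have hdet : IsUnit (G' y).det := by
    rw [hG'.self_of_nhds, det_mul, det_mul, det_transpose]
    exact (hJ.mul h).mul hJ
  set J := jac φ y with hJdef
  set B : Fin 3 → Mat3 := fun a => J⁻¹ * dMat (jac φ) y (e3 a)
      + ∑ d, J d a • (J⁻¹ * chrMat e3 G (φ y) d * J) with hBdef
  have hJJ : J * J⁻¹ = 1 := mul_nonsing_inv J hJ
  -- the right-hand side is torsion-free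
  have hB : ∀ a d c, B a d c = B c d a := by
    intro a d c
    simp only [hBdef, Matrix.add_apply, Matrix.sum_apply, Matrix.smul_apply, smul_eq_mul]
    congr 1
    · simp only [mul_apply]
      exact sum_congr rfl fun e _ => by rw [dMat_jac_symm hφ]
    · simp only [mul_apply, mul_sum, sum_mul]
      conv_rhs => rw [sum_comm]
      refine sum_congr rfl fun e _ => sum_congr rfl fun f _ =>
        sum_congr rfl fun m _ => ?_
      rw [chrMat_symm hs e m f]; ring
  -- the metric is constant with respect to it
  have hcomp : ∀ a, dTen (fun w => tens2 (G' w)) y (e3 a) = act (B a) (tens2 (G' y)) := by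
    intro a
    have hu' : ∀ᶠ w in 𝓝 y, tens2 (G' w) = pull (jac φ w) (tens2 (G (φ w))) := by
      filter_upwards [hG'] with w hw
      rw [tens2_pull, hw]
    rw [dTen_pull_comp (u := fun w => tens2 (G w)) hφ hJ hu' (fun a => hG _ _) a, hBdef]
    simp only [act_add_left, act_sum_left, act_smul_left]
    rw [add_comm]
    congr 1
    refine sum_congr rfl fun d _ => ?_
    rw [dTen_tens2_eq hs h, hu'.self_of_nhds, ← hJdef, pull_act]
    rw [← Matrix.mul_assoc, ← Matrix.mul_assoc, hJJ, Matrix.one_mul]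
  ext m n
  have := koszul (A := fun a => dMat G' y (e3 a)) (B := B) hdet hs'.self_of_nhds
    (fun a b d => hB a d b)
    (fun a b c => by
      have := congrFun (hcomp a) ![b, c]
      rw [act_tens2] at this
      simpa [dTen, tens2, dMat] using this) m a n
  exact this.symm

/-- The covariant derivative does not depend on the coordinates. -/
lemma covD_transform {G G' : E3 → Mat3} (hφ : ContDiffAt ℝ 2 φ y) (hJ : IsUnit (jac φ y).det)
    (hG' : ∀ᶠ w in 𝓝 y, G' w = (jac φ w).transpose * G (φ w) * jac φ w)
    (hG : ∀ i j, DifferentiableAt ℝ (fun w => G w i j) (φ y))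
    (hs : ∀ᶠ w in 𝓝 (φ y), ∀ i j, G w i j = G w j i) (h : IsUnit (G (φ y)).det) {u u' : E3 → Ten k}
    (hu' : ∀ᶠ w in 𝓝 y, u' w = pull (jac φ w) (u (φ w)))
    (hu : ∀ a, DifferentiableAt ℝ (fun w => u w a) (φ y)) :
    covD e3 G' u' y = pull (jac φ y) (covD e3 G u (φ y)) := by
  ext a
  rw [pull_cons]
  simp only [covD]
  rw [dTen_pull_comp hφ hJ hu' hu, chrMat_transform hφ hJ hG' hG hs h]
  have hJJ : jac φ y * (jac φ y)⁻¹ = 1 := mul_nonsing_inv _ hJ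
  simp only [act_add_left, act_sum_left, act_smul_left, Pi.add_apply]
  rw [add_comm, add_sub_add_left_eq_sub, ← Pi.sub_apply, ← sum_sub_distrib, Finset.sum_apply]
  refine sum_congr rfl fun d _ => ?_
  have h1 : act ((jac φ y)⁻¹ * chrMat e3 G (φ y) d * jac φ y) (u' y)
      = pull (jac φ y) (act (chrMat e3 G (φ y) d) (u (φ y))) := by
    rw [hu'.self_of_nhds, pull_act]
    rw [← Matrix.mul_assoc, ← Matrix.mul_assoc, hJJ, Matrix.one_mul]
  rw [h1, ← smul_sub, Pi.smul_apply, smul_eq_mul]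
  congr 1
  have h2 : ∀ v w : Ten k, pull (jac φ y) v - pull (jac φ y) w = pull (jac φ y) (v - w) := by
    intro v w
    rw [sub_eq_add_neg v, pull_add, ← neg_one_smul ℝ w, pull_smul, neg_one_smul, sub_eq_add_neg]
  rw [h2]
  simp only [Fin.cons_zero, Fin.tail_cons]
  rfl

end Covariance

/-! ### Lie derivatives and the connection -/

section LieDerivative

variable {b : Fin 3 → V} {z v₀ : V} {G : V → Mat3} {X : Fin 3 → V → ℝ}

/-- The vector field `v₀ + Xᶜ ∂_c`. -/
def vfield (v₀ : V) (b : Fin 3 → V) (X : Fin 3 → V → ℝ) (z : V) : V := v₀ + ∑ c, X c z • b c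

/-- The matrix `Wᶜ_d = ∂_d Xᶜ`. -/
def gradX (b : Fin 3 → V) (X : Fin 3 → V → ℝ) (z : V) : Mat3 := fun c d => pderiv b d (X c) z

/-- The operator `∂_{v₀} + ℒ_X` on covariant tensors. -/
def lieD (v₀ : V) (b : Fin 3 → V) (X : Fin 3 → V → ℝ) (u : V → Ten k) (z : V) : Ten k :=
  dTen u z (vfield v₀ b X z) + act (gradX b X z) (u z)

/-- The variation of the Christoffel symbols along `∂_{v₀} + ℒ_X`. -/
def dChr (v₀ : V) (b : Fin 3 → V) (G : V → Mat3) (X : Fin 3 → V → ℝ) (z : V) (a : Fin 3) : Mat3 :=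
  dMat (fun w => chrMat b G w a) z (vfield v₀ b X z) + dMat (gradX b X) z (b a)
    + (∑ e, gradX b X z e a • chrMat b G z e)
    + (chrMat b G z a * gradX b X z - gradX b X z * chrMat b G z a)

lemma dTen_act {A : V → Mat3} {u : V → Ten k} (hA : ∀ i j, DifferentiableAt ℝ (fun w => A w i j) z)
    (hu : ∀ a, DifferentiableAt ℝ (fun w => u w a) z) (v : V) :
    dTen (fun w => act (A w) (u w)) z v = act (dMat A z v) (u z) + act (A z) (dTen u z v) := by
  ext a
  have : HasFDerivAt (fun w => act (A w) (u w) a)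
      (∑ i, ∑ c, (A z c (a i) • fderiv ℝ (fun w => u w (update a i c)) z
        + u z (update a i c) • fderiv ℝ (fun w => A w c (a i)) z)) z := by
    unfold act
    exact HasFDerivAt.fun_sum fun i _ => HasFDerivAt.fun_sum fun c _ =>
      (hA c (a i)).hasFDerivAt.fun_mul (hu _).hasFDerivAt
  simp only [dTen]
  rw [this.fderiv]
  simp only [sum_apply, add_apply, smul_apply, smul_eq_mul, Pi.add_apply, act, dMat,
    sum_add_distrib]
  rw [add_comm]
  congr 1
  exact sum_congr rfl fun i _ => sum_congr rfl fun c _ => mul_comm _ _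

lemma differentiableAt_act {A : V → Mat3} {u : V → Ten k}
    (hA : ∀ i j, DifferentiableAt ℝ (fun w => A w i j) z)
    (hu : ∀ a, DifferentiableAt ℝ (fun w => u w a) z) (a : Fin k → Fin 3) :
    DifferentiableAt ℝ (fun w => act (A w) (u w) a) z := by
  unfold act
  exact DifferentiableAt.fun_sum fun i _ => DifferentiableAt.fun_sum fun c _ =>
    (hA c (a i)).fun_mul (hu _)

lemma contDiffAt_fderiv_apply {f : V → ℝ} {n m : ℕ∞ω} {y : V → V}
    (hf : ContDiffAt ℝ n f z) (hmn : m + 1 ≤ n) (hy : ContDiffAt ℝ m y z) :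
    ContDiffAt ℝ m (fun w => fderiv ℝ f w (y w)) z :=
  (hf.fderiv_right hmn).clm_apply hy

lemma contDiffAt_vfield {n : ℕ∞ω} (hX : ∀ c, ContDiffAt ℝ n (X c) z) :
    ContDiffAt ℝ n (vfield v₀ b X) z := by
  unfold vfield
  exact contDiffAt_const.add (ContDiffAt.sum fun c _ => (hX c).smul contDiffAt_const)

lemma contDiffAt_gradX {n m : ℕ∞ω} (hX : ∀ c, ContDiffAt ℝ n (X c) z) (hmn : m + 1 ≤ n)
    (i j : Fin 3) : ContDiffAt ℝ m (fun w => gradX b X w i j) z :=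
  contDiffAt_fderiv_apply (hX i) hmn contDiffAt_const

lemma contDiffAt_chrMat {n m : ℕ∞ω} (hG : ∀ i j, ContDiffAt ℝ n (fun w => G w i j) z)
    (h : IsUnit (G z).det) (hmn : m + 1 ≤ n) (a i j : Fin 3) :
    ContDiffAt ℝ m (fun w => chrMat b G w a i j) z := by
  unfold chrMat christoffel pderiv
  refine contDiffAt_const.mul (ContDiffAt.sum fun s _ => ?_)
  refine ((contDiffAt_inv hG h i s).of_le (le_self_add.trans hmn)).mul ?_
  exact ((contDiffAt_fderiv_apply (hG _ _) hmn contDiffAt_const).add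
    (contDiffAt_fderiv_apply (hG _ _) hmn contDiffAt_const)).sub
      (contDiffAt_fderiv_apply (hG _ _) hmn contDiffAt_const)

lemma contDiffAt_act {n : ℕ∞ω} {A : V → Mat3} {u : V → Ten k}
    (hA : ∀ i j, ContDiffAt ℝ n (fun w => A w i j) z)
    (hu : ∀ a, ContDiffAt ℝ n (fun w => u w a) z) (a : Fin k → Fin 3) :
    ContDiffAt ℝ n (fun w => act (A w) (u w) a) z := by
  unfold act
  exact ContDiffAt.sum fun i _ => ContDiffAt.sum fun c _ => (hA c (a i)).mul (hu _)

lemma contDiffAt_covD {n m : ℕ∞ω} (hG : ∀ i j, ContDiffAt ℝ n (fun w => G w i j) z)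
    (h : IsUnit (G z).det) {u : V → Ten k}
    (hu : ∀ a, ContDiffAt ℝ n (fun w => u w a) z) (hmn : m + 1 ≤ n) (a : Fin (k + 1) → Fin 3) :
    ContDiffAt ℝ m (fun w => covD b G u w a) z := by
  unfold covD dTen
  exact (contDiffAt_fderiv_apply (hu _) hmn contDiffAt_const).sub
    (contDiffAt_act (contDiffAt_chrMat hG h hmn (a 0))
      (fun a => (hu a).of_le (le_self_add.trans hmn)) _)

lemma contDiffAt_lieD {n m : ℕ∞ω} (hX : ∀ c, ContDiffAt ℝ n (X c) z)
    {u : V → Ten k} (hu : ∀ a, ContDiffAt ℝ n (fun w => u w a) z)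
    (hmn : m + 1 ≤ n) (a : Fin k → Fin 3) : ContDiffAt ℝ m (fun w => lieD v₀ b X u w a) z := by
  unfold lieD dTen
  have hle : m ≤ n := le_self_add.trans hmn
  exact (contDiffAt_fderiv_apply (hu _) hmn (contDiffAt_vfield fun c => (hX c).of_le hle)).add
    (contDiffAt_act (contDiffAt_gradX hX hmn) (fun a => (hu a).of_le hle) _)

/-- The commutator `[∂ₐ, v₀ + X] = (∂ₐ Xᶜ) ∂_c` on functions. -/
lemma pderiv_fderiv_vfield {f : V → ℝ} (hf : ContDiffAt ℝ 2 f z)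
    (hX : ∀ c, DifferentiableAt ℝ (X c) z) (a : Fin 3) :
    fderiv ℝ (fun w => fderiv ℝ f w (vfield v₀ b X w)) z (b a)
      = fderiv ℝ (fun w => fderiv ℝ f w (b a)) z (vfield v₀ b X z)
        + ∑ c, gradX b X z c a * fderiv ℝ f z (b c) := by
  have h1 : DifferentiableAt ℝ (fderiv ℝ f) z :=
    (hf.fderiv_right (m := 1) (by norm_num)).differentiableAt (by norm_num)
  have h2 : HasFDerivAt (vfield v₀ b X) (∑ c, (fderiv ℝ (X c) z).smulRight (b c)) z := by
    unfold vfield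
    refine HasFDerivAt.const_add _ (HasFDerivAt.fun_sum fun c _ => ?_)
    exact (hX c).hasFDerivAt.smul_const (b c)
  have h3 := h1.hasFDerivAt.clm_apply h2
  have h4 := h1.hasFDerivAt.clm_apply (hasFDerivAt_const (b a) z)
  rw [h3.fderiv, h4.fderiv]
  simp only [add_apply, comp_apply, ContinuousLinearMap.flip_apply, sum_apply,
    smulRight_apply, map_sum, map_smul, smul_eq_mul, zero_apply, map_zero,
    zero_add]
  rw [(hf.isSymmSndFDerivAt (by simp)) (b a) (vfield v₀ b X z), add_comm]
  rfl

/-- The commutator of `∂_{v₀} + ℒ_X` with the covariant derivative. -/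
lemma lieD_covD (hG : ∀ i j, ContDiffAt ℝ 2 (fun w => G w i j) z) (h : IsUnit (G z).det)
    (hX : ∀ c, ContDiffAt ℝ 2 (X c) z) {u : V → Ten k}
    (hu : ∀ a, ContDiffAt ℝ 2 (fun w => u w a) z) (a : Fin (k + 1) → Fin 3) :
    lieD v₀ b X (covD b G u) z a = covD b G (lieD v₀ b X u) z a
      - act (dChr v₀ b G X z (a 0)) (u z) (tail a) := by
  have e12 : (1 : ℕ∞ω) + 1 ≤ 2 := by norm_num
  have hΓ : ∀ c i j, DifferentiableAt ℝ (fun w => chrMat b G w c i j) z := fun c i j =>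
    (contDiffAt_chrMat hG h e12 c i j).differentiableAt (by norm_num)
  have hu1 : ∀ a, DifferentiableAt ℝ (fun w => u w a) z := fun a =>
    (hu a).differentiableAt (by norm_num)
  have hW : ∀ i j, DifferentiableAt ℝ (fun w => gradX b X w i j) z := fun i j =>
    (contDiffAt_gradX hX e12 i j).differentiableAt (by norm_num)
  have hX1 : ∀ c, DifferentiableAt ℝ (X c) z := fun c => (hX c).differentiableAt (by norm_num)
  have hdu : ∀ v a, DifferentiableAt ℝ (fun w => fderiv ℝ (fun w => u w a) w v) z := fun v a =>
    (contDiffAt_fderiv_apply (hu a) e12 contDiffAt_const).differentiableAt (by norm_num)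
  have hVu : ∀ a, DifferentiableAt ℝ
      (fun w => fderiv ℝ (fun w => u w a) w (vfield v₀ b X w)) z := fun a =>
    (contDiffAt_fderiv_apply (hu a) e12
      (contDiffAt_vfield fun c => (hX c).of_le (by norm_num))).differentiableAt (by norm_num)
  set W := gradX b X z with hWdef
  set vz := vfield v₀ b X z with hvz
  -- the derivative of `∇u` along the vector field
  have h1 : dTen (covD b G u) z vz a
      = fderiv ℝ (fun w => fderiv ℝ (fun w => u w (tail a)) w (b (a 0))) z vz
        - (act (dMat (fun w => chrMat b G w (a 0)) z vz) (u z) (tail a)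
          + act (chrMat b G z (a 0)) (dTen u z vz) (tail a)) := by
    have := congrFun (dTen_act (hΓ (a 0)) hu1 vz) (tail a)
    rw [← Pi.add_apply, ← this]
    simp only [dTen, covD]
    rw [fderiv_fun_sub (hdu _ _) (differentiableAt_act (hΓ (a 0)) hu1 _)]
    rfl
  -- the coordinate derivative of `(∂ + ℒ_X) u`
  have h2 : dTen (lieD v₀ b X u) z (b (a 0)) (tail a)
      = fderiv ℝ (fun w => fderiv ℝ (fun w => u w (tail a)) w (vfield v₀ b X w)) z (b (a 0))
        + (act (dMat (gradX b X) z (b (a 0))) (u z) (tail a)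
          + act W (dTen u z (b (a 0))) (tail a)) := by
    have := congrFun (dTen_act hW hu1 (b (a 0))) (tail a)
    rw [← Pi.add_apply, ← this]
    simp only [dTen, lieD, Pi.add_apply]
    rw [fderiv_fun_add (hVu _) (differentiableAt_act hW hu1 _)]
    rfl
  have h3 : ∀ e, (fun β => covD b G u z (Fin.cons e β))
      = dTen u z (b e) - act (chrMat b G z e) (u z) := by
    intro e; ext β; simp [covD]
  have h4 : ∀ c, covD b G u z (Fin.cons c (tail a))
      = dTen u z (b c) (tail a) - act (chrMat b G z c) (u z) (tail a) := by
    intro c; simp [covD]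
  have h5 := congrFun (act_act_sub W (chrMat b G z (a 0)) (u z)) (tail a)
  rw [act_sub_left] at h5
  simp only [Pi.sub_apply] at h5
  have hL : lieD v₀ b X (covD b G u) z a = dTen (covD b G u) z vz a + act W (covD b G u z) a := rfl
  have hR : covD b G (lieD v₀ b X u) z a = dTen (lieD v₀ b X u) z (b (a 0)) (tail a)
      - act (chrMat b G z (a 0)) (dTen u z vz + act W (u z)) (tail a) := rfl
  rw [hL, hR, h1, h2, act_cons, h3]
  simp only [h4]
  rw [pderiv_fderiv_vfield (hu _) hX1]
  simp only [dChr, act_add_left, act_sum_left, act_smul_left, act_sub_left, act_sub, act_add,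
    Pi.add_apply, Pi.sub_apply, Finset.sum_apply, Pi.smul_apply, smul_eq_mul, mul_sub,
    sum_sub_distrib, ← hWdef, ← hvz]
  simp only [dTen] at *
  linear_combination -h5

lemma dChr_symm (hs : ∀ᶠ w in 𝓝 z, ∀ i j, G w i j = G w j i)
    (hX : ∀ c, ContDiffAt ℝ 2 (X c) z) (a c d : Fin 3) :
    dChr v₀ b G X z a c d = dChr v₀ b G X z d c a := by
  have hs' : ∀ᶠ w in 𝓝 z, ∀ a c d, chrMat b G w a c d = chrMat b G w d c a := by
    filter_upwards [hs.eventually_nhds] with w hw a c d using chrMat_symm hw a c d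
  have h1 : ∀ v, dMat (fun w => chrMat b G w a) z v c d = dMat (fun w => chrMat b G w d) z v c a := by
    intro v
    simp only [dMat]
    rw [EventuallyEq.fderiv_eq (hs'.mono fun w hw => hw a c d)]
  have h2 : dMat (gradX b X) z (b a) c d = dMat (gradX b X) z (b d) c a := by
    have hd : DifferentiableAt ℝ (fderiv ℝ (X c)) z :=
      ((hX c).fderiv_right (m := 1) (by norm_num)).differentiableAt (by norm_num)
    have key : ∀ a d, dMat (gradX b X) z (b a) c d = fderiv ℝ (fderiv ℝ (X c)) z (b a) (b d) := by
      intro a d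
      simp only [dMat, gradX, pderiv]
      rw [(hd.hasFDerivAt.clm_apply (hasFDerivAt_const (b d) z)).fderiv]
      simp
    rw [key, key, ((hX c).isSymmSndFDerivAt (by simp)) (b a) (b d)]
  have hz := hs'.self_of_nhds
  simp only [dChr, Matrix.add_apply, Matrix.sub_apply, Matrix.sum_apply, Matrix.smul_apply,
    smul_eq_mul, mul_apply, h1, h2]
  have e1 : ∀ a d, ∑ e, gradX b X z e a * chrMat b G z e c d
      = ∑ e, chrMat b G z d c e * gradX b X z e a := fun a d =>
    sum_congr rfl fun e _ => by rw [hz e c d]; ring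
  have e2 : ∑ e, gradX b X z c e * chrMat b G z a e d = ∑ e, gradX b X z c e * chrMat b G z d e a :=
    sum_congr rfl fun e _ => by rw [hz a e d]
  rw [e1, e1, e2]; ring

/-- The variation of the Christoffel symbols in terms of the variation of the metric. -/
lemma dChr_eq (hG : ∀ i j, ContDiffAt ℝ 2 (fun w => G w i j) z) (h : IsUnit (G z).det)
    (hs : ∀ᶠ w in 𝓝 z, ∀ i j, G w i j = G w j i) (hX : ∀ c, ContDiffAt ℝ 2 (X c) z)
    (m l n : Fin 3) : dChr v₀ b G X z m l n = (1 / 2) * ∑ s, (G z)⁻¹ l s *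
      (covD b G (lieD v₀ b X fun w => tens2 (G w)) z ![m, s, n]
        + covD b G (lieD v₀ b X fun w => tens2 (G w)) z ![n, s, m]
        - covD b G (lieD v₀ b X fun w => tens2 (G w)) z ![s, m, n]) := by
  have hdet : ∀ᶠ w in 𝓝 z, IsUnit (G w).det := by
    filter_upwards [(contDiffAt_det hG).continuousAt.eventually_ne h.ne_zero] with w hw
      using isUnit_iff_ne_zero.2 hw
  have h0 : covD b G (fun w => tens2 (G w)) =ᶠ[𝓝 z] 0 := by
    filter_upwards [hdet, hs.eventually_nhds] with w hw hsw using covD_metric hsw hw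
  have h1 : ∀ a, lieD v₀ b X (covD b G (fun w => tens2 (G w))) z a = 0 := by
    intro a
    have h2 : (fun w => covD b G (fun w => tens2 (G w)) w a) =ᶠ[𝓝 z] fun _ => 0 := by
      filter_upwards [h0] with w hw; rw [hw]; rfl
    simp only [lieD, Pi.add_apply, dTen]
    rw [h2.fderiv_eq, h0.self_of_nhds]
    simp [act]
  refine koszul (A := fun a => fun i j =>
    covD b G (lieD v₀ b X fun w => tens2 (G w)) z ![a, i, j]) (B := dChr v₀ b G X z) h
    hs.self_of_nhds (fun a b d => dChr_symm hs hX _ _ _) (fun a i j => ?_) l m n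
  have h3 := lieD_covD (v₀ := v₀) (b := b) hG h hX (u := fun w => tens2 (G w)) (fun a => hG _ _) ![a, i, j]
  rw [h1] at h3
  have h4 : tail ![a, i, j] = ![i, j] := by ext m; fin_cases m <;> rfl
  rw [h4, act_tens2] at h3
  simp only [Matrix.cons_val_zero, Matrix.cons_val_one] at h3
  linarith

/-- The derivative of the norm of a tensor along `v₀ + X`. -/
lemma fderiv_tensorNormSq (hG : ∀ i j, DifferentiableAt ℝ (fun w => G w i j) z)
    (h : IsUnit (G z).det) (hs : ∀ i j, G z i j = G z j i) {u : V → Ten k}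
    (hu : ∀ a, DifferentiableAt ℝ (fun w => u w a) z) :
    fderiv ℝ (fun w => tensorNormSq (G w) (u w)) z (vfield v₀ b X z)
      = 2 * dot (pull (G z)⁻¹ (u z)) (lieD v₀ b X u z)
        - dot (act ((dMat G z (vfield v₀ b X z) + (gradX b X z).transpose * G z
            + G z * gradX b X z) * (G z)⁻¹) (pull (G z)⁻¹ (u z))) (u z) := by
  set vz := vfield v₀ b X z
  set W := gradX b X z
  have hI := differentiableAt_inv hG h
  have hGi : IsUnit ((G z)⁻¹).det := by
    rw [Matrix.det_nonsing_inv]; exact h.ringInverse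
  have hpd : ∀ a, DifferentiableAt ℝ (fun w => pull (G w)⁻¹ (u w) a) z := fun a =>
    (hasFDerivAt_pull hI hu a).differentiableAt
  have h1 : fderiv ℝ (fun w => tensorNormSq (G w) (u w)) z vz
      = dot (dTen (fun w => pull (G w)⁻¹ (u w)) z vz) (u z)
        + dot (pull (G z)⁻¹ (u z)) (dTen u z vz) := by
    simp only [tensorNormSq_eq_dot, dot]
    rw [fderiv_fun_sum fun a _ => (hpd a).fun_mul (hu a), sum_apply, ← sum_add_distrib]
    refine sum_congr rfl fun a _ => ?_
    rw [fderiv_fun_mul (hpd a) (hu a)]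
    simp [dTen]; ring
  have hGG : (G z)⁻¹ * G z = 1 := nonsing_inv_mul _ h
  have hGG' : G z * (G z)⁻¹ = 1 := mul_nonsing_inv _ h
  have hT : ((G z)⁻¹).transpose = (G z)⁻¹ := by
    rw [Matrix.transpose_nonsing_inv]; congr 1; ext i j; exact hs j i
  rw [h1, dTen_pull_of_isUnit (A := fun w => (G w)⁻¹) hI hGi hu, dMat_inv hG h]
  rw [Matrix.nonsing_inv_nonsing_inv _ h]
  have e1 : G z * -((G z)⁻¹ * dMat G z vz * (G z)⁻¹) = W.transpose + G z * W * (G z)⁻¹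
        - (dMat G z vz + W.transpose * G z + G z * W) * (G z)⁻¹ := by
    rw [Matrix.add_mul, Matrix.add_mul, Matrix.mul_assoc W.transpose, hGG', Matrix.mul_one,
      Matrix.mul_neg, ← Matrix.mul_assoc, ← Matrix.mul_assoc, hGG', Matrix.one_mul]
    abel
  have e2 : act (G z * W * (G z)⁻¹) (pull (G z)⁻¹ (u z)) = pull (G z)⁻¹ (act W (u z)) := by
    rw [pull_act]
    rw [← Matrix.mul_assoc, ← Matrix.mul_assoc, hGG, Matrix.one_mul]
  rw [e1, act_sub_left, act_add_left, e2]
  have e3 : dot (act W.transpose (pull (G z)⁻¹ (u z))) (u z)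
      = dot (pull (G z)⁻¹ (u z)) (act W (u z)) := by
    rw [dot_act, Matrix.transpose_transpose]
  have e4 : ∀ v, dot (pull (G z)⁻¹ v) (u z) = dot (pull (G z)⁻¹ (u z)) v := by
    intro v; rw [dot_pull, hT, dot_comm]
  have e5 : ∀ v w x : Ten k, dot (v - w) x = dot v x - dot w x := by
    intro v w x; simp [dot, sub_mul, sum_sub_distrib]
  rw [dot_comm, dot_add, dot_comm _ (pull _ _), e4, dot_comm (u z), e5, dot_comm (_ + _), dot_add,
    dot_comm (u z), dot_comm (u z), e3, e4, lieD, dot_add]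
  ring

/-- The Jacobi formula. -/
lemma fderiv_det (hG : ∀ i j, DifferentiableAt ℝ (fun w => G w i j) z)
    (h : IsUnit (G z).det) (v : V) :
    fderiv ℝ (fun w => (G w).det) z v = (G z).det * ((G z)⁻¹ * dMat G z v).trace := by
  have h1 : (G z).det • (G z)⁻¹ = (G z).adjugate := by
    rw [Matrix.inv_def, smul_smul, Ring.mul_inverse_cancel _ h, one_smul]
  rw [← smul_eq_mul, ← Matrix.trace_smul, ← Matrix.smul_mul, h1]
  have h2 : ∀ i j, HasFDerivAt (fun w => G w i j) (fderiv ℝ (fun w => G w i j) z) z :=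
    fun i j => (hG i j).hasFDerivAt
  have h3 := (((((((h2 0 0).fun_mul (h2 1 1)).fun_mul (h2 2 2)).fun_sub
    (((h2 0 0).fun_mul (h2 1 2)).fun_mul (h2 2 1))).fun_sub
    (((h2 0 1).fun_mul (h2 1 0)).fun_mul (h2 2 2))).fun_add
    (((h2 0 1).fun_mul (h2 1 2)).fun_mul (h2 2 0))).fun_add
    (((h2 0 2).fun_mul (h2 1 0)).fun_mul (h2 2 1))).fun_sub
    (((h2 0 2).fun_mul (h2 1 1)).fun_mul (h2 2 0))
  simp only [det_fin_three]
  rw [h3.fderiv]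
  simp only [Matrix.trace, Matrix.diag, mul_apply, sum_univ_three, adjugate_fin_three, dMat]
  simp
  ring

/-- The derivative of the volume element along `v₀ + X`. -/
lemma fderiv_sqrt_det (hG : ∀ i j, DifferentiableAt ℝ (fun w => G w i j) z) (h : 0 < (G z).det) :
    fderiv ℝ (fun w => √(G w).det) z (vfield v₀ b X z)
      = √(G z).det * ((1 / 2) * (((G z)⁻¹ * (dMat G z (vfield v₀ b X z)
          + (gradX b X z).transpose * G z + G z * gradX b X z)).trace) - (gradX b X z).trace) := by
  have hu : IsUnit (G z).det := isUnit_iff_ne_zero.2 h.ne'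
  have hd : DifferentiableAt ℝ (fun w => (G w).det) z := by
    simp only [det_fin_three]
    have := hG
    fun_prop
  have hGG : (G z)⁻¹ * G z = 1 := nonsing_inv_mul _ hu
  have hGG' : G z * (G z)⁻¹ = 1 := mul_nonsing_inv _ hu
  rw [(hd.hasFDerivAt.sqrt h.ne').fderiv]
  simp only [smul_apply, smul_eq_mul]
  rw [fderiv_det hG hu]
  have e1 : ((G z)⁻¹ * ((gradX b X z).transpose * G z)).trace = (gradX b X z).trace := by
    rw [Matrix.trace_mul_comm, Matrix.mul_assoc, hGG', Matrix.mul_one, Matrix.trace_transpose]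
  have e2 : ((G z)⁻¹ * (G z * gradX b X z)).trace = (gradX b X z).trace := by
    rw [← Matrix.mul_assoc, hGG, Matrix.one_mul]
  rw [Matrix.mul_add, Matrix.mul_add, Matrix.trace_add, Matrix.trace_add, e1, e2]
  have hsq : √(G z).det * √(G z).det = (G z).det := Real.mul_self_sqrt h.le
  have hpos : 0 < √(G z).det := sqrt_pos.2 h
  field_simp
  rw [sq, hsq]; ring

end LieDerivative

/-! ### Tensor fields and metrics in charts -/

section Charts

/-- The change of coordinates from the chart centred at `c` to the one centred at `c'`. -/
def trans (c c' : M) (y : E3) : E3 := chartAt E3 c' (chartPt c y)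

/-- The domain of the change of coordinates `trans c c'`. -/
def overlap (c c' : M) : Set E3 := {y | y ∈ (chartAt E3 c).target ∧ chartPt c y ∈ (chartAt E3 c').source}

variable {c c' : M} {y : E3}

lemma chartPt_mem (hy : y ∈ (chartAt E3 c).target) : chartPt c y ∈ (chartAt E3 c).source :=
  (chartAt E3 c).map_target hy

lemma chartAt_chartPt (hy : y ∈ (chartAt E3 c).target) : chartAt E3 c (chartPt c y) = y :=
  (chartAt E3 c).right_inv hy

lemma chartPt_chartAt {x : M} (hx : x ∈ (chartAt E3 c).source) :
    chartPt c (chartAt E3 c x) = x := (chartAt E3 c).left_inv hx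

lemma chartPt_trans (hy : y ∈ overlap c c') : chartPt c' (trans c c' y) = chartPt c y :=
  chartPt_chartAt hy.2

lemma trans_mem (hy : y ∈ overlap c c') : trans c c' y ∈ overlap c' c :=
  ⟨(chartAt E3 c').map_source hy.2, by rw [chartPt_trans hy]; exact chartPt_mem hy.1⟩

lemma trans_trans (hy : y ∈ overlap c c') : trans c' c (trans c c' y) = y := by
  rw [trans, chartPt_trans hy, chartAt_chartPt hy.1]

lemma isOpen_overlap (c c' : M) : IsOpen (overlap c c') :=
  (chartAt E3 c).symm.isOpen_inter_preimage (chartAt E3 c').open_source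

lemma mem_overlap_self (hy : y ∈ (chartAt E3 c).target) : y ∈ overlap c (chartPt c y) :=
  ⟨hy, mem_chart_source E3 _⟩

lemma target_mem_nhds (hy : y ∈ (chartAt E3 c).target) : (chartAt E3 c).target ∈ 𝓝 y :=
  (chartAt E3 c).open_target.mem_nhds hy

lemma continuousOn_chartPt (c : M) : ContinuousOn (chartPt c) (chartAt E3 c).target :=
  (chartAt E3 c).continuousOn_symm

lemma contDiffAt_trans (hy : y ∈ overlap c c') : ContDiffAt ℝ ∞ (trans c c') y := by
  have h := contDiffWithinAt_ext_coord_change (I := 𝓘(ℝ, E3)) (n := ∞) c' c (y := y) (by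
    simp only [mfld_simps]
    exact hy)
  have h' : ContDiffAt ℝ ∞ (chartAt E3 c' ∘ (chartAt E3 c).symm) y := by
    simpa only [mfld_simps, contDiffWithinAt_univ] using h
  exact h'

lemma contDiffAt_trans_two (hy : y ∈ overlap c c') : ContDiffAt ℝ 2 (trans c c') y :=
  (contDiffAt_trans hy).of_le (show ((2 : ℕ∞) : ℕ∞ω) ≤ ((⊤ : ℕ∞) : ℕ∞ω) from
    WithTop.coe_le_coe.2 le_top)

lemma fderiv_trans (hy : y ∈ overlap c c') :
    fderiv ℝ (trans c c') y = tangentCoordChange 𝓘(ℝ, E3) c c' (chartPt c y) := by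
  rw [tangentCoordChange_def]
  simp only [mfld_simps]
  rw [fderivWithin_univ]
  rw [chartAt_chartPt hy.1]
  rfl

lemma fderiv_trans_trans (hy : y ∈ overlap c c') (v : E3) :
    fderiv ℝ (trans c' c) (trans c c' y) (fderiv ℝ (trans c c') y v) = v := by
  rw [fderiv_trans hy, fderiv_trans (trans_mem hy), chartPt_trans hy, tangentCoordChange_comp,
    tangentCoordChange_self]
  · simpa using chartPt_mem hy.1
  · simp only [mfld_simps]
    exact ⟨⟨chartPt_mem hy.1, hy.2⟩, chartPt_mem hy.1⟩

lemma jac_mul_jac (hy : y ∈ overlap c c') :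
    jac (trans c' c) (trans c c' y) * jac (trans c c') y = 1 := by
  ext i j
  rw [mul_apply]
  have h := fderiv_trans_trans hy (e3 j)
  rw [fderiv_e3_expand (fderiv ℝ (trans c' c) (trans c c' y))] at h
  have h2 := congrArg (fun v : E3 => v i) h
  simp only [WithLp.ofLp_sum, Finset.sum_apply, WithLp.ofLp_smul, Pi.smul_apply, smul_eq_mul] at h2
  simp only [jac]
  rw [sum_congr rfl fun d _ => mul_comm _ _, h2]
  simp [e3, Matrix.one_apply]

lemma isUnit_det_jac (hy : y ∈ overlap c c') : IsUnit (jac (trans c c') y).det := by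
  have h := congrArg Matrix.det (jac_mul_jac hy)
  rw [det_mul, Matrix.det_one] at h
  exact IsUnit.of_mul_eq_one_right _ h

lemma chartVec_eq_trans (hy : y ∈ overlap c c') (v : E3) :
    tangentCoordChange 𝓘(ℝ, E3) c' (chartPt c y) (chartPt c y) (fderiv ℝ (trans c c') y v)
      = chartVec c y v := by
  rw [fderiv_trans hy, tangentCoordChange_comp]
  · rfl
  · simpa using ⟨chartPt_mem hy.1, hy.2⟩

lemma chartVec_add (c : M) (y v w : E3) : chartVec c y (v + w) = chartVec c y v + chartVec c y w :=
  map_add _ _ _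

lemma chartVec_smul (c : M) (y : E3) (r : ℝ) (v : E3) :
    chartVec c y (r • v) = r • chartVec c y v := map_smul _ _ _

/-- The coordinates of a tangent vector at `chartPt c y`, the inverse of `chartVec c y`. -/
def vecCoord (c : M) (y : E3) : TangentSpace 𝓘(ℝ, E3) (chartPt c y) →L[ℝ] E3 :=
  tangentCoordChange 𝓘(ℝ, E3) (chartPt c y) c (chartPt c y)

lemma vecComp_eq (X : VecField M) (c : M) (y : E3) :
    vecComp X c y = vecCoord c y (X (chartPt c y)) := rfl

lemma vecCoord_chartVec (hy : y ∈ (chartAt E3 c).target) (v : E3) :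
    vecCoord c y (chartVec c y v) = v :=
  (tangentCoordChange_comp (I := 𝓘(ℝ, E3)) (v := v) (by simpa using chartPt_mem hy)).trans
    (tangentCoordChange_self (by simpa using chartPt_mem hy))

lemma chartVec_vecCoord (hy : y ∈ (chartAt E3 c).target) (v : TangentSpace 𝓘(ℝ, E3) (chartPt c y)) :
    chartVec c y (vecCoord c y v) = v := by
  unfold vecCoord chartVec
  exact (tangentCoordChange_comp (I := 𝓘(ℝ, E3)) (v := (v : E3))
    (by simpa using chartPt_mem hy)).trans (tangentCoordChange_self (by simp))

lemma chartVec_vecComp (hy : y ∈ (chartAt E3 c).target) (X : VecField M) :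
    chartVec c y (vecComp X c y) = X (chartPt c y) := chartVec_vecCoord hy _

lemma chartVec_expand (c : M) (y v : E3) : chartVec c y v = ∑ i, v i • chartVec c y (e3 i) :=
  fderiv_e3_expand (tangentCoordChange 𝓘(ℝ, E3) c (chartPt c y) (chartPt c y)) v

lemma bilin_chartVec (B : BilinField M) (c : M) (y v w : E3) :
    B (chartPt c y) (chartVec c y v) (chartVec c y w)
      = ∑ i, ∑ j, v i * w j * bilinComp B c y i j := by
  rw [chartVec_expand c y v, chartVec_expand c y w]
  simp only [map_sum, sum_apply, map_smul, smul_apply, smul_eq_mul, bilinComp]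
  simp only [sum_univ_three]
  ring

lemma bilinComp_transform (B : BilinField M) (hy : y ∈ overlap c c') :
    bilinComp B c y = (jac (trans c c') y).transpose * bilinComp B c' (trans c c' y)
      * jac (trans c c') y := by
  have hp := chartPt_trans hy
  have h : ∀ p, p = chartPt c y → ∀ v w : E3,
      B p (tangentCoordChange 𝓘(ℝ, E3) c' p p v) (tangentCoordChange 𝓘(ℝ, E3) c' p p w)
      = B (chartPt c y) (tangentCoordChange 𝓘(ℝ, E3) c' (chartPt c y) (chartPt c y) v)
        (tangentCoordChange 𝓘(ℝ, E3) c' (chartPt c y) (chartPt c y) w) := by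
    rintro p rfl v w; rfl
  ext i j
  have h1 := bilin_chartVec B c' (trans c c' y) (fderiv ℝ (trans c c') y (e3 i))
    (fderiv ℝ (trans c c') y (e3 j))
  have h2 := h _ hp (fderiv ℝ (trans c c') y (e3 i)) (fderiv ℝ (trans c c') y (e3 j))
  rw [chartVec_eq_trans hy, chartVec_eq_trans hy] at h2
  refine h2.symm.trans (h1.trans ?_)
  simp only [mul_apply, transpose_apply, jac, sum_univ_three]
  ring

lemma vecComp_transform (X : VecField M) (hy : y ∈ overlap c c') :
    vecComp X c' (trans c c' y) = fderiv ℝ (trans c c') y (vecComp X c y) := by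
  unfold vecComp
  rw [chartPt_trans hy, fderiv_trans hy]
  refine (tangentCoordChange_comp (I := 𝓘(ℝ, E3)) (v := (X (chartPt c y) : E3)) ?_).symm
  simpa using ⟨chartPt_mem hy.1, hy.2⟩

/-- A tensor field: the components in different charts are related by the transformation law of
covariant tensors. -/
def IsTensor {k : ℕ} (u : TField M k) : Prop :=
  ∀ c c' : M, ∀ y ∈ overlap c c', u c y = pull (jac (trans c c') y) (u c' (trans c c' y))

/-- The components of a tensor field in every chart are of class `C^n`. -/
def TSmooth {k : ℕ} (n : ℕ∞ω) (u : TField M k) : Prop :=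
  ∀ (c : M) (a : Fin k → Fin 3), ContDiffOn ℝ n (fun y => u c y a) (chartAt E3 c).target

/-- A Riemannian metric of class `C^n`. -/
structure IsMetric (n : ℕ∞ω) (g : BilinField M) : Prop where
  symm : ∀ x v w, g x v w = g x w v
  pos : ∀ x, ∀ v ≠ 0, 0 < g x v v
  smooth : ∀ (c : M) (i j : Fin 3),
    ContDiffOn ℝ n (fun y => bilinComp g c y i j) (chartAt E3 c).target

variable {g : BilinField M} {n : ℕ∞ω}

lemma isTensor_ofFun (u : M → ℝ) : IsTensor (ofFun u) := by
  intro c c' y hy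
  ext a
  simp only [ofFun, pull, mpull, Finset.univ_eq_empty, Finset.prod_empty, one_mul]
  rw [Fintype.sum_unique, chartPt_trans hy]

lemma isTensor_ofBilin (B : BilinField M) : IsTensor (ofBilin B) := by
  intro c c' y hy
  have h : ∀ c y, ofBilin B c y = tens2 (bilinComp B c y) := fun _ _ => rfl
  rw [h, h, tens2_pull, bilinComp_transform B hy]

lemma IsMetric.bilinComp_symm (hg : IsMetric n g) (c : M) (y : E3) (i j : Fin 3) :
    bilinComp g c y i j = bilinComp g c y j i := hg.symm _ _ _

lemma IsMetric.quad_pos (hg : IsMetric n g) (hy : y ∈ (chartAt E3 c).target) {v : E3}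
    (hv : v ≠ 0) : 0 < ∑ i, ∑ j, v i * v j * bilinComp g c y i j := by
  rw [← bilin_chartVec]
  refine hg.pos _ _ fun h0 => hv ?_
  rw [← vecCoord_chartVec hy v, h0, map_zero]

lemma IsMetric.posDef (hg : IsMetric n g) (hy : y ∈ (chartAt E3 c).target) :
    (bilinComp g c y).PosDef := by
  refine Matrix.PosDef.of_dotProduct_mulVec_pos (by ext i j; exact hg.bilinComp_symm c y j i) ?_
  intro x hx
  refine (hg.quad_pos hy (v := WithLp.toLp 2 x) (by simpa using hx)).trans_eq ?_
  simp only [star_trivial, dotProduct, mulVec, sum_univ_three]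
  ring

lemma IsMetric.det_pos (hg : IsMetric n g) (hy : y ∈ (chartAt E3 c).target) :
    0 < (bilinComp g c y).det := (hg.posDef hy).det_pos

lemma IsMetric.isUnit_det (hg : IsMetric n g) (hy : y ∈ (chartAt E3 c).target) :
    IsUnit (bilinComp g c y).det := isUnit_iff_ne_zero.2 (hg.det_pos hy).ne'

lemma IsMetric.contDiffAt (hg : IsMetric n g) (hy : y ∈ (chartAt E3 c).target) (i j : Fin 3) :
    ContDiffAt ℝ n (fun y => bilinComp g c y i j) y :=
  (hg.smooth c i j).contDiffAt (target_mem_nhds hy)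

lemma TSmooth.contDiffAt {u : TField M k} (hu : TSmooth n u) (hy : y ∈ (chartAt E3 c).target)
    (a : Fin k → Fin 3) : ContDiffAt ℝ n (fun y => u c y a) y :=
  (hu c a).contDiffAt (target_mem_nhds hy)

lemma IsMetric.of_le (hg : IsMetric n g) {m : ℕ∞ω} (h : m ≤ n) : IsMetric m g :=
  ⟨hg.symm, hg.pos, fun c i j => (hg.smooth c i j).of_le h⟩

lemma TSmooth.of_le {u : TField M k} (hu : TSmooth n u) {m : ℕ∞ω} (h : m ≤ n) :
    TSmooth m u := fun c a => (hu c a).of_le h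

lemma isTensor_covDeriv (hg : IsMetric n g) (hn : 1 ≤ n) {u : TField M k} (hu : IsTensor u)
    (hus : TSmooth n u) : IsTensor (covDeriv g u) := by
  intro c c' y hy
  have hn0 : n ≠ 0 := (one_pos.trans_le hn).ne'
  refine covD_transform (G := bilinComp g c') (contDiffAt_trans_two hy) (isUnit_det_jac hy) ?_
    (fun i j => (hg.contDiffAt (trans_mem hy).1 i j).differentiableAt hn0)
    (.of_forall fun w i j => hg.bilinComp_symm _ _ _ _)
    (hg.isUnit_det (trans_mem hy).1) ?_
    (fun a => (hus.contDiffAt (trans_mem hy).1 a).differentiableAt hn0)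
  · filter_upwards [(isOpen_overlap c c').mem_nhds hy] with w hw using bilinComp_transform g hw
  · filter_upwards [(isOpen_overlap c c').mem_nhds hy] with w hw using hu c c' w hw

lemma tsmooth_covDeriv {m : ℕ∞ω} (hg : IsMetric n g) {u : TField M k} (hus : TSmooth n u)
    (hmn : m + 1 ≤ n) : TSmooth m (covDeriv g u) := by
  intro c a y hy
  exact (contDiffAt_covD (G := bilinComp g c) (fun i j => hg.contDiffAt hy i j) (hg.isUnit_det hy)
    (fun a => hus.contDiffAt hy a) hmn a).contDiffWithinAt

lemma tsmooth_iterCovDeriv {g : BilinField M} {u : TField M k} {n m p : ℕ} (h : p + m ≤ n)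
    (hg : IsMetric n g) (hus : TSmooth n u) : TSmooth p (iterCovDeriv g u m) := by
  induction m generalizing p with
  | zero => exact hus.of_le (mod_cast h)
  | succ m ih =>
    have h1 : TSmooth ((p + 1 : ℕ) : ℕ∞ω) (iterCovDeriv g u m) := ih (p := p + 1) (by omega)
    exact tsmooth_covDeriv (n := ((p + 1 : ℕ) : ℕ∞ω))
      (hg.of_le (mod_cast (by omega : p + 1 ≤ n))) h1 (by push_cast; rfl)

lemma isTensor_iterCovDeriv {g : BilinField M} {u : TField M k} {n m : ℕ} (h : m ≤ n)
    (hg : IsMetric n g) (hu : IsTensor u) (hus : TSmooth n u) : IsTensor (iterCovDeriv g u m) := by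
  induction m with
  | zero => exact hu
  | succ m ih =>
    exact isTensor_covDeriv (n := ((1 : ℕ) : ℕ∞ω))
      (hg.of_le (mod_cast (by omega : 1 ≤ n))) (by norm_num) (ih (by omega))
      (tsmooth_iterCovDeriv (by omega) hg hus)

/-- The pointwise norm may be computed in any chart. -/
lemma normSqAt_chartPt {u : TField M k} (hu : IsTensor u) (g : BilinField M)
    (hy : y ∈ (chartAt E3 c).target) :
    normSqAt g u (chartPt c y) = tensorNormSq (bilinComp g c y) (u c y) := by
  have hy' := mem_overlap_self hy
  rw [hu _ _ _ hy', bilinComp_transform g hy', tensorNormSq_pull (isUnit_det_jac hy')]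
  rfl

/-- The components of a smooth Riemannian metric are smooth. -/
lemma isMetric_inner (γ : Bundle.ContMDiffRiemannianMetric 𝓘(ℝ, E3) ∞ E3
    (fun x : M => TangentSpace 𝓘(ℝ, E3) x)) : IsMetric ∞ (M := M) γ.inner where
  symm := γ.symm
  pos := γ.pos
  smooth c i j := by
    intro y hy
    have hp := chartPt_mem hy
    have hv : ∀ v : E3, ContMDiffAt 𝓘(ℝ, E3) (𝓘(ℝ, E3).prod 𝓘(ℝ, E3)) ∞
        (fun m : M => (Bundle.TotalSpace.mk' E3 m
          ((trivializationAt E3 (TangentSpace 𝓘(ℝ, E3)) c).symmL ℝ m v) :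
            TangentBundle 𝓘(ℝ, E3) M)) (chartPt c y) := by
      intro v
      refine ContMDiffAt.clm_bundle_apply (F₁ := E3) (E₁ := Bundle.Trivial M E3)
        (b := fun m : M => m)
        (ϕ := fun m => (trivializationAt E3 (TangentSpace 𝓘(ℝ, E3)) c).symmL ℝ m)
        (v := fun _ => v) ?_ ?_
      · exact Bundle.Trivialization.contMDiffAt_symmL _ (by simpa using hp)
      · exact (Bundle.contMDiffAt_section _).2 contMDiffAt_const
    have h2 : ContMDiffAt 𝓘(ℝ, E3) (𝓘(ℝ, E3).prod 𝓘(ℝ, ℝ)) ∞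
        (fun m : M => (Bundle.TotalSpace.mk' ℝ m (γ.inner m
          ((trivializationAt E3 (TangentSpace 𝓘(ℝ, E3)) c).symmL ℝ m (e3 i))
          ((trivializationAt E3 (TangentSpace 𝓘(ℝ, E3)) c).symmL ℝ m (e3 j))) :
            Bundle.TotalSpace ℝ (Bundle.Trivial M ℝ))) (chartPt c y) :=
      ContMDiffAt.clm_bundle_apply₂ (F₁ := E3) (F₂ := E3) (γ.contMDiff.contMDiffAt) (hv _) (hv _)
    have h3 := (Bundle.contMDiffAt_section _).1 h2
    have h4 : ContMDiffAt 𝓘(ℝ, E3) 𝓘(ℝ, E3) ∞ (chartPt c) y :=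
      (contMDiffOn_chart_symm (I := 𝓘(ℝ, E3)) (n := ∞) (x := c)).contMDiffAt (target_mem_nhds hy)
    have h5 := (ContMDiffAt.comp y h3 h4).contDiffAt
    refine ContDiffAt.contDiffWithinAt (h5.congr_of_eventuallyEq ?_)
    filter_upwards [target_mem_nhds hy] with w hw
    simp only [Function.comp_apply, bilinComp, chartVec]
    rw [TangentBundle.symmL_trivializationAt_eq_core (chartPt_mem hw)]
    rfl

end Charts

/-! ### The Riemannian measure and coordinate balls -/

section Measure

variable {c c' : M} {y : E3}

lemma continuous_of_chart {φ : M → ℝ}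
    (h : ∀ c : M, ContinuousOn (fun y => φ (chartPt c y)) (chartAt E3 c).target) :
    Continuous φ := by
  rw [continuous_iff_continuousAt]
  intro x
  have hx := mem_chart_source E3 x
  have h1 : ContinuousAt (fun y => φ (chartPt x y)) (chartAt E3 x x) :=
    (h x).continuousAt (target_mem_nhds (mem_chart_target E3 x))
  refine (ContinuousAt.comp h1 ((chartAt E3 x).continuousAt hx)).congr ?_
  filter_upwards [(chartAt E3 x).open_source.mem_nhds hx] with z hz
  simp [chartPt_chartAt hz]

variable {g : BilinField M} {n : ℕ∞ω}

lemma IsMetric.continuousOn_sqrt_det (hg : IsMetric n g) (c : M) :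
    ContinuousOn (fun y => √(bilinComp g c y).det) (chartAt E3 c).target := fun _ hy =>
  ((contDiffAt_det (G := bilinComp g c) (n := 0)
    (fun i j => (hg.contDiffAt hy i j).of_le zero_le)).continuousAt.sqrt).continuousWithinAt

variable (M) in
/-- A finite atlas of coordinate balls with a subordinate partition of unity. The closed balls of
twice the radius are still contained in the domains of the coordinates. -/
structure PatchAtlas where
  ι : Type
  [fin : Fintype ι]
  ctr : ι → M
  rad : ι → ℝ
  rad_pos : ∀ j, 0 < rad j
  ball_subset : ∀ j, closedBall (chartAt E3 (ctr j) (ctr j)) (2 * rad j)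
    ⊆ (chartAt E3 (ctr j)).target
  χ : ι → M → ℝ
  χ_nonneg : ∀ j x, 0 ≤ χ j x
  χ_sum : ∀ x, ∑ j, χ j x = 1
  χ_supp : ∀ j x, χ j x ≠ 0 → x ∈ (chartAt E3 (ctr j)).source ∧
    chartAt E3 (ctr j) x ∈ ball (chartAt E3 (ctr j) (ctr j)) (rad j)
  χ_smooth : ∀ j c, ContDiffOn ℝ ∞ (fun y => χ j (chartPt c y)) (chartAt E3 c).target

attribute [instance] PatchAtlas.fin

lemma nonempty_patchAtlas [T2Space M] [CompactSpace M] : Nonempty (PatchAtlas M) := by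
  have hr : ∀ x : M, ∃ r : ℝ, 0 < r ∧ closedBall (chartAt E3 x x) (2 * r)
      ⊆ (chartAt E3 x).target := by
    intro x
    obtain ⟨r, hr, hsub⟩ := nhds_basis_closedBall.mem_iff.1
      (target_mem_nhds (mem_chart_target E3 x))
    exact ⟨r / 2, by positivity, by rwa [mul_div_cancel₀ r two_ne_zero]⟩
  choose r hr0 hr using hr
  set U : M → Set M := fun x => (chartAt E3 x).symm '' ball (chartAt E3 x x) (r x) with hU
  have hsub1 : ∀ x, ball (chartAt E3 x x) (r x) ⊆ (chartAt E3 x).target := fun x =>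
    ((ball_subset_ball (by linarith [hr0 x])).trans ball_subset_closedBall).trans
      (hr x)
  have hUo : ∀ x, IsOpen (U x) := fun x =>
    (chartAt E3 x).isOpen_image_symm_of_subset_target isOpen_ball (hsub1 x)
  obtain ⟨t, ht⟩ := CompactSpace.elim_nhds_subcover U fun x => (hUo x).mem_nhds
    ⟨chartAt E3 x x, Metric.mem_ball_self (hr0 x), (chartAt E3 x).left_inv (mem_chart_source E3 x)⟩
  let p : Fin t.card → M := fun i => (t.equivFin.symm i : M)
  have hcov : (univ : Set M) ⊆ ⋃ i, U (p i) := by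
    intro x _
    have hx : x ∈ ⋃ x ∈ t, U x := by rw [ht]; trivial
    simp only [mem_iUnion] at hx ⊢
    obtain ⟨c, hc, hx⟩ := hx
    exact ⟨t.equivFin ⟨c, hc⟩, by simpa [p] using hx⟩
  obtain ⟨f, hf⟩ := SmoothPartitionOfUnity.exists_isSubordinate 𝓘(ℝ, E3) isClosed_univ
    (fun i => U (p i)) (fun i => hUo _) hcov
  refine ⟨{ ι := Fin t.card, ctr := p, rad := fun i => r (p i), rad_pos := fun i => hr0 _,
            ball_subset := fun i => hr _, χ := fun i => f i, χ_nonneg := fun i => f.nonneg i,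
            χ_sum := ?_, χ_supp := ?_, χ_smooth := ?_ }⟩
  · intro x
    have := f.sum_eq_one (mem_univ x)
    rwa [finsum_eq_sum_of_fintype] at this
  · intro j x hx
    obtain ⟨y, hy, rfl⟩ := hf j (subset_tsupport _ hx)
    have := hsub1 _ hy
    exact ⟨chartPt_mem this, by rwa [(chartAt E3 (p j)).right_inv this]⟩
  · intro j c
    have h4 : ContMDiffOn 𝓘(ℝ, E3) 𝓘(ℝ, E3) ∞ (chartPt c) (chartAt E3 c).target :=
      contMDiffOn_chart_symm (I := 𝓘(ℝ, E3)) (n := ∞) (x := c)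
    exact ((f j).contMDiff.comp_contMDiffOn h4).contDiffOn

namespace PatchAtlas

variable (U : PatchAtlas M)

/-- The centre of a coordinate ball. -/
def mid (j : U.ι) : E3 := chartAt E3 (U.ctr j) (U.ctr j)

/-- The coordinate balls. -/
def ball (j : U.ι) : Set E3 := Metric.ball (U.mid j) (U.rad j)

/-- The coordinate balls of twice the radius. -/
def ball2 (j : U.ι) : Set E3 := Metric.ball (U.mid j) (2 * U.rad j)

lemma ball2_subset (j : U.ι) : U.ball2 j ⊆ (chartAt E3 (U.ctr j)).target :=
  Metric.ball_subset_closedBall.trans (U.ball_subset j)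

lemma ball_subset_ball2 (j : U.ι) : U.ball j ⊆ U.ball2 j :=
  Metric.ball_subset_ball (by linarith [U.rad_pos j])

lemma ball_subset_target (j : U.ι) : U.ball j ⊆ (chartAt E3 (U.ctr j)).target :=
  (U.ball_subset_ball2 j).trans (U.ball2_subset j)

lemma continuous_χ (j : U.ι) : Continuous (U.χ j) :=
  continuous_of_chart fun c => (U.χ_smooth j c).continuousOn

end PatchAtlas

variable [MeasurableSpace M] [BorelSpace M]

/-- The measure `√(det g_{ij}) dy` in the chart centred at `c`. -/
def chartMeas (g : BilinField M) (c : M) : Measure M :=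
  ((volume.restrict (chartAt E3 c).target).withDensity
        fun y => ofReal √(bilinComp g c y).det).map (chartAt E3 c).symm

lemma measurableSet_source (c : M) : MeasurableSet (chartAt E3 c).source :=
  (chartAt E3 c).open_source.measurableSet

lemma measurableSet_target (c : M) : MeasurableSet (chartAt E3 c).target :=
  (chartAt E3 c).open_target.measurableSet

lemma aemeasurable_chart_symm (g : BilinField M) (c : M) :
    AEMeasurable (chartAt E3 c).symm ((volume.restrict (chartAt E3 c).target).withDensity
      fun y => ofReal √(bilinComp g c y).det) := by
  have h : AEMeasurable (chartAt E3 c).symm (volume.restrict (chartAt E3 c).target) :=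
    (chartAt E3 c).continuousOn_symm.aemeasurable (measurableSet_target c)
  exact h.mono_ac (withDensity_absolutelyContinuous _ _)

lemma ae_mem_source_chartMeas (g : BilinField M) (c : M) :
    ∀ᵐ x ∂(chartMeas g c), x ∈ (chartAt E3 c).source := by
  refine (ae_map_iff (p := fun x => x ∈ (chartAt E3 c).source)
    (aemeasurable_chart_symm g c) (measurableSet_source c)).2 ?_
  refine (withDensity_absolutelyContinuous _ _).ae_le ?_
  filter_upwards [ae_restrict_mem (measurableSet_target c)] with z hz using chartPt_mem hz

lemma measurableSet_image_chart {B : Set M} (hB : MeasurableSet B)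
    (hBc : B ⊆ (chartAt E3 c).source) : MeasurableSet (chartAt E3 c '' B) := by
  rw [(chartAt E3 c).image_eq_target_inter_inv_preimage hBc]
  convert! (measurableSet_target c).subtype_image
    ((continuousOn_chartPt c).domRestrict.measurable hB) using 1
  exact (Subtype.image_preimage_val _ _).symm

lemma chartMeas_apply {B : Set M} (hB : MeasurableSet B) (hBc : B ⊆ (chartAt E3 c).source) :
    chartMeas g c B = ∫⁻ y in chartAt E3 c '' B, ofReal √(bilinComp g c y).det := by
  have hm := measurableSet_image_chart hB hBc
  rw [chartMeas, Measure.map_apply_of_aemeasurable (aemeasurable_chart_symm g c) hB]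
  have h1 : (chartAt E3 c).symm ⁻¹' B ∩ (chartAt E3 c).target = chartAt E3 c '' B := by
    rw [(chartAt E3 c).image_eq_target_inter_inv_preimage hBc, inter_comm]
  have h2 : ∀ᵐ z ∂((volume.restrict (chartAt E3 c).target).withDensity
      fun y => ofReal √(bilinComp g c y).det), z ∈ (chartAt E3 c).target :=
    (withDensity_absolutelyContinuous _ _).ae_le (ae_restrict_mem (measurableSet_target c))
  rw [← Measure.measure_inter_eq_of_ae h2, inter_comm, h1]
  rw [withDensity_apply _ hm, Measure.restrict_restrict hm]
  congr 2
  rw [← h1]; exact inter_eq_left.2 inter_subset_right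

lemma det_bilinComp_transform (g : BilinField M) (hy : y ∈ overlap c c') : √(bilinComp g c y).det
      = |(jac (trans c c') y).det| * √(bilinComp g c' (trans c c' y)).det := by
  rw [bilinComp_transform g hy, det_mul, det_mul, det_transpose,
    mul_right_comm, sqrt_mul (mul_self_nonneg _), Real.sqrt_mul_self_eq_abs]

lemma det_fderiv_eq (L : E3 →L[ℝ] E3) : L.det = Matrix.det (fun i a => L (e3 a) i : Mat3) := by
  rw [ContinuousLinearMap.det, ← LinearMap.det_toMatrix (EuclideanSpace.basisFun (Fin 3) ℝ).toBasis]
  congr 1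

/-- The Riemannian measures of two charts agree on the intersection of their domains. -/
lemma chartMeas_eq {B : Set M} (hB : MeasurableSet B) (hBc : B ⊆ (chartAt E3 c).source)
    (hBc' : B ⊆ (chartAt E3 c').source) : chartMeas g c B = chartMeas g c' B := by
  rw [chartMeas_apply hB hBc, chartMeas_apply hB hBc']
  have hm := measurableSet_image_chart hB hBc
  have hov : ∀ z ∈ chartAt E3 c '' B, z ∈ overlap c c' := by
    rintro z ⟨x, hx, rfl⟩
    refine ⟨(chartAt E3 c).map_source (hBc hx), ?_⟩
    rw [chartPt_chartAt (hBc hx)]; exact hBc' hx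
  have himg : chartAt E3 c' '' B = trans c c' '' (chartAt E3 c '' B) := by
    rw [image_image]
    refine image_congr fun x hx => ?_
    rw [trans, chartPt_chartAt (hBc hx)]
  rw [himg, lintegral_image_eq_lintegral_abs_det_fderiv_mul volume hm
    (f' := fun z => fderiv ℝ (trans c c') z)
    (fun z hz => ((contDiffAt_trans (hov z hz)).differentiableAt
      (by simp)).hasFDerivAt.hasFDerivWithinAt)
    (fun z hz w hw h => by rw [← trans_trans (hov z hz), h, trans_trans (hov w hw)])]
  refine setLIntegral_congr_fun hm fun z hz => ?_
  rw [det_bilinComp_transform g (hov z hz), ofReal_mul (abs_nonneg _), det_fderiv_eq]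
  rfl

variable [CompactSpace M]

/-- On the domain of a chart, the Riemannian measure is the coordinate measure of this chart alone.
-/
lemma riemVol_apply {B : Set M} (hB : MeasurableSet B) (hBc : B ⊆ (chartAt E3 c).source) :
    riemVol g B = chartMeas g c B := by
  set s : Fin (chartCover M).card → Set M := fun j => (chartAt E3 (coverPt M j)).source with hs
  have hd : ∀ i, MeasurableSet (disjointed s i) :=
    fun i => by
      rw [disjointed_apply]
      exact (measurableSet_source _).diff (Finset.sup_induction (p := MeasurableSet)
        MeasurableSet.empty (fun _ h _ h' => h.union h') fun j _ => measurableSet_source _)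
  have hun : (⋃ i, disjointed s i) = univ := by
    rw [iUnion_disjointed, eq_univ_iff_forall]
    intro x
    have hx : x ∈ (⋃ c ∈ chartCover M, (chartAt E3 c).source) := by
      rw [show (⋃ c ∈ chartCover M, (chartAt E3 c).source) = univ from
        (exists_chart_cover M).choose_spec]; trivial
    simp only [mem_iUnion] at hx ⊢
    obtain ⟨c, hc, hx⟩ := hx
    refine ⟨(chartCover M).equivFin ⟨c, hc⟩, ?_⟩
    simpa [hs, coverPt] using hx
  have h1 : riemVol g B = ∑ i, chartMeas g (coverPt M i) (B ∩ disjointed s i) := by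
    rw [riemVol, Measure.sum_apply _ hB, tsum_fintype]
    refine sum_congr rfl fun i _ => ?_
    rw [Measure.restrict_apply hB]; rfl
  rw [h1]
  have h2 : ∀ i, chartMeas g (coverPt M i) (B ∩ disjointed s i)
      = chartMeas g c (B ∩ disjointed s i) := fun i =>
    chartMeas_eq (hB.inter (hd i)) (inter_subset_right.trans (disjointed_subset s i))
      (inter_subset_left.trans hBc)
  simp only [h2]
  have h3 : B = ⋃ i, B ∩ disjointed s i := by rw [← inter_iUnion, hun, inter_univ]
  conv_rhs => rw [h3]
  rw [measure_iUnion (fun i j hij =>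
    ((disjoint_disjointed s) hij).mono inter_subset_right inter_subset_right)
    (fun i => hB.inter (hd i)), tsum_fintype]

lemma riemVol_restrict (g : BilinField M) (c : M) : (riemVol g).restrict (chartAt E3 c).source
      = (chartMeas g c).restrict (chartAt E3 c).source := by
  ext B hB
  rw [Measure.restrict_apply hB, Measure.restrict_apply hB,
    riemVol_apply (hB.inter (measurableSet_source c)) inter_subset_right]

lemma integral_source (hg : IsMetric n g) {φ : M → ℝ} (hφ : ContinuousOn φ (chartAt E3 c).source) :
    ∫ x in (chartAt E3 c).source, φ x ∂(riemVol g)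
      = ∫ y in (chartAt E3 c).target, φ (chartPt c y) * √(bilinComp g c y).det := by
  have hms := measurableSet_source c
  have hsupp := Measure.restrict_eq_self_of_ae_mem (ae_mem_source_chartMeas g c)
  have hsm : AEStronglyMeasurable φ (chartMeas g c) := by
    rw [← hsupp]; exact hφ.aestronglyMeasurable hms
  have hdens := ((hg.continuousOn_sqrt_det c).aemeasurable
    (measurableSet_target c) (μ := volume)).real_toNNReal
  rw [riemVol_restrict, hsupp, chartMeas, integral_map (aemeasurable_chart_symm g c) hsm]
  have := integral_withDensity_eq_integral_smul₀ hdens fun y => φ ((chartAt E3 c).symm y)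
  refine Eq.trans ?_ (this.trans ?_)
  · rfl
  · refine integral_congr_ae (.of_forall fun y => ?_)
    simp only [NNReal.smul_def, coe_toNNReal _ (sqrt_nonneg _), smul_eq_mul]
    rw [mul_comm]; rfl

/-- The integral of a function that vanishes outside the domain of a chart, in that chart. -/
lemma integral_eq_chart (hg : IsMetric n g) {φ : M → ℝ} (hφ : Continuous φ)
    (hs : ∀ x, φ x ≠ 0 → x ∈ (chartAt E3 c).source) : ∫ x, φ x ∂(riemVol g)
      = ∫ y in (chartAt E3 c).target, φ (chartPt c y) * √(bilinComp g c y).det := by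
  rw [← integral_source hg hφ.continuousOn]
  exact (setIntegral_eq_integral_of_forall_compl_eq_zero fun x hx => by
    by_contra h; exact hx (hs x h)).symm

lemma isFiniteMeasure_riemVol (hg : IsMetric n g) : IsFiniteMeasure (riemVol g) := by
  have : IsLocallyFiniteMeasure (riemVol g) := by
    refine ⟨fun x => ?_⟩
    obtain ⟨r, hr, hsub⟩ := nhds_basis_closedBall.mem_iff.1
      (target_mem_nhds (mem_chart_target E3 x))
    set K := closedBall (chartAt E3 x x) r
    have hK : IsCompact K := isCompact_closedBall _ _
    have hcont := (hg.continuousOn_sqrt_det x).mono hsub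
    have himg : IsOpen ((chartAt E3 x).symm '' ball (chartAt E3 x x) r) :=
      (chartAt E3 x).isOpen_image_symm_of_subset_target isOpen_ball
        (ball_subset_closedBall.trans hsub)
    refine ⟨_, himg.mem_nhds ⟨chartAt E3 x x, Metric.mem_ball_self hr,
      (chartAt E3 x).left_inv (mem_chart_source E3 x)⟩, ?_⟩
    have hsrc : (chartAt E3 x).symm '' ball (chartAt E3 x x) r ⊆ (chartAt E3 x).source := by
      rintro _ ⟨y, hy, rfl⟩
      exact chartPt_mem (hsub (ball_subset_closedBall hy))
    rw [riemVol_apply himg.measurableSet hsrc, chartMeas_apply himg.measurableSet hsrc]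
    have himg2 : chartAt E3 x '' ((chartAt E3 x).symm '' ball (chartAt E3 x x) r) ⊆ K := by
      rintro _ ⟨_, ⟨y, hy, rfl⟩, rfl⟩
      rw [(chartAt E3 x).right_inv (hsub (ball_subset_closedBall hy))]
      exact ball_subset_closedBall hy
    exact (lintegral_mono_set himg2).trans_lt (hcont.integrableOn_compact hK).lintegral_lt_top
  exact CompactSpace.isFiniteMeasure

lemma IsMetric.integrable (hg : IsMetric n g) {φ : M → ℝ} (hφ : Continuous φ) :
    Integrable φ (riemVol g) := by
  have := isFiniteMeasure_riemVol hg
  exact hφ.integrable_of_hasCompactSupport (HasCompactSupport.of_compactSpace _)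

lemma integral_eq_sum_patch (U : PatchAtlas M) (hg : IsMetric n g) {φ : M → ℝ} (hφ : Continuous φ) :
    ∫ x, φ x ∂(riemVol g) = ∑ j, ∫ y in U.ball j, U.χ j (chartPt (U.ctr j) y)
      * (φ (chartPt (U.ctr j) y) * √(bilinComp g (U.ctr j) y).det) := by
  have hχ : ∀ j, Continuous fun x => U.χ j x * φ x := fun j => (U.continuous_χ j).mul hφ
  have h1 : ∀ x, φ x = ∑ j, U.χ j x * φ x := fun x => by
    rw [← sum_mul, U.χ_sum, one_mul]
  rw [integral_congr_ae (.of_forall h1), integral_finsetSum _ fun j _ => hg.integrable (hχ j)]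
  refine sum_congr rfl fun j _ => ?_
  rw [integral_eq_chart (c := U.ctr j) (φ := fun x => U.χ j x * φ x) hg (hχ j) fun x hx =>
    (U.χ_supp j x (left_ne_zero_of_mul hx)).1]
  rw [← setIntegral_eq_of_subset_of_forall_sdiff_eq_zero (measurableSet_target _)
    (U.ball_subset_target j)]
  · simp only [mul_assoc]
  · intro y hy
    have : U.χ j (chartPt (U.ctr j) y) = 0 := by
      by_contra h
      have := (U.χ_supp j _ h).2
      rw [chartAt_chartPt hy.1] at this
      exact hy.2 this
    rw [this]; ring

end Measure

/-! ### The Sobolev embedding in a ball -/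

section Sobolev

/-- Taylor's formula along a segment, from the endpoint `x + z` back to `x`. -/
lemma taylor_segment [CompleteSpace F] {Ω : Set E3} (hΩ : IsOpen Ω) {u : E3 → F}
    (hu : ContDiffOn ℝ 2 u Ω) {x z : E3} (hxz : ∀ t ∈ Icc (0 : ℝ) 1, x + t • z ∈ Ω) :
    u x = u (x + z) - fderiv ℝ u (x + z) z
      + ∫ t in (0 : ℝ)..1, t • fderiv ℝ (fderiv ℝ u) (x + t • z) z z := by
  have hmem : ∀ t ∈ Icc (0 : ℝ) 1, Ω ∈ 𝓝 (x + t • z) := fun t ht => hΩ.mem_nhds (hxz t ht)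
  have h1 : ∀ t : ℝ, HasDerivAt (fun t : ℝ => x + t • z) z t := fun t => by
    simpa using ((hasDerivAt_id t).smul_const z).const_add x
  have hd1 : ∀ t ∈ Icc (0 : ℝ) 1, HasDerivAt (fun t : ℝ => u (x + t • z))
      (fderiv ℝ u (x + t • z) z) t := by
    intro t ht
    exact ((hu.contDiffAt (hmem t ht)).differentiableAt (by norm_num)).hasFDerivAt.comp_hasDerivAt
      t (h1 t)
  have hd2 : ∀ t ∈ Icc (0 : ℝ) 1, HasDerivAt (fun t : ℝ => fderiv ℝ u (x + t • z) z)
      (fderiv ℝ (fderiv ℝ u) (x + t • z) z z) t := by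
    intro t ht
    have h2 : DifferentiableAt ℝ (fderiv ℝ u) (x + t • z) :=
      ((hu.contDiffAt (hmem t ht)).fderiv_right (m := 1) (by norm_num)).differentiableAt
        (by norm_num)
    exact (ContinuousLinearMap.apply ℝ F z).hasFDerivAt.comp_hasDerivAt t
      (h2.hasFDerivAt.comp_hasDerivAt t (h1 t))
  have hd : ∀ t ∈ uIcc (0 : ℝ) 1, HasDerivAt
      (fun t : ℝ => t • fderiv ℝ u (x + t • z) z - u (x + t • z))
      (t • fderiv ℝ (fderiv ℝ u) (x + t • z) z z) t := by
    intro t ht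
    rw [uIcc_of_le zero_le_one] at ht
    have := ((hasDerivAt_id' t).fun_smul (hd2 t ht)).fun_sub (hd1 t ht)
    simpa only [one_smul, add_sub_cancel_right] using this
  have hcont : ContinuousOn (fun t : ℝ => t • fderiv ℝ (fderiv ℝ u) (x + t • z) z z)
      (uIcc (0 : ℝ) 1) := by
    rw [uIcc_of_le zero_le_one]
    have h2 : ContinuousOn (fun t : ℝ => fderiv ℝ (fderiv ℝ u) (x + t • z)) (Icc 0 1) :=
      ((hu.fderiv_of_isOpen hΩ (m := 1) (by norm_num)).continuousOn_fderiv_of_isOpen hΩ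
        (by norm_num)).comp (by fun_prop) hxz
    exact continuousOn_id.smul ((h2.clm_apply continuousOn_const).clm_apply continuousOn_const)
  rw [intervalIntegral.integral_eq_sub_of_hasDerivAt hd hcont.intervalIntegrable]
  simp only [one_smul, zero_smul, zero_sub, add_zero]
  abel

/-- Scaling in the ball: the `L¹` norm of `w` on the shrinking balls, with the
Cauchy-Schwarz inequality. -/
lemma lintegral_ball_scaled {w : E3 → ENNReal} {x : E3} {R : ℝ}
    (hw : AEMeasurable w (volume.restrict (ball x R))) {t : ℝ} (ht : 0 < t) (ht1 : t ≤ 1) :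
    ∫⁻ z in ball (0 : E3) R, w (x + t • z)
      ≤ ofReal (t ^ (-(3 / 2) : ℝ)) * (volume (ball (0 : E3) R)) ^ (1 / 2 : ℝ)
        * (∫⁻ y in ball x R, w y ^ (2 : ℝ)) ^ (1 / 2 : ℝ) := by
  have hmap : ∀ f : E3 → ENNReal, ∫⁻ z in ball (0 : E3) R, f (x + t • z)
      = ofReal (t ^ (-3 : ℝ)) * ∫⁻ y in ball x (t * R), f y := by
    intro f
    have hinj : InjOn (fun z : E3 => x + t • z) (ball 0 R) := by
      intro a _ b _ hab
      exact smul_right_injective E3 ht.ne' (add_left_cancel hab)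
    have himg : (fun z : E3 => x + t • z) '' ball 0 R = ball x (t * R) := by
      rw [← image_image (x + ·) (t • ·), image_smul, smul_ball ht.ne', smul_zero,
        norm_of_nonneg ht.le, image_add_left, preimage_add_ball, zero_sub, neg_neg]
    have hder : ∀ z ∈ ball (0 : E3) R, HasFDerivWithinAt (fun z : E3 => x + t • z)
        (t • ContinuousLinearMap.id ℝ E3) (ball 0 R) z := fun z _ =>
      (((hasFDerivAt_id z).const_smul t).const_add x).hasFDerivWithinAt
    have h := lintegral_image_eq_lintegral_abs_det_fderiv_mul volume measurableSet_ball hder hinj f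
    have hdet : (t • ContinuousLinearMap.id ℝ E3).det = t ^ 3 := by
      simp [ContinuousLinearMap.det]
    rw [himg, hdet, abs_of_pos (by positivity), lintegral_const_mul' _ _ ofReal_ne_top] at h
    rw [h, ← mul_assoc, ← ofReal_mul (by positivity)]
    have : t ^ (-3 : ℝ) * t ^ 3 = 1 := by
      rw [← Real.rpow_natCast t 3, ← Real.rpow_add ht]; norm_num
    rw [this]; simp
  have hsub : ball x (t * R) ⊆ ball x R := by
    rcases le_or_gt R 0 with hR | hR
    · rw [Metric.ball_eq_empty.2 (mul_nonpos_of_nonneg_of_nonpos ht.le hR)]; exact empty_subset _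
    · exact ball_subset_ball (by nlinarith)
  have hw' : AEMeasurable w (volume.restrict (ball x (t * R))) :=
    hw.mono_measure (Measure.restrict_mono hsub le_rfl)
  have hvol : volume (ball x (t * R)) = ofReal (t ^ (3 : ℝ)) * volume (ball (0 : E3) R) := by
    have := hmap (fun _ => 1)
    simp only [lintegral_const, one_mul, Measure.restrict_apply, MeasurableSet.univ, univ_inter]
      at this
    rw [this, ← mul_assoc, ← ofReal_mul (by positivity), ← Real.rpow_add ht]
    simp
  have hCS := ENNReal.lintegral_mul_le_Lp_mul_Lq (volume.restrict (ball x (t * R)))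
    (Real.HolderConjugate.two_two) (aemeasurable_const (b := (1 : ENNReal))) hw'
  simp only [Pi.mul_apply, one_mul, ENNReal.one_rpow, lintegral_const, Measure.restrict_apply,
    MeasurableSet.univ, univ_inter] at hCS
  rw [hmap w]
  calc _ ≤ ofReal (t ^ (-3 : ℝ)) * ((volume (ball x (t * R))) ^ (1 / 2 : ℝ)
        * (∫⁻ y in ball x R, w y ^ (2 : ℝ)) ^ (1 / 2 : ℝ)) := by
        gcongr
        refine hCS.trans ?_
        gcongr
    _ = _ := by
        rw [hvol, ENNReal.mul_rpow_of_nonneg _ _ (by norm_num), ENNReal.ofReal_rpow_of_pos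
          (by positivity), ← Real.rpow_mul ht.le, ← mul_assoc, ← mul_assoc,
          ← ofReal_mul (by positivity), ← Real.rpow_add ht]
        norm_num

lemma lintegral_rpow_neg_half : ∫⁻ t in Ioc (0 : ℝ) 1, ofReal (t ^ (-(1 / 2) : ℝ)) = 2 := by
  have hint : IntervalIntegrable (fun t : ℝ => t ^ (-(1 / 2) : ℝ)) volume 0 1 :=
    intervalIntegral.intervalIntegrable_rpow' (by norm_num)
  rw [← ofReal_integral_eq_lintegral_ofReal
    ((intervalIntegrable_iff_integrableOn_Ioc_of_le zero_le_one).1 hint)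
    ((ae_restrict_mem measurableSet_Ioc).mono fun t ht => Real.rpow_nonneg ht.1.le _),
    ← intervalIntegral.integral_of_le zero_le_one, integral_rpow (Or.inl (by norm_num))]
  norm_num

omit [NormedSpace ℝ F] in
lemma eLpNorm_two_eq (w : E3 → F) (μ : Measure E3) :
    eLpNorm w 2 μ = (∫⁻ y, ‖w y‖ₑ ^ (2 : ℝ) ∂μ) ^ (1 / 2 : ℝ) := by
  rw [eLpNorm_eq_lintegral_rpow_enorm_toReal (by norm_num) (by norm_num)]
  simp

set_option maxSynthPendingDepth 3 in
/-- The Sobolev embedding of `H²` into the bounded functions, in three dimensions. -/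
lemma sobolev_ball [CompleteSpace F] (r : ℝ) (hr : 0 < r) :
    ∃ C : NNReal, ∀ (y₀ : E3) (u : E3 → F), ContDiffOn ℝ 2 u (ball y₀ (2 * r)) →
      ∀ x ∈ ball y₀ r, ‖u x‖ₑ ≤ C * (eLpNorm u 2 (volume.restrict (ball y₀ (2 * r)))
          + eLpNorm (fderiv ℝ u) 2 (volume.restrict (ball y₀ (2 * r)))
          + eLpNorm (fderiv ℝ (fderiv ℝ u)) 2 (volume.restrict (ball y₀ (2 * r)))) := by
  set v : ENNReal := volume (ball (0 : E3) r) with hv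
  have hv0 : v ≠ 0 := (Metric.measure_ball_pos volume _ hr).ne'
  have hvt : v ≠ ⊤ := measure_ball_lt_top.ne
  refine ⟨(v⁻¹ * v ^ (1 / 2 : ℝ) * ofReal (1 + r + 2 * r ^ 2)).toNNReal, fun y₀ u hu x hx => ?_⟩
  rw [ENNReal.coe_toNNReal (ENNReal.mul_ne_top (ENNReal.mul_ne_top (ENNReal.inv_ne_top.2 hv0)
    (ENNReal.rpow_ne_top_of_nonneg (by norm_num) hvt)) ofReal_ne_top)]
  set Ω := ball y₀ (2 * r) with hΩ
  have hΩo : IsOpen Ω := isOpen_ball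
  have hxr : ball x r ⊆ Ω := Metric.ball_subset_ball' (by
    linarith [Metric.mem_ball.1 hx])
  have hmem : ∀ z ∈ ball (0 : E3) r, ∀ t ∈ Icc (0 : ℝ) 1, x + t • z ∈ Ω := by
    intro z hz t ht
    refine hxr ?_
    rw [mem_ball_zero_iff] at hz
    rw [Metric.mem_ball, dist_eq_norm, add_sub_cancel_left, norm_smul, norm_of_nonneg ht.1]
    nlinarith [norm_nonneg z, ht.2]
  have hD1 : ContDiffOn ℝ 1 (fderiv ℝ u) Ω := hu.fderiv_of_isOpen hΩo (by norm_num)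
  have hc2 : ContinuousOn (fderiv ℝ (fderiv ℝ u)) Ω :=
    hD1.continuousOn_fderiv_of_isOpen hΩo (by norm_num)
  set A0 := eLpNorm u 2 (volume.restrict Ω)
  set A1 := eLpNorm (fderiv ℝ u) 2 (volume.restrict Ω)
  set A2 := eLpNorm (fderiv ℝ (fderiv ℝ u)) 2 (volume.restrict Ω)
  -- the scaled `L¹` norms are bounded by the `L²` norms
  have hsc : ∀ w : E3 → ENNReal, ContinuousOn w Ω → ∀ t : ℝ, 0 < t → t ≤ 1 →
      ∫⁻ z in ball (0 : E3) r, w (x + t • z)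
        ≤ ofReal (t ^ (-(3 / 2) : ℝ)) * v ^ (1 / 2 : ℝ)
          * (∫⁻ y in Ω, w y ^ (2 : ℝ)) ^ (1 / 2 : ℝ) := by
    intro w hw t ht ht1
    refine (lintegral_ball_scaled ((hw.mono hxr).aemeasurable measurableSet_ball) ht ht1).trans ?_
    gcongr
  have hpt : ∀ z ∈ ball (0 : E3) r, ‖u x‖ₑ ≤ ‖u (x + (1 : ℝ) • z)‖ₑ
      + ofReal r * ‖fderiv ℝ u (x + (1 : ℝ) • z)‖ₑ
      + ofReal (r ^ 2) * ∫⁻ t in Ioc (0 : ℝ) 1, ofReal t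
        * ‖fderiv ℝ (fderiv ℝ u) (x + t • z)‖ₑ := by
    intro z hz
    have hz' : ‖z‖ₑ ≤ ofReal r := by
      rw [← ofReal_norm]
      exact ofReal_le_ofReal (mem_ball_zero_iff.1 hz).le
    rw [one_smul]
    rw [taylor_segment hΩo hu (hmem z hz)]
    refine (enorm_add_le _ _).trans (add_le_add ((enorm_sub_le).trans (add_le_add le_rfl ?_)) ?_)
    · refine (le_opENorm _ _).trans ?_
      rw [mul_comm]; gcongr
    · rw [intervalIntegral.integral_of_le zero_le_one]
      refine (enorm_integral_le_lintegral_enorm _).trans ?_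
      rw [← lintegral_const_mul' _ _ ofReal_ne_top]
      refine setLIntegral_mono' measurableSet_Ioc fun t ht => ?_
      rw [enorm_smul, Real.enorm_of_nonneg ht.1.le, mul_left_comm]
      gcongr
      refine ((le_opENorm _ _).trans (mul_le_mul_left (le_opENorm _ _) _)).trans ?_
      rw [mul_assoc, mul_comm, sq, ofReal_mul hr.le]
      gcongr
  have hmeas2 : AEMeasurable (Function.uncurry fun (z : E3) (t : ℝ) => ofReal t
      * ‖fderiv ℝ (fderiv ℝ u) (x + t • z)‖ₑ)
      ((volume.restrict (ball (0 : E3) r)).prod (volume.restrict (Ioc (0 : ℝ) 1))) := by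
    rw [Measure.prod_restrict]
    have hid : AEMeasurable (fun p : E3 × ℝ => ofReal p.2)
        ((volume.prod volume).restrict (ball (0 : E3) r ×ˢ Ioc (0 : ℝ) 1)) := by fun_prop
    refine hid.mul ?_
    have : ContinuousOn (fun p : E3 × ℝ => fderiv ℝ (fderiv ℝ u) (x + p.2 • p.1))
        (ball (0 : E3) r ×ˢ Ioc (0 : ℝ) 1) :=
      hc2.comp (by fun_prop) fun p hp => hmem p.1 hp.1 p.2 (Ioc_subset_Icc_self hp.2)
    exact this.enorm.aemeasurable (measurableSet_ball.prod measurableSet_Ioc)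
  -- the factor `t` of the remainder turns `t^{-3/2}` into the integrable `t^{-1/2}`
  have h3 : ∫⁻ z in ball (0 : E3) r, ∫⁻ t in Ioc (0 : ℝ) 1, ofReal t
      * ‖fderiv ℝ (fderiv ℝ u) (x + t • z)‖ₑ ≤ 2 * v ^ (1 / 2 : ℝ) * A2 := by
    rw [lintegral_lintegral_swap hmeas2]
    calc _ ≤ ∫⁻ t in Ioc (0 : ℝ) 1, ofReal (t ^ (-(1 / 2) : ℝ))
          * (v ^ (1 / 2 : ℝ) * A2) := by
          refine setLIntegral_mono' measurableSet_Ioc fun t ht => ?_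
          rw [lintegral_const_mul' _ _ ofReal_ne_top]
          refine (mul_le_mul_right (hsc _ hc2.enorm t ht.1 ht.2) _).trans_eq ?_
          rw [← eLpNorm_two_eq, ← mul_assoc, ← mul_assoc, ← ofReal_mul ht.1.le, ← Real.rpow_one_add' ht.1.le
            (by norm_num), mul_assoc]
          norm_num
          rfl
      _ = _ := by
          rw [lintegral_mul_const'' _ ((by fun_prop : Measurable fun t : ℝ =>
            ofReal (t ^ (-(1 / 2) : ℝ))).aemeasurable), lintegral_rpow_neg_half, mul_assoc]
  have hbm : MeasurableSet (ball (0 : E3) r) := measurableSet_ball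
  -- average the pointwise bound over the ball
  have htot : v * ‖u x‖ₑ ≤ v ^ (1 / 2 : ℝ) * (A0 + ofReal r * A1 + ofReal (2 * r ^ 2) * A2) := by
    have hm : ∀ w : E3 → ENNReal, ContinuousOn w Ω → AEMeasurable (fun z => w (x + (1 : ℝ) • z))
          (volume.restrict (ball (0 : E3) r)) := by
      intro w hw
      exact (hw.comp (by fun_prop) fun z hz => hmem z hz 1 ⟨zero_le_one, le_rfl⟩).aemeasurable hbm
    have hm0 := hm _ hu.continuousOn.enorm
    have hm1 := (hm _ hD1.continuousOn.enorm).const_mul (ofReal r)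
    calc v * ‖u x‖ₑ = ∫⁻ _ in ball (0 : E3) r, ‖u x‖ₑ := by
          rw [setLIntegral_const, mul_comm]
      _ ≤ ∫⁻ z in ball (0 : E3) r, (‖u (x + (1 : ℝ) • z)‖ₑ
          + ofReal r * ‖fderiv ℝ u (x + (1 : ℝ) • z)‖ₑ
          + ofReal (r ^ 2) * ∫⁻ t in Ioc (0 : ℝ) 1, ofReal t
            * ‖fderiv ℝ (fderiv ℝ u) (x + t • z)‖ₑ) := setLIntegral_mono' hbm hpt
      _ ≤ v ^ (1 / 2 : ℝ) * A0 + ofReal r * (v ^ (1 / 2 : ℝ) * A1)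
          + ofReal (r ^ 2) * (2 * v ^ (1 / 2 : ℝ) * A2) := by
          have hm01 : AEMeasurable (fun z => ‖u (x + (1 : ℝ) • z)‖ₑ
              + ofReal r * ‖fderiv ℝ u (x + (1 : ℝ) • z)‖ₑ)
              (volume.restrict (ball (0 : E3) r)) := hm0.add hm1
          rw [lintegral_add_left' hm01, lintegral_add_left' hm0,
            lintegral_const_mul' _ _ ofReal_ne_top,
            lintegral_const_mul' _ _ ofReal_ne_top]
          have s0 := hsc _ hu.continuousOn.enorm 1 one_pos le_rfl
          have s1 := hsc _ hD1.continuousOn.enorm 1 one_pos le_rfl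
          rw [Real.one_rpow, ENNReal.ofReal_one, one_mul, ← eLpNorm_two_eq] at s0 s1
          gcongr
      _ = _ := by
          rw [ofReal_mul (by norm_num : (0 : ℝ) ≤ 2)]
          simp only [ENNReal.ofReal_ofNat]
          ring
  have hfin : A0 + ofReal r * A1 + ofReal (2 * r ^ 2) * A2
      ≤ ofReal (1 + r + 2 * r ^ 2) * (A0 + A1 + A2) := by
    have e0 : A0 ≤ ofReal (1 + r + 2 * r ^ 2) * A0 := by
      exact le_mul_of_one_le_left' (ENNReal.one_le_ofReal.2 (by nlinarith))
    have e1 : ofReal r ≤ ofReal (1 + r + 2 * r ^ 2) := ofReal_le_ofReal (by nlinarith)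
    have e2 : ofReal (2 * r ^ 2) ≤ ofReal (1 + r + 2 * r ^ 2) := ofReal_le_ofReal (by nlinarith)
    rw [mul_add, mul_add]
    gcongr
  rw [mul_assoc, mul_assoc, ← ENNReal.mul_le_iff_le_inv hv0 hvt]
  exact htot.trans (mul_le_mul_right hfin _)

end Sobolev

/-! ### Products and inverses in Sobolev spaces -/

section Calculus

variable {B : Set E3} {n p q : ℕ} {u v : E3 → ℝ} {A A' : ℝ≥0}

/-- Quantitative regularity of a function `u` on an open set `B`: it is of class `C^n`, its
derivatives of order `< p` are bounded by `A` in `L²`, and those of order `< q` are bounded by `A`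
pointwise. -/
structure Bnd (B : Set E3) (n p q : ℕ) (u : E3 → ℝ) (A : ℝ≥0) : Prop where
  isOpen : IsOpen B
  hp : p ≤ n + 1
  hq : q ≤ n + 1
  smooth : ContDiffOn ℝ n u B
  l2 : ∀ i < p, eLpNorm (iteratedFDeriv ℝ i u) 2 (volume.restrict B) ≤ A
  sup : ∀ i < q, ∀ y ∈ B, ‖iteratedFDeriv ℝ i u y‖ ≤ A

/-- Bounds as in the Sobolev space `H^a` in three dimensions: `a` derivatives in `L²`, and `a - 2`
derivatives pointwise. -/
abbrev Bd (B : Set E3) (a : ℕ) (u : E3 → ℝ) (A : ℝ≥0) : Prop := Bnd B a (a + 1) (a - 1) u A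

/-- Bounds in the space `C^a`. -/
abbrev Bc (B : Set E3) (a : ℕ) (u : E3 → ℝ) (A : ℝ≥0) : Prop := Bnd B a 0 (a + 1) u A

/-- Bounds on `a` derivatives in `L²`. -/
abbrev Bl (B : Set E3) (a : ℕ) (u : E3 → ℝ) (A : ℝ≥0) : Prop := Bnd B a (a + 1) 0 u A

lemma Bnd.contDiffAt (h : Bnd B n p q u A) {y : E3} (hy : y ∈ B) : ContDiffAt ℝ n u y :=
  h.smooth.contDiffAt (h.isOpen.mem_nhds hy)

lemma Bnd.mono {n' p' q' : ℕ} (h : Bnd B n p q u A) (hn : n' ≤ n := by omega)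
    (hp : p' ≤ p := by omega) (hq : q' ≤ q := by omega) (hp' : p' ≤ n' + 1 := by omega)
    (hq' : q' ≤ n' + 1 := by omega) (hA : A ≤ A' := by exact le_rfl) : Bnd B n' p' q' u A' where
  isOpen := h.isOpen
  hp := hp'
  hq := hq'
  smooth := h.smooth.of_le (mod_cast hn)
  l2 i hi := (h.l2 i (hi.trans_le hp)).trans (mod_cast hA)
  sup i hi y hy := (h.sup i (hi.trans_le hq) y hy).trans (mod_cast hA)

lemma Bnd.le (h : Bnd B n p q u A) (hA : A ≤ A') : Bnd B n p q u A' :=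
  h.mono le_rfl le_rfl le_rfl h.hp h.hq hA

lemma Bd.mono {a b : ℕ} (h : Bd B a u A) (hb : b ≤ a) : Bd B b u A :=
  Bnd.mono h

lemma continuousOn_iteratedFDeriv    {u : E3 → F} (hB : IsOpen B) (h : ContDiffOn ℝ n u B) {i : ℕ}
    (hi : i ≤ n) : ContinuousOn (iteratedFDeriv ℝ i u) B :=
  (h.continuousOn_iteratedFDerivWithin (mod_cast hi) hB.uniqueDiffOn).congr
    fun y hy => (iteratedFDerivWithin_of_isOpen i hB hy).symm

lemma iteratedFDeriv_congr_on (hB : IsOpen B) (h : EqOn u v B) (i : ℕ) :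
    EqOn (iteratedFDeriv ℝ i u) (iteratedFDeriv ℝ i v) B := fun _ hy =>
  (EventuallyEq.iteratedFDeriv (𝕜 := ℝ)
    (Filter.eventuallyEq_of_mem (hB.mem_nhds hy) h) i).eq_of_nhds

lemma eLpNorm_restrict_le_sum {F ι : Type*} [NormedAddCommGroup F] (hB : MeasurableSet B)
    {f : E3 → F} (s : Finset ι) {g : ι → E3 → ℝ} {c : ι → ℝ≥0}
    (hfg : ∀ y ∈ B, ‖f y‖ ≤ ∑ i ∈ s, g i y)
    (hm : ∀ i ∈ s, AEStronglyMeasurable (g i) (volume.restrict B))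
    (hg : ∀ i ∈ s, eLpNorm (g i) 2 (volume.restrict B) ≤ c i) :
    eLpNorm f 2 (volume.restrict B) ≤ (∑ i ∈ s, c i : ℝ≥0) := by
  have h1 : eLpNorm f 2 (volume.restrict B) ≤ eLpNorm (∑ i ∈ s, g i) 2 (volume.restrict B) := by
    refine eLpNorm_mono_ae_real ((ae_restrict_mem hB).mono fun y hy => ?_)
    rw [Finset.sum_apply]
    exact hfg y hy
  refine h1.trans ((eLpNorm_sum_le hm (by norm_num)).trans ?_)
  rw [ENNReal.ofNNReal_finsetSum]
  exact sum_le_sum hg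

lemma eLpNorm_restrict_le_mul {F G : Type*} [NormedAddCommGroup F] [NormedAddCommGroup G]
    (hB : MeasurableSet B) {f : E3 → F} {g : E3 → G} {c d : ℝ≥0}
    (hfg : ∀ y ∈ B, ‖f y‖ ≤ c * ‖g y‖) (hg : eLpNorm g 2 (volume.restrict B) ≤ d) :
    eLpNorm f 2 (volume.restrict B) ≤ (c * d : ℝ≥0) := by
  refine (eLpNorm_le_mul_eLpNorm_of_ae_le_mul
    ((ae_restrict_mem hB).mono fun y hy => hfg y hy) _).trans ?_
  rw [ENNReal.ofReal_coe_nnreal, ENNReal.coe_mul]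
  gcongr

lemma Bnd.congr (h : Bnd B n p q u A) (huv : EqOn v u B) : Bnd B n p q v A where
  isOpen := h.isOpen
  hp := h.hp
  hq := h.hq
  smooth := h.smooth.congr huv
  l2 i hi := by
    rw [eLpNorm_congr_ae ((ae_restrict_mem h.isOpen.measurableSet).mono
      (iteratedFDeriv_congr_on h.isOpen huv i))]
    exact h.l2 i hi
  sup i hi y hy := by rw [iteratedFDeriv_congr_on h.isOpen huv i hy]; exact h.sup i hi y hy

lemma Bnd.aesm (h : Bnd B n p q u A) {i : ℕ} (hi : i ≤ n) :
    AEStronglyMeasurable (iteratedFDeriv ℝ i u) (volume.restrict B) :=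
  (continuousOn_iteratedFDeriv h.isOpen h.smooth hi).aestronglyMeasurable
    h.isOpen.measurableSet

lemma Bnd.sum (hB : IsOpen B) (hp : p ≤ n + 1) (hq : q ≤ n + 1) (s : Finset ι)
    {u : ι → E3 → ℝ} {A : ι → ℝ≥0} (h : ∀ j ∈ s, Bnd B n p q (u j) (A j)) :
    Bnd B n p q (fun y => ∑ j ∈ s, u j y) (∑ j ∈ s, A j) := by
  have hpt : ∀ i ≤ n, ∀ y ∈ B, iteratedFDeriv ℝ i (fun y => ∑ j ∈ s, u j y) y
      = ∑ j ∈ s, iteratedFDeriv ℝ i (u j) y := fun i hi y hy =>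
    iteratedFDeriv_fun_sum_apply fun j hj => ((h j hj).contDiffAt hy).of_le (mod_cast hi)
  refine ⟨hB, hp, hq, ContDiffOn.sum fun j hj => (h j hj).smooth, fun i hi => ?_,
    fun i hi y hy => ?_⟩
  · refine eLpNorm_restrict_le_sum hB.measurableSet s
      (g := fun j y => ‖iteratedFDeriv ℝ i (u j) y‖)
      (fun y hy => ?_) (fun j hj => ((h j hj).aesm (by omega)).norm) fun j hj => ?_
    · rw [hpt i (by omega) y hy]; exact norm_sum_le _ _
    · rw [eLpNorm_norm]; exact (h j hj).l2 i hi
  · rw [hpt i (by omega) y hy, NNReal.coe_sum]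
    exact (norm_sum_le _ _).trans (sum_le_sum fun j hj => (h j hj).sup i hi y hy)

lemma Bnd.sum_card [Fintype ι] (hB : IsOpen B) (hp : p ≤ n + 1) (hq : q ≤ n + 1)
    {u : ι → E3 → ℝ} {A : ℝ≥0} (h : ∀ j, Bnd B n p q (u j) A) :
    Bnd B n p q (fun y => ∑ j, u j y) (Fintype.card ι * A) := by
  simpa using Bnd.sum hB hp hq Finset.univ (A := fun _ => A) fun j _ => h j

lemma Bnd.add (hu : Bnd B n p q u A) (hv : Bnd B n p q v A') :
    Bnd B n p q (fun y => u y + v y) (A + A') := by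
  have := Bnd.sum hu.isOpen hu.hp hu.hq Finset.univ (u := ![u, v]) (A := ![A, A'])
    (by simp [Fin.forall_fin_two, hu, hv])
  simpa using this

lemma Bnd.const_mul (c : ℝ) (hu : Bnd B n p q u A) : Bnd B n p q (fun y => c * u y) (‖c‖₊ * A) := by
  have hpt : ∀ i ≤ n, ∀ y ∈ B, ‖iteratedFDeriv ℝ i (fun y => c * u y) y‖
      ≤ ‖c‖₊ * ‖iteratedFDeriv ℝ i u y‖ := fun i hi y hy => by
    have := iteratedFDeriv_const_smul_apply' (a := c)
      ((hu.contDiffAt hy).of_le (mod_cast hi : (i : ℕ∞ω) ≤ n))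
    simp only [smul_eq_mul] at this
    rw [this, norm_smul]; rfl
  refine ⟨hu.isOpen, hu.hp, hu.hq, contDiffOn_const.mul hu.smooth, fun i hi => ?_,
    fun i hi y hy => ?_⟩
  · exact eLpNorm_restrict_le_mul hu.isOpen.measurableSet
      (hpt i (by have := hu.hp; omega)) (hu.l2 i hi)
  · refine (hpt i (by have := hu.hq; omega) y hy).trans ?_
    rw [NNReal.coe_mul]
    exact mul_le_mul_of_nonneg_left (hu.sup i hi y hy) (by positivity)

lemma Bnd.neg (hu : Bnd B n p q u A) : Bnd B n p q (fun y => -u y) A := by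
  simpa using hu.const_mul (-1)

lemma Bnd.sub (hu : Bnd B n p q u A) (hv : Bnd B n p q v A') :
    Bnd B n p q (fun y => u y - v y) (A + A') := by
  simpa [sub_eq_add_neg] using hu.add hv.neg

lemma Bnd.zero (hB : IsOpen B) (hp : p ≤ n + 1) (hq : q ≤ n + 1) : Bnd B n p q (fun _ => 0) 0 := by
  simpa using Bnd.sum hB hp hq (∅ : Finset ℕ) (u := fun _ _ => 0) (A := fun _ => 0) (by simp)

lemma norm_iteratedFDeriv_mul_le_of_isOpen (hB : IsOpen B) (hu : ContDiffOn ℝ n u B)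
    (hv : ContDiffOn ℝ n v B) {y : E3} (hy : y ∈ B) :
    ‖iteratedFDeriv ℝ n (fun y => u y * v y) y‖ ≤ ∑ i ∈ Finset.range (n + 1),
      (n.choose i : ℝ) * ‖iteratedFDeriv ℝ i u y‖ * ‖iteratedFDeriv ℝ (n - i) v y‖ := by
  have h := norm_iteratedFDerivWithin_mul_le hu hv hB.uniqueDiffOn hy (n := n) le_rfl
  simpa only [iteratedFDerivWithin_of_isOpen _ hB hy] using h

lemma sum_choose_mul_le {n c : ℕ} (hn : n ≤ c) (A A' : ℝ≥0) :
    ∑ i ∈ Finset.range (n + 1), (n.choose i : ℝ≥0) * A * A' ≤ 2 ^ c * A * A' := by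
  rw [← sum_mul, ← sum_mul]
  gcongr
  have h : (∑ i ∈ Finset.range (n + 1), (n.choose i : ℝ≥0)) = 2 ^ n := by
    exact_mod_cast Nat.sum_range_choose n
  rw [h]
  exact pow_le_pow_right₀ (by norm_num) hn

/-- Products: in each term of the Leibniz formula, one of the two factors is controlled
pointwise. -/
lemma Bnd.mul_of {a b c p' q' : ℕ} (hu : Bnd B a p q u A) (hv : Bnd B b p' q' v A')
    {r s : ℕ} (ha : c ≤ a) (hb : c ≤ b) (hr : r ≤ c + 1) (hs : s ≤ c + 1)
    (hl : ∀ i j, i + j < r → (i < q ∧ j < p') ∨ (i < p ∧ j < q'))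
    (hsup : ∀ i j, i + j < s → i < q ∧ j < q') :
    Bnd B c r s (fun y => u y * v y) (2 ^ c * A * A') := by
  have hu' : ∀ i ≤ c, ContDiffOn ℝ i u B := fun i hi =>
    hu.smooth.of_le (mod_cast hi.trans ha)
  have hv' : ∀ i ≤ c, ContDiffOn ℝ i v B := fun i hi =>
    hv.smooth.of_le (mod_cast hi.trans hb)
  refine ⟨hu.isOpen, hr, hs, (hu' c le_rfl).mul (hv' c le_rfl), fun m hm => ?_,
    fun m hm y hy => ?_⟩
  · refine (eLpNorm_restrict_le_sum hu.isOpen.measurableSet (Finset.range (m + 1))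
      (c := fun i => (m.choose i : ℝ≥0) * A * A')
      (fun y hy => norm_iteratedFDeriv_mul_le_of_isOpen hu.isOpen (hu' m (by omega))
        (hv' m (by omega)) hy) (fun i hi => ?_) fun i hi => ?_).trans
        (ENNReal.coe_le_coe.2 (sum_choose_mul_le (by omega) A A'))
    · rw [Finset.mem_range] at hi
      exact ((hu.aesm (by omega)).norm.const_mul _).mul (hv.aesm (by omega)).norm
    · rw [Finset.mem_range] at hi
      rcases hl i (m - i) (by omega) with ⟨h1, h2⟩ | ⟨h1, h2⟩
      · refine eLpNorm_restrict_le_mul hu.isOpen.measurableSet (fun y hy => ?_) (hv.l2 _ h2)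
        rw [norm_mul, norm_mul, norm_norm, norm_norm, NNReal.coe_mul, RCLike.norm_natCast,
          NNReal.coe_natCast]
        gcongr
        exact hu.sup _ h1 y hy
      · rw [mul_right_comm]
        refine eLpNorm_restrict_le_mul hu.isOpen.measurableSet (fun y hy => ?_) (hu.l2 _ h1)
        rw [norm_mul, norm_mul, norm_norm, norm_norm, NNReal.coe_mul, RCLike.norm_natCast,
          NNReal.coe_natCast, mul_right_comm]
        gcongr
        exact hv.sup _ h2 y hy
  · refine (norm_iteratedFDeriv_mul_le_of_isOpen hu.isOpen (hu' m (by omega))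
        (hv' m (by omega)) hy).trans
      (le_trans (sum_le_sum fun i hi => ?_)
        ((NNReal.coe_sum _ _).symm.trans_le
          (NNReal.coe_le_coe.2 (sum_choose_mul_le (by omega : m ≤ c) A A'))))
    rw [Finset.mem_range] at hi
    obtain ⟨h1, h2⟩ := hsup i (m - i) (by omega)
    push_cast
    gcongr
    · exact hu.sup _ h1 y hy
    · exact hv.sup _ h2 y hy

/-- Products in `H^a` and `H^b` with `a + b ≥ c + 3`, the orders being those of `Bd`. -/
lemma Bd.mul {a b c : ℕ} (hu : Bd B a u A) (hv : Bd B b v A') (ha : c ≤ a) (hb : c ≤ b)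
    (hab : c + 3 ≤ a + b) : Bd B c (fun y => u y * v y) (2 ^ c * A * A') :=
  Bnd.mul_of hu hv ha hb le_rfl (by omega) (by omega) (by omega)

lemma Bc.mul {a : ℕ} (hu : Bc B a u A) (hv : Bc B a v A') :
    Bc B a (fun y => u y * v y) (2 ^ a * A * A') :=
  Bnd.mul_of hu hv le_rfl le_rfl (by omega) le_rfl (by omega) (by omega)

lemma Bc.mul_bl {a b : ℕ} (hu : Bc B a u A) (hv : Bl B b v A') (hab : b ≤ a) :
    Bl B b (fun y => u y * v y) (2 ^ b * A * A') :=
  Bnd.mul_of hu hv hab le_rfl le_rfl (by omega) (by omega) (by omega)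

lemma Bd.bc {a : ℕ} (h : Bd B (a + 2) u A) : Bc B a u A :=
  Bnd.mono h

lemma Bd.bl {a : ℕ} (h : Bd B a u A) : Bl B a u A :=
  Bnd.mono h

lemma Bc.bd {a : ℕ} (h : Bc B a u A) {V : ℝ≥0}
    (hV : eLpNorm (fun _ : E3 => (1 : ℝ)) 2 (volume.restrict B) ≤ V) : Bd B a u ((1 + V) * A) := by
  have h1 : A ≤ (1 + V) * A := by
    rw [one_add_mul]; exact le_self_add
  refine ⟨h.isOpen, le_rfl, by omega, h.smooth, fun i hi => ?_, fun i hi y hy => ?_⟩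
  · refine (eLpNorm_restrict_le_mul (c := A) h.isOpen.measurableSet (fun y hy => ?_) hV).trans ?_
    · simpa using h.sup i (by omega) y hy
    · rw [mul_comm A]
      exact ENNReal.coe_le_coe.2 (by gcongr; exact le_add_self)
  · exact (h.sup i (by omega) y hy).trans (mod_cast h1)

lemma norm_e3 (i : Fin 3) : ‖e3 i‖ = 1 := by simp [e3]

lemma norm_iteratedFDeriv_pderiv_le {y : E3} (hu : ContDiffAt ℝ (n + 1) u y) (i : Fin 3) :
    ‖iteratedFDeriv ℝ n (pderiv e3 i u) y‖ ≤ ‖iteratedFDeriv ℝ (n + 1) u y‖ := by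
  have h := norm_iteratedFDerivWithin_clm_apply_const (𝕜 := ℝ) (f := fderiv ℝ u) (c := e3 i)
    (s := univ) (x := y) (N := n) (n := n)
    (hu.fderiv_right (m := n) le_rfl).contDiffWithinAt uniqueDiffOn_univ (mem_univ _) le_rfl
  rw [iteratedFDerivWithin_univ, iteratedFDerivWithin_univ, norm_e3, one_mul,
    norm_iteratedFDeriv_fderiv] at h
  exact h

lemma norm_iteratedFDeriv_succ_le_sum_pderiv (hB : IsOpen B) (hu : ContDiffOn ℝ (n + 1) u B)
    {y : E3} (hy : y ∈ B) :
    ‖iteratedFDeriv ℝ (n + 1) u y‖ ≤ ∑ i, ‖iteratedFDeriv ℝ n (pderiv e3 i u) y‖ := by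
  have hc : ∀ i, ContDiffAt ℝ n (pderiv e3 i u) y := fun i =>
    ((hu.contDiffAt (hB.mem_nhds hy)).fderiv_right (m := n) le_rfl).clm_apply contDiffAt_const
  set L : Fin 3 → ℝ →L[ℝ] E3 →L[ℝ] ℝ := fun i =>
    (ContinuousLinearMap.id ℝ ℝ).smulRight (coordL i) with hL
  have hL1 : ∀ i, ‖L i‖ ≤ 1 := by
    intro i
    refine ContinuousLinearMap.opNorm_le_bound _ zero_le_one fun t => ?_
    rw [one_mul, hL, smulRight_apply, norm_smul]
    refine mul_le_of_le_one_right (norm_nonneg _) ?_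
    refine ContinuousLinearMap.opNorm_le_bound _ zero_le_one fun v => ?_
    rw [one_mul]
    exact PiLp.norm_apply_le v i
  have hexp : fderiv ℝ u = fun z => ∑ i, (L i ∘ pderiv e3 i u) z := by
    funext z
    ext v
    rw [fderiv_e3_expand]
    simp [hL, pderiv, coordL, mul_comm]
  rw [← norm_iteratedFDeriv_fderiv, hexp, iteratedFDeriv_fun_sum_apply fun i _ =>
    (L i).contDiff.contDiffAt.comp y (hc i)]
  refine (norm_sum_le _ _).trans (sum_le_sum fun i _ => ?_)
  refine ((L i).norm_iteratedFDeriv_comp_left (hc i) le_rfl).trans ?_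
  exact mul_le_of_le_one_left (norm_nonneg _) (hL1 i)

lemma Bnd.pderiv (h : Bnd B (n + 1) p q u A) (i : Fin 3) :
    Bnd B n (p - 1) (q - 1) (pderiv e3 i u) A := by
  have hc : ∀ m ≤ n, ∀ y ∈ B, ‖iteratedFDeriv ℝ m (EinsteinVlasov.pderiv e3 i u) y‖
      ≤ ‖iteratedFDeriv ℝ (m + 1) u y‖ := fun m hm y hy =>
    norm_iteratedFDeriv_pderiv_le ((h.contDiffAt hy).of_le (mod_cast Nat.succ_le_succ hm)) i
  have hp := h.hp
  have hq := h.hq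
  refine ⟨h.isOpen, by omega, by omega, ?_, fun m hm => ?_, fun m hm y hy => ?_⟩
  · exact (h.smooth.fderiv_of_isOpen h.isOpen le_rfl).clm_apply contDiffOn_const
  · simpa using eLpNorm_restrict_le_mul (c := 1) h.isOpen.measurableSet
      (fun y hy => by simpa using hc m (by omega) y hy) (h.l2 (m + 1) (by omega))
  · exact (hc m (by omega) y hy).trans (h.sup (m + 1) (by omega) y hy)

/-- Bounds on a function and its partial derivatives give bounds on one more derivative. -/
lemma Bnd.of_pderiv (hu : ContDiffOn ℝ (n + 1) u B) (h0 : Bnd B 0 (min 1 p) (min 1 q) u A)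
    (h : ∀ i, Bnd B n (p - 1) (q - 1) (EinsteinVlasov.pderiv e3 i u) A) :
    Bnd B (n + 1) p q u (3 * A) := by
  have h3 : A ≤ 3 * A := le_mul_of_one_le_left' (by norm_num)
  have hp := (h 0).hp
  have hq := (h 0).hq
  have hle : ∀ m ≤ n, ∀ y ∈ B, _ := fun m hm y hy => norm_iteratedFDeriv_succ_le_sum_pderiv
    h0.isOpen (hu.of_le (mod_cast Nat.succ_le_succ hm)) hy
  refine ⟨h0.isOpen, by omega, by omega, hu, fun m hm => ?_, fun m hm y hy => ?_⟩ <;>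
    rcases m with _ | m
  · exact (h0.l2 0 (by omega)).trans (mod_cast h3)
  · refine (eLpNorm_restrict_le_sum h0.isOpen.measurableSet Finset.univ (c := fun _ => A)
      (hle m (by omega)) (fun i _ => ((h i).aesm (by omega)).norm) fun i _ => ?_).trans (by simp)
    rw [eLpNorm_norm]; exact (h i).l2 m (by omega)
  · exact (h0.sup 0 (by omega) y hy).trans (mod_cast h3)
  · exact (hle m (by omega) y hy).trans
      ((sum_le_sum fun i _ => (h i).sup m (by omega) y hy).trans (by simp))

/-- A bound on the function alone. -/
lemma bc_zero (hB : IsOpen B) (hu : ContDiffOn ℝ 0 u B) (h : ∀ y ∈ B, |u y| ≤ A) : Bc B 0 u A := by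
  refine ⟨hB, by omega, by omega, hu, by simp, fun i hi y hy => ?_⟩
  obtain rfl : i = 0 := by omega
  rw [norm_iteratedFDeriv_zero]
  exact h y hy

lemma Bc.mono {a b : ℕ} (h : Bc B a u A) (hb : b ≤ a) : Bc B b u A :=
  Bnd.mono h

lemma Bc.abs_le {a : ℕ} (h : Bc B a u A) {y : E3} (hy : y ∈ B) : |u y| ≤ A := by
  have := h.sup 0 (by omega) y hy
  rwa [norm_iteratedFDeriv_zero] at this

lemma Bc.of_pderiv {a : ℕ} (hu : ContDiffOn ℝ (a + 1) u B) (hB : IsOpen B)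
    (h0 : ∀ y ∈ B, |u y| ≤ A) (h : ∀ i, Bc B a (EinsteinVlasov.pderiv e3 i u) A) :
    Bc B (a + 1) u (3 * A) :=
  Bnd.of_pderiv hu (Bnd.mono (bc_zero hB (hu.of_le (by simp)) h0)) h

lemma pderiv_inv {y : E3} (hu : DifferentiableAt ℝ u y) (hy : u y ≠ 0) (i : Fin 3) :
    pderiv e3 i (fun y => (u y)⁻¹) y = -((u y)⁻¹ * (u y)⁻¹ * pderiv e3 i u y) := by
  have h := (hasDerivAt_inv hy).comp_hasFDerivAt y hu.hasFDerivAt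
  have h2 : fderiv ℝ (fun y => (u y)⁻¹) y = -(u y ^ 2)⁻¹ • fderiv ℝ u y := h.fderiv
  rw [pderiv, h2, smul_apply, smul_eq_mul, pderiv]
  ring

lemma Bc.inv (a : ℕ) (A w : ℝ≥0) (hw : 0 < w) : ∃ C : ℝ≥0, ∀ (B : Set E3) (u : E3 → ℝ),
    Bc B a u A → (∀ y ∈ B, w ≤ u y) → Bc B a (fun y => (u y)⁻¹) C := by
  have hs : ∀ (B : Set E3) (u : E3 → ℝ), (∀ y ∈ B, (w : ℝ) ≤ u y) →
      ∀ y ∈ B, 0 < u y ∧ |(u y)⁻¹| ≤ (w⁻¹ : ℝ≥0) := by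
    intro B u h y hy
    have h0 : 0 < u y := lt_of_lt_of_le (mod_cast hw) (h y hy)
    refine ⟨h0, ?_⟩
    rw [abs_inv, abs_of_pos h0, NNReal.coe_inv]
    exact inv_anti₀ (mod_cast hw) (h y hy)
  induction a with
  | zero =>
    refine ⟨w⁻¹, fun B u hu h => bc_zero hu.isOpen ?_ fun y hy => (hs B u h y hy).2⟩
    exact hu.smooth.inv fun y hy => (hs B u h y hy).1.ne'
  | succ a ih =>
    obtain ⟨C, hC⟩ := ih
    refine ⟨3 * (w⁻¹ + 2 ^ a * (2 ^ a * C * C) * A), fun B u hu h => ?_⟩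
    have hi := hC B u (hu.mono (by omega)) h
    have hne : ∀ y ∈ B, u y ≠ 0 := fun y hy => (hs B u h y hy).1.ne'
    refine Bc.of_pderiv ?_ hu.isOpen (fun y hy => ((hs B u h y hy).2).trans ?_) fun i => ?_
    · exact_mod_cast hu.smooth.inv hne
    · exact_mod_cast le_self_add
    · refine Bnd.congr (((Bc.mul (Bc.mul hi hi) (hu.pderiv i)).neg).le le_add_self) fun y hy => ?_
      exact pderiv_inv ((hu.contDiffAt hy).differentiableAt (by simp)) (hne y hy) i

/-- For `a ≥ 2`, the gain of one derivative includes the pointwise bounds. -/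
lemma Bd.succ {a : ℕ} (h0 : Bd B a u A) (ha : 2 ≤ a) (hu : ContDiffOn ℝ (a + 1) u B)
    (h : ∀ i, Bd B a (EinsteinVlasov.pderiv e3 i u) A) : Bd B (a + 1) u (3 * A) :=
  Bnd.of_pderiv hu (Bnd.mono h0) h

/-- Inverses in the algebra `H^a`. The first derivatives are controlled pointwise, and each further
derivative is controlled by `∂(1/u) = -(1/u)² ∂u`. -/
lemma Bd.inv {a : ℕ} (ha : 6 ≤ a) (A w V : ℝ≥0) (hw : 0 < w) : ∃ C : ℝ≥0,
    ∀ (B : Set E3) (u : E3 → ℝ), eLpNorm (fun _ : E3 => (1 : ℝ)) 2 (volume.restrict B) ≤ V →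
      Bd B a u A → (∀ y ∈ B, w ≤ u y) → Bd B a (fun y => (u y)⁻¹) C := by
  have key : ∀ b : ℕ, 4 ≤ b → b ≤ a → ∃ C : ℝ≥0, ∀ (B : Set E3) (u : E3 → ℝ),
      eLpNorm (fun _ : E3 => (1 : ℝ)) 2 (volume.restrict B) ≤ V →
      Bd B a u A → (∀ y ∈ B, w ≤ u y) → Bd B b (fun y => (u y)⁻¹) C := by
    intro b hb
    induction b, hb using Nat.le_induction with
    | base =>
      -- `H⁶ ⊂ C⁴`
      intro _
      obtain ⟨C, hC⟩ := Bc.inv 4 A w hw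
      exact ⟨_, fun B u hV hu h => (hC B u (Bd.bc (hu.mono ha)) h).bd hV⟩
    | succ b hb ih =>
      intro hba
      obtain ⟨C, hC⟩ := ih (by omega)
      refine ⟨3 * (C + 2 ^ b * (2 ^ b * C * C) * A), fun B u hV hu h => ?_⟩
      have hi := hC B u hV hu h
      have hne : ∀ y ∈ B, u y ≠ 0 := fun y hy =>
        (lt_of_lt_of_le (mod_cast hw) (h y hy)).ne'
      refine Bd.succ (hi.le le_self_add) (by omega) ?_ fun i => ?_
      · exact_mod_cast (hu.mono hba).smooth.inv hne
      · refine Bnd.congr (((Bd.mul (Bd.mul hi hi le_rfl le_rfl (by omega)) ((hu.mono hba).pderiv i)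
          le_rfl le_rfl (by omega)).neg).le le_add_self) fun y hy => ?_
        exact pderiv_inv ((hu.contDiffAt hy).differentiableAt (by norm_cast; omega)) (hne y hy) i
  exact key a (by omega) le_rfl

end Calculus

/-! ### Ellipticity and `L²` norms -/

section Ellipticity

variable {w Λ : ℝ}

/-- Uniform ellipticity: a symmetric matrix with entries bounded by `Λ` and eigenvalues at
least `w`. -/
structure Ell (w Λ : ℝ) (G : Mat3) : Prop where
  symm : ∀ i j, G i j = G j i
  bound : ∀ i j, |G i j| ≤ Λ
  pos : ∀ v : Fin 3 → ℝ, w * ∑ i, v i ^ 2 ≤ ∑ i, ∑ j, v i * v j * G i j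

lemma Ell.mono {G : Mat3} (h : Ell w Λ G) {w' Λ' : ℝ} (hw : w' ≤ w) (hΛ : Λ ≤ Λ') : Ell w' Λ' G :=
  ⟨h.symm, fun i j => (h.bound i j).trans hΛ, fun v =>
    (mul_le_mul_of_nonneg_right hw (sum_nonneg fun _ _ => sq_nonneg _)).trans (h.pos v)⟩

/-- Compactness of this set of matrices is the source of all uniform constants for metrics. -/
lemma isCompact_ell (w Λ : ℝ) : IsCompact {G : Mat3 | Ell w Λ G} := by
  have hK : IsCompact (Set.pi univ fun _ : Fin 3 => Set.pi univ fun _ : Fin 3 => Icc (-Λ) Λ) :=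
    isCompact_univ_pi fun _ => isCompact_univ_pi fun _ => isCompact_Icc
  have hent : ∀ i j, Continuous fun G : Mat3 => G i j := fun i j =>
    (continuous_apply j).comp (continuous_apply i)
  have hcl : IsClosed {G : Mat3 | Ell w Λ G} := by
    have : {G : Mat3 | Ell w Λ G} = (⋂ i, ⋂ j, {G : Mat3 | G i j = G j i})
        ∩ (⋂ i, ⋂ j, {G : Mat3 | |G i j| ≤ Λ})
        ∩ ⋂ v : Fin 3 → ℝ, {G : Mat3 | w * ∑ i, v i ^ 2 ≤ ∑ i, ∑ j, v i * v j * G i j} := by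
      ext G
      simp only [mem_inter_iff, mem_iInter, mem_ofPred_eq]
      exact ⟨fun h => ⟨⟨h.symm, h.bound⟩, h.pos⟩, fun h => ⟨h.1.1, h.1.2, h.2⟩⟩
    rw [this]
    refine ((isClosed_iInter fun i => isClosed_iInter fun j => isClosed_eq (hent i j) (hent j i)).inter
      (isClosed_iInter fun i => isClosed_iInter fun j =>
        isClosed_le (hent i j).abs continuous_const)).inter
      (isClosed_iInter fun v => isClosed_le continuous_const ?_)
    exact continuous_finsetSum _ fun i _ => continuous_finsetSum _ fun j _ =>
      continuous_const.mul (hent i j)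
  refine hK.of_isClosed_subset hcl fun G hG => ?_
  simp only [mem_pi, mem_univ, true_implies, mem_Icc]
  exact fun i j => abs_le.1 (hG.bound i j)

lemma Ell.posDef {G : Mat3} (h : Ell w Λ G) (hw : 0 < w) : G.PosDef := by
  refine Matrix.PosDef.of_dotProduct_mulVec_pos (by ext i j; exact h.symm j i) ?_
  intro x hx
  have h1 := h.pos x
  have h2 : 0 < ∑ i, x i ^ 2 := by
    obtain ⟨i, hi⟩ := Function.ne_iff.1 hx
    exact Finset.sum_pos' (fun i _ => sq_nonneg _) ⟨i, Finset.mem_univ _, by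
      have : x i ≠ 0 := hi
      positivity⟩
  refine ((mul_pos hw h2).trans_le h1).trans_eq ?_
  simp only [star_trivial, dotProduct, mulVec, sum_univ_three]
  ring

open scoped MatrixOrder in
lemma tensorNormSq_pos {G : Mat3} (hG : G.PosDef) {u : Ten k} (hu : u ≠ 0) :
    0 < tensorNormSq G u := by
  have hGi : (G⁻¹).PosDef := hG.inv
  obtain ⟨B, hB⟩ := CStarAlgebra.nonneg_iff_eq_star_mul_self.mp hGi.posSemidef.nonneg
  have hB' : G⁻¹ = B.transpose * B := hB
  have hdet : IsUnit B.det := by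
    have h1 := hGi.det_pos
    rw [hB', det_mul, det_transpose] at h1
    exact isUnit_iff_ne_zero.2 fun h0 => by simp [h0] at h1
  rw [tensorNormSq_eq_dot, hB', pull_mul, dot_pull]
  have hne : pull B.transpose u ≠ 0 := by
    intro h0
    refine hu ?_
    have h1 : B.transpose * (B.transpose)⁻¹ = 1 := mul_nonsing_inv _ (by rwa [det_transpose])
    have h2 : pull (B.transpose)⁻¹ (pull B.transpose u) = u := by
      rw [← pull_mul, h1, pull_one]
    rw [← h2, h0]
    ext a
    simp [pull, mpull]
  obtain ⟨a, ha⟩ := Function.ne_iff.1 hne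
  have ha' : pull B.transpose u a ≠ 0 := ha
  exact Finset.sum_pos' (fun a _ => mul_self_nonneg _) ⟨a, Finset.mem_univ _,
    mul_self_pos.2 ha'⟩

lemma tensorNormSq_nonneg {G : Mat3} (hG : G.PosDef) (u : Ten k) : 0 ≤ tensorNormSq G u := by
  by_cases hu : u = 0
  · simp [hu, tensorNormSq]
  · exact (tensorNormSq_pos hG hu).le

lemma tensorNormSq_smul (G : Mat3) (c : ℝ) (u : Ten k) :
    tensorNormSq G (c • u) = c ^ 2 * tensorNormSq G u := by
  simp only [tensorNormSq, mul_sum, Pi.smul_apply, smul_eq_mul]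
  refine sum_congr rfl fun a _ => sum_congr rfl fun b _ => by ring

lemma continuousOn_matrix_inv_apply (i j : Fin 3) :
    ContinuousOn (fun G : Mat3 => G⁻¹ i j) {G | G.det ≠ 0} := by
  simp only [Matrix.inv_def, Ring.inverse_eq_inv', Matrix.smul_apply, smul_eq_mul]
  refine ContinuousOn.mul (ContinuousOn.inv₀ (Continuous.continuousOn (by fun_prop)) fun G hG => hG) ?_
  have : Continuous fun G : Mat3 => G.adjugate := Continuous.matrix_adjugate continuous_id
  exact ((continuous_apply j).comp ((continuous_apply i).comp this)).continuousOn

/-- A positive function that is homogeneous of degree two in the fibre is uniformly comparable to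
the square of the Euclidean norm over a compact set. -/
lemma exists_bound_of_homogeneous {Z ι : Type*} [TopologicalSpace Z] [Fintype ι] {K : Set Z}
    (hK : IsCompact K) {f : Z → (ι → ℝ) → ℝ}
    (hf : ContinuousOn (fun p : Z × (ι → ℝ) => f p.1 p.2) (K ×ˢ univ))
    (hpos : ∀ z ∈ K, ∀ v ≠ 0, 0 < f z v) (hh : ∀ z c v, f z (c • v) = c ^ 2 * f z v) :
    ∃ C, 0 < C ∧ ∀ z ∈ K, ∀ v, ∑ i, v i ^ 2 ≤ C * f z v ∧ f z v ≤ C * ∑ i, v i ^ 2 := by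
  have hg : ∀ v : ι → ℝ, v ≠ 0 → 0 < ∑ i, v i ^ 2 := fun v hv => by
    obtain ⟨i, hi⟩ := Function.ne_iff.1 hv
    exact Finset.sum_pos' (fun i _ => sq_nonneg _) ⟨i, Finset.mem_univ _, sq_pos_of_ne_zero hi⟩
  have hS := hK.prod (isCompact_sphere (0 : ι → ℝ) 1)
  have hne : ∀ p ∈ K ×ˢ Metric.sphere (0 : ι → ℝ) 1, p.2 ≠ 0 := fun p hp =>
    Metric.ne_of_mem_sphere hp.2 one_ne_zero
  have hfS := hf.mono (prod_mono_right (subset_univ (Metric.sphere 0 1)))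
  have hgS : ContinuousOn (fun p : Z × (ι → ℝ) => ∑ i, p.2 i ^ 2) (K ×ˢ Metric.sphere 0 1) := by
    fun_prop
  obtain ⟨C₁, h1⟩ := hS.exists_bound_of_continuousOn (hfS.div hgS fun p hp => (hg _ (hne p hp)).ne')
  obtain ⟨C₂, h2⟩ := hS.exists_bound_of_continuousOn
    (hgS.div hfS fun p hp => (hpos _ hp.1 _ (hne p hp)).ne')
  refine ⟨max 1 (max C₁ C₂), by positivity, fun z hz v => ?_⟩
  by_cases hv : v = 0
  · have := hh z 0 v
    simp_all
  have hmem : (z, ‖v‖⁻¹ • v) ∈ K ×ˢ Metric.sphere 0 1 := ⟨hz, by simp [norm_smul, hv]⟩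
  have hn : ‖v‖⁻¹ ^ 2 ≠ 0 := by simpa using hv
  have h1 := (le_abs_self _).trans (h1 _ hmem)
  have h2 := (le_abs_self _).trans (h2 _ hmem)
  simp only [Pi.div_apply, hh, Pi.smul_apply, smul_eq_mul, mul_pow, ← mul_sum,
    mul_div_mul_left _ _ hn] at h1 h2
  rw [div_le_iff₀ (hg v hv)] at h1
  rw [div_le_iff₀ (hpos z hz v hv)] at h2
  have := hg v hv
  have := hpos z hz v hv
  exact ⟨h2.trans (by gcongr; simp), h1.trans (by gcongr; simp)⟩

lemma sq_le_sum_sq [Fintype ι] (u : ι → ℝ) (a : ι) : u a ^ 2 ≤ ∑ a, u a ^ 2 :=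
  single_le_sum (f := fun a => u a ^ 2) (fun _ _ => sq_nonneg _) (Finset.mem_univ a)

/-- Uniformly elliptic metrics induce uniformly equivalent norms on tensors. -/
lemma ell_tensorNormSq (k : ℕ) (w Λ : ℝ) (hw : 0 < w) : ∃ C : ℝ, 0 < C ∧
    ∀ G : Mat3, Ell w Λ G → ∀ u : Ten k,
      ∑ a, u a ^ 2 ≤ C * tensorNormSq G u ∧ tensorNormSq G u ≤ C * ∑ a, u a ^ 2 := by
  refine exists_bound_of_homogeneous (isCompact_ell w Λ) ?_
    (fun G hG u hu => tensorNormSq_pos (Ell.posDef hG hw) hu) tensorNormSq_smul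
  unfold tensorNormSq
  refine continuousOn_finsetSum _ fun a _ => continuousOn_finsetSum _ fun b _ =>
    ((continuousOn_finsetProd _ fun i _ => ?_).mul (by fun_prop)).mul (by fun_prop)
  exact (continuousOn_matrix_inv_apply _ _).comp continuousOn_fst
    fun p hp => ((hp.1 : Ell w Λ p.1).posDef hw).det_pos.ne'

lemma ell_det (w Λ : ℝ) (hw : 0 < w) : ∃ d : ℝ≥0, 0 < d ∧ ∀ G : Mat3, Ell w Λ G →
    (d : ℝ) ≤ G.det ∧ (d : ℝ) ≤ √G.det ∧ √G.det ≤ d⁻¹ := by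
  have hc : Continuous fun G : Mat3 => G.det := by fun_prop
  have hK := isCompact_ell w Λ
  obtain ⟨C₁, hC₁⟩ := hK.exists_bound_of_continuousOn hc.continuousOn
  obtain ⟨C₂, hC₂⟩ := hK.exists_bound_of_continuousOn
    (hc.continuousOn.inv₀ fun G (hG : Ell w Λ G) => (hG.posDef hw).det_pos.ne')
  set D : ℝ≥0 := ⟨max 1 (max C₁ C₂), by positivity⟩ with hD
  have hD1 : (1 : ℝ) ≤ D := le_max_left _ _
  refine ⟨D⁻¹, by rw [inv_pos]; exact_mod_cast (by linarith : (0 : ℝ) < D), fun G hG => ?_⟩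
  have h0 := (hG.posDef hw).det_pos
  have h1 := hC₁ G hG
  have h2 := hC₂ G hG
  rw [norm_of_nonneg h0.le] at h1
  rw [Pi.inv_apply, norm_inv, norm_of_nonneg h0.le] at h2
  have h1' : G.det ≤ D := h1.trans ((le_max_left _ _).trans (le_max_right _ _))
  have h2' : (G.det)⁻¹ ≤ D := h2.trans ((le_max_right _ _).trans (le_max_right _ _))
  have hlow : (D : ℝ)⁻¹ ≤ G.det := by
    rw [inv_le_comm₀ (by linarith) h0]; exact h2'
  rw [inv_inv, NNReal.coe_inv]
  refine ⟨hlow, ?_, ?_⟩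
  · refine Real.le_sqrt_of_sq_le (le_trans ?_ hlow)
    rw [sq]
    exact mul_le_of_le_one_left (by positivity) (inv_le_one_of_one_le₀ hD1)
  · refine Real.sqrt_le_iff.2 ⟨by positivity, h1'.trans ?_⟩
    nlinarith

end Ellipticity

section MetricEllipticity

variable {c : M} {g : BilinField M} {n : ℕ∞ω}

lemma IsMetric.exists_ell (hg : IsMetric n g) {K : Set E3} (hK : IsCompact K)
    (hKc : K ⊆ (chartAt E3 c).target) : ∃ w Λ : ℝ, 0 < w ∧ ∀ y ∈ K, Ell w Λ (bilinComp g c y) := by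
  have hco : ∀ i j, ContinuousOn (fun y => bilinComp g c y i j) K := fun i j =>
    (hg.smooth c i j).continuousOn.mono hKc
  have hb : ∀ i j, ∃ C, ∀ y ∈ K, |bilinComp g c y i j| ≤ C := fun i j =>
    hK.exists_bound_of_continuousOn (hco i j)
  choose Cb hCb using hb
  obtain ⟨C, hC, hCe⟩ := exists_bound_of_homogeneous hK
    (f := fun y v => ∑ i, ∑ j, v i * v j * bilinComp g c y i j)
    (continuousOn_finsetSum _ fun i _ => continuousOn_finsetSum _ fun j _ =>
      ContinuousOn.mul (by fun_prop) ((hco i j).comp continuousOn_fst fun p hp => hp.1))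
    (fun y hy v hv => hg.quad_pos (hKc hy) (v := WithLp.toLp 2 v) (by simpa using hv))
    (fun y c v => by
      simp only [Pi.smul_apply, smul_eq_mul, sum_univ_three]; ring)
  refine ⟨C⁻¹, ∑ i, ∑ j, |Cb i j|, by positivity, fun y hy =>
    ⟨hg.bilinComp_symm c y, fun i j => ?_, fun v => ?_⟩⟩
  · refine ((hCb i j y hy).trans (le_abs_self _)).trans ?_
    refine (single_le_sum (f := fun j => |Cb i j|) (fun j _ => abs_nonneg _)
      (Finset.mem_univ j)).trans ?_
    exact single_le_sum (f := fun i => ∑ j, |Cb i j|)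
      (fun i _ => sum_nonneg fun j _ => abs_nonneg _) (Finset.mem_univ i)
  · exact (inv_mul_le_iff₀ hC).2 (hCe y hy v).1

end MetricEllipticity

section EnergyLocal

variable {c : M} {g : BilinField M} {n : ℕ∞ω}

lemma continuousOn_tensorNormSq (hg : IsMetric n g) {u : TField M k} (hus : TSmooth 0 u) (c : M) :
    ContinuousOn (fun y => tensorNormSq (bilinComp g c y) (u c y)) (chartAt E3 c).target := by
  unfold tensorNormSq
  refine continuousOn_finsetSum _ fun a _ => continuousOn_finsetSum _ fun b _ => ?_
  refine ((continuousOn_finsetProd _ fun i _ => ?_).mul (hus c a).continuousOn).mul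
    (hus c b).continuousOn
  intro y hy
  exact (contDiffAt_inv (G := bilinComp g c) (n := 0)
    (fun i j => (hg.contDiffAt hy i j).of_le zero_le) (hg.isUnit_det hy) _ _).continuousAt.continuousWithinAt

lemma continuous_normSqAt (hg : IsMetric n g) {u : TField M k} (hu : IsTensor u)
    (hus : TSmooth 0 u) : Continuous (normSqAt g u) :=
  continuous_of_chart fun c => (continuousOn_tensorNormSq hg hus c).congr
    fun _ hy => normSqAt_chartPt hu g hy

lemma normSqAt_nonneg (hg : IsMetric n g) (u : TField M k) (x : M) : 0 ≤ normSqAt g u x :=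
  tensorNormSq_nonneg (hg.posDef (mem_chart_target E3 x)) _

lemma PatchAtlas.χ_le_one (U : PatchAtlas M) (j : U.ι) (x : M) : U.χ j x ≤ 1 := by
  rw [← U.χ_sum x]
  exact single_le_sum (f := fun j => U.χ j x) (fun j _ => U.χ_nonneg j x)
    (Finset.mem_univ j)

variable [MeasurableSpace M] [BorelSpace M] [CompactSpace M]

lemma lintegral_source (hg : IsMetric n g) {φ : M → ENNReal} (hφ : Measurable φ) :
    ∫⁻ x in (chartAt E3 c).source, φ x ∂(riemVol g)
      = ∫⁻ y in (chartAt E3 c).target, φ (chartPt c y) * ofReal √(bilinComp g c y).det := by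
  rw [riemVol_restrict, Measure.restrict_eq_self_of_ae_mem (ae_mem_source_chartMeas g c), chartMeas,
    lintegral_map' hφ.aemeasurable (aemeasurable_chart_symm g c),
    lintegral_withDensity_eq_lintegral_mul_non_measurable₀]
  · exact lintegral_congr fun y => mul_comm _ _
  · exact ((hg.continuousOn_sqrt_det c).aemeasurable (measurableSet_target c)).ennreal_ofReal
  · exact .of_forall fun y => ENNReal.ofReal_lt_top

/-- The global `L²` norm of a tensor field controls the components. -/
lemma eLpNorm_comp_le (k : ℕ) (w Λ : ℝ) (hw : 0 < w) : ∃ C : ℝ≥0,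
    ∀ {g : BilinField M} {n : ℕ∞ω} {c : M} {B : Set E3}, IsMetric n g → MeasurableSet B →
      B ⊆ (chartAt E3 c).target → (∀ y ∈ B, Ell w Λ (bilinComp g c y)) →
      ∀ u : TField M k, IsTensor u → TSmooth 0 u → ∀ a,
        eLpNorm (fun y => u c y a) 2 (volume.restrict B)
          ≤ (C * (√(∫ x, normSqAt g u x ∂(riemVol g))).toNNReal : ℝ≥0) := by
  obtain ⟨C, hC, hCe⟩ := ell_tensorNormSq k w Λ hw
  obtain ⟨d, hd, hde⟩ := ell_det w Λ hw
  refine ⟨(√(C * (d : ℝ)⁻¹)).toNNReal, fun {g n c B} hg hBm hB hell u hu hus a => ?_⟩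
  have hcn := continuous_normSqAt hg hu hus
  set E := ∫ x, normSqAt g u x ∂(riemVol g) with hE
  have hdpos : (0 : ℝ) < d := hd
  have hE0 : 0 ≤ E := integral_nonneg fun x => normSqAt_nonneg hg u x
  set φ : E3 → ℝ := fun y => tensorNormSq (bilinComp g c y) (u c y) * √(bilinComp g c y).det with hφ
  have hφ0 : ∀ y ∈ (chartAt E3 c).target, 0 ≤ φ y := fun y hy =>
    mul_nonneg (tensorNormSq_nonneg (hg.posDef hy) _) (sqrt_nonneg _)
  have hφc : ContinuousOn φ (chartAt E3 c).target :=
    (continuousOn_tensorNormSq hg hus c).mul (hg.continuousOn_sqrt_det c)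
  -- the energy density in the chart, as a lower integral
  have hsrc : ∫⁻ y in (chartAt E3 c).target, ofReal (φ y) ≤ ofReal E := by
    have h1 : ∫⁻ x in (chartAt E3 c).source, ofReal (normSqAt g u x) ∂(riemVol g) ≤ ofReal E := by
      rw [hE, ofReal_integral_eq_lintegral_ofReal (hg.integrable hcn)
        (.of_forall fun x => normSqAt_nonneg hg u x)]
      exact setLIntegral_le_lintegral _ _
    refine le_trans (le_of_eq ?_) h1
    rw [lintegral_source hg hcn.measurable.ennreal_ofReal]
    refine setLIntegral_congr_fun (measurableSet_target c) fun y hy => ?_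
    rw [normSqAt_chartPt hu g hy, hφ, ofReal_mul (tensorNormSq_nonneg (hg.posDef hy) _)]
  have hle : ∫⁻ y in B, ofReal (u c y a ^ 2) ≤ ofReal (C * (d : ℝ)⁻¹) * ofReal E := by
    calc _ ≤ ∫⁻ y in B, ofReal (C * (d : ℝ)⁻¹) * ofReal (φ y) := by
          refine setLIntegral_mono' hBm fun y hy => ?_
          rw [← ofReal_mul (by positivity)]
          refine ofReal_le_ofReal (((sq_le_sum_sq _ a).trans
            (hCe _ (hell y hy) (u c y)).1).trans ?_)
          have h1 := (hde _ (hell y hy)).2.1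
          have h2 := tensorNormSq_nonneg (hg.posDef (hB hy)) (u c y)
          rw [hφ, mul_assoc]
          gcongr
          rw [mul_left_comm]
          refine le_mul_of_one_le_right h2 ?_
          rw [← div_eq_inv_mul, one_le_div hdpos]
          exact h1
      _ = ofReal (C * (d : ℝ)⁻¹) * ∫⁻ y in B, ofReal (φ y) :=
          lintegral_const_mul' _ _ ofReal_ne_top
      _ ≤ _ := by
          gcongr
          exact (lintegral_mono_set hB).trans hsrc
  rw [eLpNorm_two_eq]
  have h1 : ∫⁻ y in B, ‖u c y a‖ₑ ^ (2 : ℝ) = ∫⁻ y in B, ofReal (u c y a ^ 2) := by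
    refine lintegral_congr fun y => ?_
    rw [← ofReal_norm, ENNReal.ofReal_rpow_of_nonneg (norm_nonneg _) (by norm_num)]
    norm_num
  rw [h1]
  refine (ENNReal.rpow_le_rpow hle (by norm_num)).trans_eq ?_
  rw [← ofReal_mul (by positivity), ENNReal.ofReal_rpow_of_nonneg (by positivity)
    (by norm_num), ← Real.sqrt_eq_rpow, sqrt_mul (by positivity),
    ofReal_mul (sqrt_nonneg _), ENNReal.coe_mul]
  rfl

/-- The Cauchy-Schwarz inequality. -/
lemma integral_mul_le_of_eLpNorm {μ : Measure E3} {v v' : E3 → ℝ} {A A' : ℝ≥0}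
    (hv : AEStronglyMeasurable v μ) (hv' : AEStronglyMeasurable v' μ)
    (h : eLpNorm v 2 μ ≤ A) (h' : eLpNorm v' 2 μ ≤ A') :
    Integrable (fun y => v y * v' y) μ ∧ ∫ y, |v y * v' y| ∂μ ≤ A * A' := by
  have hm : MemLp v 2 μ := ⟨hv, h.trans_lt ENNReal.coe_lt_top⟩
  have hm' : MemLp v' 2 μ := ⟨hv', h'.trans_lt ENNReal.coe_lt_top⟩
  have hi : Integrable (fun y => v y * v' y) μ := hm.integrable_mul hm'
  refine ⟨hi, ?_⟩
  have h1 : ∫⁻ y, ‖v y * v' y‖ₑ ∂μ ≤ A * A' := by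
    simp only [enorm_mul]
    refine (ENNReal.lintegral_mul_le_Lp_mul_Lq μ Real.HolderConjugate.two_two hv.enorm hv'.enorm).trans ?_
    rw [← eLpNorm_two_eq, ← eLpNorm_two_eq]
    gcongr
  have h2 : ∫ y, |v y * v' y| ∂μ = (∫⁻ y, ‖v y * v' y‖ₑ ∂μ).toReal := by
    rw [← integral_norm_eq_lintegral_enorm hi.aestronglyMeasurable]
    rfl
  rw [h2]
  exact ENNReal.toReal_le_of_le_ofReal (by positivity) (by
    rw [ofReal_mul (by positivity)]; simpa using h1)

/-- The components of a tensor field on the coordinate balls control the global `L²` norm. -/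
lemma sqrt_integral_normSqAt_le (U : PatchAtlas M) (k : ℕ) (w Λ : ℝ) (hw : 0 < w) : ∃ C : ℝ≥0,
    ∀ {g : BilinField M} {n : ℕ∞ω}, IsMetric n g →
      (∀ j, ∀ y ∈ U.ball j, Ell w Λ (bilinComp g (U.ctr j) y)) →
      ∀ u : TField M k, IsTensor u → TSmooth 0 u → ∀ A : ℝ≥0,
        (∀ j a, eLpNorm (fun y => u (U.ctr j) y a) 2 (volume.restrict (U.ball j)) ≤ A) →
        √(∫ x, normSqAt g u x ∂(riemVol g)) ≤ C * A := by
  obtain ⟨C, hC, hCe⟩ := ell_tensorNormSq k w Λ hw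
  obtain ⟨d, hd, hde⟩ := ell_det w Λ hw
  have hdpos : (0 : ℝ) < d := hd
  refine ⟨(√(Fintype.card U.ι * (C * (d : ℝ)⁻¹ * Fintype.card (Fin k → Fin 3)))).toNNReal,
    fun {g n} hg hell u hu hus A hA => ?_⟩
  rw [coe_toNNReal _ (sqrt_nonneg _)]
  refine Real.sqrt_le_iff.2 ⟨by positivity, ?_⟩
  rw [mul_pow, sq_sqrt (by positivity), integral_eq_sum_patch U hg (continuous_normSqAt hg hu hus)]
  have hj : ∀ j, ∫ y in U.ball j, U.χ j (chartPt (U.ctr j) y) * (normSqAt g u (chartPt (U.ctr j) y)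
      * √(bilinComp g (U.ctr j) y).det) ≤ C * (d : ℝ)⁻¹ * Fintype.card (Fin k → Fin 3) * (A : ℝ) ^ 2 := by
    intro j
    have hbm : MeasurableSet (U.ball j) := isOpen_ball.measurableSet
    have hsq : ∀ a, Integrable (fun y => u (U.ctr j) y a * u (U.ctr j) y a)
        (volume.restrict (U.ball j))
        ∧ ∫ y in U.ball j, |u (U.ctr j) y a * u (U.ctr j) y a| ≤ A * A := fun a => by
      have hm := ((hus (U.ctr j) a).continuousOn.mono
        (U.ball_subset_target j)).aestronglyMeasurable (μ := volume) hbm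
      exact integral_mul_le_of_eLpNorm hm hm (hA j a) (hA j a)
    calc _ ≤ ∫ y in U.ball j, C * (d : ℝ)⁻¹ * ∑ a, |u (U.ctr j) y a * u (U.ctr j) y a| := by
          refine integral_mono_of_nonneg ?_ ?_ ?_
          · refine .of_forall fun y => ?_
            exact mul_nonneg (U.χ_nonneg j _) (mul_nonneg (normSqAt_nonneg hg u _) (sqrt_nonneg _))
          · exact (integrable_finsetSum _ fun a _ => (hsq a).1.abs).const_mul _
          · filter_upwards [ae_restrict_mem hbm] with y hy
            have hy' := U.ball_subset_target j hy
            rw [normSqAt_chartPt hu g hy']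
            have h0 := tensorNormSq_nonneg (hg.posDef hy') (u (U.ctr j) y)
            have h1 := (hCe _ (hell j y hy) (u (U.ctr j) y)).2
            have h2 := (hde _ (hell j y hy)).2.2
            rw [NNReal.coe_inv] at h2
            have h3 : ∑ a, |u (U.ctr j) y a * u (U.ctr j) y a| = ∑ a, u (U.ctr j) y a ^ 2 :=
              sum_congr rfl fun a _ => by rw [abs_mul_self, sq]
            rw [h3]
            calc _ ≤ 1 * (C * (∑ a, u (U.ctr j) y a ^ 2) * (d : ℝ)⁻¹) := by
                  have := U.χ_le_one j (chartPt (U.ctr j) y)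
                  have := U.χ_nonneg j (chartPt (U.ctr j) y)
                  gcongr
              _ = _ := by ring
      _ ≤ C * (d : ℝ)⁻¹ * ∑ _a : Fin k → Fin 3, (A : ℝ) * A := by
          rw [integral_const_mul, integral_finsetSum _ fun a _ => (hsq a).1.abs]
          gcongr with a
          exact (hsq a).2
      _ = _ := by
          rw [Finset.sum_const, Finset.card_univ, nsmul_eq_mul]; ring
  refine (sum_le_sum fun j _ => hj j).trans_eq ?_
  rw [Finset.sum_const, Finset.card_univ, nsmul_eq_mul]; ring

end EnergyLocal

/-! ### Bounds of covariant derivatives -/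

section LocalCovariant

variable {k n p q s : ℕ} {B : Set E3} {A K D : ℝ≥0} {G : E3 → Mat3} {u : E3 → Ten k}

lemma Bnd.act {Q : E3 → Mat3} (hB : IsOpen B) (hp : p ≤ n + 1) (hq : q ≤ n + 1)
    (h : ∀ i j a, Bnd B n p q (fun y => Q y i j * u y a) D) (a : Fin k → Fin 3) :
    Bnd B n p q (fun y => EinsteinVlasov.act (Q y) (u y) a) (k * (3 * D)) := by
  have h1 : ∀ i : Fin k, Bnd B n p q
      (fun y => ∑ c, Q y c (a i) * u y (update a i c)) (3 * D) := fun i => by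
    simpa using Bnd.sum_card hB hp hq fun c => h c (a i) (update a i c)
  simpa [EinsteinVlasov.act] using Bnd.sum_card hB hp hq h1

lemma covD_apply_zero {u : E3 → (Fin 0 → Fin 3) → ℝ} (y : E3) (a : Fin 1 → Fin 3) :
    covD e3 G u y a = pderiv e3 (a 0) (fun w => u w (tail a)) y := by
  simp [covD, act, dTen, pderiv]

lemma covD_apply (y : E3) (a : Fin (k + 1) → Fin 3) :
    covD e3 G u y a = pderiv e3 (a 0) (fun w => u w (tail a)) y
      - act (chrMat e3 G y (a 0)) (u y) (tail a) := rfl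

/-- Covariant derivatives, for a connection with bounds in `H^s`. For functions, the connection is
not involved. -/
lemma Bd.covD (hΓ : ∀ a i j, Bd B s (fun y => chrMat e3 G y a i j) K)
    (hu : ∀ a, Bd B (n + 1) (fun y => u y a) A) (hn : k ≠ 0 → n ≤ s) (hs : 2 ≤ s)
    (a : Fin (k + 1) → Fin 3) :
    Bd B n (fun y => covD e3 G u y a) ((1 + k * (3 * (2 ^ n * K))) * A) := by
  have h1 : Bd B n (pderiv e3 (a 0) fun w => u w (tail a)) A := (hu (tail a)).pderiv (a 0)
  rcases Nat.eq_zero_or_pos k with rfl | hk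
  · refine Bnd.congr (h1.le ?_) fun y _ => covD_apply_zero y a
    simp
  · have h2 := Bnd.act (Q := fun y => chrMat e3 G y (a 0)) (u := u) (n := n) (p := n + 1)
      (q := n - 1) (D := 2 ^ n * K * A) h1.isOpen le_rfl (by omega)
      (fun i j b => (hΓ (a 0) i j).mul (hu b) (hn hk.ne') (by omega) (by omega)) (tail a)
    refine Bnd.congr ((h1.sub h2).le (le_of_eq ?_)) fun y _ => covD_apply y a
    ring

lemma Bl.covD (hΓ : ∀ a i j, Bc B s (fun y => chrMat e3 G y a i j) K)
    (hu : ∀ a, Bl B (n + 1) (fun y => u y a) A) (hn : n ≤ s) (a : Fin (k + 1) → Fin 3) :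
    Bl B n (fun y => EinsteinVlasov.covD e3 G u y a) ((1 + k * (3 * (2 ^ n * K))) * A) := by
  have h1 : Bl B n (pderiv e3 (a 0) fun w => u w (tail a)) A := (hu (tail a)).pderiv (a 0)
  have h2 := Bnd.act (Q := fun y => chrMat e3 G y (a 0)) (u := u) (n := n) (p := n + 1)
    (q := 0) (D := 2 ^ n * K * A) h1.isOpen le_rfl (by omega)
    (fun i j b => (hΓ (a 0) i j).mul_bl ((hu b).mono (n' := n)) hn) (tail a)
  refine Bnd.congr ((h1.sub h2).le (le_of_eq ?_)) fun y _ => covD_apply y a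
  ring

/-- A tensor field whose covariant derivative is controlled: the partial derivatives differ from the
covariant ones by the connection coefficients. -/
lemma Bl.of_covD (hu : ∀ a, Bl B n (fun y => u y a) A)
    (hus : ∀ a, ContDiffOn ℝ (n + 1) (fun y => u y a) B)
    (hD : ∀ a, Bl B n (fun y => EinsteinVlasov.covD e3 G u y a) A)
    (hact : ∀ c a, Bl B n (fun y => EinsteinVlasov.act (chrMat e3 G y c) (u y) a) A)
    (a : Fin k → Fin 3) : Bl B (n + 1) (fun y => u y a) (6 * A) := by
  have h2 : A ≤ 2 * A := le_mul_of_one_le_left' (by norm_num)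
  refine (Bnd.of_pderiv (A := 2 * A) (hus a) ((hu a).mono (hA := h2)) fun i => ?_).le
    (le_of_eq (by ring))
  refine Bnd.congr (((hD (Fin.cons i a)).add (hact i a)).le (le_of_eq (by ring))) fun y _ => ?_
  simp [covD_apply]

end LocalCovariant

section SobolevBd

set_option maxSynthPendingDepth 3 in
lemma norm_fderiv_fderiv_iteratedFDeriv (u : E3 → ℝ) (i : ℕ) (y : E3) :
    ‖fderiv ℝ (fderiv ℝ (iteratedFDeriv ℝ i u)) y‖ = ‖iteratedFDeriv ℝ (i + 2) u y‖ := by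
  rw [← norm_fderiv_iteratedFDeriv, fderiv_iteratedFDeriv]
  set e := (continuousMultilinearCurryLeftEquiv ℝ (fun _ : Fin (i + 1) => E3) ℝ)
  rw [LinearIsometryEquiv.comp_fderiv]
  exact e.toLinearIsometry.norm_toContinuousLinearMap_comp

set_option maxSynthPendingDepth 3 in
/-- The Sobolev embedding, for derivatives of any order. -/
lemma Bl.bd_ball (r : ℝ) (hr : 0 < r) (n : ℕ) : ∃ C : ℝ≥0, ∀ (y₀ : E3) (u : E3 → ℝ) (A : ℝ≥0),
    Bl (ball y₀ (2 * r)) n u A → Bd (ball y₀ r) n u (C * A) := by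
  have h := fun i : ℕ => sobolev_ball (F := E3 [×i]→L[ℝ] ℝ) r hr
  choose C hC using h
  set C' : ℝ≥0 := 1 + 3 * ∑ i ∈ Finset.range n, C i
  refine ⟨C', fun y₀ u A hu => ?_⟩
  have hsub : ball y₀ r ⊆ ball y₀ (2 * r) := ball_subset_ball (by linarith)
  have h1 : A ≤ C' * A := le_mul_of_one_le_left' le_self_add
  refine ⟨isOpen_ball, le_rfl, by omega, hu.smooth.mono hsub, fun i hi => ?_,
    fun i hi y hy => ?_⟩
  · refine ((eLpNorm_mono_measure _ (Measure.restrict_mono hsub le_rfl)).trans (hu.l2 i hi)).trans ?_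
    exact_mod_cast h1
  · have hcd : ContDiffOn ℝ 2 (iteratedFDeriv ℝ i u) (ball y₀ (2 * r)) := fun z hz =>
      ((hu.contDiffAt hz).iteratedFDeriv_right (m := 2) (i := i)
        (mod_cast (by omega : 2 + i ≤ n))).contDiffWithinAt
    have h2 := hC i y₀ _ hcd y hy
    have e1 : eLpNorm (fderiv ℝ (iteratedFDeriv ℝ i u)) 2 (volume.restrict (ball y₀ (2 * r)))
        ≤ A := by
      rw [eLpNorm_congr_norm_ae (g := iteratedFDeriv ℝ (i + 1) u)
        (.of_forall fun z => norm_fderiv_iteratedFDeriv)]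
      exact hu.l2 _ (by omega)
    have e2 : eLpNorm (fderiv ℝ (fderiv ℝ (iteratedFDeriv ℝ i u))) 2
        (volume.restrict (ball y₀ (2 * r))) ≤ A := by
      rw [eLpNorm_congr_norm_ae (g := iteratedFDeriv ℝ (i + 2) u)
        (.of_forall fun z => norm_fderiv_fderiv_iteratedFDeriv u i z)]
      exact hu.l2 _ (by omega)
    have e0 := hu.l2 i (by omega)
    have h3 : ‖iteratedFDeriv ℝ i u y‖ₑ ≤ ((C i * (A + A + A) : ℝ≥0) : ENNReal) := by
      refine h2.trans ?_
      push_cast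
      gcongr
    have h4 : ‖iteratedFDeriv ℝ i u y‖ ≤ ((C i * (A + A + A) : ℝ≥0) : ℝ) := by
      rw [← coe_nnnorm]
      exact_mod_cast h3
    refine h4.trans (NNReal.coe_le_coe.2 ?_)
    have h5 : C i ≤ ∑ i ∈ Finset.range n, C i :=
      single_le_sum (fun _ _ => zero_le) (Finset.mem_range.2 (by omega))
    calc C i * (A + A + A) = 3 * C i * A := by ring
      _ ≤ (1 + 3 * ∑ i ∈ Finset.range n, C i) * A := by
        gcongr
        exact le_add_left (by gcongr)

/-- Smooth functions have bounds of every order on relatively compact sets. -/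
lemma exists_bc {U K B : Set E3} (hU : IsOpen U) (hK : IsCompact K) (hKU : K ⊆ U) (hB : IsOpen B)
    (hBK : B ⊆ K) {u : E3 → ℝ} {n : ℕ} (hu : ContDiffOn ℝ n u U) : ∃ A : ℝ≥0, Bc B n u A := by
  have h : ∀ i : ℕ, ∃ C : ℝ, i ≤ n → ∀ y ∈ K, ‖iteratedFDeriv ℝ i u y‖ ≤ C := by
    intro i
    by_cases hi : i ≤ n
    · obtain ⟨C, hC⟩ := hK.exists_bound_of_continuousOn
        ((continuousOn_iteratedFDeriv hU hu hi).mono hKU)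
      exact ⟨C, fun _ => hC⟩
    · exact ⟨0, fun h => absurd h hi⟩
  choose C hC using h
  refine ⟨∑ i ∈ Finset.range (n + 1), (C i).toNNReal, hB, by omega, le_rfl,
    hu.mono (hBK.trans hKU), by simp, fun i hi y hy => ?_⟩
  refine ((hC i (by omega) y (hBK hy)).trans (Real.le_coe_toNNReal _)).trans (NNReal.coe_le_coe.2 ?_)
  exact single_le_sum (f := fun i => (C i).toNNReal) (fun _ _ => zero_le)
    (Finset.mem_range.2 hi)

end SobolevBd

/-! ### Sobolev norms in coordinates -/

section GlobalNorms

lemma exists_nnreal_bound [Fintype ι] (A : ι → ℝ≥0) : ∃ K : ℝ≥0, ∀ i, A i ≤ K :=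
  ⟨∑ i, A i, fun i => single_le_sum (fun _ _ => zero_le) (Finset.mem_univ i)⟩

variable {γ : BilinField M} {k n : ℕ} {A : ℝ≥0}

/-- The components of a tensor field on the coordinate balls of an atlas have the bounds `Bnd`. -/
def TBnd (U : PatchAtlas M) (n p q : ℕ) (u : TField M k) (A : ℝ≥0) : Prop :=
  ∀ j a, Bnd (U.ball j) n p q (fun y => u (U.ctr j) y a) A

/-- The bounds `Bd` in all coordinate balls. -/
abbrev TBd (U : PatchAtlas M) (n : ℕ) (u : TField M k) (A : ℝ≥0) : Prop :=
  TBnd U n (n + 1) (n - 1) u A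

/-- The bounds `Bl` in all coordinate balls. -/
abbrev TBl (U : PatchAtlas M) (n : ℕ) (u : TField M k) (A : ℝ≥0) : Prop :=
  TBnd U n (n + 1) 0 u A

lemma IsMetric.exists_ell_atlas (hγ : IsMetric ∞ γ) (U : PatchAtlas M) :
    ∃ w Λ : ℝ, 0 < w ∧ ∀ j, ∀ y ∈ U.ball2 j, Ell w Λ (bilinComp γ (U.ctr j) y) := by
  have h := fun j => hγ.exists_ell (isCompact_closedBall (U.mid j) (2 * U.rad j)) (U.ball_subset j)
  choose w Λ hw hell using h
  refine ⟨(1 + ∑ j, (w j)⁻¹)⁻¹, ∑ j, |Λ j|, ?_, fun j y hy => ?_⟩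
  · have : 0 ≤ ∑ j, (w j)⁻¹ := sum_nonneg fun j _ => (inv_pos.2 (hw j)).le
    positivity
  · refine (hell j y (ball_subset_closedBall hy)).mono ?_ ?_
    · have h1 : (w j)⁻¹ ≤ ∑ j, (w j)⁻¹ :=
        single_le_sum (f := fun j => (w j)⁻¹) (fun j _ => (inv_pos.2 (hw j)).le)
          (Finset.mem_univ j)
      rw [inv_le_comm₀ (by linarith [inv_pos.2 (hw j)]) (hw j)]
      linarith
    · exact (le_abs_self _).trans (single_le_sum (f := fun j => |Λ j|)
        (fun j _ => abs_nonneg _) (Finset.mem_univ j))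

lemma contDiffOn_nat_of_infty {f : E3 → ℝ} {U : Set E3} (h : ContDiffOn ℝ ∞ f U) (n : ℕ) :
    ContDiffOn ℝ n f U :=
  h.of_le (by exact_mod_cast (WithTop.coe_le_coe.2 le_top : ((n : ℕ∞) : ℕ∞ω) ≤ (⊤ : ℕ∞)))

lemma nat_le_infty (n : ℕ) : (n : ℕ∞ω) ≤ (∞ : ℕ∞ω) := by
  exact_mod_cast (WithTop.coe_le_coe.2 le_top : ((n : ℕ∞) : ℕ∞ω) ≤ (⊤ : ℕ∞))

/-- A smooth metric is bounded in all `C^n`, on the larger coordinate balls. -/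
lemma IsMetric.exists_bc (hγ : IsMetric ∞ γ) (U : PatchAtlas M) (n : ℕ) : ∃ K : ℝ≥0, ∀ j,
    (∀ i l, Bc (U.ball2 j) n (fun y => bilinComp γ (U.ctr j) y i l) K)
      ∧ ∀ a i l, Bc (U.ball2 j) n (fun y => chrMat e3 (bilinComp γ (U.ctr j)) y a i l) K := by
  have h1 : ∀ x : U.ι × Fin 3 × Fin 3, ∃ K, Bc (U.ball2 x.1) n
      (fun y => bilinComp γ (U.ctr x.1) y x.2.1 x.2.2) K := fun x =>
    EinsteinVlasov.exists_bc (chartAt E3 (U.ctr x.1)).open_target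
      (isCompact_closedBall (U.mid x.1) (2 * U.rad x.1)) (U.ball_subset x.1) isOpen_ball
      ball_subset_closedBall (contDiffOn_nat_of_infty (hγ.smooth _ _ _) n)
  have h2 : ∀ x : U.ι × Fin 3 × Fin 3 × Fin 3, ∃ K, Bc (U.ball2 x.1) n
      (fun y => chrMat e3 (bilinComp γ (U.ctr x.1)) y x.2.1 x.2.2.1 x.2.2.2) K := fun x =>
    EinsteinVlasov.exists_bc (chartAt E3 (U.ctr x.1)).open_target
      (isCompact_closedBall (U.mid x.1) (2 * U.rad x.1)) (U.ball_subset x.1) isOpen_ball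
      ball_subset_closedBall fun y hy =>
        (contDiffAt_chrMat (n := ((n + 1 : ℕ) : ℕ∞ω)) (m := n)
          (fun i j => (hγ.contDiffAt hy i j).of_le (nat_le_infty _)) (hγ.isUnit_det hy)
          (by norm_cast) _ _ _).contDiffWithinAt
  choose K₁ hK₁ using h1
  choose K₂ hK₂ using h2
  obtain ⟨C₁, hC₁⟩ := exists_nnreal_bound K₁
  obtain ⟨C₂, hC₂⟩ := exists_nnreal_bound K₂
  exact ⟨C₁ + C₂, fun j => ⟨fun i l => (hK₁ (j, i, l)).le ((hC₁ _).trans le_self_add),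
    fun a i l => (hK₂ (j, a, i, l)).le ((hC₂ _).trans le_add_self)⟩⟩

variable [CompactSpace M] [MeasurableSpace M]

/-- The Sobolev norm as a non-negative real number. -/
def sobNN (g : BilinField M) (n : ℕ) (u : TField M k) : ℝ≥0 := (sobolevNorm g n u).toNNReal

lemma coe_sobNN (g : BilinField M) (n : ℕ) (u : TField M k) :
    (sobNN g n u : ℝ) = sobolevNorm g n u := coe_toNNReal _ (sqrt_nonneg _)

lemma sqrt_integral_le_sobNN {g : BilinField M} {N : ℕ∞ω} (hg : IsMetric N g) {m : ℕ} (hm : m ≤ n)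
    (u : TField M k) :
    (√(∫ x, normSqAt g (iterCovDeriv g u m) x ∂(riemVol g))).toNNReal ≤ sobNN g n u := by
  refine Real.toNNReal_le_toNNReal (Real.sqrt_le_sqrt ?_)
  exact single_le_sum (f := fun m => ∫ x, normSqAt g (iterCovDeriv g u m) x ∂(riemVol g))
    (fun m _ => integral_nonneg fun x => normSqAt_nonneg hg _ x) (Finset.mem_range.2 (by omega))

lemma bl_zero {B : Set E3} (hB : IsOpen B) {u : E3 → ℝ} (hu : ContinuousOn u B)
    (h : eLpNorm u 2 (volume.restrict B) ≤ A) : Bl B 0 u A := by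
  refine ⟨hB, le_rfl, by omega, contDiffOn_zero.2 hu, fun i hi => ?_, by simp⟩
  obtain rfl : i = 0 := by omega
  rw [eLpNorm_congr_norm_ae (g := u) (.of_forall fun y => norm_iteratedFDeriv_zero)]
  exact h

lemma bl_zero_eLpNorm {B : Set E3} {u : E3 → ℝ} (h : Bl B n u A) :
    eLpNorm u 2 (volume.restrict B) ≤ A := by
  rw [← eLpNorm_congr_norm_ae (f := iteratedFDeriv ℝ 0 u)
    (.of_forall fun y => norm_iteratedFDeriv_zero)]
  exact h.l2 0 (by omega)

variable [BorelSpace M]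

/-- By induction on the order, from the bounds of the covariant derivatives with respect to `γ`. -/
lemma bl_of_sobolevNorm (hγ : IsMetric ∞ γ) (U : PatchAtlas M) (k n : ℕ) : ∃ C : ℝ≥0,
    ∀ u : TField M k, IsTensor u → TSmooth n u →
      ∀ j a, Bl (U.ball2 j) n (fun y => u (U.ctr j) y a) (C * sobNN γ n u) := by
  obtain ⟨w, Λ, hw, hell⟩ := hγ.exists_ell_atlas U
  obtain ⟨K, hK⟩ := hγ.exists_bc U n
  have h0 := fun m : ℕ => eLpNorm_comp_le (M := M) (k + m) w Λ hw
  choose C₀ hC₀ using h0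
  have key : ∀ i : ℕ, ∃ C : ℝ≥0, ∀ u : TField M k, IsTensor u → TSmooth n u → ∀ m, m + i ≤ n →
      ∀ j a, Bl (U.ball2 j) i (fun y => iterCovDeriv γ u m (U.ctr j) y a) (C * sobNN γ n u) := by
    intro i
    induction i with
    | zero =>
      refine ⟨∑ m ∈ Finset.range (n + 1), C₀ m, fun u hu hus m hm j a => ?_⟩
      have hts : TSmooth (0 : ℕ) (iterCovDeriv γ u m) :=
        tsmooth_iterCovDeriv (n := n) (by omega) (hγ.of_le (nat_le_infty _)) hus
      have hten : IsTensor (iterCovDeriv γ u m) :=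
        isTensor_iterCovDeriv (n := n) (by omega) (hγ.of_le (nat_le_infty _)) hu hus
      have h1 := hC₀ m hγ (c := U.ctr j) (B := U.ball2 j) isOpen_ball.measurableSet
        (U.ball2_subset j) (hell j) _ hten (mod_cast hts) a
      refine bl_zero isOpen_ball ((hts _ a).continuousOn.mono (U.ball2_subset j))
        (h1.trans (ENNReal.coe_le_coe.2 ?_))
      gcongr
      · exact single_le_sum (f := C₀) (fun _ _ => zero_le) (Finset.mem_range.2 (by omega))
      · exact sqrt_integral_le_sobNN hγ (by omega) u
    | succ i ih =>
      obtain ⟨C, hC⟩ := ih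
      refine ⟨6 * (C + ((k + n : ℕ) : ℝ≥0) * (3 * (2 ^ i * K * C))), fun u hu hus m hm j a => ?_⟩
      rw [mul_assoc]
      have hCle : C * sobNN γ n u
          ≤ (C + ((k + n : ℕ) : ℝ≥0) * (3 * (2 ^ i * K * C))) * sobNN γ n u := by
        gcongr; exact le_self_add
      have hts : TSmooth ((i + 1 : ℕ)) (iterCovDeriv γ u m) :=
        tsmooth_iterCovDeriv (n := n) (by omega) (hγ.of_le (nat_le_infty _)) hus
      refine Bl.of_covD (G := bilinComp γ (U.ctr j)) (u := iterCovDeriv γ u m (U.ctr j))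
        (fun a => (hC u hu hus m (by omega) j a).le hCle)
        (fun a => by exact_mod_cast (hts (U.ctr j) a).mono (U.ball2_subset j))
        (fun a => (hC u hu hus (m + 1) (by omega) j a).le hCle) (fun c a => ?_) a
      refine (Bnd.act isOpen_ball le_rfl (by omega) (fun i' l a =>
        Bc.mul_bl ((hK j).2 c i' l) (hC u hu hus m (by omega) j a) (by omega)) a).le ?_
      calc ((k + m : ℕ) : ℝ≥0) * (3 * (2 ^ i * K * (C * sobNN γ n u)))
          = ((k + m : ℕ) : ℝ≥0) * (3 * (2 ^ i * K * C)) * sobNN γ n u := by ring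
        _ ≤ _ := by
          gcongr
          refine le_trans ?_ le_add_self
          gcongr
          omega
  obtain ⟨C, hC⟩ := key n
  exact ⟨C, fun u hu hus j a => hC u hu hus 0 (by omega) j a⟩

/-- The Sobolev norm controls the components of a tensor field on the coordinate balls, in `L²` and,
by the Sobolev embedding, pointwise. -/
lemma tbd_of_sobolevNorm (hγ : IsMetric ∞ γ) (U : PatchAtlas M) (k n : ℕ) : ∃ C : ℝ≥0,
    ∀ u : TField M k, IsTensor u → TSmooth n u → TBd U n u (C * sobNN γ n u) := by
  obtain ⟨C, hC⟩ := bl_of_sobolevNorm hγ U k n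
  have h := fun j => Bl.bd_ball (U.rad j) (U.rad_pos j) n
  choose C' hC' using h
  obtain ⟨D, hD⟩ := exists_nnreal_bound C'
  refine ⟨D * C, fun u hu hus j a => ((hC' j _ _ _ (hC u hu hus j a)).le ?_)⟩
  rw [mul_assoc]
  gcongr
  exact hD j

/-- The components on the coordinate balls control the Sobolev norm. -/
lemma sobolevNorm_le_of_tbl (hγ : IsMetric ∞ γ) (U : PatchAtlas M) (k n : ℕ) : ∃ C : ℝ≥0,
    ∀ u : TField M k, IsTensor u → TSmooth n u → ∀ A : ℝ≥0, TBl U n u A →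
      sobolevNorm γ n u ≤ C * A := by
  obtain ⟨w, Λ, hw, hell⟩ := hγ.exists_ell_atlas U
  obtain ⟨K, hK⟩ := hγ.exists_bc U n
  have h0 := fun m : ℕ => sqrt_integral_normSqAt_le U (k + m) w Λ hw
  choose C₀ hC₀ using h0
  have key : ∀ m : ℕ, ∃ C : ℝ≥0, m ≤ n → ∀ u : TField M k, ∀ A, TBl U n u A →
      TBl U (n - m) (iterCovDeriv γ u m) (C * A) := by
    intro m
    induction m with
    | zero => exact ⟨1, fun _ u A hA j a => (hA j a).le (by simp)⟩
    | succ m ih =>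
      obtain ⟨C, hC⟩ := ih
      refine ⟨(1 + ((k + m : ℕ) : ℝ≥0) * (3 * (2 ^ (n - (m + 1)) * K))) * C,
        fun hm u A hA j a => ?_⟩
      have h1 := hC (by omega) u A hA
      have hnm : n - m = n - (m + 1) + 1 := by omega
      rw [hnm] at h1
      rw [mul_assoc]
      refine Bl.covD (G := bilinComp γ (U.ctr j)) (fun a i l => ?_) (fun a => h1 j a)
        (by omega : n - (m + 1) ≤ n) a
      have h2 := (hK j).2 a i l
      refine ⟨isOpen_ball, h2.hp, h2.hq, h2.smooth.mono (U.ball_subset_ball2 j), by simp,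
        fun i hi y hy => h2.sup i hi y (U.ball_subset_ball2 j hy)⟩
  choose C hC using key
  refine ⟨∑ m ∈ Finset.range (n + 1), C₀ m * C m, fun u hu hus A hA => ?_⟩
  have hterm : ∀ m ∈ Finset.range (n + 1),
      √(∫ x, normSqAt γ (iterCovDeriv γ u m) x ∂(riemVol γ)) ≤ (C₀ m * C m : ℝ≥0) * A := by
    intro m hm
    rw [Finset.mem_range] at hm
    have hts : TSmooth (0 : ℕ) (iterCovDeriv γ u m) :=
      tsmooth_iterCovDeriv (n := n) (by omega) (hγ.of_le (nat_le_infty _)) hus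
    have hten : IsTensor (iterCovDeriv γ u m) :=
      isTensor_iterCovDeriv (n := n) (by omega) (hγ.of_le (nat_le_infty _)) hu hus
    have h1 := hC₀ m hγ (fun j y hy => hell j y (U.ball_subset_ball2 j hy)) _ hten
      (mod_cast hts) (C m * A) fun j a => bl_zero_eLpNorm (hC m (by omega) u A hA j a)
    refine h1.trans (le_of_eq ?_)
    push_cast; ring
  rw [sobolevNorm]
  refine Real.sqrt_le_iff.2 ⟨by positivity, ?_⟩
  calc ∑ m ∈ Finset.range (n + 1), ∫ x, normSqAt γ (iterCovDeriv γ u m) x ∂(riemVol γ)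
      = ∑ m ∈ Finset.range (n + 1),
        √(∫ x, normSqAt γ (iterCovDeriv γ u m) x ∂(riemVol γ)) ^ 2 :=
        sum_congr rfl fun m _ => (sq_sqrt
          (integral_nonneg fun x => normSqAt_nonneg hγ _ x)).symm
    _ ≤ (∑ m ∈ Finset.range (n + 1),
        √(∫ x, normSqAt γ (iterCovDeriv γ u m) x ∂(riemVol γ))) ^ 2 :=
        Finset.sum_sq_le_sq_sum_of_nonneg fun m _ => sqrt_nonneg _
    _ ≤ _ := by
        refine pow_le_pow_left₀ (sum_nonneg fun m _ => sqrt_nonneg _) ?_ 2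
        rw [NNReal.coe_sum, sum_mul]
        exact sum_le_sum hterm

end GlobalNorms

/-! ### Metrics close to a fixed metric -/

section MetricBounds

variable {s : ℕ} {B : Set E3} {A : ℝ≥0} {G : E3 → Mat3}

lemma Bd.det (hs : 3 ≤ s) (hG : ∀ i j, Bd B s (fun y => G y i j) A) :
    Bd B s (fun y => (G y).det) (6 * (2 ^ s * (2 ^ s * A * A) * A)) := by
  have h3 : ∀ i j i' j' i'' j'', Bd B s (fun y => G y i j * G y i' j' * G y i'' j'')
      (2 ^ s * (2 ^ s * A * A) * A) := fun i j i' j' i'' j'' =>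
    Bd.mul (Bd.mul (hG i j) (hG i' j') le_rfl le_rfl (by omega)) (hG i'' j'') le_rfl le_rfl
      (by omega)
  refine Bnd.congr (Bnd.le (((((h3 0 0 1 1 2 2).sub (h3 0 0 1 2 2 1)).sub (h3 0 1 1 0 2 2)).add
    (h3 0 1 1 2 2 0)).add (h3 0 2 1 0 2 1) |>.sub (h3 0 2 1 1 2 0)) (le_of_eq (by ring)))
    fun y _ => ?_
  rw [det_fin_three]

lemma Bd.adjugate (hs : 3 ≤ s) (hG : ∀ i j, Bd B s (fun y => G y i j) A) (i j : Fin 3) :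
    Bd B s (fun y => (G y).adjugate i j) (2 ^ s * A * A + 2 ^ s * A * A) := by
  have h2 : ∀ i j i' j', Bd B s (fun y => G y i j * G y i' j') (2 ^ s * A * A) :=
    fun i j i' j' => Bd.mul (hG i j) (hG i' j') le_rfl le_rfl (by omega)
  simp only [adjugate_fin_three]
  fin_cases i <;> fin_cases j <;>
    first
    | exact (h2 _ _ _ _).sub (h2 _ _ _ _)
    | (simp [← sub_eq_neg_add]; exact (h2 _ _ _ _).sub (h2 _ _ _ _))

/-- The inverse metric has the same regularity as the metric. -/
lemma Bd.matrix_inv (hs : 6 ≤ s) (A V : ℝ≥0) (w Λ : ℝ) (hw : 0 < w) : ∃ C : ℝ≥0,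
    ∀ (B : Set E3) (G : E3 → Mat3), eLpNorm (fun _ : E3 => (1 : ℝ)) 2 (volume.restrict B) ≤ V →
      (∀ i j, Bd B s (fun y => G y i j) A) → (∀ y ∈ B, Ell w Λ (G y)) →
      ∀ i j, Bd B s (fun y => (G y)⁻¹ i j) C := by
  obtain ⟨d, hd, hde⟩ := ell_det w Λ hw
  obtain ⟨C, hC⟩ := Bd.inv hs (6 * (2 ^ s * (2 ^ s * A * A) * A)) d V hd
  refine ⟨2 ^ s * C * (2 ^ s * A * A + 2 ^ s * A * A), fun B G hV hG hell i j => ?_⟩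
  have h1 := hC B _ hV (Bd.det (by omega) hG) fun y hy => (hde _ (hell y hy)).1
  refine Bnd.congr (Bd.mul h1 (Bd.adjugate (by omega) hG i j) le_rfl le_rfl (by omega)) fun y _ => ?_
  simp [Matrix.inv_def, Ring.inverse_eq_inv']

lemma Bd.chrMat {C : ℝ≥0} (hs : 3 ≤ s) (hG : ∀ i j, Bd B (s + 1) (fun y => G y i j) A)
    (hI : ∀ i j, Bd B (s + 1) (fun y => (G y)⁻¹ i j) C) (a i j : Fin 3) :
    Bd B s (fun y => chrMat e3 G y a i j) (3 * (2 ^ s * C * (3 * A))) := by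
  have h1 : ∀ σ, Bd B s (fun y => (G y)⁻¹ i σ * (pderiv e3 a (fun w => G w σ j) y
      + pderiv e3 j (fun w => G w σ a) y - pderiv e3 σ (fun w => G w a j) y))
      (2 ^ s * C * (3 * A)) := fun σ => by
    refine Bd.mul (hI i σ) (Bnd.le (((hG σ j).pderiv a).add ((hG σ a).pderiv j) |>.sub
      ((hG a j).pderiv σ)) (le_of_eq (by ring))) (by omega) le_rfl (by omega)
  have h2 := (Bnd.sum_card (h1 0).isOpen le_rfl (by omega) h1).const_mul (1 / 2)
  refine Bnd.le h2 ?_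
  have : ‖(1 / 2 : ℝ)‖₊ ≤ 1 := by
    rw [← NNReal.coe_le_coe, coe_nnnorm]; norm_num
  calc _ ≤ 1 * (Fintype.card (Fin 3) * (2 ^ s * C * (3 * A))) := by gcongr
    _ = _ := by simp

variable {γ g : BilinField M}

/-- The bounds on a Riemannian metric that follow from its closeness to a fixed one: uniform
ellipticity, and bounds on the metric, its inverse and its connection. -/
structure MetricBd (U : PatchAtlas M) (s : ℕ) (w Λ : ℝ) (A : ℝ≥0) (g : BilinField M) : Prop where
  ell : ∀ j, ∀ y ∈ U.ball j, Ell w Λ (bilinComp g (U.ctr j) y)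
  inv : ∀ j i l, Bd (U.ball j) s (fun y => (bilinComp g (U.ctr j) y)⁻¹ i l) A
  chr : ∀ j a i l, Bd (U.ball j) (s - 1) (fun y => chrMat e3 (bilinComp g (U.ctr j)) y a i l) A

lemma bilinComp_sub (g γ : BilinField M) (c : M) (y : E3) (i j : Fin 3) :
    bilinComp (fun x => g x - γ x) c y i j = bilinComp g c y i j - bilinComp γ c y i j := by
  simp [bilinComp]

/-- Uniform ellipticity is stable under small perturbations. -/
lemma Ell.perturb {w Λ ε : ℝ} {G G' : Mat3} (h : Ell w Λ G) (hs : ∀ i j, G' i j = G' j i)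
    (hε : ∀ i j, |G' i j - G i j| ≤ ε) : Ell (w - 3 * ε) (Λ + ε) G' := by
  refine ⟨hs, fun i j => ?_, fun v => ?_⟩
  · have := abs_add_le (G i j) (G' i j - G i j)
    rw [add_sub_cancel] at this
    linarith [h.bound i j, hε i j]
  · have h1 := h.pos v
    have h2 : |∑ i, ∑ j, v i * v j * (G' i j - G i j)| ≤ 3 * ε * ∑ i, v i ^ 2 := by
      calc _ ≤ ∑ i, ∑ j, (v i ^ 2 + v j ^ 2) / 2 * ε := by
            refine (abs_sum_le_sum_abs _ _).trans (sum_le_sum fun i _ =>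
              (abs_sum_le_sum_abs _ _).trans (sum_le_sum fun j _ => ?_))
            rw [abs_mul]
            refine mul_le_mul ?_ (hε i j) (abs_nonneg _) (by positivity)
            rw [abs_mul]
            nlinarith [sq_nonneg (|v i| - |v j|), sq_abs (v i), sq_abs (v j)]
        _ = _ := by simp only [sum_univ_three]; ring
    have h3 : ∑ i, ∑ j, v i * v j * G' i j = ∑ i, ∑ j, v i * v j * G i j
        + ∑ i, ∑ j, v i * v j * (G' i j - G i j) := by
      simp only [sum_univ_three]; ring
    rw [h3]
    have h4 := (abs_le.1 h2).1
    linarith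

variable [CompactSpace M] [MeasurableSpace M] [BorelSpace M]

/-- A metric that is close to `γ` in `H⁶`, and bounded in `H^{l-1}`, satisfies the bounds
`MetricBd`. -/
lemma exists_metricBd (hγ : IsMetric ∞ γ) (U : PatchAtlas M) :
    ∃ δ w Λ : ℝ, 0 < δ ∧ 0 < w ∧ ∀ l : ℕ, 4 ≤ l → ∀ K : ℝ, ∃ (s : ℕ) (A : ℝ≥0), 6 ≤ s ∧ l - 1 ≤ s ∧
      ∀ (n : ℕ) (g : BilinField M), l + 2 ≤ n → IsMetric n g →
        sobolevNorm γ 6 (ofBilin fun x => g x - γ x) < δ →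
        (8 ≤ l → sobolevNorm γ (l - 1) (ofBilin fun x => g x - γ x) ≤ K) →
        MetricBd U s w Λ A g := by
  obtain ⟨w, Λ, hw, hell⟩ := hγ.exists_ell_atlas U
  obtain ⟨C₆, hC₆⟩ := tbd_of_sobolevNorm hγ U 2 6
  -- for this `δ`, the components of the metric differ from those of `γ` by at most `w / 6`
  have hδ : 0 < w / (6 * (C₆ + 1)) := by positivity
  refine ⟨w / (6 * (C₆ + 1)), w / 2, Λ + w, hδ, by positivity, fun l hl K => ?_⟩
  -- for `l ≤ 7`, the closeness in `H⁶` suffices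
  obtain ⟨s, hs6, hsl, hsle, hs⟩ : ∃ s : ℕ, 6 ≤ s ∧ l - 1 ≤ s ∧ s ≤ l + 2 ∧
      (s = 6 ∨ (8 ≤ l ∧ s = l - 1)) := by
    by_cases h8 : 8 ≤ l
    · exact ⟨l - 1, by omega, le_rfl, by omega, Or.inr ⟨h8, rfl⟩⟩
    · exact ⟨6, le_rfl, by omega, by omega, Or.inl rfl⟩
  obtain ⟨C, hC⟩ := tbd_of_sobolevNorm hγ U 2 s
  obtain ⟨Kγ, hKγ⟩ := hγ.exists_bc U s
  obtain ⟨V, hV⟩ : ∃ V : ℝ≥0, ∀ j,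
      eLpNorm (fun _ : E3 => (1 : ℝ)) 2 (volume.restrict (U.ball j)) ≤ V := by
    obtain ⟨V, hV⟩ := exists_nnreal_bound fun j =>
      (eLpNorm (fun _ : E3 => (1 : ℝ)) 2 (volume.restrict (U.ball j))).toNNReal
    refine ⟨V, fun j => ?_⟩
    have : IsFiniteMeasure (volume.restrict (U.ball j)) :=
      ⟨by rw [Measure.restrict_apply_univ]; exact measure_ball_lt_top⟩
    exact (ENNReal.coe_toNNReal (memLp_const (1 : ℝ)).2.ne).ge.trans (ENNReal.coe_le_coe.2 (hV j))
  set D : ℝ≥0 := (1 + V) * Kγ + C * ((w / (6 * (C₆ + 1))).toNNReal + K.toNNReal) with hD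
  obtain ⟨Ci, hCi⟩ := Bd.matrix_inv hs6 D V (w / 2) (Λ + w) (by positivity)
  refine ⟨s, Ci + 3 * (2 ^ (s - 1) * Ci * (3 * D)), hs6, hsl, fun n g hn hg h6 hK => ?_⟩
  have hten := isTensor_ofBilin fun x => g x - γ x
  have hts : TSmooth n (ofBilin fun x => g x - γ x) := fun c a =>
    ((hg.smooth c (a 0) (a 1)).sub (contDiffOn_nat_of_infty (hγ.smooth c (a 0) (a 1)) n)).congr
      fun y _ => bilinComp_sub g γ c y _ _
  have hb6 := hC₆ _ hten (hts.of_le (mod_cast (by omega : 6 ≤ n)))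
  have hell' : ∀ j, ∀ y ∈ U.ball j, Ell (w / 2) (Λ + w) (bilinComp g (U.ctr j) y) := by
    intro j y hy
    have h1 : ∀ i l, |bilinComp g (U.ctr j) y i l - bilinComp γ (U.ctr j) y i l| ≤ w / 6 := by
      intro i l
      have h2 := Bc.abs_le (Bd.bc (a := 4) (hb6 j ![i, l])) hy
      rw [NNReal.coe_mul, coe_sobNN] at h2
      rw [← bilinComp_sub]
      refine h2.trans ?_
      calc (C₆ : ℝ) * _ ≤ (C₆ + 1) * (w / (6 * (C₆ + 1))) := by
            gcongr
            · exact sqrt_nonneg _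
            · linarith
        _ = w / 6 := by field_simp
    exact ((hell j y (U.ball_subset_ball2 j hy)).perturb (hg.bilinComp_symm _ y) h1).mono
      (by linarith) (by linarith)
  have hbs : TBd U s (ofBilin fun x => g x - γ x)
      (C * ((w / (6 * (C₆ + 1))).toNNReal + K.toNNReal)) := by
    intro j a
    refine Bnd.le (hC _ hten (hts.of_le (mod_cast (by omega : s ≤ n))) j a) ?_
    gcongr
    rcases hs with rfl | ⟨h8, rfl⟩
    · exact (Real.toNNReal_le_toNNReal h6.le).trans le_self_add
    · exact (Real.toNNReal_le_toNNReal (hK h8)).trans le_add_self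
  have hgb : ∀ j i l, Bd (U.ball j) s (fun y => bilinComp g (U.ctr j) y i l) D := by
    intro j i l
    have h1 : Bc (U.ball j) s (fun y => bilinComp γ (U.ctr j) y i l) Kγ := by
      have h2 := (hKγ j).1 i l
      exact ⟨isOpen_ball, h2.hp, h2.hq, h2.smooth.mono (U.ball_subset_ball2 j), by simp,
        fun i hi y hy => h2.sup i hi y (U.ball_subset_ball2 j hy)⟩
    exact Bnd.congr ((h1.bd (hV j)).add (hbs j ![i, l])) fun y _ =>
      eq_add_of_sub_eq' (bilinComp_sub g γ _ y i l).symm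
  have hinv : ∀ j i l, Bd (U.ball j) s (fun y => (bilinComp g (U.ctr j) y)⁻¹ i l) Ci := fun j =>
    hCi _ _ (hV j) (hgb j) (hell' j)
  refine ⟨hell', fun j i l => (hinv j i l).le le_self_add, fun j a i l => ?_⟩
  obtain ⟨s', rfl⟩ : ∃ s', s = s' + 1 := ⟨s - 1, by omega⟩
  exact (Bd.chrMat (by omega) (hgb j) (hinv j) a i l).le le_add_self

end MetricBounds

/-! ### Norms of the dynamical metric -/

section DynamicNorms

variable {γ g : BilinField M} {U : PatchAtlas M} {s l : ℕ} {w Λ : ℝ} {K : ℝ≥0}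

/-- Covariant derivatives of functions with respect to the dynamical metric. -/
lemma MetricBd.tbd_iterCovDeriv (U : PatchAtlas M) (s l : ℕ) (hs : 6 ≤ s) (hl : l - 1 ≤ s)
    (w Λ : ℝ) (K : ℝ≥0) (m : ℕ) : ∃ C : ℝ≥0, m ≤ l → ∀ g : BilinField M, MetricBd U s w Λ K g →
      ∀ (u : TField M 0) (A : ℝ≥0), TBd U l u A → TBd U (l - m) (iterCovDeriv g u m) (C * A) := by
  induction m with
  | zero => exact ⟨1, fun _ g _ u A hA j a => (hA j a).le (by simp)⟩
  | succ m ih =>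
    obtain ⟨C, hC⟩ := ih
    refine ⟨(1 + ((0 + m : ℕ) : ℝ≥0) * (3 * (2 ^ (l - (m + 1)) * K))) * C, fun hm g hg u A hA j a => ?_⟩
    have h1 := hC (by omega) g hg u A hA
    have hnm : l - m = l - (m + 1) + 1 := by omega
    rw [hnm] at h1
    rw [mul_assoc]
    exact Bd.covD (G := bilinComp g (U.ctr j)) (hg.chr j) (fun a => h1 j a) (by omega) (by omega) a

/-- The recursion `R_{m+1} = ∇R_m - Q·∇ᵐu` for the commutator of `∇ᵐ` with a derivation, in a
coordinate ball. -/
lemma exists_commutator_bound (s l : ℕ) (hs : 6 ≤ s) (hls : l - 1 ≤ s) (hl : 4 ≤ l) (K : ℝ≥0)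
    (m : ℕ) : ∃ C : ℝ≥0, m ≤ l → ∀ (B : Set E3) (G : E3 → Mat3)
      (v R : ∀ m : ℕ, E3 → (Fin (0 + m) → Fin 3) → ℝ) (Q : E3 → Fin 3 → Mat3) (D A : ℝ≥0), IsOpen B →
      (∀ a i j, Bd B (s - 1) (fun y => chrMat e3 G y a i j) K) →
      (∀ a i j, Bd B (l - 2) (fun y => Q y a i j) D) →
      (∀ m ≤ l, ∀ a, Bd B (l - m) (fun y => v m y a) A) → (∀ y ∈ B, ∀ a, R 0 y a = 0) →
      (∀ m < l, ∀ y ∈ B, ∀ a : Fin (0 + m + 1) → Fin 3, R (m + 1) y a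
        = covD e3 G (R m) y a - act (Q y (a 0)) (v m y) (tail a)) →
      ∀ a, Bd B (l - m) (fun y => R m y a) (C * (D * A)) := by
  induction m with
  | zero =>
    refine ⟨1, fun _ B G v R Q D A hB _ _ _ h0 _ a => ?_⟩
    exact Bnd.congr ((Bnd.zero hB le_rfl (by omega)).le zero_le) fun y hy => h0 y hy a
  | succ m ih =>
    obtain ⟨C, hC⟩ := ih
    refine ⟨(1 + ((0 + m : ℕ) : ℝ≥0) * (3 * (2 ^ (l - (m + 1)) * K))) * C
      + ((0 + m : ℕ) : ℝ≥0) * (3 * 2 ^ (l - (m + 1))), fun hm B G v R Q D A hB hΓ hQ hv h0 hR a => ?_⟩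
    have h1 := hC (by omega) B G v R Q D A hB hΓ hQ hv h0 hR
    have hnm : l - m = l - (m + 1) + 1 := by omega
    rw [hnm] at h1
    have h2 := Bd.covD (G := G) hΓ h1 (by omega) (by omega) a
    have h3 : Bd B (l - (m + 1)) (fun y => act (Q y (a 0)) (v m y) (tail a))
        (((0 + m : ℕ) : ℝ≥0) * (3 * (2 ^ (l - (m + 1)) * D * A))) := by
      -- for `m = 0`, one derivative of `Q` too few is known, but `Q` acts trivially on functions
      rcases Nat.eq_zero_or_pos m with rfl | hm0
      · refine Bnd.congr ((Bnd.zero hB le_rfl (by omega)).le zero_le) fun y _ => ?_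
        simp [act]
      · exact Bnd.act hB le_rfl (by omega) (fun i j b => Bd.mul (hQ (a 0) i j) (hv m (by omega) b)
          (by omega) (by omega) (by omega)) _
    refine Bnd.congr ((h2.sub h3).le (le_of_eq (by ring))) fun y hy => hR m (by omega) y hy a

variable [CompactSpace M] [MeasurableSpace M] [BorelSpace M]

lemma sobNN_le_of_tbl (hγ : IsMetric ∞ γ) (U : PatchAtlas M) (k n : ℕ) : ∃ C : ℝ≥0,
    ∀ u : TField M k, IsTensor u → TSmooth n u → ∀ A : ℝ≥0, TBl U n u A → sobNN γ n u ≤ C * A := by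
  obtain ⟨C, hC⟩ := sobolevNorm_le_of_tbl hγ U k n
  refine ⟨C, fun u hu hus A hA => ?_⟩
  rw [← NNReal.coe_le_coe, coe_sobNN, NNReal.coe_mul]
  exact hC u hu hus A hA

/-- The energy with respect to the dynamical metric controls the Sobolev norm of a function. -/
lemma sobNN_le_sobNN (hγ : IsMetric ∞ γ) (U : PatchAtlas M) (s l : ℕ) (hs : 6 ≤ s)
    (hl : l - 1 ≤ s) (w Λ : ℝ) (hw : 0 < w) (K : ℝ≥0) : ∃ C : ℝ≥0, ∀ g : BilinField M,
      IsMetric l g → MetricBd U s w Λ K g → ∀ u : TField M 0, IsTensor u → TSmooth l u →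
        sobNN γ l u ≤ C * sobNN g l u := by
  have h0 := fun m : ℕ => eLpNorm_comp_le (M := M) (0 + m) w Λ hw
  choose C₀ hC₀ using h0
  have key : ∀ n : ℕ, ∃ C : ℝ≥0, ∀ g : BilinField M, IsMetric l g → MetricBd U s w Λ K g →
      ∀ u : TField M 0, IsTensor u → TSmooth l u → ∀ m, m + n ≤ l →
        sobNN γ n (iterCovDeriv g u m) ≤ C * sobNN g l u := by
    intro n
    induction n with
    | zero =>
      have h1 := fun m : ℕ => sobNN_le_of_tbl hγ U (0 + m) 0
      choose C₁ hC₁ using h1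
      refine ⟨∑ m ∈ Finset.range (l + 1), C₁ m * C₀ m, fun g hg hgb u hu hus m hm => ?_⟩
      have hten := isTensor_iterCovDeriv (m := m) (by omega) hg hu hus
      have hts := tsmooth_iterCovDeriv (p := 0) (m := m) (by omega) hg hus
      refine (hC₁ m _ hten hts (C₀ m * sobNN g l u) fun j a => ?_).trans ?_
      · have h2 := hC₀ m hg (c := U.ctr j) (B := U.ball j) isOpen_ball.measurableSet
          (U.ball_subset_target j) (hgb.ell j) _ hten (mod_cast hts) a
        refine bl_zero isOpen_ball ((hts _ a).continuousOn.mono (U.ball_subset_target j))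
          (h2.trans (ENNReal.coe_le_coe.2 ?_))
        gcongr
        exact sqrt_integral_le_sobNN hg (by omega) u
      · rw [← mul_assoc]
        gcongr
        exact single_le_sum (f := fun m => C₁ m * C₀ m) (fun _ _ => zero_le)
          (Finset.mem_range.2 (by omega))
    | succ n ih =>
      obtain ⟨C, hC⟩ := ih
      have h1 := fun m : ℕ => sobNN_le_of_tbl hγ U (0 + m) (n + 1)
      choose C₁ hC₁ using h1
      have h2 := fun m : ℕ => tbd_of_sobolevNorm hγ U (0 + m) n
      choose C₂ hC₂ using h2
      set E : ℕ → ℝ≥0 := fun m => C₁ m * (6 * (C₂ m * C + C₂ (m + 1) * C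
        + ((0 + m : ℕ) : ℝ≥0) * (3 * (2 ^ n * K * (C₂ m * C))))) with hE
      refine ⟨∑ m ∈ Finset.range (l + 1), E m, fun g hg hgb u hu hus m hm => ?_⟩
      have hts := tsmooth_iterCovDeriv (p := n + 1) (m := m) (by omega) hg hus
      have b : ∀ m, m + n ≤ l → TBd U n (iterCovDeriv g u m) (C₂ m * C * sobNN g l u) :=
        fun m hm j a => Bnd.le (hC₂ m _ (isTensor_iterCovDeriv (by omega) hg hu hus)
          (tsmooth_iterCovDeriv (by omega) hg hus) j a)
          (by rw [mul_assoc]; gcongr; exact hC g hg hgb u hu hus m hm)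
      have b0 := b m (by omega)
      set X : ℝ≥0 := C₂ m * C * sobNN g l u + C₂ (m + 1) * C * sobNN g l u
        + ((0 + m : ℕ) : ℝ≥0) * (3 * (2 ^ n * K * (C₂ m * C * sobNN g l u))) with hX
      refine (hC₁ m _ (isTensor_iterCovDeriv (by omega) hg hu hus) hts (6 * X) fun j a => ?_).trans ?_
      · refine Bl.of_covD (G := bilinComp g (U.ctr j)) (u := iterCovDeriv g u m (U.ctr j))
          (fun a => (Bd.bl (b0 j a)).le (le_self_add.trans le_self_add))
          (fun a => by exact_mod_cast (hts (U.ctr j) a).mono (U.ball_subset_target j))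
          (fun a => (Bd.bl (b (m + 1) (by omega) j a)).le (le_add_self.trans le_self_add)) (fun c a => ?_) a
        rcases Nat.eq_zero_or_pos m with rfl | hm0
        · refine Bnd.congr ((Bnd.zero isOpen_ball le_rfl (by omega)).le zero_le)
            fun y _ => ?_
          simp [act]
        · exact Bnd.le (Bd.bl (Bnd.act isOpen_ball le_rfl (by omega) (fun i j' b =>
            Bd.mul (hgb.chr j c i j') (b0 j b) (by omega) le_rfl (by omega)) a)) le_add_self
      · calc C₁ m * (6 * X) = E m * sobNN g l u := by rw [hX, hE]; ring
          _ ≤ _ := by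
            gcongr
            exact single_le_sum (f := E) (fun _ _ => zero_le)
              (Finset.mem_range.2 (by omega))
  obtain ⟨C, hC⟩ := key l
  exact ⟨C, fun g hg hgb u hu hus => hC g hg hgb u hu hus 0 (by omega)⟩

end DynamicNorms

/-! ### Integrals depending on parameters -/

section Param

variable {V F : Type} [NormedAddCommGroup V] [NormedSpace ℝ V] [FiniteDimensional ℝ V]
  [NormedAddCommGroup F] [NormedSpace ℝ F]

/-- The function `h` on `U × ℝ³` vanishes for large `p`, locally uniformly in the parameter. -/
def FibreSupp (U : Set V) (h : V × E3 → F) : Prop :=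
  ∀ z₀ ∈ U, ∃ R : ℝ, ∀ᶠ z in 𝓝 z₀, ∀ p : E3, R < ‖p‖ → h (z, p) = 0

omit [FiniteDimensional ℝ V] [NormedSpace ℝ V] [NormedSpace ℝ F] in
lemma FibreSupp.mono_zero {U : Set V} {F' : Type} [NormedAddCommGroup F']
    {h : V × E3 → F} {h' : V × E3 → F'} (H : FibreSupp U h)
    (hz : ∀ z ∈ U, ∀ p, h (z, p) = 0 → h' (z, p) = 0) (hU : IsOpen U) : FibreSupp U h' := by
  intro z₀ hz₀
  obtain ⟨R, hR⟩ := H z₀ hz₀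
  refine ⟨R, ?_⟩
  filter_upwards [hR, hU.mem_nhds hz₀] with z h1 h2 p hp using hz z h2 p (h1 p hp)

omit [FiniteDimensional ℝ V] [NormedSpace ℝ V] [NormedSpace ℝ F] in
lemma FibreSupp.integrable {U : Set V} {h : V × E3 → F} (H : FibreSupp U h)
    (hc : ContinuousOn h (U ×ˢ univ)) {z : V} (hz : z ∈ U) :
    Integrable (fun p => h (z, p)) ∧ HasCompactSupport (fun p => h (z, p)) := by
  obtain ⟨R, hR⟩ := H z hz
  have hR := hR.self_of_nhds
  have hcont : Continuous fun p => h (z, p) := by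
    rw [← continuousOn_univ]
    exact hc.comp (by fun_prop) fun p _ => ⟨hz, mem_univ _⟩
  have hcs : HasCompactSupport fun p => h (z, p) := by
    refine HasCompactSupport.intro (isCompact_closedBall (0 : E3) R) fun p hp => hR p ?_
    simpa using hp
  exact ⟨hcont.integrable_of_hasCompactSupport hcs, hcs⟩

/-- The partial derivative of `h` with respect to the parameter. -/
def pfderiv (h : V × E3 → F) (x : V × E3) : V →L[ℝ] F :=
  (fderiv ℝ h x).comp (inl ℝ V E3)

omit [FiniteDimensional ℝ V] in
lemma hasFDerivAt_slice {h : V × E3 → F} {z : V} {p : E3} (hd : DifferentiableAt ℝ h (z, p)) :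
    HasFDerivAt (fun z => h (z, p)) (pfderiv h (z, p)) z := by
  have h2 : HasFDerivAt (fun z : V => (z, p)) (inl ℝ V E3) z := hasFDerivAt_prodMk_left z p
  exact hd.hasFDerivAt.comp z h2

omit [FiniteDimensional ℝ V] in
lemma FibreSupp.pfderiv {U : Set V} (hU : IsOpen U) {h : V × E3 → F} (H : FibreSupp U h)
    (hd : DifferentiableOn ℝ h (U ×ˢ univ)) : FibreSupp U (pfderiv h) := by
  intro z₀ hz₀
  obtain ⟨R, hR⟩ := H z₀ hz₀
  refine ⟨R, ?_⟩
  filter_upwards [hR.eventually_nhds, hU.mem_nhds hz₀] with z h1 h2 p hp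
  have hd' : DifferentiableAt ℝ h (z, p) :=
    hd.differentiableAt ((hU.prod isOpen_univ).mem_nhds ⟨h2, mem_univ _⟩)
  have := hasFDerivAt_slice hd'
  refine this.unique ?_
  refine (hasFDerivAt_const (0 : F) z).congr_of_eventuallyEq ?_
  filter_upwards [h1] with z' hz' using hz' p hp

/-- Differentiation under the integral: near a parameter, the integrand has a fixed compact support.
-/
lemma hasFDerivAt_integral_param {U : Set V} (hU : IsOpen U) {h : V × E3 → F}
    (H : FibreSupp U h) (hc : ContDiffOn ℝ 1 h (U ×ˢ univ)) {z₀ : V} (hz₀ : z₀ ∈ U) :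
    HasFDerivAt (fun z => ∫ p, h (z, p)) (∫ p, EinsteinVlasov.pfderiv h (z₀, p)) z₀ := by
  have hO : IsOpen (U ×ˢ (univ : Set E3)) := hU.prod isOpen_univ
  have hd : DifferentiableOn ℝ h (U ×ˢ univ) := hc.differentiableOn (by norm_num)
  have hcf : ContinuousOn (EinsteinVlasov.pfderiv h) (U ×ˢ univ) := by
    have h1 : ContinuousOn (fderiv ℝ h) (U ×ˢ univ) := hc.continuousOn_fderiv_of_isOpen hO le_rfl
    exact h1.clm_comp continuousOn_const
  have Hf := H.pfderiv hU hd
  obtain ⟨R, hR⟩ := Hf z₀ hz₀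
  obtain ⟨ε, hε, hball⟩ := nhds_basis_closedBall.mem_iff.1 (Filter.inter_mem hR (hU.mem_nhds hz₀))
  obtain ⟨B, hB⟩ := ((isCompact_closedBall z₀ ε).prod
    (isCompact_closedBall (0 : E3) R)).exists_bound_of_continuousOn
      (hcf.mono (prod_mono (fun z hz => (hball hz).2) (subset_univ _)))
  refine hasFDerivAt_integral_of_dominated_of_fderiv_le (s := ball z₀ ε)
    (bound := (closedBall (0 : E3) R).indicator fun _ => B)
    (F' := fun z p => EinsteinVlasov.pfderiv h (z, p)) (Metric.ball_mem_nhds _ hε) ?_ ?_ ?_ ?_ ?_ ?_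
  · filter_upwards [hU.mem_nhds hz₀] with z hz
    exact (H.integrable hc.continuousOn hz).1.aestronglyMeasurable
  · exact (H.integrable hc.continuousOn hz₀).1
  · exact (Hf.integrable hcf hz₀).1.aestronglyMeasurable
  · refine .of_forall fun p z hz => ?_
    have hz' := ball_subset_closedBall hz
    by_cases hp : p ∈ closedBall (0 : E3) R
    · rw [indicator_of_mem hp]
      exact hB (z, p) ⟨hz', hp⟩
    · rw [indicator_of_notMem hp, (hball hz').1 p (by simpa using hp)]
      simp
  · exact (integrable_indicator_iff measurableSet_closedBall).2
      (integrableOn_const (measure_closedBall_lt_top.ne))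
  · refine .of_forall fun p z hz => ?_
    exact hasFDerivAt_slice (hd.differentiableAt
      (hO.mem_nhds ⟨(hball (ball_subset_closedBall hz)).2, mem_univ _⟩))

end Param

lemma contDiffOn_integral_param {V : Type} [NormedAddCommGroup V] [NormedSpace ℝ V]
    [FiniteDimensional ℝ V] {U : Set V} (hU : IsOpen U) (n : ℕ) :
    ∀ {F : Type} [NormedAddCommGroup F] [NormedSpace ℝ F] {h : V × E3 → F}
      (_ : FibreSupp U h) (_ : ContDiffOn ℝ n h (U ×ˢ univ)),
      ContDiffOn ℝ n (fun z => ∫ p, h (z, p)) U := by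
  induction n with
  | zero =>
    intro F _ _ h H hc
    rw [Nat.cast_zero, contDiffOn_zero] at *
    intro z₀ hz₀
    obtain ⟨R, hR⟩ := H z₀ hz₀
    obtain ⟨ε, hε, hball⟩ := nhds_basis_closedBall.mem_iff.1 (Filter.inter_mem hR (hU.mem_nhds hz₀))
    obtain ⟨B, hB⟩ := ((isCompact_closedBall z₀ ε).prod
      (isCompact_closedBall (0 : E3) R)).exists_bound_of_continuousOn
        (hc.mono (prod_mono (fun z hz => (hball hz).2) (subset_univ _)))
    refine ContinuousAt.continuousWithinAt ?_
    refine continuousAt_of_dominated (bound := (closedBall (0 : E3) R).indicator fun _ => B)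
      ?_ ?_ ?_ ?_
    · filter_upwards [hU.mem_nhds hz₀] with z hz
      exact (H.integrable hc hz).1.aestronglyMeasurable
    · filter_upwards [Metric.closedBall_mem_nhds z₀ hε] with z hz
      refine .of_forall fun p => ?_
      by_cases hp : p ∈ closedBall (0 : E3) R
      · rw [indicator_of_mem hp]
        exact hB (z, p) ⟨hz, hp⟩
      · rw [indicator_of_notMem hp, (hball hz).1 p (by simpa using hp)]
        simp
    · exact (integrable_indicator_iff measurableSet_closedBall).2
        (integrableOn_const (measure_closedBall_lt_top.ne))
    · refine .of_forall fun p => ?_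
      have h1 : ContinuousAt h (z₀, p) :=
        hc.continuousAt ((hU.prod isOpen_univ).mem_nhds ⟨hz₀, mem_univ _⟩)
      exact h1.comp (f := fun z : V => (z, p)) (by fun_prop)
  | succ n ih =>
    intro F _ _ h H hc
    have hO : IsOpen (U ×ˢ (univ : Set E3)) := hU.prod isOpen_univ
    have hc1 : ContDiffOn ℝ 1 h (U ×ˢ univ) := hc.of_le (by norm_cast; omega)
    have hd : DifferentiableOn ℝ h (U ×ˢ univ) := hc1.differentiableOn (by norm_num)
    rw [show ((n + 1 : ℕ) : ℕ∞ω) = (n : ℕ∞ω) + 1 by norm_cast,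
      contDiffOn_succ_iff_fderiv_of_isOpen hU]
    refine ⟨fun z hz => (hasFDerivAt_integral_param hU H hc1 hz).differentiableAt.differentiableWithinAt,
      by simp, ?_⟩
    have h2 : ContDiffOn ℝ n (pfderiv h) (U ×ˢ univ) := by
      have h1 : ContDiffOn ℝ n (fderiv ℝ h) (U ×ˢ univ) := hc.fderiv_of_isOpen hO (by norm_cast)
      exact h1.clm_comp contDiffOn_const
    refine (ih (H.pfderiv hU hd) h2).congr fun z hz => ?_
    exact (hasFDerivAt_integral_param hU H hc1 hz).fderiv

lemma integral_fderiv_eq_zero {φ : E3 → ℝ} (hφ : ContDiff ℝ 1 φ) (hs : HasCompactSupport φ)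
    (v : E3) : ∫ p, fderiv ℝ φ p v = 0 := by
  obtain ⟨R, hR⟩ := hs.isCompact.isBounded.subset_closedBall (0 : E3)
  have hcont : Continuous fun p => fderiv ℝ φ p v := by
    have := hφ.continuous_fderiv (by norm_num)
    fun_prop
  -- the translates of `φ` all have the same integral
  have hconst : ∀ t : ℝ, ∫ p, φ (t • v + p) = ∫ p, φ p := fun t => integral_add_left_eq_self φ _
  have hcd : ContDiff ℝ 1 (fun x : ℝ × E3 => φ (x.1 • v + x.2)) :=
    hφ.comp ((contDiff_fst.smul contDiff_const).add contDiff_snd)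
  have H : FibreSupp (univ : Set ℝ) (fun x : ℝ × E3 => φ (x.1 • v + x.2)) := by
    intro t _
    refine ⟨R + (|t| + 1) * ‖v‖, ?_⟩
    filter_upwards [Metric.ball_mem_nhds t one_pos] with t' ht' p hp
    by_contra hne
    have h1 : t' • v + p ∈ closedBall (0 : E3) R :=
      hR (subset_tsupport _ (Function.mem_support.2 hne))
    rw [mem_closedBall_zero_iff] at h1
    have h2 : |t'| ≤ |t| + 1 := by
      rw [Metric.mem_ball, Real.dist_eq] at ht'
      have := abs_sub_abs_le_abs_sub t' t
      linarith
    have h3 : ‖p‖ ≤ ‖t' • v + p‖ + ‖t' • v‖ := by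
      have := norm_sub_le (t' • v + p) (t' • v)
      simpa using this
    rw [norm_smul, Real.norm_eq_abs] at h3
    have h4 := mul_le_mul_of_nonneg_right h2 (norm_nonneg v)
    linarith
  have h1 := hasFDerivAt_integral_param isOpen_univ H hcd.contDiffOn (mem_univ (0 : ℝ))
  have h2 : (∫ p, pfderiv (fun x : ℝ × E3 => φ (x.1 • v + x.2)) ((0 : ℝ), p)) = 0 := by
    refine h1.unique ?_
    simp only [hconst]
    exact hasFDerivAt_const _ _
  have hint : Integrable fun p : E3 => pfderiv (fun x : ℝ × E3 => φ (x.1 • v + x.2)) ((0 : ℝ), p) :=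
    ((H.pfderiv isOpen_univ (hcd.differentiable (by norm_num)).differentiableOn).integrable
      (((hcd.continuous_fderiv (by norm_num)).clm_comp continuous_const).continuousOn)
      (mem_univ _)).1
  have h3 := ContinuousLinearMap.integral_apply hint (1 : ℝ)
  rw [h2] at h3
  rw [show (0 : ℝ →L[ℝ] ℝ) 1 = 0 from rfl] at h3
  rw [h3]
  refine integral_congr_ae (.of_forall fun p => ?_)
  have hd : HasFDerivAt (fun t : ℝ => φ (t • v + p))
      ((fderiv ℝ φ p).comp ((1 : ℝ →L[ℝ] ℝ).smulRight v)) 0 := by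
    have ha : HasFDerivAt (fun t : ℝ => t • v + p) ((1 : ℝ →L[ℝ] ℝ).smulRight v) 0 :=
      (((1 : ℝ →L[ℝ] ℝ).smulRight v).hasFDerivAt (x := (0 : ℝ))).add_const p
    have hb : HasFDerivAt φ (fderiv ℝ φ p) ((0 : ℝ) • v + p) := by
      rw [zero_smul, zero_add]
      exact (hφ.differentiable (by norm_num)).differentiableAt.hasFDerivAt
    exact hb.comp (0 : ℝ) ha
  have hs : HasFDerivAt (fun t : ℝ => φ (t • v + p))
      (pfderiv (fun x : ℝ × E3 => φ (x.1 • v + x.2)) ((0 : ℝ), p)) 0 :=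
    hasFDerivAt_slice (h := fun x : ℝ × E3 => φ (x.1 • v + x.2))
      (hcd.differentiable (by norm_num)).differentiableAt
  simp only [hs.unique hd]
  simp

/-! ### The mass shell in canonical momenta -/

section MassShell

/-- The bilinear form on `ℝ³` with matrix `G`. -/
def gq (G : Mat3) (v w : E3) : ℝ := ∑ i, ∑ j, v i * w j * G i j

/-- The matrix `A` as a linear map of `ℝ³`. -/
def mv (A : Mat3) : E3 →L[ℝ] E3 :=
  ((Matrix.toLin (EuclideanSpace.basisFun (Fin 3) ℝ).toBasis
    (EuclideanSpace.basisFun (Fin 3) ℝ).toBasis A) : E3 →ₗ[ℝ] E3).toContinuousLinearMap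

/-- The pairing of a covector and a vector. -/
def pair (q v : E3) : ℝ := ∑ i, q i * v i

lemma mv_apply (A : Mat3) (v : E3) (i : Fin 3) : mv A v i = ∑ j, A i j * v j := by
  show (Matrix.toLin _ _ A v : E3) i = _
  rw [Matrix.toLin_apply]
  simp [mulVec, dotProduct, Pi.single_apply]

lemma mv_mul (A B : Mat3) (v : E3) : mv (A * B) v = mv A (mv B v) := by
  ext i
  simp only [mv_apply, mul_apply, sum_univ_three]
  ring

lemma mv_one (v : E3) : mv 1 v = v := by
  ext i
  simp [mv_apply, Matrix.one_apply]

lemma mv_det (A : Mat3) : (mv A).det = A.det := by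
  rw [det_fderiv_eq]
  congr 1
  ext i a
  simp [mv_apply, e3]

lemma gq_eq_pair (G : Mat3) (v w : E3) : gq G v w = pair v (mv G w) := by
  simp only [gq, pair, mv_apply, sum_univ_three]; ring

lemma gq_add_left (G : Mat3) (u v w : E3) : gq G (u + v) w = gq G u w + gq G v w := by
  simp only [gq, PiLp.add_apply, sum_univ_three]; ring

lemma gq_smul_left (G : Mat3) (r : ℝ) (v w : E3) : gq G (r • v) w = r * gq G v w := by
  simp only [gq, PiLp.smul_apply, smul_eq_mul, sum_univ_three]; ring

lemma gq_comm {G : Mat3} (hG : ∀ i j, G i j = G j i) (v w : E3) : gq G v w = gq G w v := by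
  simp only [gq, sum_univ_three]; rw [hG 1 0, hG 2 0, hG 2 1]; ring

lemma pair_comm (v w : E3) : pair v w = pair w v :=
  sum_congr rfl fun _ _ => mul_comm _ _

lemma gq_pos {G : Mat3} (hG : G.PosDef) {v : E3} (hv : v ≠ 0) : 0 < gq G v v := by
  have h := hG.dotProduct_mulVec_pos (x := v.ofLp) (by
    intro h; exact hv (by ext i; exact congrFun h i))
  refine h.trans_eq ?_
  simp only [star_trivial, dotProduct, mulVec, gq, sum_univ_three]; ring

lemma gq_nonneg {G : Mat3} (hG : G.PosDef) (v : E3) : 0 ≤ gq G v v := by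
  by_cases hv : v = 0
  · simp [hv, gq]
  · exact (gq_pos hG hv).le

lemma posDef_symm {G : Mat3} (hG : G.PosDef) (i j : Fin 3) : G i j = G j i := by
  simpa using hG.isHermitian.apply j i

lemma gq_comb {G : Mat3} (hG : ∀ i j, G i j = G j i) (r : ℝ) (v w : E3) :
    gq G (v + r • w) (v + r • w) = gq G v v + 2 * r * gq G v w + r ^ 2 * gq G w w := by
  have hs := gq_comm hG
  rw [gq_add_left, gq_smul_left, hs v (v + _), hs w (v + _), gq_add_left, gq_add_left,
    gq_smul_left, gq_smul_left, hs w v]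
  ring

lemma gq_cauchy {G : Mat3} (hG : G.PosDef) (v w : E3) : gq G v w ^ 2 ≤ gq G v v * gq G w w := by
  by_cases hw : w = 0
  · simp [hw, gq]
  have h0 := gq_pos hG hw
  have h1 := gq_nonneg hG (gq G w w • v + (-gq G v w) • w)
  have hs := gq_comm (posDef_symm hG)
  rw [gq_comb (posDef_symm hG), gq_smul_left, gq_smul_left, hs v (_ • v), gq_smul_left] at h1
  have h2 : 0 ≤ gq G w w * (gq G v v * gq G w w - gq G v w ^ 2) := by
    refine h1.trans_eq (by ring)
  have := nonneg_of_mul_nonneg_right h2 h0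
  linarith

variable (τ N : ℝ) (G : Mat3) (X : E3)

/-- The energy `(1 + τ² |π|²)^{1/2}` of a particle with canonical momentum `π`. -/
def energy (q : E3) : ℝ := √(1 + τ ^ 2 * gq G⁻¹ q q)

/-- The rescaled momentum that belongs to the canonical momentum `π`. -/
def psi (q : E3) : E3 := mv G⁻¹ q - (τ⁻¹ * (energy τ G q / N)) • X

/-- `p̂` in coordinates. -/
def phat (p : E3) : ℝ :=
  √(τ ^ 2 * (gq G X p / N) ^ 2 + (1 - gq G X X / N ^ 2) * (1 + τ ^ 2 * gq G p p))

/-- `p⁰` in coordinates. -/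
def pzero (p : E3) : ℝ :=
  N⁻¹ * (1 - gq G X X / N ^ 2)⁻¹ * (τ * (gq G X p / N) + phat τ N G X p)

/-- The canonical momentum that belongs to the rescaled momentum `p`. -/
def psiInv (p : E3) : E3 := mv G (p + (τ⁻¹ * pzero τ N G X p) • X)

variable {τ N G X}

lemma mv_inv_mv (hG : G.PosDef) (v : E3) : mv G⁻¹ (mv G v) = v := by
  rw [← mv_mul, nonsing_inv_mul G hG.det_pos.ne'.isUnit, mv_one]

lemma mv_mv_inv (hG : G.PosDef) (v : E3) : mv G (mv G⁻¹ v) = v := by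
  rw [← mv_mul, mul_nonsing_inv G hG.det_pos.ne'.isUnit, mv_one]

lemma gq_mv_inv (hG : G.PosDef) (q v : E3) : gq G v (mv G⁻¹ q) = pair q v := by
  rw [gq_eq_pair, mv_mv_inv hG, pair_comm]

lemma gq_inv (hG : G.PosDef) (q r : E3) : gq G⁻¹ q r = gq G (mv G⁻¹ q) (mv G⁻¹ r) := by
  rw [gq_comm (posDef_symm hG), gq_mv_inv hG, gq_eq_pair]

lemma energy_pos (hG : G.PosDef) (q : E3) : 0 < energy τ G q :=
  sqrt_pos.2 (by have := gq_nonneg hG.inv q; positivity)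

lemma energy_sq (hG : G.PosDef) (q : E3) : energy τ G q ^ 2 = 1 + τ ^ 2 * gq G⁻¹ q q :=
  sq_sqrt (by have := gq_nonneg hG.inv q; positivity)

lemma energy_sub_pos (hG : G.PosDef) (hN : 0 < N) (hX : gq G X X < N ^ 2) (q : E3) :
    0 < energy τ G q - τ * (pair q X / N) := by
  have hE := energy_pos (τ := τ) hG q
  have hsq := energy_sq (τ := τ) hG q
  have hc := gq_cauchy hG X (mv G⁻¹ q)
  rw [gq_mv_inv hG, ← gq_inv hG] at hc
  have h0 := gq_nonneg hG.inv q
  have hc2 : pair q X ^ 2 ≤ N ^ 2 * gq G⁻¹ q q := hc.trans (by gcongr)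
  have h2 : (τ * (pair q X / N)) ^ 2 < energy τ G q ^ 2 := by
    rw [hsq, mul_pow, div_pow]
    have : pair q X ^ 2 / N ^ 2 ≤ gq G⁻¹ q q := by
      rw [div_le_iff₀ (by positivity)]; linarith
    nlinarith [sq_nonneg τ]
  have : |τ * (pair q X / N)| < energy τ G q := abs_lt_of_sq_lt_sq h2 hE.le
  linarith [(abs_lt.1 this).2]

lemma one_sub_gq_pos (hN : 0 < N) (hX : gq G X X < N ^ 2) : 0 < 1 - gq G X X / N ^ 2 := by
  rwa [sub_pos, div_lt_one (by positivity)]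

lemma gq_psi (hG : G.PosDef) (q : E3) :
    gq G X (psi τ N G X q) = pair q X - τ⁻¹ * (energy τ G q / N) * gq G X X := by
  have hs := gq_comm (posDef_symm hG)
  rw [psi, sub_eq_add_neg, ← neg_smul, hs, gq_add_left, gq_smul_left, hs, gq_mv_inv hG]; ring

/-- In canonical momenta, the expression under the root of `p̂` is a square. -/
lemma phat_psi (hG : G.PosDef) (hN : 0 < N) (hτ : τ ≠ 0) (hX : gq G X X < N ^ 2) (q : E3) :
    phat τ N G X (psi τ N G X q) = energy τ G q - τ * (pair q X / N) := by
  have hE := energy_sq (τ := τ) hG q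
  rw [phat, Real.sqrt_eq_iff_mul_self_eq_of_pos (energy_sub_pos hG hN hX q)]
  have hs := gq_comm (posDef_symm hG)
  have h2 : gq G (psi τ N G X q) (psi τ N G X q) = gq G⁻¹ q q
      - 2 * (τ⁻¹ * (energy τ G q / N)) * pair q X
      + (τ⁻¹ * (energy τ G q / N)) ^ 2 * gq G X X := by
    rw [psi, sub_eq_add_neg, ← neg_smul, gq_comb (posDef_symm hG), ← gq_inv hG, hs _ X, gq_mv_inv hG]
    ring
  rw [gq_psi hG, h2]
  have h3 : gq G⁻¹ q q = (energy τ G q ^ 2 - 1) / τ ^ 2 := by rw [hE]; field_simp; ring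
  rw [h3]
  field_simp
  ring

lemma pzero_psi (hG : G.PosDef) (hN : 0 < N) (hτ : τ ≠ 0) (hX : gq G X X < N ^ 2) (q : E3) :
    pzero τ N G X (psi τ N G X q) = energy τ G q / N := by
  have hX' : N ^ 2 - gq G X X ≠ 0 := by linarith
  rw [pzero, phat_psi hG hN hτ hX, gq_psi hG, one_sub_div (by positivity)]
  field_simp
  ring

lemma psi_add (q : E3) : psi τ N G X q + (τ⁻¹ * (energy τ G q / N)) • X = mv G⁻¹ q := by
  rw [psi, sub_add_cancel]

lemma psiInv_psi (hG : G.PosDef) (hN : 0 < N) (hτ : τ ≠ 0) (hX : gq G X X < N ^ 2) (q : E3) :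
    psiInv τ N G X (psi τ N G X q) = q := by
  rw [psiInv, pzero_psi hG hN hτ hX, psi_add, mv_mv_inv hG]

lemma phat_arg_pos (hG : G.PosDef) (hN : 0 < N) (hX : gq G X X < N ^ 2) (p : E3) :
    0 < τ ^ 2 * (gq G X p / N) ^ 2 + (1 - gq G X X / N ^ 2) * (1 + τ ^ 2 * gq G p p) := by
  have h0 := gq_nonneg hG p
  have h1 := one_sub_gq_pos hN hX
  positivity

lemma psi_psiInv (hG : G.PosDef) (hN : 0 < N) (hτ : τ ≠ 0) (hX : gq G X X < N ^ 2) (p : E3) :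
    psi τ N G X (psiInv τ N G X p) = p := by
  have hs := gq_comm (posDef_symm hG)
  have hD : 0 < N ^ 2 - gq G X X := by linarith
  have hpp := phat_arg_pos (τ := τ) hG hN hX p
  have hph : 0 < phat τ N G X p := sqrt_pos.2 hpp
  have hph2 : phat τ N G X p ^ 2 = _ := sq_sqrt hpp.le
  have hXp := gq_cauchy hG X p
  have h1 := one_sub_gq_pos hN hX
  have hpos : 0 < τ * (gq G X p / N) + phat τ N G X p := by
    have h0 := gq_nonneg hG p
    have h2 : (τ * (gq G X p / N)) ^ 2 < phat τ N G X p ^ 2 := by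
      rw [hph2, mul_pow]
      have : 0 < (1 - gq G X X / N ^ 2) * (1 + τ ^ 2 * gq G p p) := by positivity
      linarith
    have : |τ * (gq G X p / N)| < phat τ N G X p := abs_lt_of_sq_lt_sq h2 hph.le
    linarith [(abs_lt.1 this).1]
  have hpz : 0 < pzero τ N G X p := by unfold pzero; positivity
  have hE : energy τ G (psiInv τ N G X p) = N * pzero τ N G X p := by
    rw [energy, Real.sqrt_eq_iff_mul_self_eq_of_pos (by positivity), gq_inv hG, psiInv,
      mv_inv_mv hG, gq_comb (posDef_symm hG), hs p X]
    have hz : phat τ N G X p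
        = N * (1 - gq G X X / N ^ 2) * pzero τ N G X p - τ * (gq G X p / N) := by
      rw [pzero, one_sub_div (by positivity)]; field_simp; ring
    rw [hz, one_sub_div (by positivity)] at hph2
    generalize pzero τ N G X p = e at *
    generalize gq G X X = b at *
    generalize gq G X p = a at *
    generalize gq G p p = c at *
    field_simp at hph2
    have hmain : (N ^ 2 - b) * (N * e * (N * e))
        = (N ^ 2 - b) * (1 + τ ^ 2 * c + 2 * τ * e * a + e ^ 2 * b) := by
      linear_combination hph2
    rw [mul_left_cancel₀ hD.ne' hmain]
    field_simp
    ring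
  rw [psi, hE, mul_div_cancel_left₀ _ hN.ne', psiInv, mv_inv_mv hG, add_sub_cancel_right]

lemma hasFDerivAt_gq_inv (hG : G.PosDef) (q : E3) :
    HasFDerivAt (fun q => gq G⁻¹ q q) ((2 : ℝ) • ∑ i, (mv G⁻¹ q i) • coordL i) q := by
  have h : HasFDerivAt (fun q : E3 => gq G⁻¹ q q)
      (∑ i, ∑ j, ((q i * q j) • (0 : E3 →L[ℝ] ℝ)
        + G⁻¹ i j • (q i • coordL j + q j • coordL i))) q := by
    unfold gq
    refine HasFDerivAt.fun_sum fun i _ => HasFDerivAt.fun_sum fun j _ => ?_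
    exact (((coordL i).hasFDerivAt (x := q)).fun_mul ((coordL j).hasFDerivAt (x := q))).fun_mul
      (hasFDerivAt_const _ _)
  convert! h using 1
  ext v
  have hc : ∀ i, coordL i v = v i := fun _ => rfl
  simp only [smul_apply, add_apply, smul_eq_mul, mv_apply, hc, sum_univ_three, zero_apply]
  have hs := posDef_symm hG.inv
  rw [hs 1 0, hs 2 0, hs 2 1]
  ring

lemma hasFDerivAt_energy (hG : G.PosDef) (q : E3) :
    HasFDerivAt (energy τ G) ((τ ^ 2 / energy τ G q) • ∑ i, (mv G⁻¹ q i) • coordL i) q := by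
  have h0 : (1 + τ ^ 2 * gq G⁻¹ q q) ≠ 0 := by have := gq_nonneg hG.inv q; positivity
  have h := (((hasFDerivAt_gq_inv hG q).const_mul (τ ^ 2)).const_add 1).sqrt h0
  convert! h using 1
  rw [smul_smul, smul_smul]
  congr 1
  rw [energy]
  field_simp

lemma hasFDerivAt_psi (hG : G.PosDef) (q : E3) :
    HasFDerivAt (psi τ N G X) (mv G⁻¹ - ((τ⁻¹ * N⁻¹) • ((τ ^ 2 / energy τ G q) •
      ∑ i, (mv G⁻¹ q i) • coordL i)).smulRight X) q := by
  have h1 := ((hasFDerivAt_energy (τ := τ) hG q).const_mul (τ⁻¹ * N⁻¹)).smul_const X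
  refine ((mv G⁻¹).hasFDerivAt.sub h1).congr_of_eventuallyEq (.of_forall fun r => ?_)
  simp only [psi, Pi.sub_apply]
  congr 2
  ring

/-- The determinant of the derivative of `psi`, a rank-one perturbation of the inverse metric. -/
lemma det_psi (hG : G.PosDef) (q : E3) : (mv G⁻¹ - ((τ⁻¹ * N⁻¹) • ((τ ^ 2 / energy τ G q) •
      ∑ i, (mv G⁻¹ q i) • coordL i)).smulRight X).det
      = G.det⁻¹ * ((energy τ G q - τ * (pair q X / N)) / energy τ G q) := by
  set f : E3 →L[ℝ] ℝ := (-(τ⁻¹ * N⁻¹)) • ((τ ^ 2 / energy τ G q) • ∑ i, (mv G⁻¹ q i) • coordL i)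
    with hf
  have h1 : ((mv G⁻¹ - ((τ⁻¹ * N⁻¹) • ((τ ^ 2 / energy τ G q) •
      ∑ i, (mv G⁻¹ q i) • coordL i)).smulRight X : E3 →L[ℝ] E3) : E3 →ₗ[ℝ] E3)
      = (mv G⁻¹ : E3 →ₗ[ℝ] E3) ∘ₗ LinearMap.transvection (f : E3 →ₗ[ℝ] ℝ) (mv G X) := by
    ext v : 1
    rw [LinearMap.comp_apply, LinearMap.transvection.apply, map_add, map_smul]
    simp only [ContinuousLinearMap.coe_coe, sub_apply, smulRight_apply,
      mv_inv_mv hG, hf, smul_apply, smul_eq_mul, neg_mul, neg_smul]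
    rw [sub_eq_add_neg]
  have h2 : (mv G⁻¹ : E3 →ₗ[ℝ] E3).det = G.det⁻¹ := by
    have := mv_det G⁻¹
    rw [Matrix.det_nonsing_inv, Ring.inverse_eq_inv'] at this
    exact this
  have h3 : f (mv G X) = -(τ⁻¹ * N⁻¹) * ((τ ^ 2 / energy τ G q) * pair q X) := by
    have : (∑ i, (mv G⁻¹ q i) • coordL i) (mv G X) = pair q X := by
      have h4 : (∑ i, (mv G⁻¹ q i) • coordL i) (mv G X) = pair (mv G⁻¹ q) (mv G X) := by
        simp [pair, coordL, sum_apply]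
      rw [h4, ← gq_eq_pair, gq_comm (posDef_symm hG), gq_mv_inv hG]
    rw [hf, smul_apply, smul_apply, this, smul_eq_mul, smul_eq_mul]
  rw [ContinuousLinearMap.det, h1, LinearMap.det_comp, h2, LinearMap.transvection.det]
  congr 1
  show 1 + f (mv G X) = _
  rw [h3]
  have := (energy_pos (τ := τ) hG q).ne'
  field_simp
  ring

/-- The change of variables from rescaled to canonical momenta. -/
lemma integral_psi (hG : G.PosDef) (hN : 0 < N) (hτ : τ ≠ 0) (hX : gq G X X < N ^ 2) (φ : E3 → ℝ) :
    ∫ p, φ p / phat τ N G X p * √G.det = ∫ q, φ (psi τ N G X q) / (energy τ G q * √G.det) := by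
  have hinj : Function.Injective (psi τ N G X) := fun q q' h => by
    rw [← psiInv_psi hG hN hτ hX q, h, psiInv_psi hG hN hτ hX]
  have himg : psi τ N G X '' univ = univ :=
    image_univ_of_surjective fun p => ⟨_, psi_psiInv hG hN hτ hX p⟩
  have h := integral_image_eq_integral_abs_det_fderiv_smul volume MeasurableSet.univ
    (fun q _ => (hasFDerivAt_psi (τ := τ) (N := N) (X := X) hG q).hasFDerivWithinAt) hinj.injOn
    (fun p => φ p / phat τ N G X p * √G.det)
  rw [himg, Measure.restrict_univ] at h
  rw [h]
  refine integral_congr_ae (.of_forall fun q => ?_)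
  have h1 := energy_sub_pos (τ := τ) hG hN hX q
  have h2 := energy_pos (τ := τ) hG q
  have h3 := hG.det_pos
  have h4 : √G.det ^ 2 = G.det := sq_sqrt h3.le
  have h5 : 0 < √G.det := sqrt_pos.2 h3
  simp only
  rw [det_psi hG, phat_psi hG hN hτ hX, abs_of_pos (by positivity), smul_eq_mul]
  generalize energy τ G q - τ * (pair q X / N) = e at *
  field_simp
  rw [h4, mul_comm]

end MassShell

/-! ### The matter quantities in canonical momenta -/

section Smooth

variable {W : Type*} [NormedAddCommGroup W] [NormedSpace ℝ W] {n : ℕ∞ω} {x : W}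

lemma contDiffAt_gq {A : W → Mat3} {v w : W → E3} (hA : ∀ i j, ContDiffAt ℝ n (fun x => A x i j) x)
    (hv : ContDiffAt ℝ n v x) (hw : ContDiffAt ℝ n w x) :
    ContDiffAt ℝ n (fun x => gq (A x) (v x) (w x)) x := by
  have hv' := contDiffAt_euclidean.1 hv
  have hw' := contDiffAt_euclidean.1 hw
  unfold gq
  exact ContDiffAt.sum fun i _ => ContDiffAt.sum fun j _ => ((hv' i).mul (hw' j)).mul (hA i j)

lemma contDiffAt_mv {A : W → Mat3} {v : W → E3} (hA : ∀ i j, ContDiffAt ℝ n (fun x => A x i j) x)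
    (hv : ContDiffAt ℝ n v x) : ContDiffAt ℝ n (fun x => mv (A x) (v x)) x := by
  have hv' := contDiffAt_euclidean.1 hv
  refine contDiffAt_euclidean.2 fun i => ?_
  simp only [mv_apply]
  exact ContDiffAt.sum fun j _ => (hA i j).mul (hv' j)

lemma contDiffAt_energy {τ : W → ℝ} {G : W → Mat3} {q : W → E3} (hτ : ContDiffAt ℝ n τ x)
    (hG : ∀ i j, ContDiffAt ℝ n (fun x => G x i j) x) (hp : (G x).PosDef)
    (hq : ContDiffAt ℝ n q x) : ContDiffAt ℝ n (fun x => energy (τ x) (G x) (q x)) x := by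
  unfold energy
  refine (contDiffAt_const.add ((hτ.pow 2).mul (contDiffAt_gq
    (contDiffAt_inv hG hp.det_pos.ne'.isUnit) hq hq))).sqrt ?_
  have := gq_nonneg hp.inv (q x)
  positivity

lemma contDiffAt_psi {τ N : W → ℝ} {G : W → Mat3} {X q : W → E3} (hτ : ContDiffAt ℝ n τ x)
    (hτ0 : τ x ≠ 0) (hN : ContDiffAt ℝ n N x) (hN0 : N x ≠ 0)
    (hG : ∀ i j, ContDiffAt ℝ n (fun x => G x i j) x) (hp : (G x).PosDef)
    (hX : ContDiffAt ℝ n X x) (hq : ContDiffAt ℝ n q x) :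
    ContDiffAt ℝ n (fun x => psi (τ x) (N x) (G x) (X x) (q x)) x := by
  unfold psi
  exact (contDiffAt_mv (contDiffAt_inv hG hp.det_pos.ne'.isUnit) hq).sub
    (((hτ.inv hτ0).mul ((contDiffAt_energy hτ hG hp hq).div hN hN0)).smul hX)

lemma contDiffAt_psiInv {τ N : W → ℝ} {G : W → Mat3} {X p : W → E3} (hτ : ContDiffAt ℝ n τ x)
    (hτ0 : τ x ≠ 0) (hN : ContDiffAt ℝ n N x) (hN0 : 0 < N x)
    (hG : ∀ i j, ContDiffAt ℝ n (fun x => G x i j) x) (hp : (G x).PosDef)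
    (hX : ContDiffAt ℝ n X x) (hX0 : gq (G x) (X x) (X x) < N x ^ 2) (hq : ContDiffAt ℝ n p x) :
    ContDiffAt ℝ n (fun x => psiInv (τ x) (N x) (G x) (X x) (p x)) x := by
  have h1 : ContDiffAt ℝ n (fun x => 1 - gq (G x) (X x) (X x) / N x ^ 2) x :=
    contDiffAt_const.sub ((contDiffAt_gq hG hX hX).div (hN.pow 2) (by positivity))
  have h2 : ContDiffAt ℝ n (fun x => gq (G x) (X x) (p x) / N x) x :=
    (contDiffAt_gq hG hX hq).div hN hN0.ne'
  have h3 : ContDiffAt ℝ n (fun x => phat (τ x) (N x) (G x) (X x) (p x)) x := by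
    unfold phat
    exact (((hτ.pow 2).mul (h2.pow 2)).add (h1.mul (contDiffAt_const.add ((hτ.pow 2).mul
      (contDiffAt_gq hG hq hq))))).sqrt (phat_arg_pos hp hN0 hX0 _).ne'
  have h4 : 1 - gq (G x) (X x) (X x) / N x ^ 2 ≠ 0 := by
    have : gq (G x) (X x) (X x) / N x ^ 2 < 1 := by rw [div_lt_one (by positivity)]; exact hX0
    linarith
  have h5 : ContDiffAt ℝ n (fun x => pzero (τ x) (N x) (G x) (X x) (p x)) x := by
    unfold pzero
    exact ((hN.inv hN0.ne').mul (h1.inv h4)).mul ((hτ.mul h2).add h3)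
  unfold psiInv
  exact contDiffAt_mv hG (hq.add (((hτ.inv hτ0).mul h5).smul hX))

end Smooth

lemma contDiff_meanCurv (τ0 : ℝ) {n : ℕ∞ω} : ContDiff ℝ n (meanCurv τ0) := by
  unfold meanCurv; fun_prop

lemma meanCurv_ne {τ0 : ℝ} (h : τ0 < 0) (T : ℝ) : meanCurv τ0 T ≠ 0 :=
  mul_ne_zero h.ne (Real.exp_pos _).ne'

lemma hasDerivAt_meanCurv (τ0 T : ℝ) : HasDerivAt (meanCurv τ0) (-meanCurv τ0 T) T := by
  have := ((Real.hasDerivAt_exp (-T)).comp T (hasDerivAt_neg T)).const_mul τ0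
  convert! this using 1
  simp [meanCurv]

variable {S : RescaledVars M} {τ0 : ℝ} {n : ℕ} {I : Set ℝ} {T : ℝ} {c c' : M} {y : E3}

variable (S c) in
/-- The metric in the coordinates `(T, y)`. -/
def metC (z : ℝ × E3) : Mat3 := bilinComp (S.g z.1) c z.2

variable (S c) in
/-- The lapse function in the coordinates `(T, y)`. -/
def lapC (z : ℝ × E3) : ℝ := S.lapse z.1 (chartPt c z.2)

variable (S c) in
/-- The shift vector in the coordinates `(T, y)`. -/
def shiC (z : ℝ × E3) : E3 := vecComp (S.shift z.1) c z.2

variable (S τ0 c) in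
/-- The energy in the coordinates `(T, y)` and canonical momenta. -/
def engC (x : Phase) : ℝ := energy (meanCurv τ0 x.1.1) (metC S c x.1) x.2

variable (S τ0 c) in
/-- The rescaled momentum as a function of `(T, y)` and the canonical momentum. -/
def psiC (x : Phase) : E3 :=
  psi (meanCurv τ0 x.1.1) (lapC S c x.1) (metC S c x.1) (shiC S c x.1) x.2

variable (S τ0 c) in
/-- The distribution function in the coordinates `(T, y)` and canonical momenta. -/
def disC (x : Phase) : ℝ :=
  S.f x.1.1 ⟨chartPt c x.1.2, chartVec c x.1.2 (psiC S τ0 c x)⟩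

variable (S c) in
/-- The vector dual to the canonical momentum. -/
def velC (x : Phase) : E3 := mv (metC S c x.1)⁻¹ x.2

variable (I c) in
/-- The domain of the coordinates `(T, y)`. -/
def domC : Set (ℝ × E3) := I ×ˢ (chartAt E3 c).target

omit [IsManifold 𝓘(ℝ, E3) ∞ M] in
lemma isOpen_domC (hI : IsOpen I) (c : M) : IsOpen (domC I c) :=
  hI.prod (chartAt E3 c).open_target

omit [IsManifold 𝓘(ℝ, E3) ∞ M] in
lemma domC_mem_nhds (hI : IsOpen I) {z : ℝ × E3} (hz : z ∈ domC I c) : domC I c ∈ 𝓝 z :=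
  (isOpen_domC hI c).mem_nhds hz

variable (h : S.IsVlasovSolution τ0 n I) (hI : IsOpen I) {z : ℝ × E3} (hz : z ∈ domC I c)

lemma isMetric_slice (h : S.IsVlasovSolution τ0 n I) (hT : T ∈ I) : IsMetric (n : ℕ∞ω) (S.g T) where
  symm := h.g_symm T hT
  pos := h.g_pos T hT
  smooth c i j := (h.g_smooth c i j).comp (f := fun y => (T, y)) (by fun_prop)
    fun y hy => ⟨hT, hy⟩

section Local

include h hz

lemma metC_posDef : (metC S c z).PosDef := (isMetric_slice h hz.1).posDef hz.2

lemma lapC_pos : 0 < lapC S c z := h.lapse_pos _ hz.1 _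

omit h hz in
lemma gq_vec_eq (B : BilinField M) (v w : E3) :
    B (chartPt c z.2) (chartVec c z.2 v) (chartVec c z.2 w) = gq (bilinComp B c z.2) v w :=
  bilin_chartVec _ _ _ _ _

omit h in
lemma gq_shift_eq (p : E3) :
    S.g z.1 (chartPt c z.2) (S.shift z.1 (chartPt c z.2)) (chartVec c z.2 p)
      = gq (metC S c z) (shiC S c z) p := by
  rw [← chartVec_vecComp hz.2 (S.shift z.1), gq_vec_eq]; rfl

omit h in
lemma gq_shift_shift_eq :
    S.g z.1 (chartPt c z.2) (S.shift z.1 (chartPt c z.2)) (S.shift z.1 (chartPt c z.2))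
      = gq (metC S c z) (shiC S c z) (shiC S c z) := by
  rw [← chartVec_vecComp hz.2 (S.shift z.1), gq_vec_eq]; rfl

lemma shiC_lt : gq (metC S c z) (shiC S c z) (shiC S c z) < lapC S c z ^ 2 := by
  rw [← gq_shift_shift_eq hz]; exact h.shift_lt _ hz.1 _

omit h in
lemma pHat_chartVec (p : E3) : S.pHat τ0 z.1 (chartPt c z.2) (chartVec c z.2 p)
    = phat (meanCurv τ0 z.1) (lapC S c z) (metC S c z) (shiC S c z) p := by
  rw [RescaledVars.pHat, gq_shift_eq hz, gq_shift_shift_eq hz, gq_vec_eq]; rfl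

omit h in
lemma p0_chartVec (p : E3) : S.p0 τ0 z.1 (chartPt c z.2) (chartVec c z.2 p)
    = pzero (meanCurv τ0 z.1) (lapC S c z) (metC S c z) (shiC S c z) p := by
  rw [RescaledVars.p0, pHat_chartVec hz, gq_shift_eq hz, gq_shift_shift_eq hz]; rfl

omit h in
lemma pProj_chartVec (p : E3) : S.pProj τ0 z.1 (chartPt c z.2) (chartVec c z.2 p)
    = chartVec c z.2 (p + ((meanCurv τ0 z.1)⁻¹
      * pzero (meanCurv τ0 z.1) (lapC S c z) (metC S c z) (shiC S c z) p) • shiC S c z) := by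
  rw [RescaledVars.pProj, p0_chartVec hz, chartVec_add, chartVec_smul]
  congr 2
  exact (chartVec_vecComp hz.2 (S.shift z.1)).symm

lemma p0_psiC (hτ : τ0 < 0) (q : E3) :
    S.p0 τ0 z.1 (chartPt c z.2) (chartVec c z.2 (psiC S τ0 c (z, q)))
      = engC S τ0 c (z, q) / lapC S c z := by
  rw [p0_chartVec hz]
  exact pzero_psi (metC_posDef h hz) (lapC_pos h hz) (meanCurv_ne hτ _) (shiC_lt h hz) q

lemma pProj_psiC (hτ : τ0 < 0) (q : E3) :
    S.pProj τ0 z.1 (chartPt c z.2) (chartVec c z.2 (psiC S τ0 c (z, q)))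
      = chartVec c z.2 (velC S c (z, q)) := by
  rw [pProj_chartVec hz]
  simp only [psiC]
  rw [pzero_psi (metC_posDef h hz) (lapC_pos h hz) (meanCurv_ne hτ _) (shiC_lt h hz) q, psi_add]
  rfl

lemma engC_pos (q : E3) : 0 < engC S τ0 c (z, q) := energy_pos (metC_posDef h hz) q

/-- Momentum integrals in canonical momenta: `√g / p̂ dp` becomes `dπ / (E √g)`. -/
lemma momentum_eq (hτ : τ0 < 0) (w : TangentSpace 𝓘(ℝ, E3) (chartPt c z.2) → ℝ) :
    S.momentum τ0 z.1 (chartPt c z.2) w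
      = ∫ q, disC S τ0 c (z, q) * w (chartVec c z.2 (psiC S τ0 c (z, q)))
          / (engC S τ0 c (z, q) * √(metC S c z).det) := by
  have hy := mem_overlap_self (c := c) hz.2
  set L : E3 →L[ℝ] E3 := fderiv ℝ (trans c (chartPt c z.2)) z.2 with hL
  have hLv : ∀ p : E3, L p = chartVec c z.2 p := fun p => by
    rw [hL, fderiv_trans hy]; rfl
  have hinj : Function.Injective L := fun p q hpq => by
    rw [hLv, hLv] at hpq
    rw [← vecCoord_chartVec hz.2 p, hpq, vecCoord_chartVec hz.2 q]
  have hsur : Function.Surjective L := fun v =>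
    ⟨vecCoord c z.2 v, by rw [hLv]; exact chartVec_vecCoord hz.2 v⟩
  have hch := integral_image_eq_integral_abs_det_fderiv_smul volume MeasurableSet.univ
    (fun q _ => (L.hasFDerivAt (x := q)).hasFDerivWithinAt) hinj.injOn
    (fun p => S.f z.1 ⟨chartPt c z.2, p⟩ * w p / S.pHat τ0 z.1 (chartPt c z.2) p
      * S.sqrtDet z.1 (chartPt c z.2))
  rw [image_univ_of_surjective hsur, Measure.restrict_univ] at hch
  have hdet : √(metC S c z).det = |L.det| * S.sqrtDet z.1 (chartPt c z.2) := by
    rw [det_fderiv_eq]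
    show √(bilinComp (S.g z.1) c z.2).det = |(jac (trans c (chartPt c z.2)) z.2).det|
      * √(bilinComp (S.g z.1) (chartPt c z.2) (trans c (chartPt c z.2) z.2)).det
    rw [bilinComp_transform (S.g z.1) hy, det_mul, det_mul, det_transpose,
      mul_right_comm, sqrt_mul (mul_self_nonneg _), Real.sqrt_mul_self_eq_abs]
  have hps := integral_psi (metC_posDef h hz) (lapC_pos h hz) (meanCurv_ne hτ z.1) (shiC_lt h hz)
    (fun p => S.f z.1 ⟨chartPt c z.2, chartVec c z.2 p⟩ * w (chartVec c z.2 p))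
  refine hch.trans (Eq.trans ?_ hps)
  refine integral_congr_ae (.of_forall fun p => ?_)
  simp only [smul_eq_mul]
  rw [hdet, hLv, pHat_chartVec hz]
  ring

end Local

section Smoothness

include h hI hz

lemma contDiffAt_metC (i j : Fin 3) : ContDiffAt ℝ n (fun z => metC S c z i j) z :=
  (h.g_smooth c i j).contDiffAt (domC_mem_nhds hI hz)

lemma contDiffAt_lapC : ContDiffAt ℝ n (lapC S c) z :=
  (h.lapse_smooth c).contDiffAt (domC_mem_nhds hI hz)

lemma contDiffAt_shiC : ContDiffAt ℝ n (shiC S c) z :=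
  (h.shift_smooth c).contDiffAt (domC_mem_nhds hI hz)

lemma contDiffAt_metC_fst (q : E3) (i j : Fin 3) :
    ContDiffAt ℝ n (fun x : Phase => metC S c x.1 i j) (z, q) :=
  ContDiffAt.comp (f := Prod.fst) (z, q) (contDiffAt_metC h hI hz i j) contDiffAt_fst

lemma contDiffAt_lapC_fst (q : E3) : ContDiffAt ℝ n (fun x : Phase => lapC S c x.1) (z, q) :=
  ContDiffAt.comp (f := Prod.fst) (z, q) (contDiffAt_lapC h hI hz) contDiffAt_fst

lemma contDiffAt_shiC_fst (q : E3) : ContDiffAt ℝ n (fun x : Phase => shiC S c x.1) (z, q) :=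
  ContDiffAt.comp (f := Prod.fst) (z, q) (contDiffAt_shiC h hI hz) contDiffAt_fst

omit h hI hz in
lemma contDiffAt_meanCurv_fst {z : ℝ × E3} (q : E3) :
    ContDiffAt ℝ n (fun x : Phase => meanCurv τ0 x.1.1) (z, q) :=
  ((contDiff_meanCurv τ0).comp (contDiff_fst.comp contDiff_fst)).contDiffAt

lemma contDiffAt_engC (q : E3) : ContDiffAt ℝ n (engC S τ0 c) (z, q) :=
  contDiffAt_energy (contDiffAt_meanCurv_fst q) (contDiffAt_metC_fst h hI hz q)
    (metC_posDef h hz) contDiffAt_snd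

lemma contDiffAt_velC (q : E3) : ContDiffAt ℝ n (velC S c) (z, q) :=
  contDiffAt_mv (contDiffAt_inv (contDiffAt_metC_fst h hI hz q)
    (metC_posDef h hz).det_pos.ne'.isUnit) contDiffAt_snd

lemma contDiffAt_psiC (hτ : τ0 < 0) (q : E3) : ContDiffAt ℝ n (psiC S τ0 c) (z, q) :=
  contDiffAt_psi (contDiffAt_meanCurv_fst q) (meanCurv_ne hτ _) (contDiffAt_lapC_fst h hI hz q)
    (lapC_pos h hz).ne' (contDiffAt_metC_fst h hI hz q) (metC_posDef h hz)
    (contDiffAt_shiC_fst h hI hz q) contDiffAt_snd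

lemma contDiffAt_f (p : E3) : ContDiffAt ℝ n
    (fun z : ℝ × E3 × E3 => S.f z.1 ⟨chartPt c z.2.1, chartVec c z.2.1 z.2.2⟩) (z.1, z.2, p) :=
  (h.f_smooth c).contDiffAt ((hI.prod ((chartAt E3 c).open_target.prod isOpen_univ)).mem_nhds
    ⟨hz.1, hz.2, mem_univ _⟩)

lemma contDiffAt_disC (hτ : τ0 < 0) (q : E3) : ContDiffAt ℝ n (disC S τ0 c) (z, q) :=
  ContDiffAt.comp (f := fun x : Phase => (x.1.1, x.1.2, psiC S τ0 c x)) (z, q)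
    (contDiffAt_f h hI hz _) ((contDiff_fst.comp contDiff_fst).contDiffAt.prodMk
      ((contDiff_snd.comp contDiff_fst).contDiffAt.prodMk (contDiffAt_psiC h hI hz hτ q)))

end Smoothness

/-- In canonical momenta, the distribution function has compact momentum support, locally uniformly
in `(T, y)`. -/
lemma fibreSupp_disC (h : S.IsVlasovSolution τ0 n I) (hI : IsOpen I) (hτ : τ0 < 0) (c : M) :
    FibreSupp (domC I c) (disC S τ0 c) := by
  intro z₀ hz₀
  obtain ⟨R, hR⟩ := h.f_supp z₀.1 hz₀.1
  have hR' : ∀ᶠ z : ℝ × E3 in 𝓝 z₀, ∀ (x : M) (p : TangentSpace 𝓘(ℝ, E3) x),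
    R < S.g z.1 x p p → S.f z.1 ⟨x, p⟩ = 0 := continuousAt_fst.eventually hR
  obtain ⟨ε, hε, hball⟩ := nhds_basis_closedBall.mem_iff.1
    (Filter.inter_mem hR' (domC_mem_nhds hI hz₀))
  have hK := isCompact_closedBall z₀ ε
  -- a positive lower bound of the metric on unit vectors
  obtain ⟨m, hm0, hm⟩ : ∃ m : ℝ, 0 < m ∧ ∀ z ∈ closedBall z₀ ε, ∀ v : E3, ‖v‖ = 1 →
      m ≤ gq (metC S c z) v v := by
    have hcont : ContinuousOn (fun x : Phase => gq (metC S c x.1) x.2 x.2)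
        (closedBall z₀ ε ×ˢ Metric.sphere (0 : E3) 1) := fun x hx =>
      (contDiffAt_gq (n := n) (contDiffAt_metC_fst h hI (hball hx.1).2 x.2) contDiffAt_snd
        contDiffAt_snd).continuousAt.continuousWithinAt
    have hne : (closedBall z₀ ε ×ˢ Metric.sphere (0 : E3) 1).Nonempty :=
      ⟨(z₀, e3 0), by simp [hε.le], by simp [e3]⟩
    obtain ⟨x, hx, hmin⟩ := (hK.prod (isCompact_sphere (0 : E3) 1)).exists_isMinOn hne hcont
    refine ⟨_, gq_pos (metC_posDef h (hball hx.1).2) (v := x.2) ?_, fun z hz v hv =>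
      hmin (a := (z, v)) ⟨hz, by simpa using hv⟩⟩
    rintro h0
    have := hx.2
    rw [h0] at this
    simp at this
  have hcont : ContinuousOn (fun x : Phase => psiInv (meanCurv τ0 x.1.1) (lapC S c x.1)
      (metC S c x.1) (shiC S c x.1) x.2)
      (closedBall z₀ ε ×ˢ closedBall (0 : E3) (√(R / m))) := fun x hx =>
    (contDiffAt_psiInv (n := n) (contDiffAt_meanCurv_fst x.2) (meanCurv_ne hτ _)
      (contDiffAt_lapC_fst h hI (hball hx.1).2 x.2) (lapC_pos h (hball hx.1).2)
      (contDiffAt_metC_fst h hI (hball hx.1).2 x.2) (metC_posDef h (hball hx.1).2)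
      (contDiffAt_shiC_fst h hI (hball hx.1).2 x.2) (shiC_lt h (hball hx.1).2)
      contDiffAt_snd).continuousAt.continuousWithinAt
  obtain ⟨B, hB⟩ := (hK.prod (isCompact_closedBall (0 : E3) (√(R / m)))).exists_bound_of_continuousOn
    hcont
  refine ⟨B, ?_⟩
  filter_upwards [Metric.closedBall_mem_nhds z₀ hε] with z hz q hq
  by_contra hne
  have hzU := (hball hz).2
  set p := psiC S τ0 c (z, q) with hp
  have hle : gq (metC S c z) p p ≤ R := by
    by_contra hlt
    push Not at hlt
    refine hne ((hball hz).1 (chartPt c z.2) (chartVec c z.2 p) ?_)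
    rw [gq_vec_eq]; exact hlt
  have hpn : ‖p‖ ≤ √(R / m) := by
    apply Real.le_sqrt_of_sq_le
    rw [le_div_iff₀ hm0]
    by_cases hp0 : p = 0
    · rw [hp0] at hle ⊢
      simpa [gq] using hle
    · have hn0 : 0 < ‖p‖ := norm_pos_iff.2 hp0
      have h1 := hm z hz (‖p‖⁻¹ • p) (by rw [norm_smul, norm_inv, norm_norm, inv_mul_cancel₀ hn0.ne'])
      rw [gq_smul_left, gq_comm (posDef_symm (metC_posDef h hzU)), gq_smul_left] at h1
      have h2 : ‖p‖⁻¹ * (‖p‖⁻¹ * gq (metC S c z) p p) * ‖p‖ ^ 2 = gq (metC S c z) p p := by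
        field_simp
      nlinarith [mul_le_mul_of_nonneg_right h1 (sq_nonneg ‖p‖)]
  have hfin := hB (z, p) ⟨hz, by simpa using hpn⟩
  have hq' : psiInv (meanCurv τ0 z.1) (lapC S c z) (metC S c z) (shiC S c z) p = q :=
    psiInv_psi (metC_posDef h hzU) (lapC_pos h hzU) (meanCurv_ne hτ _) (shiC_lt h hzU) q
  simp only [hq'] at hfin
  linarith

/-! ### The evolution equation and the moments -/

section Matter

/-- The coordinate vector fields `∂₁, ∂₂, ∂₃` of `ℝ × ℝ³`. -/
def frame3 (i : Fin 3) : ℝ × E3 := (0, e3 i)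

lemma pderiv_slice {f : ℝ × E3 → ℝ} {z : ℝ × E3} (hf : DifferentiableAt ℝ f z) (i : Fin 3) :
    pderiv e3 i (fun y => f (z.1, y)) z.2 = pderiv frame3 i f z := by
  have h1 : HasFDerivAt (fun y : E3 => (z.1, y)) (ContinuousLinearMap.inr ℝ ℝ E3) z.2 :=
    hasFDerivAt_prodMk_right z.1 z.2
  have h2 : HasFDerivAt f (fderiv ℝ f z) (z.1, z.2) := hf.hasFDerivAt
  have h3 := h2.comp z.2 h1
  rw [pderiv, pderiv]
  erw [h3.fderiv]
  rfl

lemma hasDerivAt_slice {f : ℝ × E3 → ℝ} {z : ℝ × E3} (hf : DifferentiableAt ℝ f z) :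
    HasDerivAt (fun t => f (t, z.2)) (fderiv ℝ f z (1, 0)) z.1 := by
  have h1 : HasFDerivAt (fun t : ℝ => (t, z.2)) (inl ℝ ℝ E3) z.1 := hasFDerivAt_prodMk_left z.1 z.2
  have h2 : HasFDerivAt f (fderiv ℝ f z) (z.1, z.2) := hf.hasFDerivAt
  exact (h2.comp z.1 h1).hasDerivAt

lemma sum_sum_mul_integral (κ : Fin 3 → Fin 3 → ℝ) {φ : Fin 3 → Fin 3 → E3 → ℝ}
    (hφ : ∀ a b, Integrable (φ a b)) :
    ∑ a, ∑ b, κ a b * ∫ q, φ a b q = ∫ q, ∑ a, ∑ b, κ a b * φ a b q := by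
  rw [integral_finsetSum _ fun a _ => integrable_finsetSum _ fun b _ => (hφ a b).const_mul _]
  refine sum_congr rfl fun a _ => ?_
  rw [integral_finsetSum _ fun b _ => (hφ a b).const_mul _]
  simp only [integral_const_mul]

variable (S c) in
/-- The variation `(∂_T + ℒ_X) g` of the metric in the coordinates `(T, y)`. -/
def varC (z : ℝ × E3) (a b : Fin 3) : ℝ :=
  fderiv ℝ (fun w => metC S c w a b) z (1, 0)
    + ∑ d, (shiC S c z d * pderiv frame3 d (fun w => metC S c w a b) z
      + metC S c z d b * pderiv frame3 a (fun w => shiC S c w d) z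
      + metC S c z a d * pderiv frame3 b (fun w => shiC S c w d) z)

variable (S c) in
/-- The rescaled second fundamental form in the coordinates `(T, y)`. -/
def kC (z : ℝ × E3) : Mat3 := bilinComp (S.k z.1) c z.2

lemma kC_eq (z : ℝ × E3) (a b : Fin 3) :
    kC S c z a b = bilinComp (S.Sig z.1) c z.2 a b + 1 / 3 * metC S c z a b := rfl

include h hI hz

omit h hI hz in
lemma natCast_ne_zero (hn : 1 ≤ n) : (n : ℕ∞ω) ≠ 0 := by
  have : n ≠ 0 := by omega
  exact_mod_cast this

/-- The evolution equation `∂_T g + ℒ_X g = 2Nk - 2g`. -/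
lemma varC_eq (hn : 1 ≤ n) (a b : Fin 3) :
    varC S c z a b = 2 * lapC S c z * kC S c z a b - 2 * metC S c z a b := by
  have hn0 := natCast_ne_zero hn
  have h1 := h.evolution_g z.1 hz.1 c z.2 hz.2 a b
  have hG : ∀ a b, DifferentiableAt ℝ (fun w => metC S c w a b) z := fun a b =>
    (contDiffAt_metC h hI hz a b).differentiableAt hn0
  have hX : ∀ d, DifferentiableAt ℝ (fun w => shiC S c w d) z := fun d =>
    (contDiffAt_euclidean.1 (contDiffAt_shiC h hI hz) d).differentiableAt hn0
  have h2 := (hasDerivAt_slice (hG a b)).deriv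
  have e1 : (fun t => metC S c (t, z.2) a b) = fun t => bilinComp (S.g t) c z.2 a b := rfl
  rw [e1, h1] at h2
  rw [varC, ← h2, kC_eq]
  have h3 : lieDerivComp (S.shift z.1) (S.g z.1) c z.2 a b =
      ∑ d, (shiC S c z d * pderiv frame3 d (fun w => metC S c w a b) z
      + metC S c z d b * pderiv frame3 a (fun w => shiC S c w d) z
      + metC S c z a d * pderiv frame3 b (fun w => shiC S c w d) z) := by
    unfold lieDerivComp
    refine sum_congr rfl fun d _ => ?_
    rw [← pderiv_slice (hG a b), ← pderiv_slice (hX d), ← pderiv_slice (hX d)]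
    rfl
  rw [h3]
  simp only [metC, lapC]
  ring

omit h hI hz in
lemma contDiffAt_pderiv  {b : ι → V} {f : V → ℝ} {z : V} {m n : ℕ∞ω}
    (hf : ContDiffAt ℝ n f z) (hmn : m + 1 ≤ n) (i : ι) : ContDiffAt ℝ m (pderiv b i f) z :=
  contDiffAt_fderiv_apply (y := fun _ => b i) hf hmn contDiffAt_const

lemma contDiffAt_varC {m : ℕ} (hmn : m + 1 ≤ n) (a b : Fin 3) :
    ContDiffAt ℝ m (fun z => varC S c z a b) z := by
  have hmn' : (m : ℕ∞ω) + 1 ≤ n := by exact_mod_cast hmn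
  have hle : (m : ℕ∞ω) ≤ n := by exact_mod_cast (by omega : m ≤ n)
  have hG := fun a b => contDiffAt_metC h hI hz a b
  have hX := contDiffAt_euclidean.1 (contDiffAt_shiC h hI hz)
  unfold varC
  refine (contDiffAt_fderiv_apply (y := fun _ => ((1 : ℝ), (0 : E3))) (hG a b) hmn'
    contDiffAt_const).add (ContDiffAt.sum fun d _ => ?_)
  exact ((((hX d).of_le hle).mul (contDiffAt_pderiv (hG a b) hmn' d)).add
    (((hG d b).of_le hle).mul (contDiffAt_pderiv (hX d) hmn' a))).add
    (((hG a d).of_le hle).mul (contDiffAt_pderiv (hX d) hmn' b))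

lemma contDiffAt_kC {m : ℕ} (hmn : m + 1 ≤ n) (a b : Fin 3) :
    ContDiffAt ℝ m (fun z => kC S c z a b) z := by
  have hle : (m : ℕ∞ω) ≤ n := by exact_mod_cast (by omega : m ≤ n)
  have hN := (contDiffAt_lapC h hI hz).of_le hle
  have hG := (contDiffAt_metC h hI hz a b).of_le hle
  refine (((contDiffAt_varC h hI hz hmn a b).add (hG.const_smul (2 : ℝ))).div
    (hN.const_smul (2 : ℝ)) (by simpa using (lapC_pos h hz).ne')).congr_of_eventuallyEq ?_
  filter_upwards [domC_mem_nhds hI hz] with w hw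
  have hw0 := (lapC_pos h hw).ne'
  simp only [smul_eq_mul, Pi.div_apply]
  rw [varC_eq h hI hw (by omega)]
  field_simp
  ring

omit hz in
lemma fibreSupp_disC_mul (hτ : τ0 < 0) (Φ : Phase → ℝ) :
    FibreSupp (domC I c) (fun x => disC S τ0 c x * Φ x) :=
  (fibreSupp_disC h hI hτ c).mono_zero (fun z _ p h0 => by rw [h0, zero_mul]) (isOpen_domC hI c)

lemma integrable_disC_mul (hτ : τ0 < 0) {Φ : Phase → ℝ}
    (hΦ : ∀ x ∈ domC I c ×ˢ univ, ContinuousAt Φ x) :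
    Integrable (fun q => disC S τ0 c (z, q) * Φ (z, q)) :=
  ((fibreSupp_disC_mul h hI hτ Φ).integrable (fun x hx =>
    ((contDiffAt_disC h hI hx.1 hτ x.2).continuousAt.mul (hΦ x hx)).continuousWithinAt) hz).1

omit hI in
lemma sqrt_det_pos : 0 < √(metC S c z).det := sqrt_pos.2 (metC_posDef h hz).det_pos

omit hI in
lemma rho_mul_sqrt_det (hτ : τ0 < 0) : S.rho τ0 z.1 (chartPt c z.2) * √(metC S c z).det
      = ∫ q, disC S τ0 c (z, q) * engC S τ0 c (z, q) := by
  rw [RescaledVars.rho, momentum_eq h hz hτ, ← integral_const_mul, ← integral_mul_const]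
  refine integral_congr_ae (.of_forall fun q => ?_)
  have h1 := (engC_pos (τ0 := τ0) h hz q).ne'
  have h2 := (lapC_pos h hz).ne'
  have h3 := (sqrt_det_pos h hz).ne'
  simp only
  rw [p0_psiC h hz hτ]
  simp only [lapC] at *
  field_simp

lemma integrable_velC (hτ : τ0 < 0) (a : Fin 3) :
    Integrable (fun q => disC S τ0 c (z, q) * velC S c (z, q) a) :=
  integrable_disC_mul (Φ := fun x => velC S c x a) h hI hz hτ fun x hx =>
    (contDiffAt_euclidean.1 (contDiffAt_velC h hI hx.1 x.2) a).continuousAt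

lemma current_mul_sqrt_det (hτ : τ0 < 0) (a : Fin 3) :
    vecComp (S.current τ0 z.1) c z.2 a * √(metC S c z).det
      = ∫ q, disC S τ0 c (z, q) * velC S c (z, q) a := by
  have h2 := (lapC_pos h hz).ne'
  have h3 := (sqrt_det_pos h hz).ne'
  have key : S.current τ0 z.1 (chartPt c z.2) = ∑ b, ((√(metC S c z).det)⁻¹
      * ∫ q, disC S τ0 c (z, q) * velC S c (z, q) b) • chartVec c z.2 (e3 b) := by
    set E : Fin 3 → E3 := fun b => chartVec c z.2 (e3 b) with hE
    have e2 : ∀ (u : Fin 3 → ℝ) (a : Fin 3), (∑ b, u b • E b : E3) a = ∑ b, u b * E b a :=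
      fun u a => by simp [sum_univ_three]
    -- the component `a` of the current, for the weight `W = p⁰ (p + τ⁻¹ p⁰ X)ᵃ`
    have hmain : ∀ (a : Fin 3) (W : TangentSpace 𝓘(ℝ, E3) (chartPt c z.2) → ℝ),
        (∀ q, W (chartVec c z.2 (psiC S τ0 c (z, q)))
          = engC S τ0 c (z, q) / lapC S c z * ∑ b, velC S c (z, q) b * E b a) →
        lapC S c z * S.momentum τ0 z.1 (chartPt c z.2) W = (∑ b, ((√(metC S c z).det)⁻¹
          * ∫ q, disC S τ0 c (z, q) * velC S c (z, q) b) • E b : E3) a := by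
      intro a W hW
      rw [momentum_eq h hz hτ, ← integral_const_mul, e2]
      simp only [hW, ← integral_const_mul, ← integral_mul_const]
      rw [← integral_finsetSum _ fun b _ =>
        ((integrable_velC h hI hz hτ b).const_mul _).mul_const _]
      refine integral_congr_ae (.of_forall fun q => ?_)
      have h1 := (engC_pos (τ0 := τ0) h hz q).ne'
      simp only [mul_sum, Finset.sum_div]
      refine sum_congr rfl fun b _ => ?_
      field_simp
    refine PiLp.ext (α := fun _ : Fin 3 => ℝ) fun a => hmain a _ fun q => ?_
    have h4 : S.pProj τ0 z.1 (chartPt c z.2) (chartVec c z.2 (psiC S τ0 c (z, q)))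
        = (∑ b, velC S c (z, q) b • E b : E3) := by
      rw [pProj_psiC h hz hτ, chartVec_expand c z.2 (velC S c (z, q))]; rfl
    rw [p0_psiC h hz hτ, h4, e2]
  rw [vecComp_eq, key, map_sum]
  simp only [map_smul, vecCoord_chartVec hz.2]
  have e2 : ∀ u : Fin 3 → ℝ, (∑ b, u b • e3 b : E3) a = u a := fun u => by
    simp [sum_univ_three, e3]; fin_cases a <;> simp
  rw [e2]
  field_simp

lemma continuousAt_gq_velC (hn : 1 ≤ n) (q : E3) :
    ContinuousAt (fun x : Phase => gq (kC S c x.1) (velC S c x) (velC S c x)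
      / engC S τ0 c x) (z, q) := by
  have h1 : ContDiffAt ℝ ((0 : ℕ) : ℕ∞ω) (fun x : Phase =>
      gq (kC S c x.1) (velC S c x) (velC S c x) / engC S τ0 c x) (z, q) := by
    have hle : ((0 : ℕ) : ℕ∞ω) ≤ n := by exact_mod_cast (Nat.zero_le n)
    refine (contDiffAt_gq (fun i j => ?_) ((contDiffAt_velC h hI hz q).of_le hle)
      ((contDiffAt_velC h hI hz q).of_le hle)).div ((contDiffAt_engC h hI hz q).of_le hle)
      (engC_pos h hz q).ne'
    exact ContDiffAt.comp (f := Prod.fst) (z, q) (contDiffAt_kC h hI hz hn i j) contDiffAt_fst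
  exact h1.continuousAt

lemma stressSource_mul_sqrt_det (hτ : τ0 < 0) :
    S.stressSource τ0 z.1 (chartPt c z.2) * √(metC S c z).det = lapC S c z * ∫ q, disC S τ0 c (z, q)
        * (gq (kC S c z) (velC S c (z, q)) (velC S c (z, q)) / engC S τ0 c (z, q)) := by
  have h3 := (sqrt_det_pos h hz).ne'
  have hy := mem_overlap_self (c := c) hz.2
  set J := jac (trans c (chartPt c z.2)) z.2 with hJ
  have hk : kC S c z = J.transpose * bilinComp (S.k z.1) (chartPt c z.2)
      (chartAt E3 (chartPt c z.2) (chartPt c z.2)) * J := bilinComp_transform (S.k z.1) hy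
  have hv : ∀ (q : E3) (a : Fin 3), (show E3 from chartVec c z.2 q) a = ∑ b, J a b * q b := by
    intro q a
    have : (show E3 from chartVec c z.2 q) = fderiv ℝ (trans c (chartPt c z.2)) z.2 q := by
      rw [fderiv_trans hy]; rfl
    rw [this, fderiv_e3_expand]
    simp [sum_univ_three, hJ, jac, mul_comm]
  set κ := bilinComp (S.k z.1) (chartPt c z.2) (chartAt E3 (chartPt c z.2) (chartPt c z.2))
  have hint : ∀ a b : Fin 3, Integrable (fun q => disC S τ0 c (z, q)
      * ((show E3 from chartVec c z.2 (velC S c (z, q))) a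
        * (show E3 from chartVec c z.2 (velC S c (z, q))) b / engC S τ0 c (z, q))) := by
    intro a b
    simp only [hv]
    refine integrable_disC_mul (Φ := fun x => (∑ d, J a d * velC S c x d)
      * (∑ d, J b d * velC S c x d) / engC S τ0 c x) h hI hz hτ fun x hx => ?_
    have hvel := fun a => (contDiffAt_euclidean.1 (contDiffAt_velC h hI hx.1 x.2) a).continuousAt
    have he := (contDiffAt_engC (τ0 := τ0) h hI hx.1 x.2).continuousAt
    have : ∀ a, ContinuousAt (fun x => ∑ d, J a d * velC S c x d) x := fun a =>
      tendsto_finsetSum _ fun d _ => continuousAt_const.mul (hvel d)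
    exact ((this a).mul (this b)).div₀ he (engC_pos h hx.1 x.2).ne'
  have hst : ∀ a b, S.stress τ0 z.1 (chartPt c z.2) a b * √(metC S c z).det
      = ∫ q, disC S τ0 c (z, q) * ((show E3 from chartVec c z.2 (velC S c (z, q))) a
        * (show E3 from chartVec c z.2 (velC S c (z, q))) b / engC S τ0 c (z, q)) := by
    intro a b
    rw [RescaledVars.stress, momentum_eq h hz hτ, ← integral_mul_const]
    refine integral_congr_ae (.of_forall fun q => ?_)
    have h1 := (engC_pos (τ0 := τ0) h hz q).ne'
    simp only
    rw [pProj_psiC h hz hτ]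
    field_simp
  rw [RescaledVars.stressSource, mul_assoc]
  congr 1
  have hsum := sum_sum_mul_integral κ hint
  calc _ = ∑ a, ∑ b, κ a b * (S.stress τ0 z.1 (chartPt c z.2) a b * √(metC S c z).det) := by
        simp only [sum_mul, mul_assoc]; rfl
    _ = _ := by
        simp only [hst]
        rw [hsum]
        refine integral_congr_ae (.of_forall fun q => ?_)
        simp only [hv]
        rw [hk]
        simp only [gq, mul_apply, transpose_apply, sum_univ_three]
        ring

end Matter

/-! ### The geodesic spray in canonical momenta -/

lemma hasFDerivAt_comp_fst {u : ℝ × E3 → F}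
    {z : ℝ × E3} {q : E3} (hu : DifferentiableAt ℝ u z) : HasFDerivAt (fun x : Phase => u x.1)
      ((fderiv ℝ u z).comp (fst ℝ (ℝ × E3) E3)) (z, q) :=
  HasFDerivAt.comp (f := Prod.fst) (z, q) hu.hasFDerivAt hasFDerivAt_fst

open RescaledVars in
/-- Hamilton's equations: let `P^μ` be the four-momentum as a function of the position and of the
spatial covariant components, and `H = -P_T`. Along the vector field
`P^μ ∂_μ - P^T (∂_c H) ∂/∂π_c`, the components `P^μ` satisfy the geodesic equation. Only the
differentiated constraints are used: the spatial components of `P_μ` are the canonical momenta, and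
`P` has constant length. -/
lemma hamilton {G4 : ℝ × E3 → Matrix (Option (Fin 3)) (Option (Fin 3)) ℝ}
    {P : Option (Fin 3) → Phase → ℝ} {H : Phase → ℝ} {z : ℝ × E3} {q : E3}
    (hG : ∀ μ ν, DifferentiableAt ℝ (fun w => G4 w μ ν) z)
    (hP : ∀ μ, DifferentiableAt ℝ (P μ) (z, q))
    (hs : ∀ μ ν, G4 z μ ν = G4 z ν μ) (hdet : IsUnit (G4 z).det)
    (hl : ∀ᶠ x in 𝓝 (z, q), ∀ a, ∑ ν, G4 x.1 (some a) ν * P ν x = x.2 a)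
    (h0 : ∀ᶠ x in 𝓝 (z, q), ∑ ν, G4 x.1 none ν * P ν x = -H x)
    (hm : ∀ᶠ x in 𝓝 (z, q), ∑ μ, P μ x * ∑ ν, G4 x.1 μ ν * P ν x = -1)
    (hPT : P none (z, q) ≠ 0) {κ : E3}
    (hκ : ∀ c, κ c = -(P none (z, q) * fderiv ℝ H (z, q) ((0, e3 c), 0))) (μ : Option (Fin 3)) :
    fderiv ℝ (P μ) (z, q) (∑ α, P α (z, q) • frame4 α, κ)
      = -∑ α, ∑ β, christoffel frame4 G4 z μ α β * P α (z, q) * P β (z, q) := by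
  set p : Option (Fin 3) → ℝ := fun μ => P μ (z, q) with hp
  set g : Matrix (Option (Fin 3)) (Option (Fin 3)) ℝ := G4 z with hg
  set dG : ℝ × E3 → Option (Fin 3) → Option (Fin 3) → ℝ :=
    fun v μ ν => fderiv ℝ (fun w => G4 w μ ν) z v with hdG
  set dP : Phase → Option (Fin 3) → ℝ := fun v μ => fderiv ℝ (P μ) (z, q) v with hdP
  -- the derivative of `P_μ`
  have hlow : ∀ μ, HasFDerivAt (fun x => ∑ ν, G4 x.1 μ ν * P ν x)
      (∑ ν, (g μ ν • fderiv ℝ (P ν) (z, q) + p ν •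
        (fderiv ℝ (fun w => G4 w μ ν) z).comp (fst ℝ (ℝ × E3) E3))) (z, q) := by
    exact fun μ => HasFDerivAt.fun_sum fun ν _ =>
      (hasFDerivAt_comp_fst (u := fun w => G4 w μ ν) (hG μ ν)).fun_mul (hP ν).hasFDerivAt
  set L : Phase → Option (Fin 3) → ℝ := fun v μ => ∑ ν, g μ ν * dP v ν with hL
  set D1 : (ℝ × E3) → Option (Fin 3) → ℝ := fun v μ => ∑ ν, p ν * dG v μ ν with hD1
  have hlow' : ∀ v μ, fderiv ℝ (fun x => ∑ ν, G4 x.1 μ ν * P ν x) (z, q) v = L v μ + D1 v.1 μ := by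
    intro v μ
    rw [(hlow μ).fderiv]
    simp only [sum_apply, add_apply, smul_apply, smul_eq_mul, sum_add_distrib]
    rfl
  have hA : ∀ v a, L v (some a) = v.2 a - D1 v.1 (some a) := by
    intro v a
    have h1 : (fun x => ∑ ν, G4 x.1 (some a) ν * P ν x) =ᶠ[𝓝 (z, q)]
        fun x => ((coordL a).comp (snd ℝ (ℝ × E3) E3)) x := by
      filter_upwards [hl] with x hx using hx a
    have h2 := hlow' v (some a)
    rw [h1.fderiv_eq, ContinuousLinearMap.fderiv] at h2
    have h3 : v.2 a = L v (some a) + D1 v.1 (some a) := h2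
    linarith
  have hN : ∀ v, L v none = -fderiv ℝ H (z, q) v - D1 v.1 none := by
    intro v
    have h2 := hlow' v none
    have h1 : (fun x => ∑ ν, G4 x.1 none ν * P ν x) =ᶠ[𝓝 (z, q)] fun x => -H x := h0
    rw [h1.fderiv_eq, fderiv_fun_neg, neg_apply] at h2
    linarith
  have hB : ∀ v, ∑ μ, p μ * L v μ = -(1 / 2) * ∑ μ, p μ * D1 v.1 μ := by
    intro v
    have h1 := HasFDerivAt.fun_sum (𝕜 := ℝ) (u := Finset.univ) fun (μ : Option (Fin 3)) _ =>
      (hP μ).hasFDerivAt.fun_mul (hlow μ)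
    have h2 : HasFDerivAt (fun x => ∑ μ, P μ x * ∑ ν, G4 x.1 μ ν * P ν x)
        (0 : Phase →L[ℝ] ℝ) (z, q) :=
      (hasFDerivAt_const (-1 : ℝ) _).congr_of_eventuallyEq hm
    have h3 := congrArg (fun A => A v) (h1.unique h2)
    have h4 : ∑ μ, (p μ * (L v μ + D1 v.1 μ) + (∑ ν, g μ ν * p ν) * dP v μ) = 0 := by
      simp only [← hlow', (hlow _).fderiv]
      refine Eq.trans ?_ h3
      simp only [sum_apply, add_apply, smul_apply, smul_eq_mul]
      rfl
    have h5 : ∑ μ, (∑ ν, g μ ν * p ν) * dP v μ = ∑ μ, p μ * L v μ := by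
      simp only [hL, sum_mul, mul_sum]
      rw [sum_comm]
      refine sum_congr rfl fun μ _ => sum_congr rfl fun ν _ => ?_
      rw [hs ν μ]; ring
    rw [sum_add_distrib, h5] at h4
    simp only [mul_add, sum_add_distrib] at h4
    linarith
  have hκ' : ∀ c, κ c = (1 / 2) * ∑ μ, p μ * D1 (0, e3 c) μ := by
    intro c
    have h1 := hB ((0, e3 c), 0)
    rw [sum_option, hN] at h1
    simp only [hA] at h1
    rw [sum_option] at h1 ⊢
    simp only [sum_univ_three, PiLp.zero_apply] at h1 ⊢
    rw [hκ]
    linarith [show P none (z, q) * fderiv ℝ H (z, q) ((0, e3 c), 0) = p none * _ from rfl]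
  -- the direction of the spray
  set ξ : ℝ × E3 := ∑ α, p α • frame4 α with hξ
  have hdGξ : ∀ μ, D1 ξ μ = ∑ α, p α * D1 (frame4 α) μ := by
    intro μ
    simp only [hD1, hdG, hξ, map_sum, map_smul, smul_eq_mul, mul_sum]
    rw [sum_comm]
    refine sum_congr rfl fun α _ => sum_congr rfl fun ν _ => by ring
  set Q : Option (Fin 3) → ℝ := fun α => ∑ μ, p μ * D1 (frame4 α) μ with hQ
  have hQξ : ∑ μ, p μ * D1 ξ μ = ∑ α, p α * Q α := by
    simp only [hdGξ, hQ, sum_option, sum_univ_three]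
    ring
  have hsome : ∀ a, L (ξ, κ) (some a) = (1 / 2) * Q (some a) - D1 ξ (some a) := by
    intro a
    rw [hA, hκ']; rfl
  have hnone : L (ξ, κ) none = (1 / 2) * Q none - D1 ξ none := by
    have h1 := hB (ξ, κ)
    simp only [sum_option, hsome] at h1
    have h3 := hQξ
    simp only [sum_option, sum_univ_three] at h1 h3
    refine mul_left_cancel₀ hPT (?_ : p none * _ = p none * _)
    linarith
  have hall : ∀ μ, L (ξ, κ) μ = (1 / 2) * Q μ - D1 ξ μ := by
    rintro (_ | a)
    exacts [hnone, hsome a]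
  have hinv : dP (ξ, κ) μ = ∑ s, g⁻¹ μ s * L (ξ, κ) s := by
    have h1 : g⁻¹.mulVec (g.mulVec (dP (ξ, κ))) = dP (ξ, κ) := by
      rw [Matrix.mulVec_mulVec, nonsing_inv_mul g hdet, Matrix.one_mulVec]
    exact (congrFun h1 μ).symm
  have hgoal : ∑ α, ∑ β, christoffel frame4 G4 z μ α β * p α * p β
      = -∑ s, g⁻¹ μ s * ((1 / 2) * Q s - D1 ξ s) := by
    simp only [hdGξ]
    simp only [hQ, hD1, hg, hdG, christoffel, pderiv, sum_option, sum_univ_three]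
    ring
  change dP (ξ, κ) μ = -∑ α, ∑ β, christoffel frame4 G4 z μ α β * p α * p β
  simp only [hgoal, hinv, neg_neg, hall]

/-! ### The Vlasov equation in canonical momenta -/

section Matter

variable (S τ0 c) in
/-- The four-momentum `P^T = -τ E / N`, `Pᵃ = τ² Ψᵃ` in canonical momenta. -/
def momC : Option (Fin 3) → Phase → ℝ
  | none, x => -meanCurv τ0 x.1.1 * (engC S τ0 c x / lapC S c x.1)
  | some a, x => meanCurv τ0 x.1.1 ^ 2 * psiC S τ0 c x a

variable (S τ0 c) in
/-- The Hamiltonian `H = X·π - τ⁻¹ N E` of the particle motion. -/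
def hamC (x : Phase) : ℝ :=
  pair x.2 (shiC S c x.1) - (meanCurv τ0 x.1.1)⁻¹ * lapC S c x.1 * engC S τ0 c x

omit [IsManifold 𝓘(ℝ, E3) ∞ M] in
lemma posDef_mv {G : Mat3} (hG : G.PosDef) (v : E3) (b : Fin 3) : gq G v (e3 b) = mv G v b := by
  have hs := posDef_symm hG
  simp only [gq, mv_apply, hs b]
  fin_cases b <;> simp [e3, sum_univ_three, mul_comm]

section
include h hz

omit hz h in
lemma metric4_some_some (z : ℝ × E3) (a b : Fin 3) : S.spacetimeMetric τ0 c z (some a) (some b)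
    = (meanCurv τ0 z.1 ^ 2)⁻¹ * metC S c z a b := rfl

lemma metric4_none_some (b : Fin 3) : S.spacetimeMetric τ0 c z none (some b)
    = (meanCurv τ0 z.1 ^ 2)⁻¹ * -mv (metC S c z) (shiC S c z) b := by
  rw [← posDef_mv (metC_posDef h hz), ← gq_shift_eq hz]; rfl

lemma metric4_some_none (b : Fin 3) : S.spacetimeMetric τ0 c z (some b) none
    = (meanCurv τ0 z.1 ^ 2)⁻¹ * -mv (metC S c z) (shiC S c z) b :=
  metric4_none_some h hz b

omit h in
lemma metric4_none_none : S.spacetimeMetric τ0 c z none none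
    = (meanCurv τ0 z.1 ^ 2)⁻¹ * (-lapC S c z ^ 2 + gq (metC S c z) (shiC S c z) (shiC S c z)) := by
  rw [← gq_shift_shift_eq hz]; rfl

lemma metric4_symm (μ ν : Option (Fin 3)) : S.spacetimeMetric τ0 c z μ ν
    = S.spacetimeMetric τ0 c z ν μ := by
  rcases μ with _ | a <;> rcases ν with _ | b
  · rfl
  · rw [metric4_none_some h hz, metric4_some_none h hz]
  · rw [metric4_none_some h hz, metric4_some_none h hz]
  · rw [metric4_some_some, metric4_some_some, posDef_symm (metC_posDef h hz)]

lemma isUnit_metric4 (hτ : τ0 < 0) : IsUnit (S.spacetimeMetric τ0 c z).det := by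
  rw [isUnit_iff_ne_zero]
  intro h0
  obtain ⟨v, hv0, hv⟩ := Matrix.exists_mulVec_eq_zero_iff.2 h0
  have hτ' := meanCurv_ne hτ z.1
  have hG := metC_posDef h hz
  set V : E3 := WithLp.toLp 2 fun a => v (some a) with hV
  have hVa : ∀ a, V a = v (some a) := fun _ => rfl
  have hs : ∀ a, mv (metC S c z) V a = v none * mv (metC S c z) (shiC S c z) a := by
    intro a
    have h1 := congrFun hv (some a)
    rw [mulVec, dotProduct, sum_option, metric4_some_none h hz] at h1
    simp only [metric4_some_some, mul_assoc, ← mul_sum, Pi.zero_apply] at h1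
    rw [mv_apply]
    simp only [hVa]
    rw [← mul_add] at h1
    have h2 := (mul_eq_zero.1 h1).resolve_left (by positivity)
    linarith
  have h1 := congrFun hv none
  rw [mulVec, dotProduct, sum_option, metric4_none_none hz] at h1
  simp only [metric4_none_some h hz, mul_assoc, ← mul_sum, Pi.zero_apply] at h1
  rw [← mul_add] at h1
  have h2 := (mul_eq_zero.1 h1).resolve_left (by positivity)
  have h3 : V = v none • shiC S c z := by
    have : mv (metC S c z) V = mv (metC S c z) (v none • shiC S c z) := by
      ext a; rw [map_smul, hs]; rfl
    rw [← mv_inv_mv hG V, this, mv_inv_mv hG]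
  have h4 : ∑ b, -mv (metC S c z) (shiC S c z) b * v (some b)
      = -(v none * gq (metC S c z) (shiC S c z) (shiC S c z)) := by
    rw [gq_eq_pair, pair, mul_sum, ← sum_neg_distrib]
    refine sum_congr rfl fun b _ => ?_
    rw [← hVa, h3]
    simp only [PiLp.smul_apply, smul_eq_mul]; ring
  simp only [neg_mul] at h4 h2
  rw [h4] at h2
  have h5 : v none = 0 := by
    have hN := lapC_pos h hz
    have : lapC S c z ^ 2 * v none = 0 := by linarith
    exact (mul_eq_zero.1 this).resolve_left (by positivity)
  rw [h5, zero_smul] at h3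
  apply hv0
  ext μ
  rcases μ with _ | a
  · exact h5
  · rw [← hVa, h3]; rfl

/-- The spatial covariant components of the four-momentum are the canonical momenta. -/
lemma lower_some (hτ : τ0 < 0) (q : E3) (a : Fin 3) :
    ∑ ν, S.spacetimeMetric τ0 c z (some a) ν * momC S τ0 c ν (z, q) = q a := by
  have hτ' := meanCurv_ne hτ z.1
  have hN := (lapC_pos h hz).ne'
  have h1 : q a = mv (metC S c z) (velC S c (z, q)) a := by
    rw [velC, mv_mv_inv (metC_posDef h hz)]
  rw [sum_option, metric4_some_none h hz, h1, mv_apply, mv_apply]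
  simp only [metric4_some_some, momC, psiC, psi, PiLp.sub_apply, PiLp.smul_apply, smul_eq_mul,
    sum_univ_three, engC, velC]
  field_simp
  ring

/-- The Hamiltonian is minus the time component of the covariant four-momentum. -/
lemma lower_none (hτ : τ0 < 0) (q : E3) :
    ∑ ν, S.spacetimeMetric τ0 c z none ν * momC S τ0 c ν (z, q) = -hamC S τ0 c (z, q) := by
  have hτ' := meanCurv_ne hτ z.1
  have hN := (lapC_pos h hz).ne'
  have h1 : pair q (shiC S c z) = pair (mv (metC S c z) (shiC S c z)) (velC S c (z, q)) := by
    rw [pair_comm (mv _ _), ← gq_eq_pair, gq_comm (posDef_symm (metC_posDef h hz)), velC,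
      gq_mv_inv (metC_posDef h hz)]
  rw [sum_option, metric4_none_none hz, hamC]
  simp only [h1]
  rw [gq_eq_pair, pair_comm]
  simp only [metric4_none_some h hz, momC, psiC, psi, PiLp.sub_apply, PiLp.smul_apply, smul_eq_mul,
    sum_univ_three, engC, velC, pair]
  field_simp
  ring

/-- The four-momentum of a particle of mass `1` has constant length. -/
lemma mass_shell (hτ : τ0 < 0) (q : E3) : ∑ μ, momC S τ0 c μ (z, q)
    * ∑ ν, S.spacetimeMetric τ0 c z μ ν * momC S τ0 c ν (z, q) = -1 := by
  have hτ' := meanCurv_ne hτ z.1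
  have hN := (lapC_pos h hz).ne'
  have hG := metC_posDef h hz
  have h1 : engC S τ0 c (z, q) ^ 2 = 1 + meanCurv τ0 z.1 ^ 2 * pair q (velC S c (z, q)) := by
    rw [engC, energy_sq hG, gq_eq_pair]; rfl
  rw [sum_option, lower_none h hz hτ]
  simp only [lower_some h hz hτ]
  have h2 : ∑ a, momC S τ0 c (some a) (z, q) * q a = meanCurv τ0 z.1 ^ 2 * (pair q (velC S c (z, q))
      - (meanCurv τ0 z.1)⁻¹ * (engC S τ0 c (z, q) / lapC S c z) * pair q (shiC S c z)) := by
    simp only [momC, psiC, psi, pair, velC, engC, PiLp.sub_apply, PiLp.smul_apply, smul_eq_mul,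
      sum_univ_three]
    ring
  rw [h2]
  simp only [momC, hamC]
  field_simp
  linear_combination (-lapC S c z) * h1

end

section
include h hI hz

lemma contDiffAt_momC (hτ : τ0 < 0) (q : E3) (μ : Option (Fin 3)) :
    ContDiffAt ℝ n (momC S τ0 c μ) (z, q) := by
  rcases μ with _ | a
  · exact (contDiffAt_meanCurv_fst q).neg.mul ((contDiffAt_engC h hI hz q).div
      (contDiffAt_lapC_fst h hI hz q) (lapC_pos h hz).ne')
  · exact ((contDiffAt_meanCurv_fst q).pow 2).mul
      (contDiffAt_euclidean.1 (contDiffAt_psiC h hI hz hτ q) a)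

lemma contDiffAt_metric4 (hτ : τ0 < 0) (μ ν : Option (Fin 3)) :
    ContDiffAt ℝ n (fun w => S.spacetimeMetric τ0 c w μ ν) z := by
  have hG := contDiffAt_metC h hI hz
  have hX := contDiffAt_shiC h hI hz
  have hN := contDiffAt_lapC h hI hz
  have ht : ContDiffAt ℝ n (fun w : ℝ × E3 => (meanCurv τ0 w.1 ^ 2)⁻¹) z :=
    (((contDiff_meanCurv τ0).comp contDiff_fst).contDiffAt.pow 2).inv
      (pow_ne_zero 2 (meanCurv_ne hτ z.1))
  have hm := fun b => (contDiffAt_euclidean.1 (contDiffAt_mv hG hX) b).neg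
  have hev := domC_mem_nhds hI hz
  rcases μ with _ | a <;> rcases ν with _ | b
  · refine (ht.mul ((hN.pow 2).neg.add (contDiffAt_gq hG hX hX))).congr_of_eventuallyEq ?_
    filter_upwards [hev] with w hw using metric4_none_none hw
  · refine (ht.mul (hm b)).congr_of_eventuallyEq ?_
    filter_upwards [hev] with w hw using metric4_none_some h hw b
  · refine (ht.mul (hm a)).congr_of_eventuallyEq ?_
    filter_upwards [hev] with w hw using metric4_some_none h hw a
  · exact ht.mul (hG a b)

/-- The Vlasov equation in canonical momenta. -/
lemma vlasov_canonical (hn : 1 ≤ n) (hτ : τ0 < 0) (q : E3) {V K : E3}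
    (hV : V = shiC S c z - (meanCurv τ0 z.1 * lapC S c z / engC S τ0 c (z, q)) • velC S c (z, q))
    (hK : ∀ a, K a = -fderiv ℝ (hamC S τ0 c) (z, q) ((0, e3 a), 0)) :
    fderiv ℝ (disC S τ0 c) (z, q) ((1, V), K) = 0 := by
  have hn0 := natCast_ne_zero hn
  have hτ' := meanCurv_ne hτ z.1
  have hN := (lapC_pos h hz).ne'
  have hE := (engC_pos (τ0 := τ0) h hz q).ne'
  have hev : ∀ᶠ x : Phase in 𝓝 (z, q), x.1 ∈ domC I c :=
    continuousAt_fst.eventually (domC_mem_nhds hI hz)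
  set PT := momC S τ0 c none (z, q) with hPT
  have hPT0 : PT ≠ 0 := by
    rw [hPT]; exact mul_ne_zero (neg_ne_zero.2 hτ') (div_ne_zero hE hN)
  have hmd := fun μ => (contDiffAt_momC h hI hz hτ q μ).differentiableAt hn0
  have hham := hamilton (G4 := S.spacetimeMetric τ0 c) (P := momC S τ0 c) (H := hamC S τ0 c)
    (z := z) (q := q) (κ := PT • K)
    (fun μ ν => (contDiffAt_metric4 h hI hz hτ μ ν).differentiableAt hn0)
    hmd (metric4_symm h hz) (isUnit_metric4 h hz hτ)
    (by filter_upwards [hev] with x hx a using lower_some h hx hτ x.2 a)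
    (by filter_upwards [hev] with x hx using lower_none h hx hτ x.2)
    (by filter_upwards [hev] with x hx using mass_shell h hx hτ x.2) hPT0
    (fun a => by simp only [PiLp.smul_apply, smul_eq_mul, hK]; ring)
  set ξ : ℝ × E3 := ∑ α, momC S τ0 c α (z, q) • RescaledVars.frame4 α with hξ
  have hξ' : ξ = PT • (1, V) := by
    rw [hξ, sum_option]
    refine Prod.ext ?_ ?_
    · simp [RescaledVars.frame4, Prod.fst_sum, hPT]
    · simp only [RescaledVars.frame4, Prod.snd_add, Prod.snd_sum, Prod.smul_snd, smul_zero, zero_add]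
      rw [hV]
      ext i
      have e2 : ∀ u : Fin 3 → ℝ, (∑ b, u b • e3 b : E3) i = u i := fun u => by
        simp [sum_univ_three, e3]; fin_cases i <;> simp
      rw [e2]
      simp only [momC, psiC, psi, hPT, PiLp.sub_apply, PiLp.smul_apply, smul_eq_mul, engC, velC] at *
      field_simp
      ring
  -- the spatial components of the momentum, as a vector
  set mvec : Phase → E3 := fun x => meanCurv τ0 x.1.1 ^ 2 • psiC S τ0 c x with hmvec
  have hmvd : DifferentiableAt ℝ mvec (z, q) :=
    ((((contDiff_meanCurv τ0 (n := 1)).comp (contDiff_fst.comp contDiff_fst)).contDiffAt.pow 2).differentiableAt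
      (by norm_num)).smul ((contDiffAt_psiC h hI hz hτ q).differentiableAt hn0)
  set z' : ℝ × E3 × E3 := (z.1, z.2, mvec (z, q)) with hz'
  have hfU : DifferentiableAt ℝ (S.fUnscaled τ0 c) z' := by
    have h1 : DifferentiableAt ℝ (fun w : ℝ × E3 × E3 =>
        (w.1, w.2.1, ((meanCurv τ0 w.1) ^ 2)⁻¹ • w.2.2)) z' := by
      have ht : DifferentiableAt ℝ (fun w : ℝ × E3 × E3 => ((meanCurv τ0 w.1) ^ 2)⁻¹) z' :=
        ((((contDiff_meanCurv τ0 (n := 1)).comp contDiff_fst).contDiffAt.pow 2).inv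
          (pow_ne_zero 2 (meanCurv_ne hτ _))).differentiableAt (by norm_num)
      fun_prop
    have h2 := (contDiffAt_f h hI hz (((meanCurv τ0 z'.1) ^ 2)⁻¹ • z'.2.2)).differentiableAt hn0
    exact DifferentiableAt.comp (f := fun w : ℝ × E3 × E3 =>
        (w.1, w.2.1, ((meanCurv τ0 w.1) ^ 2)⁻¹ • w.2.2)) z' h2 h1
  have hscale : ∀ x : Phase, ((meanCurv τ0 x.1.1) ^ 2)⁻¹ • mvec x = psiC S τ0 c x := fun x => by
    rw [hmvec, smul_smul, inv_mul_cancel₀ (pow_ne_zero 2 (meanCurv_ne hτ _)), one_smul]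
  have hcomp : disC S τ0 c = fun x => S.fUnscaled τ0 c (x.1.1, x.1.2, mvec x) := by
    funext x
    simp only [RescaledVars.fUnscaled, hscale]; rfl
  have hder : ∀ v, fderiv ℝ (disC S τ0 c) (z, q) v
      = fderiv ℝ (S.fUnscaled τ0 c) z' (v.1.1, v.1.2, fderiv ℝ mvec (z, q) v) := by
    intro v
    rw [hcomp]
    exact DFunLike.congr_fun (HasFDerivAt.comp (f := fun x : Phase => (x.1.1, x.1.2, mvec x))
      (z, q) hfU.hasFDerivAt ((hasFDerivAt_fst.comp (z, q) hasFDerivAt_fst).prodMk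
        ((hasFDerivAt_snd.comp (z, q) hasFDerivAt_fst).prodMk hmvd.hasFDerivAt))).fderiv v
  have hmvcomp : ∀ a, HasFDerivAt (momC S τ0 c (some a)) ((coordL a).comp (fderiv ℝ mvec (z, q)))
      (z, q) := fun a => (coordL a).hasFDerivAt.comp (z, q) hmvd.hasFDerivAt
  have hV' := h.vlasov z.1 hz.1 c z.2 hz.2 (mvec (z, q))
  have hmom : S.spacetimeMomentum τ0 c z' = fun μ => momC S τ0 c μ (z, q) := by
    funext μ
    rcases μ with _ | a
    · show -meanCurv τ0 z.1 * S.p0 τ0 z.1 (chartPt c z.2)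
        (chartVec c z.2 (((meanCurv τ0 z.1) ^ 2)⁻¹ • mvec (z, q))) = _
      rw [hscale (z, q), p0_psiC h hz hτ]; rfl
    · rfl
  rw [RescaledVars.sprayDeriv] at hV'
  change S.spacetimeMomentum τ0 c z' none * _ + ∑ a, S.spacetimeMomentum τ0 c z' (some a) * _
    - ∑ a, (∑ μ, ∑ ν, _ * S.spacetimeMomentum τ0 c z' μ * S.spacetimeMomentum τ0 c z' ν) * _ = 0 at hV'
  rw [hmom] at hV'
  simp only [neg_eq_iff_eq_neg.1 (hham _).symm] at hV'
  have hmain : fderiv ℝ (disC S τ0 c) (z, q) (ξ, PT • K) = 0 := by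
    rw [hder]
    refine Eq.trans ?_ hV'
    set m := fderiv ℝ mvec (z, q) (ξ, PT • K) with hm
    have hdir : (ξ.1, ξ.2, m)
        = PT • ((1 : ℝ), (0 : E3), (0 : E3)) + ∑ a, momC S τ0 c (some a) (z, q) • ((0 : ℝ), e3 a, (0 : E3))
          + ∑ a, m a • ((0 : ℝ), (0 : E3), e3 a) := by
      refine Prod.ext ?_ (Prod.ext ?_ ?_)
      · simp [hξ, sum_option, RescaledVars.frame4, Prod.fst_sum, hPT]
      · simp [hξ, sum_option, RescaledVars.frame4, Prod.fst_sum, Prod.snd_sum]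
      · simp only [Prod.snd_add, Prod.snd_sum, Prod.smul_snd, smul_zero, zero_add, sum_const_zero]
        exact e3_expand m
    simp only [hdir, map_add, map_sum, map_smul, smul_eq_mul]
    rw [sub_eq_add_neg, ← sum_neg_distrib]
    congr 1
    refine sum_congr rfl fun a _ => ?_
    rw [hm, (hmvcomp a).fderiv, neg_mul, neg_neg]
    rfl
  have hsc : ((ξ, PT • K) : Phase) = PT • ((1, V), K) := by rw [hξ']; rfl
  rw [hsc, map_smul, smul_eq_mul] at hmain
  exact (mul_eq_zero.1 hmain).resolve_left hPT0

end

end Matter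

/-! ### The continuity equation -/

lemma fderiv_fderiv_comm {H : V → ℝ} {x : V} (hH : ContDiffAt ℝ 2 H x) (u v : V) :
    fderiv ℝ (fun x => fderiv ℝ H x u) x v = fderiv ℝ (fun x => fderiv ℝ H x v) x u := by
  have h1 : DifferentiableAt ℝ (fderiv ℝ H) x :=
    (hH.fderiv_right (m := 1) (by norm_num)).differentiableAt (by norm_num)
  have h2 : ∀ u : V, HasFDerivAt (fun x => fderiv ℝ H x u)
      ((fderiv ℝ (fderiv ℝ H) x).flip u) x := fun u => by
    have := h1.hasFDerivAt.clm_apply (hasFDerivAt_const u x)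
    convert! this using 1
    ext v
    simp
  rw [(h2 u).fderiv, (h2 v).fderiv]
  simp only [ContinuousLinearMap.flip_apply]
  exact hH.isSymmSndFDerivAt (by simp) v u

lemma hasFDerivAt_pair {u v : V → E3}
    {u' v' : V →L[ℝ] E3} {x : V} (hu : HasFDerivAt u u' x) (hv : HasFDerivAt v v' x) :
    HasFDerivAt (fun x => pair (u x) (v x))
      (∑ i, (u x i • (coordL i).comp v' + v x i • (coordL i).comp u')) x := by
  have e : ∀ {w : V → E3} {w' : V →L[ℝ] E3} (_ : HasFDerivAt w w' x) (i : Fin 3),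
      HasFDerivAt (fun x => w x i) ((coordL i).comp w') x := fun hw i =>
    (coordL i).hasFDerivAt.comp x hw
  unfold pair
  exact HasFDerivAt.fun_sum fun i _ => (e hu i).fun_mul (e hv i)

lemma fderiv_pair {u v : V → E3}
    {x : V} (hu : DifferentiableAt ℝ u x) (hv : DifferentiableAt ℝ v x) (η : V) :
    fderiv ℝ (fun x => pair (u x) (v x)) x η
      = pair (u x) (fderiv ℝ v x η) + pair (fderiv ℝ u x η) (v x) := by
  rw [(hasFDerivAt_pair hu.hasFDerivAt hv.hasFDerivAt).fderiv]
  simp only [pair, sum_apply, add_apply, smul_apply, smul_eq_mul, comp_apply, sum_add_distrib]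
  congr 1
  exact sum_congr rfl fun i _ => mul_comm _ _

lemma fderiv_mv {A : V → Mat3} {v : V → E3}
    {x : V} (hA : ∀ i j, DifferentiableAt ℝ (fun x => A x i j) x) (hv : DifferentiableAt ℝ v x)
    (η : V) :
    fderiv ℝ (fun x => mv (A x) (v x)) x η = mv (dMat A x η) (v x) + mv (A x) (fderiv ℝ v x η) := by
  have e : ∀ {w : V → E3} (_ : DifferentiableAt ℝ w x) (i : Fin 3),
      HasFDerivAt (fun x => w x i) ((coordL i).comp (fderiv ℝ w x)) x := fun hw i =>
    (coordL i).hasFDerivAt.comp x hw.hasFDerivAt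
  have hd : DifferentiableAt ℝ (fun x => mv (A x) (v x)) x := by
    refine (differentiableAt_euclidean).2 fun i => ?_
    simp only [mv_apply]
    exact DifferentiableAt.fun_sum fun j _ => (hA i j).fun_mul (e hv j).differentiableAt
  ext i
  have h1 : HasFDerivAt (fun x => mv (A x) (v x) i) (∑ j, (A x i j • (coordL j).comp (fderiv ℝ v x)
      + v x j • fderiv ℝ (fun x => A x i j) x)) x := by
    simp only [mv_apply]
    exact HasFDerivAt.fun_sum fun j _ => (hA i j).hasFDerivAt.fun_mul (e hv j)
  have h2 := congrArg (fun L => L η) ((e hd i).unique h1)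
  refine Eq.trans h2 ?_
  simp only [sum_apply, add_apply, smul_apply, smul_eq_mul, comp_apply,
    sum_add_distrib, PiLp.add_apply, mv_apply, dMat]
  rw [add_comm]
  congr 1
  exact sum_congr rfl fun i _ => mul_comm _ _

section Matter

include h hI hz

omit hI in
lemma engC_sq (q : E3) :
    engC S τ0 c (z, q) ^ 2 = 1 + meanCurv τ0 z.1 ^ 2 * pair q (velC S c (z, q)) := by
  rw [engC, energy_sq (metC_posDef h hz), gq_eq_pair]; rfl

/-- The derivative of the energy. -/
lemma engC_mul_fderiv (hn : 1 ≤ n) (q : E3) (v : ℝ × E3) (η : E3) :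
    engC S τ0 c (z, q) * fderiv ℝ (engC S τ0 c) (z, q) (v, η)
      = -(v.1 * meanCurv τ0 z.1 ^ 2 * pair q (velC S c (z, q)))
        - meanCurv τ0 z.1 ^ 2 / 2 * gq (dMat (metC S c) z v) (velC S c (z, q)) (velC S c (z, q))
        + meanCurv τ0 z.1 ^ 2 * pair η (velC S c (z, q)) := by
  have hn0 := natCast_ne_zero hn
  have hE := engC_pos (τ0 := τ0) h hz q
  have hEd := (contDiffAt_engC (τ0 := τ0) h hI hz q).differentiableAt hn0
  have hwd := (contDiffAt_velC h hI hz q).differentiableAt hn0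
  have hGd := fun i j => (contDiffAt_metC_fst h hI hz q i j).differentiableAt hn0
  have hev : ∀ᶠ x : Phase in 𝓝 (z, q), x.1 ∈ domC I c :=
    continuousAt_fst.eventually (domC_mem_nhds hI hz)
  have hτd : HasFDerivAt (fun x : Phase => meanCurv τ0 x.1.1)
      ((-meanCurv τ0 z.1) • (fst ℝ ℝ E3).comp
        (fst ℝ (ℝ × E3) E3)) (z, q) :=
    HasDerivAt.comp_hasFDerivAt (f := fun x : Phase => x.1.1) (z, q)
      (hasDerivAt_meanCurv τ0 z.1) (hasFDerivAt_fst.comp (z, q) hasFDerivAt_fst)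
  set w := velC S c (z, q) with hw
  -- differentiate `G w = q`
  have h1 : mv (dMat (metC S c) z v) w + mv (metC S c z) (fderiv ℝ (velC S c) (z, q) (v, η)) = η := by
    have e1 : (fun x : Phase => mv (metC S c x.1) (velC S c x)) =ᶠ[𝓝 (z, q)] Prod.snd := by
      filter_upwards [hev] with x hx using mv_mv_inv (metC_posDef h hx) _
    have e2 := fderiv_mv (A := fun x : Phase => metC S c x.1) hGd hwd (v, η)
    rw [e1.fderiv_eq, fderiv_snd] at e2
    have e3 : dMat (fun x : Phase => metC S c x.1) (z, q) (v, η) = dMat (metC S c) z v := by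
      ext i j
      simp only [dMat]
      rw [(hasFDerivAt_comp_fst (u := fun w => metC S c w i j)
        ((contDiffAt_metC h hI hz i j).differentiableAt hn0)).fderiv]
      rfl
    rw [e3] at e2
    exact e2.symm
  have h2 : pair q (fderiv ℝ (velC S c) (z, q) (v, η))
      = pair η w - gq (dMat (metC S c) z v) w w := by
    have e1 : pair q (fderiv ℝ (velC S c) (z, q) (v, η))
        = pair w (mv (metC S c z) (fderiv ℝ (velC S c) (z, q) (v, η))) := by
      rw [← gq_eq_pair, gq_comm (posDef_symm (metC_posDef h hz)), hw, velC,
        gq_mv_inv (metC_posDef h hz)]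
    rw [e1, ← sub_eq_of_eq_add' h1.symm, gq_eq_pair]
    simp only [pair, PiLp.sub_apply, sum_univ_three]; ring
  -- differentiate `E² = 1 + τ² ⟨q, w⟩`
  have h3 : (fun x => engC S τ0 c x * engC S τ0 c x) =ᶠ[𝓝 (z, q)]
      fun x => 1 + meanCurv τ0 x.1.1 * meanCurv τ0 x.1.1 * pair x.2 (velC S c x) := by
    filter_upwards [hev] with x hx
    have := engC_sq (τ0 := τ0) h hx x.2
    rw [← sq, ← sq]; exact this
  have h4 := (hEd.hasFDerivAt.fun_mul hEd.hasFDerivAt)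
  have hpd := (hasFDerivAt_pair (hasFDerivAt_snd (𝕜 := ℝ) (p := (z, q))) hwd.hasFDerivAt)
  have h5 := ((hτd.fun_mul hτd).fun_mul hpd).const_add 1
  have h6 := congrArg (fun L => L (v, η)) (h4.unique (h5.congr_of_eventuallyEq h3))
  have h7 := fderiv_pair (u := Prod.snd) (x := (z, q)) (differentiableAt_snd) hwd (v, η)
  rw [hpd.fderiv, fderiv_snd] at h7
  simp only [add_apply, smul_apply, smul_eq_mul, h7, comp_apply] at h6
  rw [ContinuousLinearMap.coe_snd', ContinuousLinearMap.coe_fst', ContinuousLinearMap.coe_fst',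
    h2] at h6
  linarith

end Matter

section Fibre

variable {V : Type} [NormedAddCommGroup V] [NormedSpace ℝ V] [FiniteDimensional ℝ V]

lemma fderiv_integral_param {U : Set V} (hU : IsOpen U) {h : V × E3 → ℝ}
    (H : FibreSupp U h) (hc : ContDiffOn ℝ 1 h (U ×ˢ univ)) {z₀ : V} (hz₀ : z₀ ∈ U) (v : V) :
    Integrable (fun p => fderiv ℝ h (z₀, p) (v, 0)) ∧
      fderiv ℝ (fun z => ∫ p, h (z, p)) z₀ v = ∫ p, fderiv ℝ h (z₀, p) (v, 0) := by
  have h1 := (hasFDerivAt_integral_param hU H hc hz₀).fderiv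
  have hcf : ContinuousOn (pfderiv h) (U ×ˢ univ) :=
    (hc.continuousOn_fderiv_of_isOpen (hU.prod isOpen_univ) le_rfl).clm_comp continuousOn_const
  have hint := ((H.pfderiv hU (hc.differentiableOn (by norm_num))).integrable hcf hz₀).1
  have h2 := ContinuousLinearMap.integral_apply hint v
  rw [h1, h2]
  exact ⟨hint.apply_continuousLinearMap v, rfl⟩

lemma integral_fderiv_fibre_eq_zero {U : Set V} (hU : IsOpen U) {h : V × E3 → ℝ}
    (H : FibreSupp U h) (hc : ContDiffOn ℝ 1 h (U ×ˢ univ)) {z₀ : V} (hz₀ : z₀ ∈ U) (v : E3) :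
    Integrable (fun p => fderiv ℝ h (z₀, p) (0, v)) ∧ ∫ p, fderiv ℝ h (z₀, p) (0, v) = 0 := by
  have hO : IsOpen (U ×ˢ (univ : Set E3)) := hU.prod isOpen_univ
  have hs := (H.integrable hc.continuousOn hz₀).2
  have hφ : ContDiff ℝ 1 fun p => h (z₀, p) := by
    rw [← contDiffOn_univ]
    exact hc.comp (by fun_prop) fun p _ => ⟨hz₀, mem_univ _⟩
  have h1 : ∀ p, fderiv ℝ (fun p => h (z₀, p)) p v = fderiv ℝ h (z₀, p) (0, v) := fun p => by
    have h2 : HasFDerivAt h (fderiv ℝ h (z₀, p)) (z₀, p) :=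
      (((hc.contDiffAt (hO.mem_nhds ⟨hz₀, mem_univ _⟩)).differentiableAt (by norm_num))).hasFDerivAt
    have h3 : HasFDerivAt (fun p : E3 => (z₀, p)) (ContinuousLinearMap.inr ℝ V E3) p :=
      hasFDerivAt_prodMk_right z₀ p
    have h4 : HasFDerivAt (fun p => h (z₀, p)) _ p := h2.comp p h3
    rw [h4.fderiv]; rfl
  simp only [← h1]
  refine ⟨?_, integral_fderiv_eq_zero hφ hs v⟩
  refine Continuous.integrable_of_hasCompactSupport ?_ ?_
  · have := hφ.continuous_fderiv (by norm_num)
    fun_prop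
  · exact (hs.fderiv (𝕜 := ℝ)).comp_left (g := fun L : E3 →L[ℝ] ℝ => L v) rfl

end Fibre

section Matter

include h hI hz

lemma contDiffAt_hamC (hτ : τ0 < 0) (q : E3) : ContDiffAt ℝ n (hamC S τ0 c) (z, q) := by
  have hX := contDiffAt_euclidean.1 (contDiffAt_shiC_fst h hI hz q)
  have hq := contDiffAt_euclidean.1
    (contDiffAt_snd (𝕜 := ℝ) (n := (n : ℕ∞ω)) (p := ((z, q) : Phase)))
  unfold hamC pair
  exact (ContDiffAt.sum fun i _ => (hq i).mul (hX i)).sub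
    ((((contDiffAt_meanCurv_fst q).inv (meanCurv_ne hτ _)).mul (contDiffAt_lapC_fst h hI hz q)).mul
      (contDiffAt_engC h hI hz q))

/-- The derivatives of the Hamiltonian at fixed time. -/
lemma fderiv_hamC (hn : 1 ≤ n) (hτ : τ0 < 0) (q : E3) (v : ℝ × E3) (hv : v.1 = 0) (η : E3) :
    fderiv ℝ (hamC S τ0 c) (z, q) (v, η) = pair η (shiC S c z) + pair q (fderiv ℝ (shiC S c) z v)
      - (meanCurv τ0 z.1)⁻¹ * (fderiv ℝ (lapC S c) z v * engC S τ0 c (z, q)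
        + lapC S c z * fderiv ℝ (engC S τ0 c) (z, q) (v, η)) := by
  have hn0 := natCast_ne_zero hn
  have hEd := (contDiffAt_engC (τ0 := τ0) h hI hz q).differentiableAt hn0
  have hNd := hasFDerivAt_comp_fst (q := q) ((contDiffAt_lapC h hI hz).differentiableAt hn0)
  have hXd := hasFDerivAt_comp_fst (q := q) ((contDiffAt_shiC h hI hz).differentiableAt hn0)
  have hτd : HasFDerivAt (fun x : Phase => (meanCurv τ0 x.1.1)⁻¹)
      ((-(-meanCurv τ0 z.1) / meanCurv τ0 z.1 ^ 2) • (fst ℝ ℝ E3).comp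
        (fst ℝ (ℝ × E3) E3)) (z, q) :=
    HasDerivAt.comp_hasFDerivAt (f := fun x : Phase => x.1.1) (z, q)
      ((hasDerivAt_meanCurv τ0 z.1).inv (meanCurv_ne hτ _))
      (hasFDerivAt_fst.comp (z, q) hasFDerivAt_fst)
  have hpd := hasFDerivAt_pair (hasFDerivAt_snd (𝕜 := ℝ) (p := (z, q))) hXd
  have h1 : HasFDerivAt (hamC S τ0 c) _ (z, q) :=
    hpd.fun_sub ((hτd.fun_mul hNd).fun_mul hEd.hasFDerivAt)
  have h7 := fderiv_pair (u := Prod.snd) (x := (z, q)) differentiableAt_snd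
    hXd.differentiableAt (v, η)
  rw [hpd.fderiv, fderiv_snd, hXd.fderiv] at h7
  rw [h1.fderiv]
  simp only [sub_apply, add_apply, smul_apply, smul_eq_mul, h7, comp_apply]
  simp only [ContinuousLinearMap.coe_fst', ContinuousLinearMap.coe_snd', hv]
  ring

/-- The energy flux `E ∂H/∂π = E X - τ N π^♯`: its second part gives the matter current. -/
lemma engC_mul_fderiv_hamC (hn : 1 ≤ n) (hτ : τ0 < 0) (q : E3) (a : Fin 3) :
    engC S τ0 c (z, q) * fderiv ℝ (hamC S τ0 c) (z, q) (0, e3 a) = engC S τ0 c (z, q) * shiC S c z a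
        - meanCurv τ0 z.1 * lapC S c z * velC S c (z, q) a := by
  have h1 := fderiv_hamC h hI hz hn hτ q 0 rfl (e3 a)
  have h2 := engC_mul_fderiv (τ0 := τ0) h hI hz hn q 0 (e3 a)
  have e1 : ∀ v : E3, pair (e3 a) v = v a := fun v => by
    simp [pair, e3]
  have e2 : ∀ w : E3, gq (dMat (metC S c) z 0) w w = 0 := fun w => by simp [gq, dMat]
  rw [e1, e2] at h2
  have e3 : pair q (0 : E3) = 0 := by simp [pair]
  have ht : (meanCurv τ0 z.1)⁻¹ * meanCurv τ0 z.1 ^ 2 = meanCurv τ0 z.1 := by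
    have := meanCurv_ne hτ z.1
    field_simp
  rw [h1, e1, map_zero, map_zero, e3]
  simp only [Prod.fst_zero] at h2
  linear_combination (-(meanCurv τ0 z.1)⁻¹ * lapC S c z) * h2
    - (lapC S c z * velC S c (z, q) a) * ht

/-- The divergence of `E` times the Hamiltonian vector field. The evolution equation of the metric
turns the derivative of the metric into `k`. -/
lemma bracket_eq (hn : 2 ≤ n) (hτ : τ0 < 0) (q : E3) :
    engC S τ0 c (z, q) * (fderiv ℝ (engC S τ0 c) (z, q) ((1, 0), 0)
      + ∑ a, (fderiv ℝ (fun x => engC S τ0 c x * fderiv ℝ (hamC S τ0 c) x (0, e3 a)) (z, q)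
            (frame3 a, 0)
          + fderiv ℝ (fun x => engC S τ0 c x * -fderiv ℝ (hamC S τ0 c) x (frame3 a, 0)) (z, q)
            (0, e3 a)))
      = -(meanCurv τ0 z.1 ^ 2) * lapC S c z * gq (kC S c z) (velC S c (z, q)) (velC S c (z, q))
        + meanCurv τ0 z.1 * engC S τ0 c (z, q)
          * ∑ a, velC S c (z, q) a * pderiv frame3 a (lapC S c) z := by
  have hn1 : 1 ≤ n := by omega
  have hn0 := natCast_ne_zero hn1
  have hτ' := meanCurv_ne hτ z.1
  have hE := (engC_pos (τ0 := τ0) h hz q).ne'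
  have hEd := (contDiffAt_engC (τ0 := τ0) h hI hz q).differentiableAt hn0
  have hH2 : ContDiffAt ℝ 2 (hamC S τ0 c) (z, q) :=
    (contDiffAt_hamC h hI hz hτ q).of_le (mod_cast hn)
  have hHd : ∀ u, DifferentiableAt ℝ (fun x => fderiv ℝ (hamC S τ0 c) x u) (z, q) := fun u =>
    (contDiffAt_fderiv_apply (m := 1) (y := fun _ => u) hH2 (by norm_num)
      contDiffAt_const).differentiableAt (by norm_num)
  set w := velC S c (z, q) with hw
  -- the mixed second derivatives of `H` cancel
  have h1 : ∀ a, fderiv ℝ (fun x => engC S τ0 c x * fderiv ℝ (hamC S τ0 c) x (0, e3 a)) (z, q)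
            (frame3 a, 0)
          + fderiv ℝ (fun x => engC S τ0 c x * -fderiv ℝ (hamC S τ0 c) x (frame3 a, 0)) (z, q)
            (0, e3 a)
      = fderiv ℝ (engC S τ0 c) (z, q) (frame3 a, 0) * fderiv ℝ (hamC S τ0 c) (z, q) (0, e3 a)
        - fderiv ℝ (engC S τ0 c) (z, q) (0, e3 a)
          * fderiv ℝ (hamC S τ0 c) (z, q) (frame3 a, 0) := by
    intro a
    rw [fderiv_fun_mul hEd (hHd _), fderiv_fun_mul hEd (hHd _).fun_neg, fderiv_fun_neg]
    simp only [add_apply, smul_apply, smul_eq_mul, neg_apply]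
    rw [fderiv_fderiv_comm hH2 (0, e3 a) (frame3 a, 0)]
    ring
  simp only [h1]
  have e1 : ∀ (a : Fin 3) (v : E3), pair (e3 a) v = v a := fun a v => by
    simp [pair, e3]
  have e0 : ∀ v : E3, pair (0 : E3) v = 0 := fun v => by simp [pair]
  have e2 : gq (dMat (metC S c) z 0) w w = 0 := by simp [gq, dMat]
  have hET := engC_mul_fderiv (τ0 := τ0) h hI hz hn1 q (1, 0) 0
  have hEy := fun a => engC_mul_fderiv (τ0 := τ0) h hI hz hn1 q (frame3 a) 0
  have hEp := fun a => engC_mul_fderiv (τ0 := τ0) h hI hz hn1 q 0 (e3 a)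
  have hHp := fun a => engC_mul_fderiv_hamC h hI hz hn1 hτ q a
  have hHy := fun a => fderiv_hamC h hI hz hn1 hτ q (frame3 a) rfl 0
  simp only [← hw, e0, e1, e2, Prod.fst_zero, frame3, mul_zero, zero_mul, neg_zero, zero_add,
    add_zero, one_mul, zero_sub, sub_self] at hET hEy hEp hHp hHy
  have hXc : ∀ (v : ℝ × E3) (d : Fin 3), fderiv ℝ (shiC S c) z v d
      = fderiv ℝ (fun w => shiC S c w d) z v := by
    intro v d
    have : HasFDerivAt (fun w => shiC S c w d) ((coordL d).comp (fderiv ℝ (shiC S c) z)) z :=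
      (coordL d).hasFDerivAt.comp z ((contDiffAt_shiC h hI hz).differentiableAt hn0).hasFDerivAt
    rw [this.fderiv]; rfl
  have hqw : ∀ d, q d = ∑ b, metC S c z d b * w b := by
    intro d
    rw [← mv_apply, hw, velC, mv_mv_inv (metC_posDef h hz)]
  have hvar : gq (fun a b => varC S c z a b) w w
      = gq (dMat (metC S c) z (1, 0)) w w + ∑ a, shiC S c z a * gq (dMat (metC S c) z (0, e3 a)) w w
        + 2 * ∑ a, w a * pair q (fderiv ℝ (shiC S c) z (0, e3 a)) := by
    have hs := posDef_symm (metC_posDef h hz)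
    simp only [gq, varC, dMat, pair, hXc, hqw, frame3, pderiv, sum_univ_three]
    rw [hs 1 0, hs 2 0, hs 2 1]
    ring
  have hvar2 : gq (fun a b => varC S c z a b) w w = 2 * lapC S c z * gq (kC S c z) w w
      - 2 * pair q w := by
    have : (fun a b => varC S c z a b) = fun a b => 2 * lapC S c z * kC S c z a b
        - 2 * metC S c z a b := by
      funext a b; exact varC_eq h hI hz hn1 a b
    rw [this]
    simp only [gq, pair, hqw, sum_univ_three]
    have hs := posDef_symm (metC_posDef h hz)
    rw [hs 1 0, hs 2 0, hs 2 1]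
    ring
  have hterm : ∀ a, engC S τ0 c (z, q) * (fderiv ℝ (engC S τ0 c) (z, q) (frame3 a, 0)
          * fderiv ℝ (hamC S τ0 c) (z, q) (0, e3 a)
        - fderiv ℝ (engC S τ0 c) (z, q) (0, e3 a) * fderiv ℝ (hamC S τ0 c) (z, q) (frame3 a, 0))
      = -(meanCurv τ0 z.1 ^ 2 / 2) * (shiC S c z a * gq (dMat (metC S c) z (0, e3 a)) w w)
        - meanCurv τ0 z.1 ^ 2 * (w a * pair q (fderiv ℝ (shiC S c) z (0, e3 a)))
        + meanCurv τ0 z.1 * engC S τ0 c (z, q) * (w a * pderiv frame3 a (lapC S c) z) := by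
    intro a
    have a1 := hEy a
    have a2 := hEp a
    have a3 := hHp a
    have a4 := hHy a
    simp only [frame3, pderiv]
    rw [a4]
    generalize fderiv ℝ (engC S τ0 c) (z, q) ((0, e3 a), 0) = Ey at *
    generalize fderiv ℝ (engC S τ0 c) (z, q) (0, e3 a) = Ep at *
    generalize fderiv ℝ (hamC S τ0 c) (z, q) (0, e3 a) = Hp at *
    generalize engC S τ0 c (z, q) = E at *
    generalize gq (dMat (metC S c) z (0, e3 a)) w w = ga at *
    generalize pair q (fderiv ℝ (shiC S c) z (0, e3 a)) = pq at *
    generalize meanCurv τ0 z.1 = t at *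
    have b1 : Ey = -(t ^ 2 / 2 * ga) / E := by field_simp; linarith
    have b2 : Ep = t ^ 2 * w a / E := by field_simp; linarith
    have b3 : Hp = (E * shiC S c z a - t * lapC S c z * w a) / E := by field_simp; linarith
    rw [b1, b2, b3]
    field_simp
    ring
  rw [mul_add, mul_sum]
  simp only [hterm]
  rw [hET]
  simp only [sum_add_distrib, sum_sub_distrib, ← mul_sum]
  rw [hvar2] at hvar
  linear_combination (meanCurv τ0 z.1 ^ 2 / 2) * hvar

end Matter

/-! ### The transport equation -/

section Matter

variable (S τ0 c) in
/-- The energy density in the coordinates `(T, y)`. -/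
def rhoC (z : ℝ × E3) : ℝ := S.rho τ0 z.1 (chartPt c z.2)

variable (S τ0 c) in
/-- The matter current in the coordinates `(T, y)`. -/
def curC (z : ℝ × E3) : E3 := vecComp (S.current τ0 z.1) c z.2

variable (S c) in
/-- The volume element in the coordinates `(T, y)`. -/
def volC (z : ℝ × E3) : ℝ := √(metC S c z).det

include h hI

lemma contDiffAt_integral_disC (hτ : τ0 < 0) {m : ℕ} (hm : m ≤ n) {Φ : Phase → ℝ}
    (hΦ : ∀ z ∈ domC I c, ∀ q, ContDiffAt ℝ m Φ (z, q)) {z : ℝ × E3} (hz : z ∈ domC I c) :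
    ContDiffAt ℝ m (fun z => ∫ q, disC S τ0 c (z, q) * Φ (z, q)) z := by
  have hO := isOpen_domC hI c
  refine (contDiffOn_integral_param hO m (fibreSupp_disC_mul h hI hτ Φ) fun x hx => ?_).contDiffAt
    (hO.mem_nhds hz)
  exact (((contDiffAt_disC h hI hx.1 hτ x.2).of_le (mod_cast hm)).mul
    (hΦ x.1 hx.1 x.2)).contDiffWithinAt

include hz

omit hI in
lemma volC_pos : 0 < volC S c z := sqrt_det_pos h hz

lemma contDiffAt_volC : ContDiffAt ℝ n (volC S c) z :=
  (contDiffAt_det (contDiffAt_metC h hI hz)).sqrt (metC_posDef h hz).det_pos.ne'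

lemma contDiffAt_rhoC (hτ : τ0 < 0) : ContDiffAt ℝ n (rhoC S τ0 c) z := by
  refine ((contDiffAt_integral_disC h hI hτ le_rfl (fun z hz q => contDiffAt_engC h hI hz q)
    hz).div (contDiffAt_volC h hI hz) (volC_pos h hz).ne').congr_of_eventuallyEq ?_
  filter_upwards [domC_mem_nhds hI hz] with w hw
  rw [Pi.div_apply, eq_div_iff (volC_pos h hw).ne']
  exact rho_mul_sqrt_det h hw hτ

lemma contDiffAt_curC (hτ : τ0 < 0) (a : Fin 3) : ContDiffAt ℝ n (fun z => curC S τ0 c z a) z := by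
  refine ((contDiffAt_integral_disC (Φ := fun x => velC S c x a) h hI hτ le_rfl
    (fun z hz q => contDiffAt_euclidean.1 (contDiffAt_velC h hI hz q) a)
    hz).div (contDiffAt_volC h hI hz) (volC_pos h hz).ne').congr_of_eventuallyEq ?_
  filter_upwards [domC_mem_nhds hI hz] with w hw
  rw [Pi.div_apply, eq_div_iff (volC_pos h hw).ne']
  exact current_mul_sqrt_det h hI hw hτ a

lemma contDiffAt_stressSource (hτ : τ0 < 0) {m : ℕ} (hm : m + 1 ≤ n) :
    ContDiffAt ℝ m (fun z : ℝ × E3 => S.stressSource τ0 z.1 (chartPt c z.2)) z := by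
  have hle : (m : ℕ∞ω) ≤ n := by exact_mod_cast (by omega : m ≤ n)
  have hΦ : ∀ z ∈ domC I c, ∀ q, ContDiffAt ℝ m (fun x : Phase =>
      gq (kC S c x.1) (velC S c x) (velC S c x) / engC S τ0 c x) (z, q) := by
    intro z hz q
    refine (contDiffAt_gq (fun i j => ?_) ((contDiffAt_velC h hI hz q).of_le hle)
      ((contDiffAt_velC h hI hz q).of_le hle)).div ((contDiffAt_engC h hI hz q).of_le hle)
      (engC_pos h hz q).ne'
    exact ContDiffAt.comp (f := Prod.fst) (z, q) (contDiffAt_kC h hI hz hm i j) contDiffAt_fst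
  refine ((((contDiffAt_lapC h hI hz).of_le hle).mul (contDiffAt_integral_disC h hI hτ (by omega)
    hΦ hz)).div ((contDiffAt_volC h hI hz).of_le hle)
    (volC_pos h hz).ne').congr_of_eventuallyEq ?_
  filter_upwards [domC_mem_nhds hI hz] with w hw
  rw [Pi.div_apply, eq_div_iff (volC_pos h hw).ne']
  exact stressSource_mul_sqrt_det h hI hw hτ

/-- Conservation of energy for the densitized energy density `ρ √g`. -/
lemma continuity_density (hn : 2 ≤ n) (hτ : τ0 < 0) :
    fderiv ℝ (fun w => rhoC S τ0 c w * volC S c w) z (1, 0)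
      + ∑ a, pderiv frame3 a (fun w => shiC S c w a * (rhoC S τ0 c w * volC S c w)
          - meanCurv τ0 w.1 * lapC S c w * (curC S τ0 c w a * volC S c w)) z
      = -(meanCurv τ0 z.1 ^ 2) * (S.stressSource τ0 z.1 (chartPt c z.2) * volC S c z)
        + meanCurv τ0 z.1 * ∑ a, pderiv frame3 a (lapC S c) z * (curC S τ0 c z a * volC S c z) := by
  have hn1 : 1 ≤ n := by omega
  have hn0 := natCast_ne_zero hn1
  have hO := isOpen_domC hI c
  have hev := hO.mem_nhds hz
  have h1n : ((1 : ℕ) : ℕ∞ω) ≤ n := by exact_mod_cast hn1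
  set Φ : Fin 3 → Phase → ℝ :=
    fun a x => engC S τ0 c x * fderiv ℝ (hamC S τ0 c) x (0, e3 a) with hΦ
  set Ψ : Fin 3 → Phase → ℝ :=
    fun a x => engC S τ0 c x * -fderiv ℝ (hamC S τ0 c) x (frame3 a, 0) with hΨ
  have hcH : ∀ z ∈ domC I c, ∀ q u, ContDiffAt ℝ 1 (fun x => fderiv ℝ (hamC S τ0 c) x u) (z, q) :=
    fun z hz q u => contDiffAt_fderiv_apply (m := 1) (n := 2) (y := fun _ => u)
      ((contDiffAt_hamC h hI hz hτ q).of_le (mod_cast hn)) (by norm_num) contDiffAt_const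
  have hcE : ∀ z ∈ domC I c, ∀ q, ContDiffAt ℝ 1 (engC S τ0 c) (z, q) := fun z hz q =>
    (contDiffAt_engC h hI hz q).of_le h1n
  have hcF : ∀ z ∈ domC I c, ∀ q, ContDiffAt ℝ 1 (disC S τ0 c) (z, q) := fun z hz q =>
    (contDiffAt_disC h hI hz hτ q).of_le h1n
  have hcΦ : ∀ a, ∀ z ∈ domC I c, ∀ q, ContDiffAt ℝ 1 (Φ a) (z, q) := fun a z hz q =>
    (hcE z hz q).mul (hcH z hz q _)
  have hcΨ : ∀ a, ∀ z ∈ domC I c, ∀ q, ContDiffAt ℝ 1 (Ψ a) (z, q) := fun a z hz q =>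
    (hcE z hz q).mul (hcH z hz q _).neg
  have hon : ∀ {Θ : Phase → ℝ} (_ : ∀ z ∈ domC I c, ∀ q, ContDiffAt ℝ 1 Θ (z, q)),
      ContDiffOn ℝ 1 (fun x => disC S τ0 c x * Θ x) (domC I c ×ˢ univ) := fun hΘ x hx =>
    ((hcF x.1 hx.1 x.2).mul (hΘ x.1 hx.1 x.2)).contDiffWithinAt
  -- the terms of the equation as integrals over momentum space
  have hρ := fderiv_integral_param hO (fibreSupp_disC_mul h hI hτ _) (hon hcE) hz (1, 0)
  have hΦi := fun a =>
    fderiv_integral_param hO (fibreSupp_disC_mul h hI hτ _) (hon (hcΦ a)) hz (frame3 a)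
  have hΨi := fun a =>
    integral_fderiv_fibre_eq_zero hO (fibreSupp_disC_mul h hI hτ _) (hon (hcΨ a)) hz (e3 a)
  have hr : (fun w => rhoC S τ0 c w * volC S c w) =ᶠ[𝓝 z]
      fun w => ∫ q, disC S τ0 c (w, q) * engC S τ0 c (w, q) := by
    filter_upwards [hev] with w hw using rho_mul_sqrt_det h hw hτ
  have hflux : ∀ a, (fun w => shiC S c w a * (rhoC S τ0 c w * volC S c w)
        - meanCurv τ0 w.1 * lapC S c w * (curC S τ0 c w a * volC S c w)) =ᶠ[𝓝 z]
      fun w => ∫ q, disC S τ0 c (w, q) * Φ a (w, q) := by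
    intro a
    filter_upwards [hev] with w hw
    have e1 : rhoC S τ0 c w * volC S c w = _ := rho_mul_sqrt_det h hw hτ
    have e2 : curC S τ0 c w a * volC S c w = _ := current_mul_sqrt_det h hI hw hτ a
    rw [e1, e2, ← integral_const_mul, ← integral_const_mul, ← integral_sub]
    · refine integral_congr_ae (.of_forall fun q => ?_)
      simp only [hΦ]
      rw [engC_mul_fderiv_hamC h hI hw hn1 hτ]
      ring
    · exact (integrable_disC_mul h hI hw hτ fun x hx =>
        (hcE x.1 hx.1 x.2).continuousAt).const_mul _
    · exact (integrable_velC h hI hw hτ a).const_mul _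
  have hadd := fun a => (integral_add (hΦi a).1 (hΨi a).1).trans
    ((congrArg (_ + ·) (hΨi a).2).trans (add_zero _))
  have hi := fun a => (hΦi a).1.fun_add (hΨi a).1
  simp only [pderiv, (hflux _).fderiv_eq, (hΦi _).2, ← hadd]
  rw [hr.fderiv_eq, hρ.2, ← integral_finsetSum _ fun a _ => hi a,
    ← integral_add hρ.1 (integrable_finsetSum _ fun a _ => hi a)]
  -- pointwise evaluation of the integrand, by the Vlasov equation
  have hpt : ∀ q, fderiv ℝ (fun x => disC S τ0 c x * engC S τ0 c x) (z, q) ((1, 0), 0)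
        + ∑ a, (fderiv ℝ (fun x => disC S τ0 c x * Φ a x) (z, q) (frame3 a, 0)
          + fderiv ℝ (fun x => disC S τ0 c x * Ψ a x) (z, q) (0, e3 a))
      = -(meanCurv τ0 z.1 ^ 2) * lapC S c z * (disC S τ0 c (z, q)
          * (gq (kC S c z) (velC S c (z, q)) (velC S c (z, q)) / engC S τ0 c (z, q)))
        + meanCurv τ0 z.1 * ∑ a, fderiv ℝ (lapC S c) z (frame3 a)
          * (disC S τ0 c (z, q) * velC S c (z, q) a) := by
    intro q
    have hE := (engC_pos (τ0 := τ0) h hz q).ne'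
    have hFd := (hcF z hz q).differentiableAt (by norm_num)
    have hEd := (hcE z hz q).differentiableAt (by norm_num)
    have hΦd := fun a => (hcΦ a z hz q).differentiableAt (by norm_num)
    have hΨd := fun a => (hcΨ a z hz q).differentiableAt (by norm_num)
    have hb := bracket_eq h hI hz hn hτ q
    set V : E3 := shiC S c z - (meanCurv τ0 z.1 * lapC S c z / engC S τ0 c (z, q)) • velC S c (z, q)
      with hV
    set K : E3 := WithLp.toLp 2 fun a => -fderiv ℝ (hamC S τ0 c) (z, q) ((0, e3 a), 0) with hK
    have hv := vlasov_canonical h hI hz hn1 hτ q hV (K := K) fun a => rfl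
    have hdir : ((1, V), K) = (((1 : ℝ), (0 : E3)), (0 : E3)) + ∑ a, V a • ((frame3 a, 0) : Phase)
        + ∑ a, K a • ((0, e3 a) : Phase) := by
      refine Prod.ext (Prod.ext ?_ ?_) ?_
      · simp [frame3, Prod.fst_sum]
      · simp only [frame3, Prod.fst_add, Prod.snd_add, Prod.fst_sum, Prod.snd_sum, Prod.smul_fst,
          Prod.smul_snd, smul_zero, sum_const_zero, add_zero, zero_add]
        exact e3_expand V
      · simp only [Prod.snd_add, Prod.snd_sum, Prod.smul_snd, smul_zero, sum_const_zero, zero_add]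
        exact e3_expand K
    rw [hdir] at hv
    simp only [map_add, map_sum, map_smul, smul_eq_mul] at hv
    have hVa : ∀ a, Φ a (z, q) = engC S τ0 c (z, q) * V a := by
      intro a
      simp only [hΦ]
      rw [engC_mul_fderiv_hamC h hI hz hn1 hτ, hV]
      simp only [PiLp.sub_apply, PiLp.smul_apply, smul_eq_mul]
      field_simp
    have hKa : ∀ a, Ψ a (z, q) = engC S τ0 c (z, q) * K a := fun a => rfl
    rw [fderiv_fun_mul hFd hEd]
    have e1 : ∀ a, fderiv ℝ (fun x => disC S τ0 c x * Φ a x) (z, q) (frame3 a, 0)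
        = disC S τ0 c (z, q) * fderiv ℝ (Φ a) (z, q) (frame3 a, 0)
          + engC S τ0 c (z, q) * V a * fderiv ℝ (disC S τ0 c) (z, q) (frame3 a, 0) := fun a => by
      rw [fderiv_fun_mul hFd (hΦd a), ← hVa]; rfl
    have e2 : ∀ a, fderiv ℝ (fun x => disC S τ0 c x * Ψ a x) (z, q) (0, e3 a)
        = disC S τ0 c (z, q) * fderiv ℝ (Ψ a) (z, q) (0, e3 a)
          + engC S τ0 c (z, q) * K a * fderiv ℝ (disC S τ0 c) (z, q) (0, e3 a) := fun a => by
      rw [fderiv_fun_mul hFd (hΨd a), ← hKa]; rfl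
    simp only [e1, e2, add_apply, smul_apply, smul_eq_mul]
    simp only [sum_univ_three, pderiv] at hv hb ⊢
    have hg : gq (kC S c z) (velC S c (z, q)) (velC S c (z, q)) = engC S τ0 c (z, q)
        * (gq (kC S c z) (velC S c (z, q)) (velC S c (z, q)) / engC S τ0 c (z, q)) := by field_simp
    rw [hg] at hb
    refine mul_left_cancel₀ hE ?_
    linear_combination disC S τ0 c (z, q) * hb + engC S τ0 c (z, q) * engC S τ0 c (z, q) * hv
  simp only [hpt]
  rw [integral_add, integral_const_mul, integral_const_mul, integral_finsetSum]
  · have e1 : S.stressSource τ0 z.1 (chartPt c z.2) * volC S c z = _ :=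
      stressSource_mul_sqrt_det h hI hz hτ
    have e2 : ∀ a, curC S τ0 c z a * volC S c z = _ := fun a => current_mul_sqrt_det h hI hz hτ a
    rw [e1]
    simp only [e2, integral_const_mul]
    ring
  · exact fun a _ => (integrable_velC h hI hz hτ a).const_mul _
  · exact (integrable_disC_mul h hI hz hτ fun x hx =>
      continuousAt_gq_velC h hI hx.1 hn1 x.2).const_mul _
  · exact (integrable_finsetSum _ fun a _ => (integrable_velC h hI hz hτ a).const_mul _).const_mul _

end Matter

section Matter

variable (S c) in
/-- The components of the shift vector field. -/
def shiF (d : Fin 3) (z : ℝ × E3) : ℝ := shiC S c z d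

variable (S c) in
/-- The vector field `∂_T + X` in the coordinates `(T, y)`. -/
def traC (z : ℝ × E3) : ℝ × E3 := vfield (1, 0) frame3 (shiF S c) z

lemma traC_eq (z : ℝ × E3) : traC S c z = (1, shiC S c z) := by
  refine Prod.ext ?_ ?_
  · simp [traC, vfield, frame3, Prod.fst_sum]
  · simp only [traC, vfield, frame3, Prod.snd_add, Prod.snd_sum, Prod.smul_snd, zero_add]
    exact (e3_expand _).symm

variable (S τ0) in
/-- The right-hand side of the transport equation `∂_T ρ + X ρ = F`. -/
def rhoSource (T : ℝ) (x : M) : ℝ :=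
  (3 - S.lapse T x) * S.rho τ0 T x - meanCurv τ0 T ^ 2 * S.stressSource τ0 T x
    + meanCurv τ0 T * S.currentSource τ0 T x

include h hI hz

lemma christoffel_slice (hn : 1 ≤ n) (l m k : Fin 3) :
    christoffel e3 (bilinComp (S.g z.1) c) z.2 l m k = christoffel frame3 (metC S c) z l m k := by
  have hG := fun i j => (contDiffAt_metC h hI hz i j).differentiableAt (natCast_ne_zero hn)
  simp only [christoffel]
  congr 1
  refine sum_congr rfl fun s _ => ?_
  rw [← pderiv_slice (hG s k), ← pderiv_slice (hG s m), ← pderiv_slice (hG m k)]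
  rfl

omit hI in
/-- The contracted Christoffel symbols are the logarithmic derivative of the volume element. -/
lemma sum_christoffel (b : Fin 3) : ∑ a, christoffel frame3 (metC S c) z a a b
    = 1 / 2 * ((metC S c z)⁻¹ * dMat (metC S c) z (frame3 b)).trace := by
  have hinv := posDef_symm (metC_posDef h hz).inv
  simp only [christoffel, Matrix.trace, Matrix.diag, mul_apply, sum_univ_three,
    hinv 1 0, hinv 2 0, hinv 2 1, dMat, pderiv]
  ring

omit h hI hz in
lemma varMat_eq (z : ℝ × E3) : dMat (metC S c) z (traC S c z)
      + (gradX frame3 (shiF S c) z).transpose * metC S c z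
      + metC S c z * gradX frame3 (shiF S c) z = Matrix.of (varC S c z) := by
  ext a b
  have h1 : dMat (metC S c) z (traC S c z) a b = fderiv ℝ (fun w => metC S c w a b) z (1, 0)
      + ∑ d, shiC S c z d * pderiv frame3 d (fun w => metC S c w a b) z := by
    simp only [dMat, traC, vfield, map_add, map_sum, map_smul, smul_eq_mul]; rfl
  simp only [Matrix.add_apply, h1, mul_apply, transpose_apply, gradX, varC,
    sum_add_distrib, Matrix.of_apply]
  have e1 : ∑ x, pderiv frame3 a (shiF S c x) z * metC S c z x b
      = ∑ x, metC S c z x b * pderiv frame3 a (fun w => shiC S c w x) z :=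
    sum_congr rfl fun _ _ => mul_comm _ _
  have e2 : ∑ x, metC S c z a x * pderiv frame3 b (shiF S c x) z
      = ∑ x, metC S c z a x * pderiv frame3 b (fun w => shiC S c w x) z := rfl
  linarith

/-- `Σ` is trace-free: it does not contribute to the change of the volume. -/
lemma trace_varMat (hn : 1 ≤ n) :
    ((metC S c z)⁻¹ * Matrix.of (varC S c z)).trace = 2 * lapC S c z - 6 := by
  have h1 : Matrix.of (varC S c z) = (2 * lapC S c z) • bilinComp (S.Sig z.1) c z.2
      + (2 * lapC S c z / 3 - 2) • metC S c z := by
    ext a b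
    show varC S c z a b = 2 * lapC S c z * bilinComp (S.Sig z.1) c z.2 a b
      + (2 * lapC S c z / 3 - 2) * metC S c z a b
    rw [varC_eq h hI hz hn, kC_eq]; ring
  have h2 : ((metC S c z)⁻¹ * bilinComp (S.Sig z.1) c z.2).trace = 0 :=
    h.Sig_trace z.1 hz.1 c z.2 hz.2
  rw [h1, Matrix.mul_add, Matrix.mul_smul, Matrix.mul_smul, Matrix.trace_add, Matrix.trace_smul,
    Matrix.trace_smul, h2, nonsing_inv_mul _ (metC_posDef h hz).det_pos.ne'.isUnit]
  simp
  ring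

lemma fderiv_volC_traC (hn : 1 ≤ n) : fderiv ℝ (volC S c) z (traC S c z)
    = volC S c z * (lapC S c z - 3 - (gradX frame3 (shiF S c) z).trace) := by
  have hG := fun i j => (contDiffAt_metC h hI hz i j).differentiableAt (natCast_ne_zero hn)
  have h1 := fderiv_sqrt_det (v₀ := ((1 : ℝ), (0 : E3))) (b := frame3) (X := shiF S c) hG
    (metC_posDef h hz).det_pos
  have h2 := varMat_eq (S := S) (c := c) z
  unfold traC at h2 ⊢
  rw [h2, trace_varMat h hI hz hn] at h1
  refine h1.trans ?_
  rw [volC]; ring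

lemma fderiv_volC_frame3 (hn : 1 ≤ n) (a : Fin 3) : pderiv frame3 a (volC S c) z
    = volC S c z * ∑ b, christoffel frame3 (metC S c) z b b a := by
  have hG := fun i j => (contDiffAt_metC h hI hz i j).differentiableAt (natCast_ne_zero hn)
  have h1 := fderiv_sqrt_det (v₀ := frame3 a) (b := frame3) (X := fun _ _ => 0) hG
    (metC_posDef h hz).det_pos
  have e1 : vfield (frame3 a) frame3 (fun (_ : Fin 3) (_ : ℝ × E3) => (0 : ℝ)) z = frame3 a := by
    simp [vfield]
  have e2 : gradX frame3 (fun (_ : Fin 3) (_ : ℝ × E3) => (0 : ℝ)) z = 0 := by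
    ext i j; simp [gradX, pderiv]
  rw [e1, e2] at h1
  rw [sum_christoffel h hz]
  refine h1.trans ?_
  simp [volC]

/-- The transport equation of the energy density, in local coordinates. -/
lemma transport_local (hn : 2 ≤ n) (hτ : τ0 < 0) :
    fderiv ℝ (rhoC S τ0 c) z (traC S c z) = (3 - lapC S c z) * rhoC S τ0 c z
      - meanCurv τ0 z.1 ^ 2 * S.stressSource τ0 z.1 (chartPt c z.2)
      + meanCurv τ0 z.1 * ((lapC S c z)⁻¹ * ∑ a,
        (pderiv frame3 a (fun w => lapC S c w ^ 2 * curC S τ0 c w a) z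
          + ∑ b, christoffel frame3 (metC S c) z a a b * (lapC S c z ^ 2 * curC S τ0 c z b))) := by
  have hn1 : 1 ≤ n := by omega
  have hn0 := natCast_ne_zero hn1
  have hs0 := (volC_pos h hz).ne'
  have hN0 := (lapC_pos h hz).ne'
  have hρ := (contDiffAt_rhoC h hI hz hτ).differentiableAt hn0
  have hs := (contDiffAt_volC h hI hz).differentiableAt hn0
  have hN := (contDiffAt_lapC h hI hz).differentiableAt hn0
  have hj := fun a => (contDiffAt_curC h hI hz hτ a).differentiableAt hn0
  have hX := fun d => (contDiffAt_euclidean.1 (contDiffAt_shiC h hI hz) d).differentiableAt hn0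
  have hτd : HasFDerivAt (fun w : ℝ × E3 => meanCurv τ0 w.1)
      ((-meanCurv τ0 z.1) • fst ℝ ℝ E3) z :=
    HasDerivAt.comp_hasFDerivAt (h₂ := meanCurv τ0) z (hasDerivAt_meanCurv τ0 z.1) hasFDerivAt_fst
  have hflux : ∀ a, pderiv frame3 a (fun w => shiC S c w a * (rhoC S τ0 c w * volC S c w)
          - meanCurv τ0 w.1 * lapC S c w * (curC S τ0 c w a * volC S c w)) z
      = pderiv frame3 a (fun w => shiC S c w a) z * (rhoC S τ0 c z * volC S c z)
        + shiC S c z a * (pderiv frame3 a (rhoC S τ0 c) z * volC S c z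
          + rhoC S τ0 c z * pderiv frame3 a (volC S c) z)
        - meanCurv τ0 z.1 * (pderiv frame3 a (lapC S c) z * (curC S τ0 c z a * volC S c z)
          + lapC S c z * (pderiv frame3 a (fun w => curC S τ0 c w a) z * volC S c z
          + curC S τ0 c z a * pderiv frame3 a (volC S c) z)) := by
    intro a
    have h1 := ((hX a).hasFDerivAt.fun_mul (hρ.hasFDerivAt.fun_mul hs.hasFDerivAt)).fun_sub
      ((hτd.fun_mul hN.hasFDerivAt).fun_mul ((hj a).hasFDerivAt.fun_mul hs.hasFDerivAt))
    have e0 : (fst ℝ ℝ E3) (frame3 a) = 0 := rfl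
    simp only [pderiv]
    rw [h1.fderiv]
    simp only [sub_apply, add_apply, smul_apply, smul_eq_mul, e0]
    ring
  have hdiv : ∀ a, pderiv frame3 a (fun w => lapC S c w ^ 2 * curC S τ0 c w a) z
      = 2 * lapC S c z * pderiv frame3 a (lapC S c) z * curC S τ0 c z a
        + lapC S c z ^ 2 * pderiv frame3 a (fun w => curC S τ0 c w a) z := by
    intro a
    have h1 := (hN.hasFDerivAt.fun_mul hN.hasFDerivAt).fun_mul (hj a).hasFDerivAt
    simp only [pderiv, sq]
    rw [h1.fderiv]
    simp only [add_apply, smul_apply, smul_eq_mul]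
    ring
  have hc := continuity_density h hI hz hn hτ
  have hv := fderiv_volC_traC h hI hz hn1
  have hva := fderiv_volC_frame3 h hI hz hn1
  rw [fderiv_fun_mul hρ hs] at hc
  simp only [hflux, add_apply, smul_apply, smul_eq_mul] at hc
  have hswap : ∑ a, (pderiv frame3 a (fun w => lapC S c w ^ 2 * curC S τ0 c w a) z
          + ∑ b, christoffel frame3 (metC S c) z a a b * (lapC S c z ^ 2 * curC S τ0 c z b))
      = ∑ a, (2 * lapC S c z * pderiv frame3 a (lapC S c) z * curC S τ0 c z a
        + lapC S c z ^ 2 * pderiv frame3 a (fun w => curC S τ0 c w a) z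
        + (∑ b, christoffel frame3 (metC S c) z b b a) * (lapC S c z ^ 2 * curC S τ0 c z a)) := by
    have e : ∑ a, ∑ b, christoffel frame3 (metC S c) z a a b * (lapC S c z ^ 2 * curC S τ0 c z b)
        = ∑ a, (∑ b, christoffel frame3 (metC S c) z b b a)
          * (lapC S c z ^ 2 * curC S τ0 c z a) := by
      rw [sum_comm]
      exact sum_congr rfl fun a _ => (sum_mul _ _ _).symm
    rw [sum_add_distrib, e, ← sum_add_distrib]
    exact sum_congr rfl fun a _ => by rw [hdiv]
  rw [hswap]
  have etr : ∀ f : ℝ × E3 → ℝ, fderiv ℝ f z (traC S c z) = fderiv ℝ f z (1, 0)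
      + ∑ a, shiC S c z a * pderiv frame3 a f z := by
    intro f
    simp only [traC, vfield, map_add, map_sum, map_smul, smul_eq_mul]; rfl
  rw [etr] at hv ⊢
  simp only [hva] at hc hv
  simp only [gradX, Matrix.trace, Matrix.diag] at hv
  generalize fderiv ℝ (volC S c) z (1, 0) = sT at *
  generalize fderiv ℝ (rhoC S τ0 c) z (1, 0) = rT at *
  generalize S.stressSource τ0 z.1 (chartPt c z.2) = SS at *
  have hθ : ∀ a, ∃ t, ∑ b, christoffel frame3 (metC S c) z b b a = t := fun a => ⟨_, rfl⟩
  choose θ hθ using hθ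
  simp only [hθ] at hc hv ⊢
  have hsh : ∀ d, pderiv frame3 d (shiF S c d) z = pderiv frame3 d (fun w => shiC S c w d) z :=
    fun d => rfl
  simp only [sum_univ_three, hsh] at hc hv ⊢
  field_simp
  refine mul_left_cancel₀ hs0 ?_
  linear_combination hc - rhoC S τ0 c z * hv

end Matter

section Matter

/-- A function of time and position, differentiated along `∂_T + X`, gives a function on `M` that
does not depend on the chart. -/
lemma fderiv_traC_trans {φ : ℝ → M → ℝ} {z : ℝ × E3} (hy : z.2 ∈ overlap c c')
    (hφ : DifferentiableAt ℝ (fun w : ℝ × E3 => φ w.1 (chartPt c' w.2)) (z.1, trans c c' z.2)) :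
    fderiv ℝ (fun w : ℝ × E3 => φ w.1 (chartPt c w.2)) z (traC S c z)
      = fderiv ℝ (fun w : ℝ × E3 => φ w.1 (chartPt c' w.2)) (z.1, trans c c' z.2)
        (traC S c' (z.1, trans c c' z.2)) := by
  have h1 : (fun w : ℝ × E3 => φ w.1 (chartPt c w.2)) =ᶠ[𝓝 z]
      fun w => φ w.1 (chartPt c' (trans c c' w.2)) := by
    have : ∀ᶠ w : ℝ × E3 in 𝓝 z, w.2 ∈ overlap c c' :=
      continuousAt_snd.eventually ((isOpen_overlap c c').mem_nhds hy)
    filter_upwards [this] with w hw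
    rw [chartPt_trans hw]
  have h2 : HasFDerivAt (trans c c') (fderiv ℝ (trans c c') z.2) z.2 :=
    ((contDiffAt_trans hy).differentiableAt (by simp)).hasFDerivAt
  have h3 : HasFDerivAt (fun w : ℝ × E3 => (w.1, trans c c' w.2)) _ z :=
    hasFDerivAt_fst.prodMk (h2.comp z hasFDerivAt_snd)
  have h4 := HasFDerivAt.comp (f := fun w : ℝ × E3 => (w.1, trans c c' w.2)) z hφ.hasFDerivAt h3
  have h5 : fderiv ℝ (fun w : ℝ × E3 => φ w.1 (chartPt c' (trans c c' w.2))) z = _ := h4.fderiv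
  rw [h1.fderiv_eq, h5, comp_apply, traC_eq, traC_eq]
  congr 1
  refine Prod.ext rfl ?_
  exact (vecComp_transform (S.shift z.1) hy).symm

include h hI

/-- The transport equation `∂_T ρ + X ρ = (3 - N) ρ - τ² N k_{ab} Tᵃᵇ + τ N⁻¹ div (N² j)`. -/
lemma transport (hn : 2 ≤ n) (hτ : τ0 < 0) {z : ℝ × E3} (hz : z ∈ domC I c) :
    fderiv ℝ (rhoC S τ0 c) z (traC S c z) = rhoSource S τ0 z.1 (chartPt c z.2) := by
  set x := chartPt c z.2 with hx
  have hy := mem_overlap_self (c := c) hz.2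
  have hz' : (z.1, trans c x z.2) ∈ domC I x := ⟨hz.1, (trans_mem hy).1⟩
  have hpt : chartPt x (trans c x z.2) = x := chartPt_trans hy
  have h1 := transport_local h hI hz' hn hτ
  have h2 := fderiv_traC_trans (S := S) (φ := S.rho τ0) hy
    ((contDiffAt_rhoC h hI hz' hτ).differentiableAt (natCast_ne_zero (by omega)))
  have h3 : fderiv ℝ (rhoC S τ0 c) z (traC S c z) = _ := h2
  rw [h3]
  refine Eq.trans h1 ?_
  simp only [rhoC, lapC, rhoSource, hpt]
  congr 2
  rw [RescaledVars.currentSource, divergence]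
  congr 1
  refine sum_congr rfl fun a _ => ?_
  have hcd : DifferentiableAt ℝ (fun w => lapC S x w ^ 2 * curC S τ0 x w a) (z.1, trans c x z.2) :=
    (((contDiffAt_lapC h hI hz').pow 2).mul (contDiffAt_curC h hI hz' hτ a)).differentiableAt
      (natCast_ne_zero (by omega))
  have hv : ∀ y a, vecComp (fun p => (S.lapse z.1 p) ^ 2 • S.current τ0 z.1 p) x y a
      = lapC S x (z.1, y) ^ 2 * curC S τ0 x (z.1, y) a := by
    intro y a
    rw [vecComp_eq, map_smul]; rfl
  have htr : trans c x z.2 = chartAt E3 x x := rfl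
  simp only [hv]
  rw [← htr]
  congr 1
  · exact (pderiv_slice hcd a).symm
  · refine sum_congr rfl fun b _ => ?_
    rw [← christoffel_slice h hI hz' (by omega)]
    simp only [lapC, hpt]

omit h hI in
lemma contDiffOn_slice {m : ℕ∞ω} {f : ℝ × E3 → ℝ} {T : ℝ} {s : Set E3}
    (hf : ∀ y ∈ s, ContDiffAt ℝ m f (T, y)) : ContDiffOn ℝ m (fun y => f (T, y)) s := fun y hy =>
  (ContDiffAt.comp (f := fun y : E3 => (T, y)) y (hf y hy) (by fun_prop)).contDiffWithinAt

lemma tsmooth_rho (hτ : τ0 < 0) (hT : T ∈ I) : TSmooth (n : ℕ∞ω) (ofFun (S.rho τ0 T)) := fun _ _ =>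
  contDiffOn_slice fun _ hy => contDiffAt_rhoC h hI (z := (T, _)) ⟨hT, hy⟩ hτ

lemma tsmooth_lapse (hT : T ∈ I) : TSmooth (n : ℕ∞ω) (ofFun fun x => 3 - S.lapse T x) := fun c _ =>
  contDiffOn_const.sub (contDiffOn_slice (f := lapC S c) fun _ hy =>
    contDiffAt_lapC h hI (z := (T, _)) ⟨hT, hy⟩)

lemma tsmooth_stressSource (hτ : τ0 < 0) (hT : T ∈ I) {m : ℕ} (hm : m + 1 ≤ n) :
    TSmooth (m : ℕ∞ω) (ofFun (S.stressSource τ0 T)) := fun c _ =>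
  contDiffOn_slice (f := fun z : ℝ × E3 => S.stressSource τ0 z.1 (chartPt c z.2)) fun _ hy =>
    contDiffAt_stressSource h hI (z := (T, _)) ⟨hT, hy⟩ hτ hm

omit h hI in
lemma contDiffAt_traC {m : ℕ∞ω} {z : ℝ × E3} (hX : ContDiffAt ℝ m (shiC S c) z) :
    ContDiffAt ℝ m (traC S c) z := by
  have : traC S c = fun z => (1, shiC S c z) := funext fun z => traC_eq z
  rw [this]
  exact contDiffAt_const.prodMk hX

lemma tsmooth_rhoSource (hn : 2 ≤ n) (hτ : τ0 < 0) (hT : T ∈ I) {m : ℕ} (hm : m + 1 ≤ n) :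
    TSmooth (m : ℕ∞ω) (ofFun (rhoSource S τ0 T)) := by
  intro c a
  have hm' : (m : ℕ∞ω) + 1 ≤ n := by exact_mod_cast hm
  have hle : (m : ℕ∞ω) ≤ n := by exact_mod_cast (by omega : m ≤ n)
  refine (contDiffOn_slice (f := fun z => fderiv ℝ (rhoC S τ0 c) z (traC S c z)) (T := T)
    fun y hy => ?_).congr fun y hy => ?_
  · have hz : ((T, y) : ℝ × E3) ∈ domC I c := ⟨hT, hy⟩
    exact contDiffAt_fderiv_apply (contDiffAt_rhoC h hI hz hτ) hm'
      (contDiffAt_traC ((contDiffAt_shiC h hI hz).of_le hle))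
  · exact (transport h hI hn hτ (z := (T, y)) ⟨hT, hy⟩).symm

lemma tsmooth_currentSource (hn : 2 ≤ n) (hτ : τ0 < 0) (hT : T ∈ I) {m : ℕ} (hm : m + 1 ≤ n) :
    TSmooth (m : ℕ∞ω) (ofFun (S.currentSource τ0 T)) := by
  intro c a
  have hle : (m : ℕ∞ω) ≤ n := by exact_mod_cast (by omega : m ≤ n)
  have h1 := tsmooth_rhoSource h hI hn hτ hT hm c a
  have h2 := (tsmooth_lapse h hI hT c a).of_le hle
  have h3 := (tsmooth_rho h hI hτ hT c a).of_le hle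
  have h4 := tsmooth_stressSource h hI hτ hT hm c a
  refine ((((h1.sub (h2.mul h3)).add (h4.const_smul (meanCurv τ0 T ^ 2))).const_smul
    (meanCurv τ0 T)⁻¹)).congr fun y hy => ?_
  have := meanCurv_ne hτ T
  simp only [ofFun, rhoSource, smul_eq_mul]
  field_simp
  ring

lemma tsmooth_k (hT : T ∈ I) {m : ℕ} (hm : m + 1 ≤ n) :
    TSmooth (m : ℕ∞ω) (ofBilin fun x => S.lapse T x • S.k T x) := by
  intro c a
  have hle : (m : ℕ∞ω) ≤ n := by exact_mod_cast (by omega : m ≤ n)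
  exact contDiffOn_slice (f := fun z => lapC S c z * kC S c z (a 0) (a 1)) fun y hy =>
    ((contDiffAt_lapC h hI (z := (T, y)) ⟨hT, hy⟩).of_le hle).mul
      (contDiffAt_kC h hI (z := (T, y)) ⟨hT, hy⟩ hm _ _)

lemma tsmooth_Sig (hT : T ∈ I) {m : ℕ} (hm : m + 1 ≤ n) :
    TSmooth (m : ℕ∞ω) (ofBilin fun x => S.lapse T x • S.Sig T x) := by
  intro c a
  have hle : (m : ℕ∞ω) ≤ n := by exact_mod_cast (by omega : m ≤ n)
  refine (contDiffOn_slice (f := fun z => lapC S c z * (kC S c z (a 0) (a 1)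
      - 1 / 3 * metC S c z (a 0) (a 1))) (T := T) fun y hy =>
    ((contDiffAt_lapC h hI (z := (T, y)) ⟨hT, hy⟩).of_le hle).mul
      ((contDiffAt_kC h hI (z := (T, y)) ⟨hT, hy⟩ hm _ _).sub
      (((contDiffAt_metC h hI (z := (T, y)) ⟨hT, hy⟩ _ _).of_le hle).const_smul
        (1 / 3 : ℝ)))).congr fun y hy => ?_
  rw [kC_eq]
  show _ * bilinComp (S.Sig T) c y (a 0) (a 1) = _
  simp [lapC]

end Matter

/-! ### Differentiation of integrals over the slices -/

section Flat

variable {I : Set ℝ} {T : ℝ} {O K : Set E3} {f : ℝ × E3 → ℝ}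

lemma indicator_eventuallyEq (hO : IsOpen O) {z : ℝ × E3} (hz : z.2 ∈ O) :
    (univ ×ˢ O).indicator f =ᶠ[𝓝 z] f := by
  filter_upwards [(isOpen_univ.prod hO).mem_nhds ⟨mem_univ _, hz⟩] with w hw
    using indicator_of_mem hw f

lemma indicator_eventuallyEq_zero (hK : IsClosed K) (h0 : ∀ t, ∀ y ∈ O, y ∉ K → f (t, y) = 0)
    {z : ℝ × E3} (hz : z.2 ∉ K) : (univ ×ˢ O).indicator f =ᶠ[𝓝 z] fun _ => 0 := by
  filter_upwards [(isOpen_univ.prod hK.isOpen_compl).mem_nhds ⟨mem_univ _, hz⟩] with w hw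
  by_cases h : w.2 ∈ O
  · rw [indicator_of_mem (mk_mem_prod (mem_univ _) h)]; exact h0 w.1 w.2 h hw.2
  · exact indicator_of_notMem (fun h' => h h'.2) f

/-- A family of functions with support in a fixed compact set, extended by zero. -/
lemma extend_by_zero (hO : IsOpen O) (hK : IsCompact K) (hKO : K ⊆ O)
    (hf : ContDiffOn ℝ 1 f (I ×ˢ O)) (hI : IsOpen I) (h0 : ∀ t, ∀ y ∈ O, y ∉ K → f (t, y) = 0) :
    ContDiffOn ℝ 1 ((univ ×ˢ O).indicator f) (I ×ˢ univ) ∧ FibreSupp I ((univ ×ˢ O).indicator f)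
      ∧ ∀ z v, fderiv ℝ ((univ ×ˢ O).indicator f) z v
        = (univ ×ˢ O).indicator (fun z => fderiv ℝ f z v) z := by
  refine ⟨fun z hz => ContDiffAt.contDiffWithinAt ?_, fun t _ => ?_, fun z v => ?_⟩
  · by_cases h : z.2 ∈ O
    · exact (hf.contDiffAt ((hI.prod hO).mem_nhds ⟨hz.1, h⟩)).congr_of_eventuallyEq
        (indicator_eventuallyEq hO h)
    · exact contDiffAt_const.congr_of_eventuallyEq
        (indicator_eventuallyEq_zero hK.isClosed h0 fun h' => h (hKO h'))
  · obtain ⟨R, hR⟩ := hK.isBounded.subset_closedBall (0 : E3)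
    refine ⟨R, .of_forall fun t' p hp => ?_⟩
    have hp' : p ∉ K := fun h => by
      have := hR h
      rw [mem_closedBall_zero_iff] at this
      linarith
    exact (indicator_eventuallyEq_zero hK.isClosed h0 (z := (t', p)) hp').self_of_nhds
  · by_cases h : z.2 ∈ O
    · rw [(indicator_eventuallyEq hO h).fderiv_eq, indicator_of_mem (mk_mem_prod (mem_univ _) h)]
    · rw [(indicator_eventuallyEq_zero hK.isClosed h0 fun h' => h (hKO h')).fderiv_eq,
        indicator_of_notMem fun h' => h h'.2]
      simp

/-- The derivative of the integral of a compactly supported density along a flow. -/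
lemma hasDerivAt_integral_transport (hO : IsOpen O) (hK : IsCompact K) (hKO : K ⊆ O)
    (hf : ContDiffOn ℝ 1 f (I ×ˢ O)) (hI : IsOpen I) (hT : T ∈ I)
    (h0 : ∀ t, ∀ y ∈ O, y ∉ K → f (t, y) = 0) {X : Fin 3 → ℝ × E3 → ℝ}
    (hX : ∀ a, ContDiffOn ℝ 1 (X a) (I ×ˢ O)) :
    HasDerivAt (fun t => ∫ y in O, f (t, y)) (∫ y in O, (fderiv ℝ f (T, y)
      (vfield (1, 0) frame3 X (T, y)) + f (T, y) * (gradX frame3 X (T, y)).trace)) T := by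
  have hind : ∀ (F : ℝ × E3 → ℝ) t y,
      (univ ×ˢ O).indicator F (t, y) = O.indicator (fun y => F (t, y)) y := fun F t y => by
    by_cases hy : y ∈ O
    · rw [indicator_of_mem hy, indicator_of_mem (mk_mem_prod (mem_univ _) hy)]
    · rw [indicator_of_notMem hy, indicator_of_notMem fun h => hy h.2]
  have key : ∀ F : ℝ × E3 → ℝ, ∀ t,
      ∫ y, (univ ×ˢ O).indicator F (t, y) = ∫ y in O, F (t, y) := fun F t => by
    rw [← integral_indicator hO.measurableSet]
    exact integral_congr_ae (.of_forall fun y => hind F t y)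
  have key' : ∀ F : ℝ × E3 → ℝ, Integrable (fun y => (univ ×ˢ O).indicator F (T, y)) →
      IntegrableOn (fun y => F (T, y)) O := fun F hF => by
    rw [← integrable_indicator_iff hO.measurableSet]
    exact hF.congr (.of_forall fun y => hind F T y)
  obtain ⟨h1, h2, h3⟩ := extend_by_zero hO hK hKO hf hI h0
  obtain ⟨h4, h5⟩ := fderiv_integral_param hI h2 h1 hT 1
  have h6 := (hasFDerivAt_integral_param hI h2 h1 hT).differentiableAt.hasFDerivAt.hasDerivAt
  simp only [h3] at h4 h5
  rw [h5] at h6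
  simp only [key] at h6
  have hXf : ∀ a, ContDiffOn ℝ 1 (fun z => X a z * f z) (I ×ˢ O) := fun a => (hX a).mul hf
  have h7 : ∀ a, IntegrableOn (fun y => pderiv frame3 a (fun z => X a z * f z) (T, y)) O ∧
      ∫ y in O, pderiv frame3 a (fun z => X a z * f z) (T, y) = 0 := fun a => by
    obtain ⟨g1, g2, g3⟩ := extend_by_zero hO hK hKO (hXf a) hI fun t y hy hyK => by
      rw [h0 t y hy hyK, mul_zero]
    obtain ⟨g4, g5⟩ := integral_fderiv_fibre_eq_zero hI g2 g1 hT (e3 a)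
    simp only [g3] at g4 g5
    rw [key] at g5
    exact ⟨key' _ g4, g5⟩
  have h8 : ∫ y in O, (fderiv ℝ f (T, y) (1, 0)
      + ∑ a, pderiv frame3 a (fun z => X a z * f z) (T, y)) = ∫ y in O, fderiv ℝ f (T, y) (1, 0) := by
    rw [integral_add (key' _ h4) (integrable_finsetSum _ fun a _ => (h7 a).1),
      integral_finsetSum _ fun a _ => (h7 a).1]
    simp [(h7 _).2]
  rw [← h8] at h6
  convert! h6 using 1
  refine setIntegral_congr_fun hO.measurableSet fun y hy => ?_
  have hd : ∀ g : ℝ × E3 → ℝ, ContDiffOn ℝ 1 g (I ×ˢ O) → DifferentiableAt ℝ g (T, y) := fun g hg =>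
    (hg.contDiffAt ((hI.prod hO).mem_nhds (mk_mem_prod hT hy))).differentiableAt (by norm_num)
  have hv : fderiv ℝ f (T, y) (vfield (1, 0) frame3 X (T, y))
      = fderiv ℝ f (T, y) (1, 0) + ∑ a, X a (T, y) * fderiv ℝ f (T, y) (frame3 a) := by
    simp only [vfield, map_add, map_sum, map_smul, smul_eq_mul]
  rw [hv, add_assoc]
  congr 1
  simp only [Matrix.trace, Matrix.diag, gradX, mul_sum, ← sum_add_distrib]
  refine sum_congr rfl fun a _ => ?_
  simp only [pderiv]
  rw [fderiv_fun_mul (hd _ (hX a)) (hd _ hf)]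
  simp only [add_apply, smul_apply, smul_eq_mul]

end Flat

section Reynolds

variable [T2Space M] [CompactSpace M] [MeasurableSpace M] [BorelSpace M]

/-- The derivative of the integral of a function over the slices: the volume element changes by the
factor `N - 3` along `∂_T + X`. The derivatives of the cut-off functions along `X` add up to zero. -/
lemma hasDerivAt_integral_riemVol (h : S.IsVlasovSolution τ0 n I) (hI : IsOpen I) (hn : 1 ≤ n)
    (hT : T ∈ I) {φ : ℝ → M → ℝ} {q : M → ℝ}
    (hφ : ∀ c : M, ContDiffOn ℝ 1 (fun z : ℝ × E3 => φ z.1 (chartPt c z.2)) (domC I c))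
    (hq : ∀ c : M, ∀ y ∈ (chartAt E3 c).target, q (chartPt c y)
      = fderiv ℝ (fun z : ℝ × E3 => φ z.1 (chartPt c z.2)) (T, y) (traC S c (T, y))
        + (S.lapse T (chartPt c y) - 3) * φ T (chartPt c y)) : Continuous q ∧
      HasDerivAt (fun t => ∫ x, φ t x ∂(riemVol (S.g t))) (∫ x, q x ∂(riemVol (S.g T))) T := by
  obtain ⟨U⟩ := nonempty_patchAtlas (M := M)
  have hn1 : (1 : ℕ∞ω) ≤ n := by exact_mod_cast hn
  have hmet := fun t (ht : t ∈ I) => isMetric_slice h ht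
  have hpt := fun {c : M} {y : E3} (hy : y ∈ (chartAt E3 c).target) => mk_mem_prod hT hy
  have hχc := U.continuous_χ
  have hχC : ∀ j c, ContDiffOn ℝ 1 (fun z : ℝ × E3 => U.χ j (chartPt c z.2)) (domC I c) :=
    fun j c => ((U.χ_smooth j c).of_le (by simp)).comp contDiffOn_snd fun z hz => hz.2
  have hφc : ∀ t ∈ I, Continuous (φ t) := fun t ht => continuous_of_chart fun c =>
    (hφ c).continuousOn.comp (f := fun y => (t, y)) (by fun_prop) fun y hy => ⟨ht, hy⟩
  have hXC : ∀ c : M, ∀ z ∈ domC I c, ContDiffAt ℝ 1 (traC S c) z := fun c z hz =>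
    contDiffAt_traC ((contDiffAt_shiC h hI hz).of_le hn1)
  have hD : ∀ (F : ℝ × E3 → ℝ) (c : M), ContDiffOn ℝ 1 F (domC I c) →
      ContinuousOn (fun y => fderiv ℝ F (T, y) (traC S c (T, y))) (chartAt E3 c).target := by
    intro F c hF
    have h1 := hF.continuousOn_fderiv_of_isOpen (isOpen_domC hI c) le_rfl
    have h2 : ContinuousOn (traC S c) (domC I c) := fun z hz =>
      (hXC c z hz).continuousAt.continuousWithinAt
    exact (h1.clm_apply h2).comp (f := fun y => (T, y)) (by fun_prop) fun y hy => ⟨hT, hy⟩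
  have hqc : Continuous q := by
    refine continuous_of_chart fun c => ?_
    refine ((hD _ c (hφ c)).add (ContinuousOn.mul (ContinuousOn.sub ?_ continuousOn_const)
      ((hφc T hT).comp_continuousOn (continuousOn_chartPt c)))).congr (hq c)
    exact ((h.lapse_smooth c).continuousOn).comp (f := fun y => (T, y)) (by fun_prop)
      fun y hy => ⟨hT, hy⟩
  -- the derivatives of the cut-off functions along the shift vector field
  set ψ : U.ι → M → ℝ := fun j x => fderiv ℝ (fun z : ℝ × E3 => U.χ j (chartPt x z.2))
    (T, chartAt E3 x x) (traC S x (T, chartAt E3 x x)) with hψ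
  have hψC : ∀ j (c : M), ∀ y ∈ (chartAt E3 c).target, ψ j (chartPt c y)
      = fderiv ℝ (fun z : ℝ × E3 => U.χ j (chartPt c z.2)) (T, y) (traC S c (T, y)) := by
    intro j c y hy
    have hy' := mem_overlap_self hy
    refine (fderiv_traC_trans (S := S) (φ := fun _ => U.χ j) (z := (T, y)) hy' ?_).symm
    exact ((hχC j _).contDiffAt (domC_mem_nhds hI (hpt (trans_mem hy').1))).differentiableAt
      (by norm_num)
  have hψc : ∀ j, Continuous (ψ j) := fun j =>
    continuous_of_chart fun c => (hD _ c (hχC j c)).congr (hψC j c)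
  have hψ0 : ∀ j x, U.χ j x = 0 → ψ j x = 0 := by
    intro j x hx
    have : IsLocalMin (fun z : ℝ × E3 => U.χ j (chartPt x z.2)) (T, chartAt E3 x x) := by
      refine .of_forall fun z => ?_
      simp only [chartPt_chartAt (mem_chart_source E3 x), hx]
      exact U.χ_nonneg j _
    simp only [hψ, this.fderiv_eq_zero, zero_apply]
  have hψs : ∀ x, ∑ j, ψ j x = 0 := by
    intro x
    have hd : ∀ j ∈ Finset.univ, DifferentiableAt ℝ (fun z : ℝ × E3 => U.χ j (chartPt x z.2))
        (T, chartAt E3 x x) := fun j _ =>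
      ((hχC j x).contDiffAt (domC_mem_nhds hI
        (hpt (mem_chart_target E3 x)))).differentiableAt (by norm_num)
    simp only [hψ]
    rw [← sum_apply, ← fderiv_fun_sum hd]
    simp [U.χ_sum]
  have hW : ∀ j, Continuous fun x => ψ j x * φ T x + U.χ j x * q x := fun j =>
    ((hψc j).mul (hφc T hT)).add ((hχc j).mul hqc)
  have hV : ∀ t ∈ I, ∀ j, Continuous fun x => U.χ j x * φ t x := fun t ht j =>
    (hχc j).mul (hφc t ht)
  -- the derivative of the part of the integral that is cut off to a coordinate ball
  have hpart : ∀ j, HasDerivAt (fun t => ∫ x, U.χ j x * φ t x ∂(riemVol (S.g t)))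
      (∫ x, (ψ j x * φ T x + U.χ j x * q x) ∂(riemVol (S.g T))) T := by
    intro j
    set c := U.ctr j
    have hK : IsCompact (closedBall (U.mid j) (U.rad j)) := isCompact_closedBall _ _
    have hKO : closedBall (U.mid j) (U.rad j) ⊆ (chartAt E3 c).target :=
      (Metric.closedBall_subset_closedBall (by linarith [U.rad_pos j])).trans (U.ball_subset j)
    have hf : ContDiffOn ℝ 1 (fun z : ℝ × E3 => U.χ j (chartPt c z.2) * φ z.1 (chartPt c z.2)
        * volC S c z) (domC I c) := ((hχC j c).mul (hφ c)).mul fun z hz =>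
      ((contDiffAt_volC h hI hz).of_le hn1).contDiffWithinAt
    have h1 := hasDerivAt_integral_transport (chartAt E3 c).open_target hK hKO hf hI hT
      (fun t y hy hyK => by
        have : U.χ j (chartPt c y) = 0 := by
          by_contra hne
          have := (U.χ_supp j _ hne).2
          rw [chartAt_chartPt hy] at this
          exact hyK (ball_subset_closedBall this)
        simp only [this, zero_mul])
      (X := shiF S c) fun a z hz => ((contDiffAt_euclidean.1 ((contDiffAt_shiC h hI hz).of_le hn1)
        a)).contDiffWithinAt
    have hsrc : ∀ (u : M → ℝ) x, U.χ j x * u x ≠ 0 → x ∈ (chartAt E3 c).source := fun u x hx =>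
      (U.χ_supp j x (left_ne_zero_of_mul hx)).1
    have h2 : (fun t => ∫ x, U.χ j x * φ t x ∂(riemVol (S.g t))) =ᶠ[𝓝 T] fun t =>
        ∫ y in (chartAt E3 c).target, U.χ j (chartPt c y) * φ t (chartPt c y)
          * volC S c (t, y) := by
      filter_upwards [hI.mem_nhds hT] with t ht
      exact integral_eq_chart (hmet t ht) (hV t ht j) (hsrc (φ t))
    refine HasDerivAt.congr_of_eventuallyEq ?_ h2
    rw [integral_eq_chart (c := c) (hmet T hT) (hW j)]
    · convert! h1 using 1
      refine setIntegral_congr_fun (measurableSet_target c) fun y hy => ?_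
      have hz : ((T, y) : ℝ × E3) ∈ domC I c := ⟨hT, hy⟩
      have hN := domC_mem_nhds hI hz
      have d1 := ((hχC j c).contDiffAt hN).differentiableAt one_ne_zero
      have d2 := ((hφ c).contDiffAt hN).differentiableAt one_ne_zero
      have d3 := ((contDiffAt_volC h hI hz).of_le hn1).differentiableAt one_ne_zero
      have e := fderiv_volC_traC h hI hz hn
      show (ψ j (chartPt c y) * φ T (chartPt c y) + U.χ j (chartPt c y) * q (chartPt c y))
        * volC S c (T, y) = _
      rw [hψC j c y hy, hq c y hy, fderiv_fun_mul (d1.fun_mul d2) d3, fderiv_fun_mul d1 d2]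
      simp only [add_apply, smul_apply, smul_eq_mul]
      unfold traC at e ⊢
      rw [e]
      simp only [lapC]
      ring
    · intro x hx
      by_contra hx'
      have h0 : U.χ j x = 0 := by by_contra hne; exact hx' (U.χ_supp j x hne).1
      exact hx (by rw [hψ0 j x h0, h0]; ring)
  have hsum := HasDerivAt.fun_sum fun j (_ : j ∈ Finset.univ) => hpart j
  refine ⟨hqc, HasDerivAt.congr_of_eventuallyEq (f₁ := fun t => ∫ x, φ t x ∂(riemVol (S.g t))) ?_ ?_
    (f := fun t => ∑ j, ∫ x, U.χ j x * φ t x ∂(riemVol (S.g t)))⟩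
  · convert! hsum using 1
    rw [← integral_finsetSum _ fun j _ => (hmet T hT).integrable (hW j)]
    refine integral_congr_ae (.of_forall fun x => ?_)
    simp only [sum_add_distrib, ← sum_mul, hψs, U.χ_sum, zero_mul, one_mul, zero_add]
  · filter_upwards [hI.mem_nhds hT] with t ht
    rw [← integral_finsetSum _ fun j _ => (hmet t ht).integrable (hV t ht j)]
    refine integral_congr_ae (.of_forall fun x => ?_)
    simp only [← sum_mul, U.χ_sum, one_mul]

end Reynolds

/-! ### Iterated covariant derivatives along the flow -/

section Linear

variable {b : Fin 3 → V} {G : V → Mat3} {u v : V → Ten k} {z : V}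

lemma dTen_congr (h : u =ᶠ[𝓝 z] v) (w : V) : dTen u z w = dTen v z w := by
  ext a
  simp only [dTen]
  rw [EventuallyEq.fderiv_eq (h.mono fun w hw => congrFun hw a)]

lemma covD_congr (h : u =ᶠ[𝓝 z] v) : covD b G u z = covD b G v z := by
  ext a
  rw [covD, covD, dTen_congr h, h.self_of_nhds]

lemma lieD_congr (h : u =ᶠ[𝓝 z] v) (v₀ : V) (X : Fin 3 → V → ℝ) :
    lieD v₀ b X u z = lieD v₀ b X v z := by
  rw [lieD, lieD, dTen_congr h, h.self_of_nhds]

lemma covD_smul_sub (r : ℝ) (hu : ∀ a, DifferentiableAt ℝ (fun w => u w a) z)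
    (hv : ∀ a, DifferentiableAt ℝ (fun w => v w a) z) (a : Fin (k + 1) → Fin 3) :
    covD b G (fun w => r • (u w - v w)) z a = r * (covD b G u z a - covD b G v z a) := by
  have h1 : dTen (fun w => r • (u w - v w)) z (b (a 0)) (tail a)
      = r * (dTen u z (b (a 0)) (tail a) - dTen v z (b (a 0)) (tail a)) := by
    have := ((hu (tail a)).hasFDerivAt.fun_sub (hv (tail a)).hasFDerivAt).const_mul r
    simp only [dTen, Pi.smul_apply, Pi.sub_apply, smul_eq_mul]
    rw [this.fderiv]
    rfl
  rw [covD, covD, covD, h1, act_smul, act_sub]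
  simp only [Pi.smul_apply, Pi.sub_apply, smul_eq_mul]
  ring

end Linear

section Matter

variable (S τ0 c) in
/-- The iterated covariant derivative `∇ᵐ ρ` in the coordinates `(T, y)`. -/
def nabC (m : ℕ) (z : ℝ × E3) : (Fin (0 + m) → Fin 3) → ℝ :=
  iterCovDeriv (S.g z.1) (ofFun (S.rho τ0 z.1)) m c z.2

/-- The covariant derivative `∇(N k)` at the time `T`. -/
def nabNk (S : RescaledVars M) (T : ℝ) : TField M 3 :=
  covDeriv (S.g T) (ofBilin fun x => S.lapse T x • S.k T x)

variable (S τ0 c) in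
/-- The derivative of `∇ᵐ ρ` along `∂_T + X`, as a Lie derivative. -/
def lieC (m : ℕ) (z : ℝ × E3) : (Fin (0 + m) → Fin 3) → ℝ :=
  lieD (1, 0) frame3 (shiF S c) (nabC S τ0 c m) z

include h hI

/-- The covariant derivative on a slice is the covariant derivative in the frame `frame3`. -/
lemma covD_slice {z : ℝ × E3} (hz : z ∈ domC I c) (hn : 1 ≤ n)
    {u : ℝ × E3 → Ten k} (hu : ∀ a, DifferentiableAt ℝ (fun w => u w a) z) :
    covD e3 (bilinComp (S.g z.1) c) (fun y => u (z.1, y)) z.2 = covD frame3 (metC S c) u z := by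
  ext a
  have h1 : chrMat e3 (bilinComp (S.g z.1) c) z.2 (a 0) = chrMat frame3 (metC S c) z (a 0) := by
    ext i j; exact christoffel_slice h hI hz hn i (a 0) j
  rw [covD, covD, h1]
  congr 1
  exact pderiv_slice (hu (tail a)) (a 0)

lemma contDiffAt_nabC (hτ : τ0 < 0) (m : ℕ) : ∀ (p : ℕ) {z : ℝ × E3}, p + m ≤ n →
    z ∈ domC I c → ∀ a, ContDiffAt ℝ p (fun w => nabC S τ0 c m w a) z := by
  induction m with
  | zero => exact fun p z hp hz a => (contDiffAt_rhoC h hI hz hτ).of_le (mod_cast hp)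
  | succ m ih =>
    intro p z hp hz a
    have h1 : (fun w => nabC S τ0 c (m + 1) w a)
        =ᶠ[𝓝 z] fun w => covD frame3 (metC S c) (nabC S τ0 c m) w a := by
      filter_upwards [domC_mem_nhds hI hz] with w hw
      exact congrFun (covD_slice h hI hw (by omega) fun a =>
        (ih 1 (by omega) hw a).differentiableAt (by simp)) a
    refine ContDiffAt.congr_of_eventuallyEq ?_ h1
    refine contDiffAt_covD (n := ((p + 1 : ℕ) : ℕ∞ω)) (fun i j =>
      (contDiffAt_metC h hI hz i j).of_le (mod_cast (by omega)))
      (metC_posDef h hz).det_pos.ne'.isUnit (fun a => ih (p + 1) (by omega) hz a) (by simp) a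

lemma nabC_succ (hτ : τ0 < 0) {m : ℕ} (hm : m + 1 ≤ n) {z : ℝ × E3} (hz : z ∈ domC I c) :
    nabC S τ0 c (m + 1) z = covD frame3 (metC S c) (nabC S τ0 c m) z :=
  covD_slice h hI hz (by omega) fun a =>
    (contDiffAt_nabC h hI hτ m 1 (by omega) hz a).differentiableAt (by simp)

/-- The variation of the Christoffel symbols is given by `∇(N k)`. -/
lemma dChr_eq_covDeriv (hn : 3 ≤ n) {z : ℝ × E3} (hz : z ∈ domC I c) (m l p : Fin 3) :
    dChr (1, 0) frame3 (metC S c) (shiF S c) z m l p = ∑ s, (metC S c z)⁻¹ l s *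
      (nabNk S z.1 c z.2 ![m, s, p] + nabNk S z.1 c z.2 ![p, s, m]
        - nabNk S z.1 c z.2 ![s, m, p]) := by
  have hn2 : ((2 : ℕ) : ℕ∞ω) ≤ n := by exact_mod_cast (by omega : 2 ≤ n)
  have hs : ∀ᶠ w in 𝓝 z, ∀ i j, metC S c w i j = metC S c w j i := by
    filter_upwards [domC_mem_nhds hI hz] with w hw using posDef_symm (metC_posDef h hw)
  have hu := (metC_posDef h hz).det_pos.ne'.isUnit
  have hG := fun i j => (contDiffAt_metC h hI hz i j).of_le hn2
  have hX : ∀ d, ContDiffAt ℝ 2 (shiF S c d) z := fun d =>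
    contDiffAt_euclidean.1 ((contDiffAt_shiC h hI hz).of_le hn2) d
  have hNk : ∀ a : Fin 2 → Fin 3,
      DifferentiableAt ℝ (fun w => tens2 (lapC S c w • kC S c w) a) z := fun a =>
    (((contDiffAt_lapC h hI hz).of_le hn2).mul ((contDiffAt_kC h hI hz (m := 2) (by omega) (a 0)
      (a 1)))).differentiableAt (by simp)
  have hGd : ∀ a : Fin 2 → Fin 3, DifferentiableAt ℝ (fun w => tens2 (metC S c w) a) z := fun a =>
    (hG (a 0) (a 1)).differentiableAt (by simp)
  have hL : lieD (1, 0) frame3 (shiF S c) (fun w => tens2 (metC S c w)) =ᶠ[𝓝 z]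
      fun w => (2 : ℝ) • (tens2 (lapC S c w • kC S c w) - tens2 (metC S c w)) := by
    filter_upwards [domC_mem_nhds hI hz] with w hw
    ext a
    have h1 := congrFun (congrFun (varMat_eq (S := S) (c := c) w) (a 0)) (a 1)
    rw [Matrix.of_apply, varC_eq h hI hw (by omega)] at h1
    simp only [lieD, Pi.add_apply, act_tens2, Pi.smul_apply, Pi.sub_apply, dTen,
      tens2, Matrix.smul_apply, smul_eq_mul]
    simp only [Matrix.add_apply, mul_apply, transpose_apply, dMat, traC, sum_univ_three] at h1
    simp only [sum_univ_three]
    linear_combination h1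
  have hP : ∀ a, covD frame3 (metC S c) (lieD (1, 0) frame3 (shiF S c) fun w => tens2 (metC S c w)) z a
      = 2 * nabNk S z.1 c z.2 a := by
    intro a
    rw [covD_congr hL, covD_smul_sub 2 hNk hGd, covD_metric hs hu,
      ← covD_slice h hI hz (by omega) hNk, Pi.zero_apply, sub_zero]
    rfl
  rw [dChr_eq hG hu hs hX]
  simp only [hP, mul_sum]
  exact sum_congr rfl fun s _ => by ring

variable (hn : 2 ≤ n) (hτ : τ0 < 0)
include hn hτ

lemma lieC_zero {z : ℝ × E3} (hz : z ∈ domC I c) (a : Fin 0 → Fin 3) :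
    lieC S τ0 c 0 z a = rhoSource S τ0 z.1 (chartPt c z.2) := by
  have h1 : act (gradX frame3 (shiF S c) z) (nabC S τ0 c 0 z) a = 0 :=
    Fintype.sum_empty (ι := Fin 0) _
  show dTen (nabC S τ0 c 0) z _ a + act (gradX frame3 (shiF S c) z) (nabC S τ0 c 0 z) a = _
  rw [h1, add_zero]
  exact transport h hI hn hτ hz

/-- The commutator of `∂_T + ℒ_X` with the covariant derivative of `∇ᵐ ρ`. -/
lemma lieC_succ {m : ℕ} (hm : m + 2 ≤ n) {z : ℝ × E3} (hz : z ∈ domC I c)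
    (a : Fin (0 + m + 1) → Fin 3) : lieC S τ0 c (m + 1) z a
      = covD e3 (bilinComp (S.g z.1) c) (fun y => lieC S τ0 c m (z.1, y)) z.2 a
        - act (dChr (1, 0) frame3 (metC S c) (shiF S c) z (a 0)) (nabC S τ0 c m z) (tail a) := by
  have hn2 : ((2 : ℕ) : ℕ∞ω) ≤ n := by exact_mod_cast hn
  have h1 : nabC S τ0 c (m + 1) =ᶠ[𝓝 z] covD frame3 (metC S c) (nabC S τ0 c m) := by
    filter_upwards [domC_mem_nhds hI hz] with w hw
      using nabC_succ h hI hτ (by omega) hw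
  have hX : ∀ d, ContDiffAt ℝ 2 (shiF S c d) z := fun d =>
    contDiffAt_euclidean.1 ((contDiffAt_shiC h hI hz).of_le hn2) d
  have hu := contDiffAt_nabC h hI hτ m 2 (by omega) hz
  have h2 := lieD_covD (v₀ := ((1 : ℝ), (0 : E3))) (b := frame3) (X := shiF S c)
    (fun i j => (contDiffAt_metC h hI hz i j).of_le hn2) (metC_posDef h hz).det_pos.ne'.isUnit
    hX hu a
  have h3 : lieC S τ0 c (m + 1) z a
      = lieD (1, 0) frame3 (shiF S c) (covD frame3 (metC S c) (nabC S τ0 c m)) z a :=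
    congrFun (lieD_congr h1 (1, 0) (shiF S c)) a
  rw [h3, h2]
  congr 1
  refine (congrFun (covD_slice h hI hz (by omega) fun a => ?_) a).symm
  exact (contDiffAt_lieD (m := 1) hX hu (by norm_num) a).differentiableAt (by norm_num)

end Matter

/-! ### The derivative of the energy -/

section Pointwise

/-- The sum of the absolute values of the components. -/
def l1 (u : Ten k) : ℝ := ∑ a, |u a|

lemma l1_nonneg (u : Ten k) : 0 ≤ l1 u := sum_nonneg fun _ _ => abs_nonneg _

lemma abs_le_l1 (u : Ten k) (a : Fin k → Fin 3) : |u a| ≤ l1 u :=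
  single_le_sum (f := fun a => |u a|) (fun _ _ => abs_nonneg _) (Finset.mem_univ a)

lemma abs_dot_le (u v : Ten k) : |dot u v| ≤ l1 u * l1 v := by
  rw [dot, l1, sum_mul]
  refine (abs_sum_le_sum_abs _ _).trans (sum_le_sum fun a _ => ?_)
  rw [abs_mul]
  exact mul_le_mul_of_nonneg_left (abs_le_l1 v a) (abs_nonneg _)

lemma sum_le_card_mul [Fintype ι] {f : ι → ℝ} {c : ℝ} (h : ∀ a, f a ≤ c) :
    ∑ a, f a ≤ Fintype.card ι * c :=
  (sum_le_sum fun a _ => h a).trans (le_of_eq (by simp))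

lemma l1_pull_le {P : Mat3} {p : ℝ} (hP : ∀ i j, |P i j| ≤ p) (u : Ten k) :
    l1 (pull P u) ≤ Fintype.card (Fin k → Fin 3) * (p ^ k * l1 u) := by
  refine sum_le_card_mul fun a => ?_
  rw [pull, mpull, l1, mul_sum]
  refine (abs_sum_le_sum_abs _ _).trans (sum_le_sum fun b _ => ?_)
  rw [abs_mul, Finset.abs_prod]
  refine mul_le_mul_of_nonneg_right ?_ (abs_nonneg _)
  refine (Finset.prod_le_prod (fun i _ => abs_nonneg _) fun i _ => hP (b i) (a i)).trans ?_
  simp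

lemma l1_act_le {B : Mat3} {c : ℝ} (hB : ∀ i j, |B i j| ≤ c) (u : Ten k) :
    l1 (act B u) ≤ Fintype.card (Fin k → Fin 3) * (k * (3 * (c * l1 u))) := by
  refine sum_le_card_mul fun a => ?_
  rw [act]
  refine (abs_sum_le_sum_abs _ _).trans ((sum_le_sum fun i _ =>
    (abs_sum_le_sum_abs _ _).trans (sum_le_sum fun d _ => ?_)).trans
    (b := ∑ _i : Fin k, ∑ _d : Fin 3, c * l1 u) (le_of_eq (by simp)))
  rw [abs_mul]
  exact mul_le_mul (hB _ _) (abs_le_l1 _ _) (abs_nonneg _) ((abs_nonneg _).trans (hB 0 0))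

/-- The rate of change of `|u|² μ` along a flow, where `P` is the inverse metric, `v` the derivative
of `u`, `H` the derivative of the metric, and `r` the derivative of the density `μ`. -/
def rate (P H : Mat3) (r : ℝ) (u v : Ten k) : ℝ :=
  2 * dot (pull P u) v - dot (act (H * P) (pull P u)) u + r * dot (pull P u) u

lemma abs_rate_le (k : ℕ) (p : ℝ≥0) : ∃ C : ℝ≥0, ∀ (P H : Mat3) (r h : ℝ)
    (u v : Ten k), (∀ i j, |P i j| ≤ p) → (∀ i j, |H i j| ≤ h) → |r| ≤ h →
      |rate P H r u v| ≤ C * (l1 u * l1 v + h * (l1 u * l1 u)) := by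
  set N : ℝ≥0 := (Fintype.card (Fin k → Fin 3) : ℝ≥0) with hN
  refine ⟨N * p ^ k * (3 + 9 * k * p * N), fun P H r h u v hP hH hr => ?_⟩
  have hNc : (N : ℝ) = Fintype.card (Fin k → Fin 3) := by simp [hN]
  have hu := l1_nonneg u
  have hv := l1_nonneg v
  have hp : (0 : ℝ) ≤ p := p.2
  have hh : 0 ≤ h := (abs_nonneg _).trans hr
  have h1 := l1_pull_le hP u
  rw [← hNc] at h1
  have hHP : ∀ i j, |(H * P) i j| ≤ 3 * (h * p) := fun i j => by
    rw [mul_apply]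
    refine (abs_sum_le_sum_abs _ _).trans ((sum_le_sum fun s _ => ?_).trans
      (b := ∑ _s : Fin 3, h * p) (le_of_eq (by simp)))
    rw [abs_mul]
    exact mul_le_mul (hH _ _) (hP _ _) (abs_nonneg _) hh
  have h2 := l1_act_le hHP (pull P u)
  rw [← hNc] at h2
  have a1 : |dot (pull P u) v| ≤ N * (p ^ k * l1 u) * l1 v :=
    (abs_dot_le _ _).trans (mul_le_mul_of_nonneg_right h1 hv)
  have a2 : |dot (pull P u) u| ≤ N * (p ^ k * l1 u) * l1 u :=
    (abs_dot_le _ _).trans (mul_le_mul_of_nonneg_right h1 hu)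
  have a3 : |dot (act (H * P) (pull P u)) u|
      ≤ N * (k * (3 * (3 * (h * p) * (N * (p ^ k * l1 u))))) * l1 u :=
    (abs_dot_le _ _).trans (mul_le_mul_of_nonneg_right (h2.trans (by gcongr)) hu)
  have a4 : |r * dot (pull P u) u| ≤ h * (N * (p ^ k * l1 u) * l1 u) := by
    rw [abs_mul]; exact mul_le_mul hr a2 (abs_nonneg _) hh
  have a5 : |rate P H r u v| ≤ 2 * |dot (pull P u) v| + |dot (act (H * P) (pull P u)) u|
      + |r * dot (pull P u) u| := by
    have e := abs_add_le (2 * dot (pull P u) v - dot (act (H * P) (pull P u)) u)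
      (r * dot (pull P u) u)
    have e' := abs_sub (2 * dot (pull P u) v) (dot (act (H * P) (pull P u)) u)
    rw [abs_mul, abs_two] at e'
    unfold rate
    linarith
  have a6 : 0 ≤ N * p ^ k * (1 + 9 * k * p * N) * (l1 u * l1 v) := by positivity
  have a7 : 0 ≤ N * p ^ k * 2 * (h * (l1 u * l1 u)) := by positivity
  push_cast
  linarith

end Pointwise

section Integral

variable [CompactSpace M] [MeasurableSpace M] [BorelSpace M]

/-- The integral of the rate of change of the square of a tensor over `M`. -/
lemma exists_integral_rate_le (U : PatchAtlas M) (k : ℕ) (w Λ : ℝ) (hw : 0 < w) (p : ℝ≥0) :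
    ∃ C : ℝ≥0, ∀ {n : ℕ∞ω} {g : BilinField M}, IsMetric n g →
      (∀ j, ∀ y ∈ U.ball j, Ell w Λ (bilinComp g (U.ctr j) y)) →
      (∀ j, ∀ y ∈ U.ball j, ∀ i l, |(bilinComp g (U.ctr j) y)⁻¹ i l| ≤ p) →
      ∀ (u v : U.ι → E3 → Ten k) (H : U.ι → E3 → Mat3) (r : U.ι → E3 → ℝ)
        (A A' h : ℝ≥0), (∀ j a, Bl (U.ball j) 0 (fun y => u j y a) A) →
      (∀ j a, Bl (U.ball j) 0 (fun y => v j y a) A') →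
      (∀ j, ∀ y ∈ U.ball j, ∀ i l, |H j y i l| ≤ h) → (∀ j, ∀ y ∈ U.ball j, |r j y| ≤ h) →
      ∀ q : M → ℝ, Continuous q → (∀ j, ∀ y ∈ U.ball j, q (chartPt (U.ctr j) y)
        = rate (bilinComp g (U.ctr j) y)⁻¹ (H j y) (r j y) (u j y) (v j y)) →
      |∫ x, q x ∂(riemVol g)| ≤ C * (A * (A' + h * A)) := by
  obtain ⟨C, hC⟩ := abs_rate_le k p
  obtain ⟨d, hd, hde⟩ := ell_det w Λ hw
  set N : ℝ≥0 := (Fintype.card (Fin k → Fin 3) : ℝ≥0)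
  refine ⟨Fintype.card U.ι * (d⁻¹ * (C * (N * (N * 1)))), fun {n g} hg hell hinv u v H r A A' h hu hv
    hH hr q hq hqe => ?_⟩
  rw [integral_eq_sum_patch U hg hq]
  have hj : ∀ j, |∫ y in U.ball j, U.χ j (chartPt (U.ctr j) y) * (q (chartPt (U.ctr j) y)
      * √(bilinComp g (U.ctr j) y).det)| ≤ d⁻¹ * (C * (N * (N * 1))) * (A * (A' + h * A)) := by
    intro j
    have hB : MeasurableSet (U.ball j) := isOpen_ball.measurableSet
    have hm : ∀ {f : E3 → ℝ} {A}, Bl (U.ball j) 0 f A →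
        AEStronglyMeasurable f (volume.restrict (U.ball j)) := fun hf =>
      hf.smooth.continuousOn.aestronglyMeasurable hB
    have i1 := fun a b => integral_mul_le_of_eLpNorm (hm (hu j a)) (hm (hv j b))
      (bl_zero_eLpNorm (hu j a)) (bl_zero_eLpNorm (hv j b))
    have i2 := fun a b => integral_mul_le_of_eLpNorm (hm (hu j a)) (hm (hu j b))
      (bl_zero_eLpNorm (hu j a)) (bl_zero_eLpNorm (hu j b))
    have i3 : ∀ a b, Integrable (fun y => |u j y a * v j y b| + h * |u j y a * u j y b|)
        (volume.restrict (U.ball j)) := fun a b =>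
      (i1 a b).1.abs.add ((i2 a b).1.abs.const_mul _)
    have i4 : ∀ a b, ∫ y in U.ball j, (|u j y a * v j y b| + h * |u j y a * u j y b|)
        ≤ A * (A' + h * A) := fun a b => by
      rw [integral_add (i1 a b).1.abs ((i2 a b).1.abs.const_mul _), integral_const_mul]
      have := mul_le_mul_of_nonneg_left (i2 a b).2 h.2
      have e := (i1 a b).2
      simp only [NNReal.val_eq_coe] at this
      linarith
    set S : E3 → ℝ := fun y => ∑ a, ∑ b, (|u j y a * v j y b| + h * |u j y a * u j y b|)
    have hS : Integrable S (volume.restrict (U.ball j)) :=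
      integrable_finsetSum _ fun a _ => integrable_finsetSum _ fun b _ => i3 a b
    have hSi : ∫ y in U.ball j, S y ≤ N * (N * (A * (A' + h * A))) := by
      rw [integral_finsetSum _ fun a _ => integrable_finsetSum _ fun b _ => i3 a b]
      refine (sum_le_card_mul (c := N * (A * (A' + h * A))) fun a => ?_).trans (le_of_eq (by simp only [N, NNReal.coe_natCast]))
      rw [integral_finsetSum _ fun b _ => i3 a b]
      exact (sum_le_card_mul fun b => i4 a b).trans (le_of_eq (by simp only [N, NNReal.coe_natCast]))
    have hle := norm_integral_le_of_norm_le (f := fun y => U.χ j (chartPt (U.ctr j) y)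
      * (q (chartPt (U.ctr j) y) * √(bilinComp g (U.ctr j) y).det))
      (hS.const_mul ((d⁻¹ : ℝ≥0) * C : ℝ)) ((ae_restrict_mem hB).mono fun y hy => ?_)
    · rw [Real.norm_eq_abs, integral_const_mul] at hle
      refine hle.trans ((mul_le_mul_of_nonneg_left hSi (by positivity)).trans (le_of_eq ?_))
      push_cast; ring
    · have e1 := hC _ _ _ h (u j y) (v j y) (hinv j y hy) (hH j y hy) (hr j y hy)
      have e2 : l1 (u j y) * l1 (v j y) + h * (l1 (u j y) * l1 (u j y)) = S y := by
        simp only [l1, Finset.sum_mul_sum]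
        simp only [mul_sum, ← sum_add_distrib, S, abs_mul]
      have e3 := (abs_of_nonneg (U.χ_nonneg j (chartPt (U.ctr j) y))).trans_le (U.χ_le_one j _)
      have e4 := (hde _ (hell j y hy)).2.2
      rw [Real.norm_eq_abs, abs_mul, abs_mul, hqe j y hy, abs_of_nonneg (sqrt_nonneg _)]
      rw [e2] at e1
      calc _ ≤ 1 * (C * S y * (d⁻¹ : ℝ≥0)) := by
            refine mul_le_mul e3 (mul_le_mul e1 (mod_cast e4) (sqrt_nonneg _)
              ((abs_nonneg _).trans e1)) (by positivity) one_pos.le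
        _ = _ := by ring
  refine (abs_sum_le_sum_abs _ _).trans ((sum_le_card_mul hj).trans (le_of_eq ?_))
  push_cast
  ring

end Integral

section Energy

variable (S τ0) in
/-- The function `|∇ᵐ ρ|²`. -/
def enM (m : ℕ) (t : ℝ) (x : M) : ℝ :=
  normSqAt (S.g t) (iterCovDeriv (S.g t) (ofFun (S.rho τ0 t)) m) x

variable (hτ : τ0 < 0)
include h hI hτ

lemma enM_chartPt {m : ℕ} (hm : m ≤ n) {z : ℝ × E3} (hz : z ∈ domC I c) :
    enM S τ0 m z.1 (chartPt c z.2) = tensorNormSq (metC S c z) (nabC S τ0 c m z) :=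
  normSqAt_chartPt (isTensor_iterCovDeriv hm (isMetric_slice h hz.1) (isTensor_ofFun _)
    (tsmooth_rho h hI hτ hz.1)) _ hz.2

lemma contDiffOn_enM {m : ℕ} (hm : m + 1 ≤ n) :
    ContDiffOn ℝ 1 (fun z : ℝ × E3 => enM S τ0 m z.1 (chartPt c z.2)) (domC I c) := by
  have h1 : ContDiffOn ℝ 1 (fun z => tensorNormSq (metC S c z) (nabC S τ0 c m z)) (domC I c) := by
    intro z hz
    have hu : ∀ a, ContDiffAt ℝ 1 (fun w => nabC S τ0 c m w a) z := fun a => by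
      simpa using contDiffAt_nabC h hI hτ m 1 (by omega) hz a
    have hG := fun i j => (contDiffAt_metC h hI hz i j).of_le
      (mod_cast (by omega : 1 ≤ n) : (1 : ℕ∞ω) ≤ n)
    have hi := contDiffAt_inv hG (metC_posDef h hz).det_pos.ne'.isUnit
    simp only [tensorNormSq]
    exact (ContDiffAt.sum fun a _ => ContDiffAt.sum fun b _ =>
      ((contDiffAt_prod fun i _ => hi _ _).mul (hu a)).mul (hu b)).contDiffWithinAt
  exact h1.congr fun z hz => enM_chartPt h hI hτ (by omega) hz

variable [T2Space M] [CompactSpace M] [MeasurableSpace M] [BorelSpace M]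

/-- The derivative of `∫ |∇ᵐ ρ|² μ_g`, as the integral of a continuous function `q` over one slice.
-/
lemma hasDerivAt_integral_enM {m : ℕ} (hm : m + 1 ≤ n) (hT : T ∈ I) : ∃ q : M → ℝ,
    Continuous q ∧ (∀ (c : M), ∀ y ∈ (chartAt E3 c).target, q (chartPt c y)
      = rate (metC S c (T, y))⁻¹ (Matrix.of (varC S c (T, y))) (S.lapse T (chartPt c y) - 3)
        (nabC S τ0 c m (T, y)) (lieC S τ0 c m (T, y))) ∧
    HasDerivAt (fun t => ∫ x, enM S τ0 m t x ∂(riemVol (S.g t))) (∫ x, q x ∂(riemVol (S.g T))) T := by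
  have hn : 1 ≤ n := by omega
  have hd : ∀ c : M, ∀ y ∈ (chartAt E3 c).target, DifferentiableAt ℝ
      (fun z : ℝ × E3 => enM S τ0 m z.1 (chartPt c z.2)) (T, y) := fun c y hy =>
    ((contDiffOn_enM h hI hτ hm).contDiffAt ((isOpen_domC hI c).mem_nhds
      (mk_mem_prod hT hy))).differentiableAt one_ne_zero
  set q : M → ℝ := fun x => fderiv ℝ (fun z : ℝ × E3 => enM S τ0 m z.1 (chartPt x z.2))
    (T, chartAt E3 x x) (traC S x (T, chartAt E3 x x)) + (S.lapse T x - 3) * enM S τ0 m T x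
  have hq : ∀ c : M, ∀ y ∈ (chartAt E3 c).target, q (chartPt c y)
      = fderiv ℝ (fun z : ℝ × E3 => enM S τ0 m z.1 (chartPt c z.2)) (T, y) (traC S c (T, y))
        + (S.lapse T (chartPt c y) - 3) * enM S τ0 m T (chartPt c y) := fun c y hy => by
    have hy' := mem_overlap_self hy
    have := fderiv_traC_trans (S := S) (φ := enM S τ0 m) (z := (T, y)) hy'
      (hd _ _ (trans_mem hy').1)
    rw [this]; rfl
  obtain ⟨hqc, hD⟩ := hasDerivAt_integral_riemVol h hI hn hT (fun c => contDiffOn_enM h hI hτ hm) hq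
  refine ⟨q, hqc, fun c y hy => ?_, hD⟩
  have hz : ((T, y) : ℝ × E3) ∈ domC I c := ⟨hT, hy⟩
  have hu := (metC_posDef h hz).det_pos.ne'.isUnit
  have h1 : (fun z : ℝ × E3 => enM S τ0 m z.1 (chartPt c z.2)) =ᶠ[𝓝 (T, y)]
      fun z => tensorNormSq (metC S c z) (nabC S τ0 c m z) := by
    filter_upwards [(isOpen_domC hI c).mem_nhds hz] with w hw
      using enM_chartPt h hI hτ (by omega) hw
  have h2 := fderiv_tensorNormSq (v₀ := ((1 : ℝ), (0 : E3))) (b := frame3) (X := shiF S c)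
    (fun i j => (contDiffAt_metC h hI hz i j).differentiableAt (natCast_ne_zero hn)) hu
    (posDef_symm (metC_posDef h hz)) fun a =>
      (contDiffAt_nabC h hI hτ m 1 (by omega) hz a).differentiableAt (by simp)
  have h3 := varMat_eq (S := S) (c := c) (T, y)
  unfold traC at h3
  rw [h3] at h2
  have h4 := enM_chartPt h hI hτ (m := m) (by omega) hz
  rw [← h1.fderiv_eq] at h2
  rw [hq c y hy]
  unfold traC
  rw [h2]
  refine (congrArg (fun e => _ + _ * e) (h4.trans (tensorNormSq_eq_dot _ _))).trans ?_
  rfl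

end Energy

section Sup

variable {γ : BilinField M}

lemma supNorm_nonneg (u : TField M k) : 0 ≤ supNorm γ u :=
  Real.iSup_nonneg fun _ => sqrt_nonneg _

variable [CompactSpace M]

/-- The components in the coordinate balls are bounded by the supremum norm. -/
lemma exists_abs_le_supNorm (hγ : IsMetric ∞ γ) (U : PatchAtlas M) (k : ℕ) : ∃ C : ℝ≥0,
    ∀ u : TField M k, IsTensor u → TSmooth 0 u → ∀ j, ∀ y ∈ U.ball j, ∀ a,
      |u (U.ctr j) y a| ≤ C * supNorm γ u := by
  obtain ⟨w, Λ, hw, hell⟩ := hγ.exists_ell_atlas U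
  obtain ⟨C, hC, hCe⟩ := ell_tensorNormSq k w Λ hw
  refine ⟨(√C).toNNReal, fun u hu hus j y hy a => ?_⟩
  have h1 := (hCe _ (hell j y (U.ball_subset_ball2 j hy)) (u (U.ctr j) y)).1
  rw [← normSqAt_chartPt hu γ (U.ball_subset_target j hy)] at h1
  have h2 : BddAbove (range fun x => √(normSqAt γ u x)) :=
    (isCompact_range (continuous_normSqAt hγ hu hus).sqrt).bddAbove
  have h3 := le_ciSup h2 (chartPt (U.ctr j) y)
  rw [coe_toNNReal _ (sqrt_nonneg _)]
  calc _ = √(u (U.ctr j) y a ^ 2) := (Real.sqrt_sq_eq_abs _).symm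
    _ ≤ √(C * normSqAt γ u (chartPt (U.ctr j) y)) := Real.sqrt_le_sqrt ((sq_le_sum_sq _ a).trans h1)
    _ = √C * √(normSqAt γ u (chartPt (U.ctr j) y)) := sqrt_mul hC.le _
    _ ≤ √C * supNorm γ u := mul_le_mul_of_nonneg_left h3 (sqrt_nonneg _)

end Sup

/-! ### Bounds of the sources and commutators -/

section Bounds

variable [CompactSpace M] [MeasurableSpace M] [BorelSpace M] {γ : BilinField M}

variable (γ) in
/-- The part of the bound of `∂_T ρ + X ρ` that comes from the matter current and stress tensor. -/
def matterNN (S : RescaledVars M) (τ0 : ℝ) (l : ℕ) (T : ℝ) : ℝ≥0 :=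
  ‖meanCurv τ0 T‖₊ ^ 2 * sobNN γ l (ofFun (S.stressSource τ0 T))
    + ‖meanCurv τ0 T‖₊ * sobNN γ l (ofFun (S.currentSource τ0 T))

variable (γ) in
/-- The norms of the geometric variables that enter through derivatives. -/
def geomNN (S : RescaledVars M) (l : ℕ) (T : ℝ) : ℝ≥0 :=
  sobNN γ (l - 2) (nabNk S T)
    + sobNN γ l (ofFun fun x => 3 - S.lapse T x)

/-- The right-hand side of the transport equation in `H^ℓ`, by the product estimate for `(3 - N) ρ`.
-/
lemma exists_rhoSource_bound (hγ : IsMetric ∞ γ) (U : PatchAtlas M) (l : ℕ) (hl : 4 ≤ l) :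
    ∃ C : ℝ≥0, ∀ (S : RescaledVars M) (τ0 : ℝ) (I : Set ℝ), τ0 < 0 → IsOpen I →
      S.IsVlasovSolution τ0 (l + 2) I → ∀ T ∈ I, TBd U l (ofFun (rhoSource S τ0 T))
        (C * (sobNN γ l (ofFun fun x => 3 - S.lapse T x) * sobNN γ l (ofFun (S.rho τ0 T))
          + matterNN γ S τ0 l T)) := by
  obtain ⟨C, hC⟩ := tbd_of_sobolevNorm hγ U 0 l
  refine ⟨2 ^ l * C * C + C, fun S τ0 I hτ hI h T hT j a => ?_⟩
  have hle : (l : ℕ∞ω) ≤ ((l + 2 : ℕ) : ℕ∞ω) := by exact_mod_cast (by omega)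
  have hN := hC _ (isTensor_ofFun _) ((tsmooth_lapse h hI hT).of_le hle) j a
  have hρ := hC _ (isTensor_ofFun _) ((tsmooth_rho h hI hτ hT).of_le hle) j a
  have hs := hC _ (isTensor_ofFun _) (tsmooth_stressSource h hI hτ hT (m := l) (by omega)) j a
  have hc := hC _ (isTensor_ofFun _)
    (tsmooth_currentSource h hI (by omega) hτ hT (m := l) (by omega)) j a
  refine Bnd.le (((Bd.mul hN hρ le_rfl le_rfl (by omega)).sub
    (hs.const_mul (meanCurv τ0 T ^ 2))).add (hc.const_mul (meanCurv τ0 T))) ?_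
  rw [nnnorm_pow, matterNN]
  generalize sobNN γ l (ofFun fun x => 3 - S.lapse T x) = a1
  generalize sobNN γ l (ofFun (S.rho τ0 T)) = a2
  generalize sobNN γ l (ofFun (S.stressSource τ0 T)) = a3
  generalize sobNN γ l (ofFun (S.currentSource τ0 T)) = a4
  generalize ‖meanCurv τ0 T‖₊ = t
  calc _ = (2 ^ l * C * C) * (a1 * a2) + C * (t ^ 2 * a3 + t * a4) := by ring
    _ ≤ (2 ^ l * C * C + C) * (a1 * a2) + (2 ^ l * C * C + C) * (t ^ 2 * a3 + t * a4) := by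
        gcongr
        · exact le_self_add
        · exact le_add_self
    _ = _ := by ring

/-- The variation of the Christoffel symbols in `H^{ℓ-2}`, by `dChr_eq_covDeriv`. -/
lemma exists_dChr_bound (hγ : IsMetric ∞ γ) (U : PatchAtlas M) (s l : ℕ) (hs : 6 ≤ s)
    (hls : l - 1 ≤ s) (hl : 4 ≤ l) (w Λ : ℝ) (K : ℝ≥0) : ∃ C : ℝ≥0,
    ∀ (S : RescaledVars M) (τ0 : ℝ) (I : Set ℝ), IsOpen I →
      S.IsVlasovSolution τ0 (l + 2) I → ∀ T ∈ I, MetricBd U s w Λ K (S.g T) → ∀ j a i p,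
        Bd (U.ball j) (l - 2) (fun y => dChr (1, 0) frame3 (metC S (U.ctr j))
          (shiF S (U.ctr j)) (T, y) a i p) (C * sobNN γ (l - 2) (nabNk S T)) := by
  obtain ⟨C, hC⟩ := tbd_of_sobolevNorm hγ U 3 (l - 2)
  refine ⟨3 * (2 ^ (l - 2) * K * (3 * C)), fun S τ0 I hI h T hT hg j a i p => ?_⟩
  have hmet : IsMetric ((l - 1 : ℕ) : ℕ∞ω) (S.g T) :=
    (isMetric_slice h hT).of_le (mod_cast (by omega))
  have hk := tsmooth_k h hI hT (m := l - 1) (by omega)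
  have hP := hC (nabNk S T) (isTensor_covDeriv hmet (mod_cast (by omega)) (isTensor_ofBilin _) hk)
    (tsmooth_covDeriv hmet hk (mod_cast (by omega))) j
  have h1 : ∀ r, Bd (U.ball j) (l - 2) (fun y => (bilinComp (S.g T) (U.ctr j) y)⁻¹ i r *
      (nabNk S T (U.ctr j) y ![a, r, p] + nabNk S T (U.ctr j) y ![p, r, a] - nabNk S T (U.ctr j) y ![r, a, p]))
      (2 ^ (l - 2) * K * (3 * (C * sobNN γ (l - 2) (nabNk S T)))) := fun r =>
    Bd.mul (hg.inv j i r) (Bnd.le (((hP ![a, r, p]).add (hP ![p, r, a])).sub (hP ![r, a, p]))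
      (le_of_eq (by ring))) (by omega) le_rfl (by omega)
  refine Bnd.congr ((Bnd.sum_card isOpen_ball le_rfl (by omega) h1).le
    (le_of_eq (by simp; ring))) fun y hy => ?_
  exact dChr_eq_covDeriv h hI (by omega) (z := (T, y)) ⟨hT, U.ball_subset_target j hy⟩ a i p

/-- The bounds of `∇ᵐ ρ` and of its derivative along `∂_T + X`. The commutators contain at most
`l - 1` derivatives of `ρ`, and `∇(N k)` with at most `l - 2` derivatives. -/
lemma exists_lieC_bound (hγ : IsMetric ∞ γ) (U : PatchAtlas M) (s l : ℕ) (hs : 6 ≤ s)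
    (hls : l - 1 ≤ s) (hl : 4 ≤ l) (w Λ : ℝ) (hw : 0 < w) (K : ℝ≥0) (m : ℕ) (hm : m ≤ l) : ∃ C : ℝ≥0,
    ∀ (S : RescaledVars M) (τ0 : ℝ) (I : Set ℝ), τ0 < 0 → IsOpen I →
      S.IsVlasovSolution τ0 (l + 2) I → ∀ T ∈ I, MetricBd U s w Λ K (S.g T) → ∀ j a,
        Bl (U.ball j) 0 (fun y => nabC S τ0 (U.ctr j) m (T, y) a)
          (C * sobNN (S.g T) l (ofFun (S.rho τ0 T))) ∧
        Bl (U.ball j) 0 (fun y => lieC S τ0 (U.ctr j) m (T, y) a)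
          (C * (geomNN γ S l T * sobNN (S.g T) l (ofFun (S.rho τ0 T)) + matterNN γ S τ0 l T)) := by
  obtain ⟨C₁, hC₁⟩ := sobNN_le_sobNN hγ U s l hs hls w Λ hw K
  obtain ⟨C₂, hC₂⟩ := tbd_of_sobolevNorm hγ U 0 l
  have h3 := fun m => MetricBd.tbd_iterCovDeriv U s l hs hls w Λ K m
  choose C₃ hC₃ using h3
  obtain ⟨C₄, hC₄⟩ := exists_rhoSource_bound hγ U l hl
  obtain ⟨C₅, hC₅⟩ := exists_dChr_bound hγ U s l hs hls hl w Λ K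
  obtain ⟨C₆, hC₆⟩ := exists_commutator_bound s l hs hls hl K m
  set B := ∑ m ∈ Finset.range (l + 1), C₃ m
  have hB : ∀ m ≤ l, C₃ m ≤ B := fun m hm =>
    single_le_sum (fun _ _ => zero_le) (Finset.mem_range.2 (by omega))
  refine ⟨B * C₂ * C₁ + (C₆ * C₅ * (B * C₂ * C₁) + B * C₄ * (C₁ + 1)),
    fun S τ0 I hτ hI h T hT hg j a => ?_⟩
  have hle : (l : ℕ∞ω) ≤ ((l + 2 : ℕ) : ℕ∞ω) := by exact_mod_cast (by omega)
  have hmet := (isMetric_slice h hT).of_le hle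
  have hρs := (tsmooth_rho h hI hτ hT).of_le hle
  have hρ := hC₁ (S.g T) hmet hg _ (isTensor_ofFun (S.rho τ0 T)) hρs
  have hyt : ∀ y ∈ U.ball j, ((T, y) : ℝ × E3) ∈ domC I (U.ctr j) := fun y hy =>
    ⟨hT, U.ball_subset_target j hy⟩
  have hn : ∀ m ≤ l, ∀ a, Bd (U.ball j) (l - m) (fun y => nabC S τ0 (U.ctr j) m (T, y) a)
      (B * C₂ * C₁ * sobNN (S.g T) l (ofFun (S.rho τ0 T))) := fun m hm a => by
    refine Bnd.le (hC₃ m hm (S.g T) hg _ _ (hC₂ _ (isTensor_ofFun (S.rho τ0 T)) hρs) j a) ?_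
    calc _ ≤ B * (C₂ * (C₁ * sobNN (S.g T) l (ofFun (S.rho τ0 T)))) := by gcongr; exact hB m hm
      _ = _ := by ring
  have hF := hC₃ m hm (S.g T) hg _ _ (hC₄ S τ0 I hτ hI h T hT) j a
  have hR := hC₆ hm (U.ball j) (bilinComp (S.g T) (U.ctr j))
    (fun m y => nabC S τ0 (U.ctr j) m (T, y))
    (fun m y a => lieC S τ0 (U.ctr j) m (T, y) a
      - iterCovDeriv (S.g T) (ofFun (rhoSource S τ0 T)) m (U.ctr j) y a)
    (fun y a => dChr (1, 0) frame3 (metC S (U.ctr j)) (shiF S (U.ctr j)) (T, y) a) _ _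
    isOpen_ball (hg.chr j) (hC₅ S τ0 I hI h T hT hg j) hn
    (fun y hy a => sub_eq_zero.2 (lieC_zero h hI (by omega) hτ (hyt y hy) a))
    (fun m hm y hy a => ?_) a
  · have hl0 : ∀ {f A b}, Bd (U.ball j) b f A → Bl (U.ball j) 0 f A := fun hf =>
      Bnd.mono hf
    refine ⟨(hl0 (hn m hm a)).le (by gcongr; exact le_self_add), ?_⟩
    refine Bnd.congr ((hl0 (hR.add hF)).le ?_) fun y _ => (sub_add_cancel _ _).symm
    rw [geomNN]
    generalize sobNN (S.g T) l (ofFun (S.rho τ0 T)) = r at *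
    generalize sobNN γ l (ofFun (S.rho τ0 T)) = r' at *
    generalize sobNN γ l (ofFun fun x => 3 - S.lapse T x) = a1
    generalize sobNN γ (l - 2) (nabNk S T) = a2
    generalize matterNN γ S τ0 l T = b
    set U := B * C₂ * C₁
    calc C₆ * (C₅ * a2 * (U * r)) + C₃ m * (C₄ * (a1 * r' + b))
        ≤ C₆ * (C₅ * a2 * (U * r)) + B * (C₄ * (a1 * (C₁ * r) + b)) := by
          gcongr
          exact hB m hm
      _ = C₆ * C₅ * U * (a2 * r) + (B * C₄ * C₁ * (a1 * r) + B * C₄ * b) := by ring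
      _ ≤ (U + (C₆ * C₅ * U + B * C₄ * (C₁ + 1))) * (a2 * r)
          + ((U + (C₆ * C₅ * U + B * C₄ * (C₁ + 1))) * (a1 * r)
          + (U + (C₆ * C₅ * U + B * C₄ * (C₁ + 1))) * b) := by
          gcongr
          · exact le_self_add.trans le_add_self
          · refine le_trans ?_ (le_add_self.trans le_add_self)
            gcongr; exact le_self_add
          · refine le_trans ?_ (le_add_self.trans le_add_self)
            exact le_mul_of_one_le_right zero_le le_add_self
      _ = _ := by ring
  · have hz := hyt y hy
    have hd1 : ∀ a, DifferentiableAt ℝ (fun y => lieC S τ0 (U.ctr j) m (T, y) a) y := fun a => by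
      have h1 : ContDiffAt ℝ 1 (fun w => lieC S τ0 (U.ctr j) m w a) (T, y) :=
        contDiffAt_lieD (n := 2) (fun d => contDiffAt_euclidean.1 ((contDiffAt_shiC h hI hz).of_le
          (mod_cast (by omega))) d) (contDiffAt_nabC h hI hτ m 2 (by omega) hz)
          (by norm_num) a
      exact (h1.comp (f := fun y : E3 => (T, y)) y (by fun_prop)).differentiableAt one_ne_zero
    have hd2 : ∀ a, DifferentiableAt ℝ (fun y =>
        iterCovDeriv (S.g T) (ofFun (rhoSource S τ0 T)) m (U.ctr j) y a) y := fun a =>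
      ((tsmooth_iterCovDeriv (n := l) (p := 1) (by omega) hmet (tsmooth_rhoSource h hI (by omega)
        hτ hT (by omega))).contDiffAt hz.2 a).differentiableAt (by simp)
    have h1 := covD_smul_sub (b := e3) (G := bilinComp (S.g T) (U.ctr j))
      (u := fun y => lieC S τ0 (U.ctr j) m (T, y)) 1 hd1 hd2 a
    simp only [one_smul, one_mul] at h1
    have h2 := lieC_succ h hI (by omega) hτ (by omega) hz a
    refine Eq.trans ?_ (congrArg (fun e => e - act (dChr (1, 0) frame3 (metC S (U.ctr j))
      (shiF S (U.ctr j)) (T, y) (a 0)) (nabC S τ0 (U.ctr j) m (T, y)) (tail a)) h1.symm)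
    rw [h2, sub_right_comm]
    rfl

end Bounds

/-! ### Times of vanishing energy -/

section Vanishing

lemma covD_eq_zero {b : Fin 3 → V}
    {G : V → Mat3} {u : V → Ten k} {z : V} (h : u =ᶠ[𝓝 z] fun _ => 0) : covD b G u z = 0 := by
  rw [covD_congr h]
  ext a
  simp [covD, dTen, act]

lemma rho_nonneg (h : S.IsVlasovSolution τ0 n I) (hT : T ∈ I) (x : M) : 0 ≤ S.rho τ0 T x := by
  refine mul_nonneg (sq_nonneg _) (integral_nonneg fun p => ?_)
  exact mul_nonneg (div_nonneg (mul_nonneg (h.f_nonneg T hT _) (sq_nonneg _)) (sqrt_nonneg _))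
    (sqrt_nonneg _)

variable (hn : 2 ≤ n) (hτ : τ0 < 0) (hT : T ∈ I) (h0 : ∀ x, S.rho τ0 T x = 0)

include h0 in
lemma nabC_eq_zero (m : ℕ) (hy : y ∈ (chartAt E3 c).target) : nabC S τ0 c m (T, y) = 0 := by
  induction m generalizing y with
  | zero => ext a; exact h0 _
  | succ m ih =>
    refine covD_eq_zero (b := e3) (G := bilinComp (S.g T) c) ?_
    filter_upwards [target_mem_nhds hy] with w hw using ih hw

include h hI hn hτ hT h0

/-- Where the energy density vanishes it has a minimum, so its time derivative vanishes too. -/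
lemma lieC_eq_zero (m : ℕ) (hm : m + 1 ≤ n) (hy : y ∈ (chartAt E3 c).target) :
    lieC S τ0 c m (T, y) = 0 := by
  induction m generalizing y with
  | zero =>
    have hz : ((T, y) : ℝ × E3) ∈ domC I c := ⟨hT, hy⟩
    have hmin : IsLocalMin (rhoC S τ0 c) (T, y) := by
      filter_upwards [domC_mem_nhds hI hz] with w hw
      exact (h0 _).le.trans (rho_nonneg h hw.1 _)
    ext a
    rw [lieC_zero h hI hn hτ hz, ← transport h hI hn hτ hz, hmin.fderiv_eq_zero]
    rfl
  | succ m ih =>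
    ext a
    have h1 : covD e3 (bilinComp (S.g T) c) (fun y => lieC S τ0 c m (T, y)) y = 0 := by
      refine covD_eq_zero ?_
      filter_upwards [target_mem_nhds hy] with w hw using ih (by omega) hw
    rw [lieC_succ h hI hn hτ (by omega) (z := (T, y)) ⟨hT, hy⟩, h1, nabC_eq_zero h0 m hy]
    simp [act]

lemma fderiv_nabC_eq_zero (m : ℕ) (hm : m + 1 ≤ n) (hy : y ∈ (chartAt E3 c).target)
    (a : Fin (0 + m) → Fin 3) : fderiv ℝ (fun w => nabC S τ0 c m w a) (T, y) = 0 := by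
  have hd : DifferentiableAt ℝ (fun w => nabC S τ0 c m w a) (T, y) :=
    (contDiffAt_nabC h hI hτ m 1 (by omega) (z := (T, y)) ⟨hT, hy⟩ a).differentiableAt (by simp)
  have h1 : ∀ i, fderiv ℝ (fun w => nabC S τ0 c m w a) (T, y) (frame3 i) = 0 := fun i => by
    have h2 : (fun y => nabC S τ0 c m (T, y) a) =ᶠ[𝓝 y] fun _ => 0 := by
      filter_upwards [target_mem_nhds hy] with w hw
      rw [nabC_eq_zero h0 m hw]; rfl
    have h3 := pderiv_slice hd i
    simp only [pderiv] at h3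
    rw [← h3, h2.fderiv_eq]
    simp
  have h2 : fderiv ℝ (fun w => nabC S τ0 c m w a) (T, y) (1, 0) = 0 := by
    have h3 := congrFun (lieC_eq_zero h hI hn hτ hT h0 m hm hy) a
    simp only [lieC, lieD, nabC_eq_zero h0 m hy, vfield, dTen, Pi.add_apply, map_add, map_sum,
      map_smul, h1] at h3
    simpa [act] using h3
  ext v
  · simpa using h2
  · have h3 : ((0 : ℝ), v) = ∑ d, v d • frame3 d := by
      refine Prod.ext ?_ ?_
      · simp [frame3, Prod.fst_sum]
      · rw [Prod.snd_sum]; exact e3_expand v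
    show fderiv ℝ (fun w => nabC S τ0 c m w a) (T, y) (0, v) = 0
    rw [h3, map_sum]
    simp [h1]

/-- Where the energy density vanishes, the energy density of `∇ᵐ ρ` vanishes to second order. -/
lemma isLittleO_enM (m : ℕ) (hm : m + 1 ≤ n) (hy : y ∈ (chartAt E3 c).target) :
    (fun z : ℝ × E3 => enM S τ0 m z.1 (chartPt c z.2) * volC S c z)
      =o[𝓝 (T, y)] fun z => (z.1 - T) ^ 2 := by
  have hz : ((T, y) : ℝ × E3) ∈ domC I c := ⟨hT, hy⟩
  have hu : ∀ a, (fun z => nabC S τ0 c m z a) =o[𝓝 (T, y)] fun z : ℝ × E3 => z.1 - T := by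
    -- strict differentiability at `(T, y)`, applied to the points `(t, y₁)` and `(T, y₁)`
    intro a
    have h1 := ((contDiffAt_nabC h hI hτ m 1 (by omega) hz a).hasStrictFDerivAt (by simp)).isLittleO
    rw [fderiv_nabC_eq_zero h hI hn hτ hT h0 m hm hy] at h1
    have h2 : Filter.Tendsto (fun z : ℝ × E3 => (z, (T, z.2))) (𝓝 (T, y)) (𝓝 ((T, y), (T, y))) :=
      (Continuous.tendsto (by fun_prop) (T, y))
    refine ((h1.comp_tendsto h2).congr' ?_ (EventuallyEq.refl _ _)).trans_isBigO
      (Asymptotics.IsBigO.of_bound 1 (.of_forall fun z => ?_))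
    · filter_upwards [domC_mem_nhds hI hz] with w hw
      simp [nabC_eq_zero h0 m hw.2]
    · simp [Prod.norm_def]
  have hi := contDiffAt_inv (contDiffAt_metC h hI hz) (metC_posDef h hz).det_pos.ne'.isUnit
  have h1 : (fun z => tensorNormSq (metC S c z) (nabC S τ0 c m z) * volC S c z)
      =o[𝓝 (T, y)] fun z : ℝ × E3 => (z.1 - T) ^ 2 := by
    have hv := (contDiffAt_volC h hI hz).continuousAt.isBigO_one ℝ
    have h2 : (fun z => tensorNormSq (metC S c z) (nabC S τ0 c m z))
        =o[𝓝 (T, y)] fun z : ℝ × E3 => (z.1 - T) ^ 2 := by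
      simp only [tensorNormSq]
      refine Asymptotics.IsLittleO.fun_sum fun a _ => Asymptotics.IsLittleO.fun_sum fun b _ => ?_
      have hp := (contDiffAt_prod fun i (_ : i ∈ Finset.univ) => hi (a i) (b i)).continuousAt.isBigO_one ℝ
      refine ((hp.mul_isLittleO (hu a)).mul (hu b)).congr_right fun z => by ring
    exact (h2.mul_isBigO hv).congr_right fun z => by ring
  refine h1.congr' ?_ (EventuallyEq.refl _ _)
  filter_upwards [domC_mem_nhds hI hz] with w hw
  rw [enM_chartPt h hI hτ (by omega) hw]

variable [T2Space M] [CompactSpace M] [MeasurableSpace M] [BorelSpace M]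

/-- The pointwise bounds, integrated over the compact slice. -/
lemma isLittleO_integral_enM (m : ℕ) (hm : m + 1 ≤ n) :
    (fun t => ∫ x, enM S τ0 m t x ∂(riemVol (S.g t))) =o[𝓝 T] fun t => (t - T) ^ 2 := by
  obtain ⟨U⟩ := nonempty_patchAtlas (M := M)
  have h1 : ∀ j, (fun t => ∫ y in U.ball j, U.χ j (chartPt (U.ctr j) y)
      * (enM S τ0 m t (chartPt (U.ctr j) y) * √(bilinComp (S.g t) (U.ctr j) y).det))
      =o[𝓝 T] fun t => (t - T) ^ 2 := by
    intro j
    have hvol : volume (U.ball j) < ⊤ := measure_ball_lt_top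
    rw [Asymptotics.isLittleO_iff]
    intro ε hε
    have hV : 0 < volume.real (U.ball j) + 1 := by positivity
    have hK : IsCompact (closedBall (U.mid j) (U.rad j)) := isCompact_closedBall _ _
    have h2 := hK.eventually_forall_of_forall_eventually (x₀ := T) (P := fun t y =>
      ‖enM S τ0 m t (chartPt (U.ctr j) y) * volC S (U.ctr j) (t, y)‖
        ≤ ε / (volume.real (U.ball j) + 1) * ‖(t - T) ^ 2‖) fun y hy =>
      (isLittleO_enM h hI hn hτ hT h0 m hm (U.ball_subset j (Metric.closedBall_subset_closedBall
        (by linarith [U.rad_pos j]) hy))).def (div_pos hε hV)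
    filter_upwards [h2] with t ht
    refine (norm_setIntegral_le_of_norm_le_const (C := ε / (volume.real (U.ball j) + 1)
      * ‖(t - T) ^ 2‖) hvol fun y hy => ?_).trans ?_
    · rw [norm_mul]
      have e := (norm_of_nonneg (U.χ_nonneg j (chartPt (U.ctr j) y))).trans_le (U.χ_le_one j _)
      exact (mul_le_of_le_one_left (norm_nonneg _) e).trans (ht y (ball_subset_closedBall hy))
    · have e : ε / (volume.real (U.ball j) + 1) * volume.real (U.ball j) ≤ ε := by
        rw [div_mul_eq_mul_div, div_le_iff₀ hV]
        nlinarith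
      calc _ = ε / (volume.real (U.ball j) + 1) * volume.real (U.ball j) * ‖(t - T) ^ 2‖ := by ring
        _ ≤ _ := mul_le_mul_of_nonneg_right e (norm_nonneg _)
  refine (Asymptotics.IsLittleO.fun_sum fun j (_ : j ∈ Finset.univ) => h1 j).congr' ?_
    (EventuallyEq.refl _ _)
  filter_upwards [hI.mem_nhds hT] with t ht
  refine (integral_eq_sum_patch U (isMetric_slice h ht) ?_).symm
  exact continuous_of_chart fun c => (contDiffOn_enM h hI hτ hm).continuousOn.comp
    (f := fun y => (t, y)) (by fun_prop) fun y hy => ⟨ht, hy⟩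

/-- The energy is differentiable at a time where the energy density vanishes. -/
lemma hasDerivAt_rhoEnergy_of_rho_eq_zero {l : ℕ} (hl : l + 1 ≤ n) :
    HasDerivAt (S.rhoEnergy τ0 l) 0 T := by
  have hE : (fun t => ∑ m ∈ Finset.range (l + 1), ∫ x, enM S τ0 m t x ∂(riemVol (S.g t)))
      =o[𝓝 T] fun t => (t - T) ^ 2 :=
    Asymptotics.IsLittleO.fun_sum fun m hm =>
      isLittleO_integral_enM h hI hn hτ hT h0 m (by have := Finset.mem_range.1 hm; omega)
  have hs : S.rhoEnergy τ0 l =o[𝓝 T] fun t => t - T := by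
    rw [Asymptotics.isLittleO_iff] at hE ⊢
    intro ε hε
    filter_upwards [hE (pow_pos hε 2)] with t ht
    refine (norm_of_nonneg (sqrt_nonneg _)).trans_le ?_
    refine Real.sqrt_le_iff.2 ⟨by positivity, (le_abs_self _).trans (ht.trans (le_of_eq ?_))⟩
    rw [norm_pow, mul_pow]
  have hT0 : S.rhoEnergy τ0 l T = 0 := by
    have := hs.def one_pos |>.self_of_nhds
    simpa using this
  rw [hasDerivAt_iff_isLittleO]
  simpa [hT0] using hs

end Vanishing

/-! ### The energy estimate -/

section Estimate

variable [T2Space M] [CompactSpace M] [MeasurableSpace M] [BorelSpace M] {γ : BilinField M}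

variable (γ) in
/-- The supremum norms that bound the derivative of the metric along `∂_T + X`. -/
def supNN (S : RescaledVars M) (T : ℝ) : ℝ≥0 :=
  (supNorm γ (ofFun fun x => 3 - S.lapse T x)).toNNReal
    + (supNorm γ (ofBilin fun x => S.lapse T x • S.Sig T x)).toNNReal

/-- The derivative `2 N Σ - (2/3) (3 - N) g` of the metric along `∂_T + X` is bounded. -/
lemma exists_varC_bound (hγ : IsMetric ∞ γ) (U : PatchAtlas M) (w Λ : ℝ) (s : ℕ) (K : ℝ≥0) :
    ∃ C : ℝ≥0, ∀ (S : RescaledVars M) (τ0 : ℝ) (n : ℕ) (I : Set ℝ), IsOpen I → 1 ≤ n →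
      S.IsVlasovSolution τ0 n I → ∀ T ∈ I, MetricBd U s w Λ K (S.g T) → ∀ j, ∀ y ∈ U.ball j,
        (∀ i p, |varC S (U.ctr j) (T, y) i p| ≤ (C * supNN γ S T : ℝ≥0)) ∧
          |S.lapse T (chartPt (U.ctr j) y) - 3| ≤ (C * supNN γ S T : ℝ≥0) := by
  obtain ⟨C₁, hC₁⟩ := exists_abs_le_supNorm hγ U 0
  obtain ⟨C₂, hC₂⟩ := exists_abs_le_supNorm hγ U 2
  refine ⟨2 * C₂ + (1 + ‖Λ‖₊) * C₁, fun S τ0 n I hI hn h T hT hg j y hy => ?_⟩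
  have hz : ((T, y) : ℝ × E3) ∈ domC I (U.ctr j) := ⟨hT, U.ball_subset_target j hy⟩
  have h1 := hC₁ _ (isTensor_ofFun _) ((tsmooth_lapse h hI hT).of_le zero_le) j y hy ![]
  have h2 := fun a => hC₂ _ (isTensor_ofBilin _) (by simpa using tsmooth_Sig h hI hT (m := 0) hn)
    j y hy a
  set a := supNorm γ (ofFun fun x => 3 - S.lapse T x) with ha
  set b := supNorm γ (ofBilin fun x => S.lapse T x • S.Sig T x) with hb
  have ha0 : 0 ≤ a := supNorm_nonneg _
  have hb0 : 0 ≤ b := supNorm_nonneg _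
  have hC1 : (0 : ℝ) ≤ C₁ := C₁.2
  have hC2 : (0 : ℝ) ≤ C₂ := C₂.2
  have hr : ((2 * C₂ + (1 + ‖Λ‖₊) * C₁) * supNN γ S T : ℝ≥0)
      = (2 * (C₂ : ℝ) + (1 + |Λ|) * C₁) * (a + b) := by
    simp [supNN, ← ha, ← hb, coe_toNNReal _ ha0, coe_toNNReal _ hb0]
  have p1 : 0 ≤ C₁ * b := by positivity
  have p2 : 0 ≤ C₂ * b := by positivity
  have p3 : 0 ≤ C₂ * a := by positivity
  have p4 : 0 ≤ |Λ| * (C₁ * a) := by positivity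
  have p5 : 0 ≤ |Λ| * (C₁ * b) := by positivity
  have p6 : 0 ≤ C₁ * a := by positivity
  rw [hr]
  refine ⟨fun i p => ?_, ?_⟩
  · have h3 : varC S (U.ctr j) (T, y) i p
        = 2 * ofBilin (fun x => S.lapse T x • S.Sig T x) (U.ctr j) y ![i, p]
          - 2 / 3 * (ofFun (fun x => 3 - S.lapse T x) (U.ctr j) y ![]
            * bilinComp (S.g T) (U.ctr j) y i p) := by
      have e : ofBilin (fun x => S.lapse T x • S.Sig T x) (U.ctr j) y ![i, p]
          = lapC S (U.ctr j) (T, y) * bilinComp (S.Sig T) (U.ctr j) y i p := by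
        simp [ofBilin, bilinComp, lapC]
      rw [varC_eq h hI hz hn, kC_eq, e]
      simp only [ofFun, lapC, metC]
      ring
    have h4 := ((hg.ell j y hy).bound i p).trans (le_abs_self Λ)
    have h5 := mul_le_mul h1 h4 (abs_nonneg _) (by positivity)
    rw [← abs_mul] at h5
    have h6 := abs_sub (2 * ofBilin (fun x => S.lapse T x • S.Sig T x) (U.ctr j) y ![i, p])
      (2 / 3 * (ofFun (fun x => 3 - S.lapse T x) (U.ctr j) y ![]
            * bilinComp (S.g T) (U.ctr j) y i p))
    rw [abs_mul 2, abs_mul (2 / 3), abs_two, abs_of_pos (by norm_num : (0 : ℝ) < 2 / 3), ← h3] at h6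
    have h7 := h2 ![i, p]
    linarith
  · rw [abs_sub_comm]
    refine h1.trans ?_
    linarith

/-- The derivative of the square of the energy. -/
lemma exists_deriv_bound (hγ : IsMetric ∞ γ) (U : PatchAtlas M) (s l : ℕ) (hs : 6 ≤ s)
    (hls : l - 1 ≤ s) (hl : 4 ≤ l) (w Λ : ℝ) (hw : 0 < w) (K : ℝ≥0) (m : ℕ) : ∃ C : ℝ≥0, m ≤ l →
    ∀ (S : RescaledVars M) (τ0 : ℝ) (I : Set ℝ), τ0 < 0 → IsOpen I →
      S.IsVlasovSolution τ0 (l + 2) I → ∀ T ∈ I, MetricBd U s w Λ K (S.g T) → ∃ D : ℝ,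
        HasDerivAt (fun t => ∫ x, enM S τ0 m t x ∂(riemVol (S.g t))) D T ∧
        |D| ≤ (C * (sobNN (S.g T) l (ofFun (S.rho τ0 T)) * ((supNN γ S T + geomNN γ S l T)
          * sobNN (S.g T) l (ofFun (S.rho τ0 T)) + matterNN γ S τ0 l T)) : ℝ≥0) := by
  by_cases hm : m ≤ l
  swap
  · exact ⟨0, fun h => absurd h hm⟩
  obtain ⟨C₁, hC₁⟩ := exists_lieC_bound hγ U s l hs hls hl w Λ hw K m hm
  obtain ⟨C₂, hC₂⟩ := exists_varC_bound hγ U w Λ s K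
  obtain ⟨C₃, hC₃⟩ := exists_integral_rate_le U (0 + m) w Λ hw K
  refine ⟨C₃ * (C₁ * (C₁ + C₂ * C₁)), fun _ S τ0 I hτ hI h T hT hg => ?_⟩
  obtain ⟨q, hqc, hq, hD⟩ := hasDerivAt_integral_enM h hI hτ (m := m) (by omega) hT
  refine ⟨_, hD, ?_⟩
  have hb := U.ball_subset_target
  have h1 := hC₁ S τ0 I hτ hI h T hT hg
  have h2 := hC₂ S τ0 (l + 2) I hI (by omega) h T hT hg
  have h3 := hC₃ (isMetric_slice h hT) hg.ell (fun j y hy i p => by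
      have := (hg.inv j i p).sup 0 (by omega) y hy
      rwa [norm_iteratedFDeriv_zero, Real.norm_eq_abs] at this)
    (fun j y => nabC S τ0 (U.ctr j) m (T, y)) (fun j y => lieC S τ0 (U.ctr j) m (T, y))
    (fun j y => Matrix.of (varC S (U.ctr j) (T, y)))
    (fun j y => S.lapse T (chartPt (U.ctr j) y) - 3) _ _ _ (fun j a => (h1 j a).1)
    (fun j a => (h1 j a).2) (fun j y hy => (h2 j y hy).1) (fun j y hy => (h2 j y hy).2) q hqc
    fun j y hy => hq (U.ctr j) y (hb j hy)
  refine h3.trans ?_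
  generalize sobNN (S.g T) l (ofFun (S.rho τ0 T)) = r
  generalize supNN γ S T = a
  generalize geomNN γ S l T = b
  generalize matterNN γ S τ0 l T = d
  have key : C₃ * (C₁ * r * (C₁ * (b * r + d) + C₂ * a * (C₁ * r)))
      ≤ C₃ * (C₁ * (C₁ + C₂ * C₁)) * (r * ((a + b) * r + d)) := by
    calc C₃ * (C₁ * r * (C₁ * (b * r + d) + C₂ * a * (C₁ * r)))
        = C₃ * (C₁ * (r * (C₁ * (b * r + d) + C₂ * C₁ * (a * r)))) := by ring
      _ ≤ C₃ * (C₁ * (r * ((C₁ + C₂ * C₁) * (b * r + d) + (C₁ + C₂ * C₁) * (a * r)))) := by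
          gcongr
          · exact le_self_add
          · exact le_add_self
      _ = _ := by ring
  exact_mod_cast key

/-- If the energy vanishes, so does the energy density. -/
lemma rho_eq_zero_of_rhoEnergy (hγ : IsMetric ∞ γ) (U : PatchAtlas M) (s l : ℕ) (hs : 6 ≤ s)
    (hls : l - 1 ≤ s) (hl : 4 ≤ l) (w Λ : ℝ) (hw : 0 < w) (K : ℝ≥0) {S : RescaledVars M} {τ0 : ℝ}
    {I : Set ℝ} (hτ : τ0 < 0) (hI : IsOpen I) (h : S.IsVlasovSolution τ0 (l + 2) I) {T : ℝ}
    (hT : T ∈ I) (hg : MetricBd U s w Λ K (S.g T)) (h0 : S.rhoEnergy τ0 l T = 0) (x : M) :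
    S.rho τ0 T x = 0 := by
  obtain ⟨C, hC⟩ := exists_lieC_bound hγ U s l hs hls hl w Λ hw K 0 (by omega)
  have hr : sobNN (S.g T) l (ofFun (S.rho τ0 T)) = 0 := by
    rw [← NNReal.coe_eq_zero, coe_sobNN]; exact h0
  obtain ⟨j, hj⟩ : ∃ j, U.χ j x ≠ 0 := by
    by_contra! hne
    have := U.χ_sum x
    simp [hne] at this
  obtain ⟨hx, hxb⟩ := U.χ_supp j x hj
  have h1 := (hC S τ0 I hτ hI h T hT hg j ![]).1
  have h2 := bl_zero_eLpNorm h1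
  have hB : IsOpen (U.ball j) := isOpen_ball
  have hc := h1.smooth.continuousOn
  rw [hr, mul_zero, ENNReal.coe_zero, nonpos_iff_eq_zero,
    eLpNorm_eq_zero_iff (hc.aestronglyMeasurable hB.measurableSet) two_ne_zero] at h2
  have h3 := Measure.eqOn_open_of_ae_eq h2 hB hc continuousOn_const hxb
  have h4 : S.rho τ0 T (chartPt (U.ctr j) (chartAt E3 (U.ctr j) x)) = 0 := h3
  rwa [chartPt_chartAt hx] at h4

end Estimate

end EinsteinVlasov

end

open EinsteinVlasov in
theorem mainTheorem3 {M : Type*} [TopologicalSpace M] [T2Space M] [CompactSpace M]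
    [ChartedSpace E3 M] [IsManifold 𝓘(ℝ, E3) ∞ M]
    [MeasurableSpace M] [BorelSpace M]
    (γ : Bundle.ContMDiffRiemannianMetric 𝓘(ℝ, E3) ∞ E3
      (fun x : M => TangentSpace 𝓘(ℝ, E3) x)) :
    ∃ δ : ℝ, 0 < δ ∧ ∀ l : ℕ, 4 ≤ l → ∀ K : ℝ, ∃ C : ℝ, 0 < C ∧
      ∀ (S : RescaledVars M) (τ₀ : ℝ) (I : Set ℝ), τ₀ < 0 → IsOpen I →
        S.IsVlasovSolution τ₀ (l + 2) I →
      ∀ T ∈ I,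
        sobolevNorm γ.inner 6 (ofBilin fun x => S.g T x - γ.inner x) < δ →
        (8 ≤ l → sobolevNorm γ.inner (l - 1) (ofBilin fun x => S.g T x - γ.inner x) ≤ K) →
        DifferentiableAt ℝ (S.rhoEnergy τ₀ l) T ∧
        |deriv (S.rhoEnergy τ₀ l) T| ≤
          C * ((supNorm γ.inner (ofFun fun x => 3 - S.lapse T x)
                + supNorm γ.inner (ofBilin fun x => S.lapse T x • S.Sig T x)
                + sobolevNorm γ.inner (l - 2)
                    (covDeriv (S.g T) (ofBilin fun x => S.lapse T x • S.k T x))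
                + sobolevNorm γ.inner l (ofFun fun x => 3 - S.lapse T x))
              * S.rhoEnergy τ₀ l T
            + |meanCurv τ₀ T| ^ 2 * sobolevNorm γ.inner l (ofFun (S.stressSource τ₀ T))
            + |meanCurv τ₀ T| * sobolevNorm γ.inner l (ofFun (S.currentSource τ₀ T))) := by
  have hγ := isMetric_inner γ
  obtain ⟨U⟩ := nonempty_patchAtlas (M := M)
  obtain ⟨δ, w, Λ, hδ, hw, H⟩ := exists_metricBd hγ U
  refine ⟨δ, hδ, fun l hl K => ?_⟩
  obtain ⟨s, A, hs, hls, hM⟩ := H l hl K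
  choose B hB using fun m => exists_deriv_bound hγ U s l hs hls hl w Λ hw A m
  refine ⟨∑ m ∈ Finset.range (l + 1), (B m : ℝ) + 1, by positivity,
    fun S τ₀ I hτ hI h T hT h6 h8 => ?_⟩
  have hg := hM (l + 2) (S.g T) le_rfl (isMetric_slice h hT) h6 h8
  have hsup : (supNN γ.inner S T : ℝ) = supNorm γ.inner (ofFun fun x => 3 - S.lapse T x)
      + supNorm γ.inner (ofBilin fun x => S.lapse T x • S.Sig T x) := by
    simp [supNN, Real.coe_toNNReal _ (supNorm_nonneg _)]
  have hgeo : (geomNN γ.inner S l T : ℝ) = sobolevNorm γ.inner (l - 2)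
        (covDeriv (S.g T) (ofBilin fun x => S.lapse T x • S.k T x))
      + sobolevNorm γ.inner l (ofFun fun x => 3 - S.lapse T x) := by
    simp [geomNN, nabNk, coe_sobNN]
  have hmat : (matterNN γ.inner S τ₀ l T : ℝ)
      = |meanCurv τ₀ T| ^ 2 * sobolevNorm γ.inner l (ofFun (S.stressSource τ₀ T))
        + |meanCurv τ₀ T| * sobolevNorm γ.inner l (ofFun (S.currentSource τ₀ T)) := by
    simp [matterNN, coe_sobNN]
  have hrho : (sobNN (S.g T) l (ofFun (S.rho τ₀ T)) : ℝ) = S.rhoEnergy τ₀ l T := coe_sobNN ..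
  rw [add_assoc (_ * S.rhoEnergy τ₀ l T), ← hmat, add_assoc (supNorm _ _ + _), ← hsup, ← hgeo]
  have hr0 : 0 ≤ S.rhoEnergy τ₀ l T := Real.sqrt_nonneg _
  have hsum : (0 : ℝ) ≤ ∑ m ∈ Finset.range (l + 1), (B m : ℝ) :=
    Finset.sum_nonneg fun m _ => (B m).2
  have hR : 0 ≤ ((supNN γ.inner S T : ℝ) + geomNN γ.inner S l T) * S.rhoEnergy τ₀ l T
      + matterNN γ.inner S τ₀ l T := by positivity
  rcases hr0.eq_or_lt with h0 | hpos
  · -- The square root is not differentiable at `0`, but here `ρ` vanishes on the whole slice.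
    have h1 := hasDerivAt_rhoEnergy_of_rho_eq_zero h hI (by omega) hτ hT
      (rho_eq_zero_of_rhoEnergy hγ U s l hs hls hl w Λ hw A hτ hI h hT hg h0.symm)
      (l := l) (by omega)
    refine ⟨h1.differentiableAt, ?_⟩
    rw [h1.deriv, abs_zero]
    positivity
  · have h1 : ∀ m, ∃ D : ℝ, m ∈ Finset.range (l + 1) →
        HasDerivAt (fun t => ∫ x, enM S τ₀ m t x ∂(riemVol (S.g t))) D T ∧
        |D| ≤ B m * (S.rhoEnergy τ₀ l T * (((supNN γ.inner S T : ℝ) + geomNN γ.inner S l T)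
          * S.rhoEnergy τ₀ l T + matterNN γ.inner S τ₀ l T)) := fun m => by
      by_cases hm : m ∈ Finset.range (l + 1)
      · obtain ⟨D, hD, hle⟩ := hB m (by simpa [Nat.lt_succ_iff] using hm) S τ₀ I hτ hI h T hT hg
        exact ⟨D, fun _ => ⟨hD, by simpa [hrho] using hle⟩⟩
      · exact ⟨0, fun h => absurd h hm⟩
    choose D hD using h1
    have h2 := HasDerivAt.fun_sum fun m hm => (hD m hm).1
    have h3 : √(∑ m ∈ Finset.range (l + 1), ∫ x, enM S τ₀ m T x ∂(riemVol (S.g T)))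
      = S.rhoEnergy τ₀ l T := rfl
    have h4 : HasDerivAt (S.rhoEnergy τ₀ l)
        ((∑ m ∈ Finset.range (l + 1), D m) / (2 * S.rhoEnergy τ₀ l T)) T := by
      rw [← h3]
      exact h2.sqrt fun h0 => hpos.ne' (by rw [← h3, h0, Real.sqrt_zero])
    refine ⟨h4.differentiableAt, ?_⟩
    rw [h4.deriv, abs_div, abs_of_pos (by positivity : 0 < 2 * S.rhoEnergy τ₀ l T),
      div_le_iff₀ (by positivity)]
    set R := ((supNN γ.inner S T : ℝ) + geomNN γ.inner S l T) * S.rhoEnergy τ₀ l T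
      + matterNN γ.inner S τ₀ l T
    have h5 : |∑ m ∈ Finset.range (l + 1), D m|
        ≤ (∑ m ∈ Finset.range (l + 1), (B m : ℝ)) * (S.rhoEnergy τ₀ l T * R) := by
      rw [Finset.sum_mul]
      exact (Finset.abs_sum_le_sum_abs _ _).trans (Finset.sum_le_sum fun m hm => (hD m hm).2)
    have h6 : 0 ≤ S.rhoEnergy τ₀ l T * R := by positivity
    nlinarith [mul_nonneg hsum h6]
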